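/- **Notation.** Let $q\in\mathbb C$, $0<|q|<1$, and let $p\in\mathbb C$, $0<|p|<1$. Put $(x;q)=\prod_{r\ge0}(1-xq^r)$, $(x;q)_n=\prod_{r=0}^{n-1}(1-xq^r)$, $\theta(x;p)=(x;p)(p/x;p)$, $\theta(x;q;p)_n=\prod_{r=0}^{n-1}\theta(xq^r;p)$ and $\Gamma(x;p,q)=\prod_{i,j\ge0}\frac{1-p^{i+1}q^{j+1}/x}{1-p^iq^jx}$; a sign $\pm$ in an argument denotes the product over both signs. Write $p=e^{w}$ and $p^{s}=e^{sw}$ for $s\in\mathbb R$, so that a choice of $w$ is a choice of $p$ and of a branch of its real powers; "$p\to0$" means $\operatorname{Re}w\to-\infty$, and functions of $p$ are functions of $w$. For $u\ne 0$ and $m\ge0$, $A(u;p,q)$ (with pole bound $m$) is the space of meromorphic functions $f$ on $\mathbb C^*$ with $f(z)=f(1/z)=f(pz)$ such that $\theta(pqz^{\pm1}/u;q;p)_{m}f(z)$ is holomorphic on $\mathbb C^*$. For $\zeta\in\mathbb R$ we say that a family $f=(f_p)$ of functions of $z$ *has an expansion at* $\zeta$ if there is a non-zero formal series $\sum_{s\in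 S}a_s(z)p^s$, with $S\subset\mathbb R$ having finitely many elements below any bound and each $a_s\in\mathbb C(z)$, such that, with $\mathrm{val}(f)=\min\{s: a_s\neq0\}$, the series $\sum_s a_s(z)p^{s-\mathrm{val}(f)}$ converges to $p^{-\mathrm{val}(f)}f_p(zp^\zeta)$, uniformly for $z\in K$ and $0<|p|\le\varepsilon_K$ (all branches), for each compact $K\subset\mathbb C^*$ outside the zero set of some fixed non-zero polynomial, which contains the poles of all the $a_s$. Then $\mathrm{lc}(f)=a_{\mathrm{val}(f)}$. For $T_0,\dots,T_5\in\mathbb C^*$ with $\prod_rT_r=pq$, $f\in A(T_4;p,q)$ with pole bound $m_f$ and $g\in A(T_5;p,q)$ with pole bound $m_g$, put $\tilde T_r=T_r$ for $r\le3$, $\tilde T_4=T_4q^{-m_f}$, $\tilde T_5=T_5q^{-m_g}$ and $$\langle f,g\rangle_{T}=\frac{(q;q)(p;p)}{2\prod_{0\le r<s\le5}\Gamma(T_rT_s;p,q)}\int_C f(z)g(z)\frac{\prod_{r=0}^5\Gamma(T_rz^{\pm1};p,q)}{\Gamma(z^{\pm2};p,q)}\frac{dz}{2\pi iz},$$ where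 $C$ is a chain in $\mathbb C^*$ (a finite integer combination of circles) that avoids the points $p^iq^j\tilde T_r$ ($i,j\ge0$, $0\le r\le5$) and their reciprocals, has winding number $1$ about each of these points and winding number $0$ about their reciprocals. For this none of these points may be the reciprocal of one of them (*non-resonance*). **Proposition.** Let $t_0,\dots,t_5\in\mathbb C^*$ satisfy $\prod_rt_r=q$ and be generic: $t_rt_s\notin q^{\mathbb Z}$ for all $r,s$ and $t_r/t_s\notin q^{\mathbb Z}$ for $r\ne s$. Let $\alpha\in\mathbb R^6$ with $\sum_{r=0}^5\alpha_r=1$. Let $0\le a\le3$ be such that $-\frac12\le\alpha_a<0$, $\alpha_a<\alpha_r\le1+\alpha_a$ for $r\ne a$, and $0<\alpha_r+\alpha_s\le1$ for distinct $r,s\ne a$. Assume moreover $$2\alpha_a=\sum_{r\ne a:\ \alpha_r+\alpha_a<0}(\alpha_r+\alpha_a).$$ Let $m_f,m_g\ge 0$ and let $f=(f_p)$, $g=(g_p)$ be families such that, for all small $p$ and all branches, $f_p\in A(t_4p^{\alpha_4};p,q)$ with pole bound $m_f$ and $g_p\in A(t_5p^{\alpha_5};p,q)$ with pole bound $m_g$,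 and such that $f$ and $g$ have expansions at $\zeta=\alpha_a$; let $\mathrm{val}$ and $\mathrm{lc}$ refer to these expansions. Then, for all small $p$ for which the parameters $t_rp^{\alpha_r}$ are non-resonant, a chain $C$ as above exists; for any choice of such chains, as $p\to0$ through these $p$, $$\begin{aligned}\lim_{p\to0}\,&p^{-\mathrm{val}(f)-\mathrm{val}(g)}\langle f_p,g_p\rangle_{(t_rp^{\alpha_r})_r} =\frac{\prod_{r<s:\alpha_r+\alpha_s=0}(t_rt_s;q)\prod_{r:\alpha_r=\alpha_a+1}(qt_a/t_r;q)}{\prod_{r<s:\alpha_r+\alpha_s=1}(q/t_rt_s;q)\prod_{r:\alpha_r=-\alpha_a}(t_rt_a;q)}\left(\frac1{(qt_a^2;q)}\right)^{1_{\alpha_a=-1/2}}\\ &\times\sum_{k\ge0}\mathrm{lc}(f)(t_aq^k)\,\mathrm{lc}(g)(t_aq^k)\left(\frac{1-t_a^2q^{2k}}{1-t_a^2}(t_a^2;q)_k\right)^{1_{\alpha_a=-1/2}}\frac{\prod_{r:\alpha_r=-\alpha_a}(t_rt_a;q)_k}{(q;q)_k\prod_{r:\alpha_r=\alpha_a+1}(qt_a/t_r;q)_k}\\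 &\qquad\times\Big((-1)^kq^{\binom k2}\Big)^{N-2}\Big(t_a^{N-2}\prod_{r\ne a:\ \alpha_r+\alpha_a<0}t_r\Big)^k,\end{aligned}$$ where $N=|\{r\ne a:\alpha_r<-\alpha_a\}|$, and the series on the right converges absolutely. -/

import Mathlib

open Filter Topology

noncomputable section

namespace EllipticPairing

/-- The infinite `q`-Pochhammer symbol `(x;q) = ∏_{r ≥ 0} (1 - x q^r)`. -/
def qPoch (x q : ℂ) : ℂ := ∏' r : ℕ, (1 - x * q ^ r)

/-- The finite `q`-Pochhammer symbol `(x;q)_n = ∏_{r < n} (1 - x q^r)`. -/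
def qPochFin (x q : ℂ) (n : ℕ) : ℂ := ∏ r ∈ Finset.range n, (1 - x * q ^ r)

/-- The theta function `θ(x;p) = (x, p/x; p)`. -/
def theta (x p : ℂ) : ℂ := qPoch x p * qPoch (p / x) p

/-- The elliptic shifted factorial `θ(x;q;p)_n = ∏_{r < n} θ(x q^r;p)`. -/
def thetaFin (x q p : ℂ) (n : ℕ) : ℂ := ∏ r ∈ Finset.range n, theta (x * q ^ r) p

/-- The elliptic gamma function
`Γ(x;p,q) = ∏_{i,j ≥ 0} (1 - p^{i+1} q^{j+1} / x) / (1 - p^i q^j x)`. -/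
def ellGamma (x p q : ℂ) : ℂ :=
  ∏' ij : ℕ × ℕ, (1 - p ^ (ij.1 + 1) * q ^ (ij.2 + 1) / x) / (1 - p ^ ij.1 * q ^ ij.2 * x)

/-- The factor `θ(pq z^{±1}/u; q; p)_m = Γ(u z^{±1}) / Γ(u q^{-m} z^{±1})`. -/
def poleFactor (u p q : ℂ) (m : ℕ) (z : ℂ) : ℂ :=
  thetaFin (p * q * z / u) q p m * thetaFin (p * q * z⁻¹ / u) q p m

/-- `f` belongs to the space `A(u;p,q)`, with `m` as the number `m_f`: it is symmetric, `p`-abelian,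
and `θ(pq z^{±1}/u; q; p)_m f(z)` is holomorphic on `ℂ ∖ {0}`. Away from `0` and the zeros of that
factor `f` is thus holomorphic; the values of the Lean function `f` at its possible poles (the
zeros of the factor) and at `0` play no role. -/
def MemA (u p q : ℂ) (m : ℕ) (f : ℂ → ℂ) : Prop :=
  (∀ z : ℂ, z ≠ 0 → poleFactor u p q m z ≠ 0 → f z⁻¹ = f z ∧ f (p * z) = f z) ∧
  ∃ F : ℂ → ℂ, DifferentiableOn ℂ F {0}ᶜ ∧
    ∀ z : ℂ, z ≠ 0 → poleFactor u p q m z ≠ 0 → F z = poleFactor u p q m z * f z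

/-- The value at `z` of a rational function. -/
def ratEval (r : RatFunc ℂ) (z : ℂ) : ℂ := RatFunc.eval (RingHom.id ℂ) z r

/-- Throughout, `p = exp w`, and `p ^ s` means `exp (s w)` for real `s`; so `w` is a choice of
`p ≠ 0` together with a branch of the real powers of `p`. -/
def pPow (w : ℂ) (s : ℝ) : ℂ := Complex.exp (s * w)

/-- The family `w ↦ f w` of functions of `z` has, after `z` is replaced by `z p^ζ`, the expansion
`f (z p^ζ) = ∑_s a_s(z) p^s`, where `c = ∑_s a_s(z) p^s` is a non-zero formal series whose set of
exponents is discrete and bounded from below, whose coefficients are rational functions of `z`, and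
which converges uniformly on compacta outside the zero set of some polynomial `P`: for such a
compactum `K`, the series of `p^{-val} f(z p^ζ)` converges uniformly for `z ∈ K` and
`0 < |p| ≤ ε` (all branches), for some `ε > 0`.
`val` is `c.order`, and `lc` is `c.leadingCoeff`. -/
def HasExpansion (ζ : ℝ) (f : ℂ → ℂ → ℂ) (c : HahnSeries ℝ (RatFunc ℂ)) : Prop :=
  c ≠ 0 ∧
  (∀ x : ℝ, (c.support ∩ Set.Iic x).Finite) ∧
  ∃ P : Polynomial ℂ, P ≠ 0 ∧
    (∀ (s : ℝ) (z : ℂ), P.eval z ≠ 0 → (c.coeff s).denom.eval z ≠ 0) ∧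
    ∀ K : Set ℂ, IsCompact K → (∀ z ∈ K, z ≠ 0 ∧ P.eval z ≠ 0) →
      ∃ ε : ℝ, 0 < ε ∧
        HasSumUniformlyOn
          (fun (s : ℝ) (x : ℂ × ℂ) => ratEval (c.coeff s) x.2 * pPow x.1 (s - c.order))
          (fun x : ℂ × ℂ => pPow x.1 (-c.order) * f x.1 (x.2 * pPow x.1 ζ))
          ({w : ℂ | ‖Complex.exp w‖ ≤ ε} ×ˢ K)

/-- A positively oriented circle with an integer multiplicity. -/
structure WeightedCircle where
  mult : ℤ
  center : ℂ
  radius : ℝ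

/-- The integral `(1/2πi) ∫ h(z) dz/z` over a chain, that is, over a finite formal integer
combination of positively oriented circles. -/
def chainIntegral (C : List WeightedCircle) (h : ℂ → ℂ) : ℂ :=
  (C.map fun c => (c.mult : ℂ) *
    ((2 * Real.pi * Complex.I)⁻¹ * circleIntegral (fun z => h z / z) c.center c.radius)).sum

/-- The winding number of a chain about a point that lies on none of its circles. -/
def windingNumber (C : List WeightedCircle) (x : ℂ) : ℤ :=
  (C.map fun c => if dist x c.center < c.radius then c.mult else 0).sum

/-- The parameters `t̃_r`: `t̃_r = t_r` for `r ≤ 3`, `t̃_4 = t_4 q^{-m_f}`, `t̃_5 = t_5 q^{-m_g}`. -/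
def tildeParam (q : ℂ) (mf mg : ℕ) (T : Fin 6 → ℂ) (r : Fin 6) : ℂ :=
  if r = 4 then T r / q ^ mf else if r = 5 then T r / q ^ mg else T r

/-- The set of points `p^i q^j t̃_r` with `i, j ≥ 0` and `0 ≤ r ≤ 5`. -/
def innerPoints (p q : ℂ) (mf mg : ℕ) (T : Fin 6 → ℂ) : Set ℂ :=
  {x | ∃ (r : Fin 6) (i j : ℕ), x = p ^ i * q ^ j * tildeParam q mf mg T r}

/-- None of the points `p^i q^j t̃_r` is the reciprocal of such a point. This is the condition under
which a contour that separates these points from their reciprocals exists. -/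
def NonResonant (p q : ℂ) (mf mg : ℕ) (T : Fin 6 → ℂ) : Prop :=
  ∀ x ∈ innerPoints p q mf mg T, ∀ y ∈ innerPoints p q mf mg T, x * y ≠ 1

/-- `C` is a chain in `ℂ ∖ {0}`, made up of circles about the origin and of circles that do not
enclose the origin, which represents the homology class of the contour: it avoids the points
`p^i q^j t̃_r` and their reciprocals, contains the former (winding number `1`) and excludes the
latter (winding number `0`). As the points accumulate at `0`, the chain winds once about `0`, so its
class in the complement of all these points is determined, and it is invariant under `z ↦ 1/z`
up to orientation. -/
def IsContour (p q : ℂ) (mf mg : ℕ) (T : Fin 6 → ℂ) (C : List WeightedCircle) : Prop :=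
  (∀ c ∈ C, 0 < c.radius ∧ (c.center = 0 ∨ c.radius < ‖c.center‖)) ∧
  ∀ x ∈ innerPoints p q mf mg T,
    (∀ c ∈ C, dist x c.center ≠ c.radius ∧ dist x⁻¹ c.center ≠ c.radius) ∧
    windingNumber C x = 1 ∧ windingNumber C x⁻¹ = 0

/-- The bilinear form `⟨f, g⟩_{T_0,…,T_5;q;p}`, with the integral taken over the chain `C`. -/
def pairing (p q : ℂ) (T : Fin 6 → ℂ) (C : List WeightedCircle) (f g : ℂ → ℂ) : ℂ :=
  qPoch q q * qPoch p p /
      (2 * ∏ rs : Fin 6 × Fin 6 with rs.1 < rs.2, ellGamma (T rs.1 * T rs.2) p q) *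
    chainIntegral C fun z =>
      f z * g z * (∏ r : Fin 6, ellGamma (T r * z) p q * ellGamma (T r * z⁻¹) p q) /
        (ellGamma (z ^ 2) p q * ellGamma (z⁻¹ ^ 2) p q)

/-- The parameters `t_r p^{α_r}`, for `p = exp w`. -/
def scaledParam (t : Fin 6 → ℂ) (α : Fin 6 → ℝ) (w : ℂ) (r : Fin 6) : ℂ := t r * pPow w (α r)

/-- Genericity of the parameters: `t_r t_s ∉ q^ℤ` for all `r, s`, and `t_r/t_s ∉ q^ℤ` for `r ≠ s`. -/
def Generic (q : ℂ) (t : Fin 6 → ℂ) : Prop :=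
  (∀ (r s : Fin 6) (n : ℤ), t r * t s ≠ q ^ n) ∧
  ∀ (r s : Fin 6) (n : ℤ), r ≠ s → t r / t s ≠ q ^ n

/-- `N = |{r | r ≠ a, α_r < -α_a}|`. -/
def countN (α : Fin 6 → ℝ) (a : Fin 6) : ℕ :=
  (Finset.univ.filter fun r : Fin 6 => r ≠ a ∧ α r < -α a).card

/-- The factor in front of the sum; products over `r, s` are over pairs `r < s`. -/
def limitPrefactor (q : ℂ) (t : Fin 6 → ℂ) (α : Fin 6 → ℝ) (a : Fin 6) : ℂ :=
  ((∏ rs : Fin 6 × Fin 6 with rs.1 < rs.2 ∧ α rs.1 + α rs.2 = 0, qPoch (t rs.1 * t rs.2) q) *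
      ∏ r : Fin 6 with α r = α a + 1, qPoch (q * t a / t r) q) /
    ((∏ rs : Fin 6 × Fin 6 with rs.1 < rs.2 ∧ α rs.1 + α rs.2 = 1,
        qPoch (q / (t rs.1 * t rs.2)) q) *
      ∏ r : Fin 6 with α r = -α a, qPoch (t r * t a) q) *
    (if α a = -1 / 2 then 1 / qPoch (q * t a ^ 2) q else 1)

/-- The weight of the point `t_a q^k` in the sum. -/
def limitWeight (q : ℂ) (t : Fin 6 → ℂ) (α : Fin 6 → ℝ) (a : Fin 6) (k : ℕ) : ℂ :=
  (if α a = -1 / 2 then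
      (1 - t a ^ 2 * q ^ (2 * k)) / (1 - t a ^ 2) * qPochFin (t a ^ 2) q k else 1) *
    ((∏ r : Fin 6 with α r = -α a, qPochFin (t r * t a) q k) /
      (qPochFin q q k * ∏ r : Fin 6 with α r = α a + 1, qPochFin (q * t a / t r) q k)) *
    ((-1) ^ k * q ^ (k.choose 2)) ^ ((countN α a : ℤ) - 2) *
    (t a ^ ((countN α a : ℤ) - 2) * ∏ r : Fin 6 with r ≠ a ∧ α r + α a < 0, t r) ^ k

end EllipticPairing

end

noncomputable section

namespace EllipticPairing

/-! ### Infinite products `∏ (1 - x c_i)` -/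

/-! Let S_r be the parameters `tildeParam`, into which the denominators of f and g have been
absorbed. Off countably many points the integrand is F G ∏ Γ(S_r z^{±1}) θ(z²;p) θ(z⁻²;q) with F, G
holomorphic on ℂ* and everything invariant under z → 1/z. The addition formula `breaker_sub_eq`
writes it as k(z) + k(1/z) (`symmKernel_eq`). The half k has lost the poles at 1/(S_a q^j) and
1/(S_b q^j), where b ≠ a is an index with α_b as small as possible. Both halves contribute the same
amount, so only k has to be integrated.

Once these poles are gone there is an exponent σ (`exists_separatingExponent`) such that a circle of
radius comparable with |p|^{-σ} encloses all poles of k that the contour has to enclose, except the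
points S_a q^k with k < K, and none of the others. The residue theorem in terms of winding numbers
then expresses the pairing as the sum of the residues at S_a q^k, k < K, plus the integral of k over
the circle (`pairing_eq`). Here K, the `cutoff`, is of the order of log(1/|p|).

For fixed k the normalised residue tends to the k-th term of the series
(`Admissible.tendsto_residueTerm`). The theta functions θ(t_r t_a q^j p^{α_r+α_a};p) with α_r + α_a
< 0 produce the power p^{kΣ(α_r+α_a)}, and a quasi-period produces p^{-2kα_a}. The balancing
condition on α says that the two cancel.

For uniformity in k, successive residues are compared by means of `stepBound`. Its logarithm is a
convex piecewise linear function of j. It vanishes at j = 0 by balancing and is negative at the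
other end of the range, so the step bound is at most c^j with c < 1 (`stepBound_le`). The residues
are then bounded by C^{k+1} c^{k(k-1)/2} (`Admissible.residueTerm_bound`). Dominated convergence
gives the limit of the sum, and the bound passes to the limit terms and gives absolute convergence
(`Admissible.summable_limit`). On the circle z = S_a q^K ω with |ω| = |q|^{-1/2}, and the integrand
obeys the bound of the residue with k = K (`Admissible.remainderTerm_bound`). As K tends to
infinity, the integral disappears.

The families f and g enter through their expansions only. `HasExpansion.bound` controls the
numerators on large annuli by the maximum principle and the symmetry. `HasExpansion.tendsto_div`
evaluates the limit at t_a q^k even if this point is excluded from the region of convergence. -/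

/-- The entire function `x ↦ ∏' i, (1 - x c_i)`. -/
def eprod {ι : Type*} (c : ι → ℂ) (x : ℂ) : ℂ := ∏' i, (1 - x * c i)

section eprod

variable {ι : Type*} {c : ι → ℂ}

lemma summable_norm_neg_mul (hc : Summable fun i => ‖c i‖) (x : ℂ) :
    Summable fun i => ‖-(x * c i)‖ := by
  simpa [norm_mul] using hc.mul_left ‖x‖

lemma multipliable_eprod (hc : Summable fun i => ‖c i‖) (x : ℂ) :
    Multipliable fun i => 1 - x * c i := by
  simpa [sub_eq_add_neg] using multipliable_one_add_of_summable (summable_norm_neg_mul hc x)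

lemma eprod_ne_zero (hc : Summable fun i => ‖c i‖) {x : ℂ} (h : ∀ i, x * c i ≠ 1) :
    eprod c x ≠ 0 := by
  have := tprod_one_add_ne_zero_of_summable (f := fun i => -(x * c i))
    (fun i hi => h i (by linear_combination -hi)) (summable_norm_neg_mul hc x)
  simpa [eprod, sub_eq_add_neg] using this

lemma hasProd_zero_of_exists {f : ι → ℂ} {i : ι} (h : f i = 0) : HasProd f 0 := by
  refine (tendsto_const_nhds (x := (0 : ℂ))).congr' ?_
  filter_upwards [eventually_ge_atTop ({i} : Finset ι)] with s hs
  exact (Finset.prod_eq_zero (hs (Finset.mem_singleton_self i)) h).symm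

lemma eprod_eq_zero_iff (hc : Summable fun i => ‖c i‖) {x : ℂ} :
    eprod c x = 0 ↔ ∃ i, x * c i = 1 := by
  constructor
  · intro h
    by_contra hne
    push Not at hne
    exact eprod_ne_zero hc hne h
  · rintro ⟨i, hi⟩
    exact (hasProd_zero_of_exists (i := i) (by rw [hi, sub_self])).tprod_eq

/-- The inequality |∏(1 + x_i) − 1| ≤ exp(∑|x_i|) − 1 for finite products survives the limit. The
estimates of Pochhammer symbols for small p rest on it. -/
lemma norm_eprod_sub_one_le (hc : Summable fun i => ‖c i‖) (x : ℂ) :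
    ‖eprod c x - 1‖ ≤ Real.exp (‖x‖ * ∑' i, ‖c i‖) - 1 := by
  have h1 : Tendsto (fun s : Finset ι => ‖∏ i ∈ s, (1 - x * c i) - 1‖) atTop
      (𝓝 ‖eprod c x - 1‖) := ((multipliable_eprod hc x).hasProd.sub_const 1).norm
  refine le_of_tendsto h1 (Eventually.of_forall fun s => ?_)
  have := Finset.norm_prod_one_add_sub_one_le s (fun i => -(x * c i))
  simp only [← sub_eq_add_neg] at this
  refine this.trans ?_
  gcongr
  simp only [norm_neg, norm_mul]
  rw [← Finset.mul_sum]
  gcongr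
  exact hc.sum_le_tsum s (fun _ _ => norm_nonneg _)

/-- On the ball of radius |x| + 1 the terms are dominated by a summable sequence, so the partial
products converge locally uniformly. -/
lemma differentiable_eprod (hc : Summable fun i => ‖c i‖) : Differentiable ℂ (eprod c) := by
  intro x
  have hK : IsOpen (Metric.ball (0 : ℂ) (‖x‖ + 1)) := Metric.isOpen_ball
  have h := Summable.hasProdLocallyUniformlyOn_one_add (f := fun i (y : ℂ) => -(y * c i)) hK
    (hc.mul_left (‖x‖ + 1)) (Eventually.of_forall fun i y hy => ?_) (fun i => by fun_prop)
  · have hd : DifferentiableOn ℂ (fun y => ∏' i, (1 + -(y * c i)))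
        (Metric.ball (0 : ℂ) (‖x‖ + 1)) := by
      rw [hasProdLocallyUniformlyOn_iff_tendstoLocallyUniformlyOn] at h
      refine h.differentiableOn (Eventually.of_forall fun s => ?_) hK
      fun_prop
    simp only [← sub_eq_add_neg] at hd
    exact hd.differentiableAt (hK.mem_nhds (by simp))
  · rw [norm_neg, norm_mul]
    gcongr
    simpa using (Metric.mem_ball.1 hy).le

/-- Splitting off finitely many factors. -/
lemma eprod_eq_prod_mul (hc : Summable fun i => ‖c i‖) (s : Finset ι) (x : ℂ) :
    eprod c x = (∏ i ∈ s, (1 - x * c i)) *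
      eprod (fun i : ((s : Set ι)ᶜ : Set ι) => c i) x := by
  have h := Multipliable.tprod_mul_tprod_compl (f := fun i => 1 - x * c i) (s := (s : Set ι))
    (multipliable_eprod (c := fun i : (s : Set ι) => c i) (hc.subtype _) x)
    (multipliable_eprod (c := fun i : ((s : Set ι)ᶜ : Set ι) => c i) (hc.subtype _) x)
  rw [eprod, ← h, Finset.tprod_subtype' s (fun i => 1 - x * c i)]
  rfl

end eprod

end EllipticPairing

end

noncomputable section

namespace EllipticPairing

/-! ### Pochhammer symbols, theta functions and the elliptic gamma function -/

lemma summable_norm_pow {q : ℂ} (hq : ‖q‖ < 1) : Summable fun r : ℕ => ‖q ^ r‖ := by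
  simpa using summable_geometric_of_lt_one (norm_nonneg q) hq

lemma summable_norm_pow_mul_pow {p q : ℂ} (hp : ‖p‖ < 1) (hq : ‖q‖ < 1) :
    Summable fun ij : ℕ × ℕ => ‖p ^ ij.1 * q ^ ij.2‖ := by
  simpa [norm_mul] using (summable_norm_pow hp).mul_norm (summable_norm_pow hq)

lemma qPoch_eq_eprod (x q : ℂ) : qPoch x q = eprod (fun r : ℕ => q ^ r) x := rfl

/-- The double infinite product `∏_{i,j ≥ 0} (1 - x p^i q^j)`. -/
def dPoch (p q x : ℂ) : ℂ := eprod (fun ij : ℕ × ℕ => p ^ ij.1 * q ^ ij.2) x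

lemma qPoch_succ {q : ℂ} (hq : ‖q‖ < 1) (x : ℂ) : qPoch x q = (1 - x) * qPoch (x * q) q := by
  have h := multipliable_eprod (summable_norm_pow hq) (x * q)
  have h2 := tprod_eq_zero_mul' (f := fun r : ℕ => 1 - x * q ^ r)
    (h.congr fun r => by rw [pow_succ]; ring)
  rw [qPoch, h2, qPoch]
  congr 1
  · simp
  · exact tprod_congr fun r => by rw [pow_succ]; ring

lemma qPoch_eq_zero_iff {q : ℂ} (hq : ‖q‖ < 1) {x : ℂ} :
    qPoch x q = 0 ↔ ∃ r : ℕ, x * q ^ r = 1 :=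
  eprod_eq_zero_iff (summable_norm_pow hq)

lemma differentiable_qPoch {q : ℂ} (hq : ‖q‖ < 1) : Differentiable ℂ fun x => qPoch x q :=
  differentiable_eprod (summable_norm_pow hq)

lemma qPoch_zero_left (q : ℂ) : qPoch 0 q = 1 := by simp [qPoch]

lemma qPoch_eq_qPochFin_mul {q : ℂ} (hq : ‖q‖ < 1) (x : ℂ) (n : ℕ) :
    qPoch x q = qPochFin x q n * qPoch (x * q ^ n) q := by
  induction n with
  | zero => simp [qPochFin]
  | succ n ih =>
    rw [ih, qPoch_succ hq (x * q ^ n), qPochFin, qPochFin, Finset.prod_range_succ, pow_succ]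
    ring_nf

lemma dPoch_eq_zero_iff {p q : ℂ} (hp : ‖p‖ < 1) (hq : ‖q‖ < 1) {x : ℂ} :
    dPoch p q x = 0 ↔ ∃ i j : ℕ, x * (p ^ i * q ^ j) = 1 := by
  rw [dPoch, eprod_eq_zero_iff (summable_norm_pow_mul_pow hp hq), Prod.exists]

lemma differentiable_dPoch {p q : ℂ} (hp : ‖p‖ < 1) (hq : ‖q‖ < 1) :
    Differentiable ℂ (dPoch p q) :=
  differentiable_eprod (summable_norm_pow_mul_pow hp hq)

lemma dPoch_comm (p q x : ℂ) : dPoch p q x = dPoch q p x := by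
  rw [dPoch, dPoch, eprod, eprod, ← (Equiv.prodComm ℕ ℕ).tprod_eq]
  exact tprod_congr fun ij => by simp [mul_comm]

lemma multipliable_dPoch {p q : ℂ} (hp : ‖p‖ < 1) (hq : ‖q‖ < 1) (x : ℂ) :
    Multipliable fun ij : ℕ × ℕ => 1 - x * (p ^ ij.1 * q ^ ij.2) :=
  multipliable_eprod (summable_norm_pow_mul_pow hp hq) x

lemma hasProd_qPoch_dPoch {p q : ℂ} (hp : ‖p‖ < 1) (hq : ‖q‖ < 1) (x : ℂ) :
    HasProd (fun i : ℕ => qPoch (x * p ^ i) q) (dPoch p q x) := by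
  refine (multipliable_dPoch hp hq x).hasProd.prod_fiberwise fun i => ?_
  have h := (multipliable_eprod (summable_norm_pow hq) (x * p ^ i)).hasProd
  refine h.congr_fun fun j => ?_
  exact congrArg (1 - ·) (mul_assoc x _ _).symm

/-- Splits off the factors with i = 0. Together with `dPoch_right` this yields the shift equations
of Γ and isolates the factor that vanishes at a pole S_a q^k. -/
lemma dPoch_left {p q : ℂ} (hp : ‖p‖ < 1) (hq : ‖q‖ < 1) (x : ℂ) :
    dPoch p q x = qPoch x q * dPoch p q (x * p) := by
  have h := hasProd_qPoch_dPoch hp hq (x * p)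
  have e : (fun i : ℕ => qPoch (x * p * p ^ i) q) = fun i => qPoch (x * p ^ (i + 1)) q := by
    funext i; rw [pow_succ]; ring_nf
  rw [e] at h
  have h2 := tprod_eq_zero_mul' (f := fun i : ℕ => qPoch (x * p ^ i) q) h.multipliable
  rw [(hasProd_qPoch_dPoch hp hq x).tprod_eq, h.tprod_eq] at h2
  simpa using h2

lemma dPoch_right {p q : ℂ} (hp : ‖p‖ < 1) (hq : ‖q‖ < 1) (x : ℂ) :
    dPoch p q x = qPoch x p * dPoch p q (x * q) := by
  rw [dPoch_comm, dPoch_left hq hp, dPoch_comm]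

lemma ellGamma_eq {p q : ℂ} (hp : ‖p‖ < 1) (hq : ‖q‖ < 1) (x : ℂ) :
    ellGamma x p q = dPoch p q (p * q / x) / dPoch p q x := by
  have hs := summable_norm_pow_mul_pow hp hq
  -- At a pole of Γ one factor of the defining product has denominator 0, hence value 0, and so has
  -- the product; this agrees with division by zero on the right.
  by_cases h : dPoch p q x = 0
  · rw [h, div_zero]
    obtain ⟨i, j, hij⟩ := (dPoch_eq_zero_iff hp hq).1 h
    refine (hasProd_zero_of_exists (i := (i, j)) ?_).tprod_eq
    dsimp only
    rw [mul_comm _ x, hij, sub_self, div_zero]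
  · refine HasProd.tprod_eq ?_
    have h1 := (multipliable_eprod hs (p * q / x)).hasProd
    have h2 := (multipliable_eprod hs x).hasProd
    have h3 : Tendsto (fun s : Finset (ℕ × ℕ) => (∏ i ∈ s, (1 - p * q / x * (p ^ i.1 * q ^ i.2))) /
      ∏ i ∈ s, (1 - x * (p ^ i.1 * q ^ i.2))) atTop
      (𝓝 (dPoch p q (p * q / x) / dPoch p q x)) := Tendsto.div h1 h2 h
    refine h3.congr fun s => ?_
    rw [← Finset.prod_div_distrib]
    refine Finset.prod_congr rfl fun ij _ => ?_
    congr 1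
    · rw [pow_succ, pow_succ]; ring
    · ring

lemma theta_div {p x : ℂ} (hp : p ≠ 0) : theta (p / x) p = theta x p := by
  rw [theta, theta, div_div_cancel₀ hp, mul_comm]

lemma theta_mul_self {p x : ℂ} (hp : ‖p‖ < 1) (hp0 : p ≠ 0) (hx : x ≠ 0) :
    theta (p * x) p = -x⁻¹ * theta x p := by
  have e : p / (p * x) = x⁻¹ := by field_simp
  rw [theta, theta, e, qPoch_succ hp x, qPoch_succ hp x⁻¹, mul_comm p x,
    show x⁻¹ * p = p / x by ring]
  field_simp
  ring

lemma theta_inv {p x : ℂ} (hp : ‖p‖ < 1) (hp0 : p ≠ 0) (hx : x ≠ 0) :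
    theta x⁻¹ p = -x⁻¹ * theta x p := by
  rw [← theta_mul_self hp hp0 hx, ← theta_div hp0, div_inv_eq_mul]

lemma theta_mul_pow {q x : ℂ} (hq : ‖q‖ < 1) (hq0 : q ≠ 0) (hx : x ≠ 0) (n : ℕ) :
    (-x) ^ n * q ^ n.choose 2 * theta (x * q ^ n) q = theta x q := by
  induction n with
  | zero => simp
  | succ n ih =>
    have h := theta_mul_self hq hq0 (mul_ne_zero hx (pow_ne_zero n hq0))
    rw [show x * q ^ (n + 1) = q * (x * q ^ n) by ring, h, ← ih, Nat.choose_succ_succ' n 1,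
      Nat.choose_one_right]
    have : q ^ n ≠ 0 := pow_ne_zero n hq0
    field_simp
    ring

lemma theta_zpow_mul {q x : ℂ} (hq : ‖q‖ < 1) (hq0 : q ≠ 0) (hx : x ≠ 0) (n : ℤ) :
    ∃ c : ℂ, c ≠ 0 ∧ theta (x * q ^ n) q = c * theta x q := by
  obtain ⟨m, rfl | rfl⟩ := n.eq_nat_or_neg
  · have h := theta_mul_pow hq hq0 hx m
    have h0 : (-x) ^ m * q ^ m.choose 2 ≠ 0 :=
      mul_ne_zero (pow_ne_zero _ (neg_ne_zero.2 hx)) (pow_ne_zero _ hq0)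
    exact ⟨_, inv_ne_zero h0, by rw [← h, zpow_natCast, inv_mul_cancel_left₀ h0]⟩
  · have hx' : x * q ^ (-(m : ℤ)) ≠ 0 := mul_ne_zero hx (zpow_ne_zero _ hq0)
    have h := theta_mul_pow hq hq0 hx' m
    refine ⟨_, mul_ne_zero (pow_ne_zero m (neg_ne_zero.2 hx')) (pow_ne_zero (m.choose 2) hq0), ?_⟩
    rw [← h]
    congr 2
    rw [zpow_neg, zpow_natCast, mul_assoc, inv_mul_cancel₀ (pow_ne_zero _ hq0), mul_one]

/-- The first Pochhammer symbol accounts for the exponents n ≤ 0, the second for n ≥ 1. -/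
lemma theta_eq_zero_iff {q x : ℂ} (hq : ‖q‖ < 1) (hq0 : q ≠ 0) (hx : x ≠ 0) :
    theta x q = 0 ↔ ∃ n : ℤ, x = q ^ n := by
  rw [theta, mul_eq_zero, qPoch_eq_zero_iff hq, qPoch_eq_zero_iff hq]
  constructor
  · rintro (⟨r, h⟩ | ⟨r, h⟩)
    · exact ⟨-r, by rw [zpow_neg, zpow_natCast]; exact eq_inv_of_mul_eq_one_left h⟩
    · refine ⟨r + 1, ?_⟩
      rw [← Nat.cast_one, ← Nat.cast_add, zpow_natCast, pow_succ]
      field_simp at h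
      linear_combination -h
  · rintro ⟨n, rfl⟩
    obtain ⟨m, rfl | rfl⟩ := n.eq_nat_or_neg
    · cases m with
      | zero => exact Or.inl ⟨0, by simp⟩
      | succ m =>
        refine Or.inr ⟨m, ?_⟩
        rw [zpow_natCast, pow_succ]
        have : q ^ m ≠ 0 := pow_ne_zero m hq0
        field_simp
    · refine Or.inl ⟨m, ?_⟩
      rw [zpow_neg, zpow_natCast, inv_mul_cancel₀ (pow_ne_zero _ hq0)]

lemma differentiableAt_theta {q x : ℂ} (hq : ‖q‖ < 1) (hx : x ≠ 0) :
    DifferentiableAt ℂ (fun y => theta y q) x := by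
  refine (differentiable_qPoch hq x).mul ?_
  exact (differentiable_qPoch hq (q / x)).comp (f := fun y => q / y) x
    ((differentiableAt_const q).div differentiableAt_id hx)

lemma ellGamma_mul_right {p q x : ℂ} (hp : ‖p‖ < 1) (hq : ‖q‖ < 1) (hq0 : q ≠ 0)
    (hx : x ≠ 0) (h : theta x p ≠ 0) : ellGamma (x * q) p q = theta x p * ellGamma x p q := by
  rw [ellGamma_eq hp hq, ellGamma_eq hp hq, dPoch_right hp hq x,
    show p * q / (x * q) = p / x by field_simp, dPoch_right hp hq (p / x),
    show p / x * q = p * q / x by ring, theta]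
  have h1 : qPoch x p ≠ 0 := left_ne_zero_of_mul h
  field_simp

lemma ellGamma_comm {p q : ℂ} (hp : ‖p‖ < 1) (hq : ‖q‖ < 1) (x : ℂ) :
    ellGamma x p q = ellGamma x q p := by
  rw [ellGamma_eq hp hq, ellGamma_eq hq hp, dPoch_comm p q, dPoch_comm p q, mul_comm p q]

lemma ellGamma_mul_pow {p q x : ℂ} (hp : ‖p‖ < 1) (hq : ‖q‖ < 1) (hq0 : q ≠ 0)
    (hx : x ≠ 0) (n : ℕ) (h : ∀ j < n, theta (x * q ^ j) p ≠ 0) :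
    ellGamma (x * q ^ n) p q =
      (∏ j ∈ Finset.range n, theta (x * q ^ j) p) * ellGamma x p q := by
  induction n with
  | zero => simp
  | succ n ih =>
    rw [pow_succ, ← mul_assoc, ellGamma_mul_right hp hq hq0
      (mul_ne_zero hx (pow_ne_zero _ hq0)) (h n n.lt_succ_self),
      ih fun j hj => h j (hj.trans n.lt_succ_self), Finset.prod_range_succ]
    ring

/-- With x = z² this turns the density 1/Γ(z^{±2}) into θ(z²;p) θ(z⁻²;q), which is holomorphic on
ℂ*. -/
lemma ellGamma_mul_ellGamma_inv {p q x : ℂ} (hp : ‖p‖ < 1) (hq : ‖q‖ < 1)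
    (h1 : dPoch p q (p * q * x) ≠ 0) (h2 : dPoch p q (p * q / x) ≠ 0) :
    ellGamma x p q * ellGamma x⁻¹ p q = (theta x p * theta x⁻¹ q)⁻¹ := by
  have e1 : dPoch p q x = qPoch x p * (qPoch (q * x) q * dPoch p q (p * q * x)) := by
    rw [dPoch_right hp hq x, dPoch_left hp hq (x * q)]; ring_nf
  have e2 : dPoch p q x⁻¹ = qPoch x⁻¹ q * (qPoch (p / x) p * dPoch p q (p * q / x)) := by
    rw [dPoch_left hp hq x⁻¹, dPoch_right hp hq (x⁻¹ * p)]; ring_nf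
  rw [ellGamma_eq hp hq, ellGamma_eq hp hq, e1, e2, theta, theta, div_inv_eq_mul, div_inv_eq_mul]
  rw [div_mul_div_comm, eq_comm, inv_eq_one_div]
  -- Where one of the theta functions vanishes, both sides are 0 by the convention for division by
  -- zero.
  by_cases h3 : qPoch x p * qPoch (p / x) p * (qPoch x⁻¹ q * qPoch (q * x) q) = 0
  · rw [h3, div_zero, eq_comm, div_eq_zero_iff]
    right
    linear_combination (dPoch p q (p * q * x) * dPoch p q (p * q / x)) * h3
  · rw [div_eq_div_iff h3]
    · ring
    · have := mul_ne_zero h3 (mul_ne_zero h1 h2)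
      convert this using 1
      ring

end EllipticPairing

end

noncomputable section

namespace EllipticPairing

/-! ### The addition formula for theta functions -/

/-- Removable singularities: the zeros of g are simple and f vanishes there, so f/g extends by the
value f'/g'. Near such a zero both functions are z − c times their `dslope`. -/
lemma exists_differentiableOn_eq_mul {f g : ℂ → ℂ} (hf : DifferentiableOn ℂ f {0}ᶜ)
    (hg : DifferentiableOn ℂ g {0}ᶜ)
    (h : ∀ z : ℂ, z ≠ 0 → g z = 0 → f z = 0 ∧ deriv g z ≠ 0) :
    ∃ k : ℂ → ℂ, DifferentiableOn ℂ k {0}ᶜ ∧ ∀ z : ℂ, z ≠ 0 → f z = k z * g z := by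
  classical
  refine ⟨fun z => if g z = 0 then deriv f z / deriv g z else f z / g z, fun c hc => ?_,
    fun z hz => ?_⟩
  · have hU : ({0}ᶜ : Set ℂ) ∈ 𝓝 c := isOpen_compl_singleton.mem_nhds hc
    refine DifferentiableAt.differentiableWithinAt ?_
    by_cases h0 : g c = 0
    · obtain ⟨hf0, hd⟩ := h c hc h0
      have df := ((Complex.differentiableOn_dslope hU).2 hf).differentiableAt hU
      have dg := ((Complex.differentiableOn_dslope hU).2 hg).differentiableAt hU
      have hd' : dslope g c c ≠ 0 := by rwa [dslope_same]
      refine (df.div dg hd').congr_of_eventuallyEq ?_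
      filter_upwards [dg.continuousAt.eventually_ne hd'] with z hz
      rcases eq_or_ne z c with rfl | hzc
      · simp [h0, dslope_same]
      · have e1 : g z = (z - c) * dslope g c z := by
          have := sub_smul_dslope g c z
          rw [h0, sub_zero, smul_eq_mul] at this
          exact this.symm
        have e2 : f z = (z - c) * dslope f c z := by
          have := sub_smul_dslope f c z
          rw [hf0, sub_zero, smul_eq_mul] at this
          exact this.symm
        have hzc' := sub_ne_zero.2 hzc
        rw [if_neg (by rw [e1]; exact mul_ne_zero hzc' hz), e1, e2]
        simp only [Pi.div_apply]
        field_simp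
    · have dg := hg.differentiableAt hU
      refine ((hf.differentiableAt hU).div dg h0).congr_of_eventuallyEq ?_
      filter_upwards [dg.continuousAt.eventually_ne h0] with z hz
      simp [hz]
  · by_cases h0 : g z = 0
    · simp [h0, (h z hz h0).1]
    · simp [h0]

lemma exists_zpow_mul_mem_annulus {q z : ℂ} (hq : ‖q‖ < 1) (hq0 : q ≠ 0) (hz : z ≠ 0) :
    ∃ n : ℤ, ‖q‖ ≤ ‖z * q ^ n‖ ∧ ‖z * q ^ n‖ ≤ 1 := by
  have hq' : 0 < ‖q‖ := norm_pos_iff.2 hq0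
  obtain ⟨n, h1, h2⟩ := exists_mem_Ioc_zpow (norm_pos_iff.2 hz) ((one_lt_inv₀ hq').2 hq)
  refine ⟨n + 1, ?_, ?_⟩
  · rw [norm_mul, norm_zpow, zpow_add_one₀ hq'.ne']
    rw [inv_zpow] at h1
    have := (inv_lt_iff_one_lt_mul₀ (zpow_pos hq' n)).1 h1
    nlinarith
  · rw [norm_mul, norm_zpow]
    rw [inv_zpow] at h2
    exact (le_inv_mul_iff₀' (zpow_pos hq' (n + 1))).1 (by simpa using h2)

/-- Liouville's theorem: k ∘ exp is entire, and it is bounded since k takes all its values on the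
compact fundamental annulus |q| ≤ |z| ≤ 1. -/
lemma eq_of_mul_periodic {q : ℂ} (hq : ‖q‖ < 1) (hq0 : q ≠ 0) {k : ℂ → ℂ}
    (hk : DifferentiableOn ℂ k {0}ᶜ) (h : ∀ z, z ≠ 0 → k (q * z) = k z) {z z' : ℂ}
    (hz : z ≠ 0) (hz' : z' ≠ 0) : k z = k z' := by
  have hz1 : ∀ z : ℂ, z ≠ 0 → ∀ n : ℕ, k (z * q ^ n) = k z := fun z hz n => by
    induction n with
    | zero => simp
    | succ n ih =>
      rw [← ih, ← h (z * q ^ n) (mul_ne_zero hz (pow_ne_zero _ hq0)), pow_succ]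
      exact congrArg k (by ring)
  have hz2 : ∀ z : ℂ, z ≠ 0 → ∀ n : ℤ, k (z * q ^ n) = k z := fun z hz n => by
    obtain ⟨m, rfl | rfl⟩ := n.eq_nat_or_neg
    · exact_mod_cast hz1 z hz m
    · rw [← hz1 (z * q ^ (-(m : ℤ))) (mul_ne_zero hz (zpow_ne_zero _ hq0)) m, zpow_neg,
        zpow_natCast, mul_assoc, inv_mul_cancel₀ (pow_ne_zero _ hq0), mul_one]
  have hd : Differentiable ℂ fun u => k (Complex.exp u) := fun u =>
    (hk.differentiableAt (isOpen_compl_singleton.mem_nhds (Complex.exp_ne_zero u))).comp u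
      Complex.differentiable_exp.differentiableAt
  have hK : IsCompact (Metric.closedBall (0 : ℂ) 1 \ Metric.ball 0 ‖q‖) :=
    (isCompact_closedBall 0 1).diff Metric.isOpen_ball
  have hb : Bornology.IsBounded (Set.range fun u => k (Complex.exp u)) := by
    refine (hK.image_of_continuousOn (hk.continuousOn.mono ?_)).isBounded.subset ?_
    · rintro w ⟨-, hw⟩ rfl
      exact hw (Metric.mem_ball_self (norm_pos_iff.2 hq0))
    · rintro _ ⟨u, rfl⟩
      obtain ⟨n, h1, h2⟩ := exists_zpow_mul_mem_annulus hq hq0 (Complex.exp_ne_zero u)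
      exact ⟨_, ⟨by simpa using h2, by simpa using h1⟩, hz2 _ (Complex.exp_ne_zero u) n⟩
  have := hd.apply_eq_apply_of_bounded hb (Complex.log z) (Complex.log z')
  simpa [Complex.exp_log hz, Complex.exp_log hz'] using this

lemma theta_one {q : ℂ} (hq : ‖q‖ < 1) (hq0 : q ≠ 0) : theta 1 q = 0 :=
  (theta_eq_zero_iff hq hq0 one_ne_zero).2 ⟨0, by simp⟩

/-- The zeros of θ are simple. At y = 1 this comes from the factor 1 − y; quasi-periodicity
transports it to q^n by induction in both directions. -/
lemma exists_hasDerivAt_theta {q : ℂ} (hq : ‖q‖ < 1) (hq0 : q ≠ 0) (n : ℤ) :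
    ∃ d : ℂ, d ≠ 0 ∧ HasDerivAt (fun y => theta y q) d (q ^ n) := by
  have hzero : ∀ n : ℤ, theta (q ^ n) q = 0 := fun n =>
    (theta_eq_zero_iff hq hq0 (zpow_ne_zero n hq0)).2 ⟨n, rfl⟩
  induction n using Int.induction_on with
  | zero =>
    have hd : DifferentiableAt ℂ (fun y => qPoch (y * q) q * qPoch (q / y) q) 1 := by
      refine DifferentiableAt.mul ?_ ?_
      · exact (differentiable_qPoch hq _).comp (f := fun y => y * q) 1 (by fun_prop)
      · exact (differentiable_qPoch hq _).comp (f := fun y => q / y) 1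
          ((differentiableAt_const q).div differentiableAt_id one_ne_zero)
    have h1 : HasDerivAt (fun y : ℂ => 1 - y) (-1) 1 := by
      simpa using (hasDerivAt_id (1 : ℂ)).const_sub 1
    have h2 := h1.mul hd.hasDerivAt
    have hne : qPoch q q ≠ 0 := fun h => by
      obtain ⟨r, hr⟩ := (qPoch_eq_zero_iff hq).1 h
      have : ‖q * q ^ r‖ < 1 := by
        rw [norm_mul, norm_pow]
        exact mul_lt_one_of_nonneg_of_lt_one_left (norm_nonneg _) hq
          (pow_le_one₀ (norm_nonneg _) hq.le)
      rw [hr, norm_one] at this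
      exact lt_irrefl _ this
    refine ⟨-1 * (qPoch (1 * q) q * qPoch (q / 1) q), by simpa using hne, ?_⟩
    rw [zpow_zero]
    rw [sub_self, zero_mul, add_zero] at h2
    refine h2.congr_of_eventuallyEq (Eventually.of_forall fun y => ?_)
    simp only [theta, Pi.mul_apply]
    rw [qPoch_succ hq y, mul_assoc]
  | succ n ih =>
    obtain ⟨d, hd, h⟩ := ih
    have hn : q ^ (n : ℤ) ≠ 0 := zpow_ne_zero _ hq0
    have e : q ^ ((n : ℤ) + 1) / q = q ^ (n : ℤ) := by rw [zpow_add_one₀ hq0]; field_simp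
    have hne : q ^ ((n : ℤ) + 1) ≠ 0 := zpow_ne_zero _ hq0
    have h1 : HasDerivAt (fun y : ℂ => theta (y / q) q) (d * (1 / q)) (q ^ ((n : ℤ) + 1)) := by
      refine HasDerivAt.comp (h₂ := fun y => theta y q) _ ?_ ((hasDerivAt_id _).div_const q)
      simpa [e] using h
    have h2 : HasDerivAt (fun y : ℂ => -(y / q)⁻¹) (deriv (fun y : ℂ => -(y / q)⁻¹)
        (q ^ ((n : ℤ) + 1))) (q ^ ((n : ℤ) + 1)) := by
      refine DifferentiableAt.hasDerivAt (DifferentiableAt.neg (DifferentiableAt.inv ?_ ?_))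
      · fun_prop
      · rw [e]; exact hn
    refine ⟨_, ?_, (h2.mul h1).congr_of_eventuallyEq ?_⟩
    · rw [e, hzero]
      simp [hd, hq0]
    · filter_upwards [isOpen_compl_singleton.mem_nhds hne] with y hy
      simp only [Pi.mul_apply]
      rw [← theta_mul_self hq hq0 (div_ne_zero hy hq0), mul_div_cancel₀ y hq0]
  | pred n ih =>
    obtain ⟨d, hd, h⟩ := ih
    have hne : q ^ (-(n : ℤ) - 1) ≠ 0 := zpow_ne_zero _ hq0
    have e : q * q ^ (-(n : ℤ) - 1) = q ^ (-(n : ℤ)) := by rw [zpow_sub_one₀ hq0]; field_simp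
    have h1 : HasDerivAt (fun y : ℂ => theta (q * y) q) (d * (q * 1)) (q ^ (-(n : ℤ) - 1)) := by
      refine HasDerivAt.comp (h₂ := fun y => theta y q) _ ?_ ((hasDerivAt_id _).const_mul q)
      simpa [e] using h
    have h2 : HasDerivAt (fun y : ℂ => -y) (-1) (q ^ (-(n : ℤ) - 1)) := (hasDerivAt_id _).neg
    refine ⟨_, ?_, (h2.mul h1).congr_of_eventuallyEq ?_⟩
    · rw [e, hzero]
      simpa [hd, hq0] using hne
    · filter_upwards [isOpen_compl_singleton.mem_nhds hne] with y hy
      simp only [Pi.mul_apply]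
      rw [theta_mul_self hq hq0 hy]
      field_simp [show y ≠ 0 from hy]

/-- The numerator `θ(Az, Bz, Cz, ABC/z; q)` of the symmetry breaking factor. -/
def breaker (q A B C z : ℂ) : ℂ :=
  theta (A * z) q * theta (B * z) q * theta (C * z) q * theta (A * B * C / z) q

section breaker

variable {q A B C : ℂ} (hq : ‖q‖ < 1) (hq0 : q ≠ 0) (hA : A ≠ 0) (hB : B ≠ 0) (hC : C ≠ 0)
include hq hq0 hA hB hC

/-- The factors in Az, Bz, Cz contribute −1/(Az), −1/(Bz), −1/(Cz) and the last one −ABC/(qz). The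
parameter ABC is chosen such that A, B, C cancel and the multiplier is that of θ(z²;q). -/
lemma breaker_mul {z : ℂ} (hz : z ≠ 0) :
    breaker q A B C (q * z) = breaker q A B C z / (q * z ^ 4) := by
  have h : ∀ X : ℂ, X ≠ 0 → theta (X * (q * z)) q = -(X * z)⁻¹ * theta (X * z) q := fun X hX => by
    rw [← theta_mul_self hq hq0 (mul_ne_zero hX hz)]
    ring_nf
  have h2 : theta (A * B * C / (q * z)) q = -(A * B * C / (q * z)) * theta (A * B * C / z) q := by
    have hne : A * B * C / (q * z) ≠ 0 := by positivity
    rw [show A * B * C / z = q * (A * B * C / (q * z)) by field_simp, theta_mul_self hq hq0 hne]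
    field_simp
  rw [breaker, breaker, h A hA, h B hB, h C hC, h2]
  field_simp

omit hq0 in
lemma differentiableOn_breaker : DifferentiableOn ℂ (breaker q A B C) {0}ᶜ := by
  intro z hz
  have hz' : z ≠ 0 := hz
  have h : ∀ X : ℂ, X ≠ 0 → DifferentiableAt ℂ (fun z => theta (X * z) q) z := fun X hX =>
    (differentiableAt_theta hq (mul_ne_zero hX hz')).comp (f := fun z => X * z) z (by fun_prop)
  have h2 : DifferentiableAt ℂ (fun z => theta (A * B * C / z) q) z :=
    (differentiableAt_theta hq (div_ne_zero (by positivity) hz')).comp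
      (f := fun z => A * B * C / z) z ((differentiableAt_const _).div differentiableAt_id hz')
  exact ((((h A hA).mul (h B hB)).mul (h C hC)).mul h2).differentiableWithinAt

/-- Both sides have the multiplier 1/(qz⁴) under z → qz, and the left side vanishes at the simple
zeros of θ(z²;q). The quotient by θ(z²;q) is therefore holomorphic and q-periodic on ℂ*, hence
constant. The constant is read off at z = 1/A, where the first term vanishes; the condition on A²
makes this possible. -/
lemma breaker_sub_eq (hA2 : theta (A ^ 2) q ≠ 0) {z : ℂ} (hz : z ≠ 0) :
    breaker q A B C z - z ^ 2 * breaker q A B C z⁻¹ =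
      theta (A * B) q * theta (A * C) q * theta (B * C) q * theta (z ^ 2) q := by
  set M : ℂ → ℂ := fun z => breaker q A B C z - z ^ 2 * breaker q A B C z⁻¹ with hM
  have hb := differentiableOn_breaker hq hA hB hC
  have hMd : DifferentiableOn ℂ M {0}ᶜ := by
    refine hb.sub (DifferentiableOn.mul (by fun_prop) ?_)
    exact hb.comp (differentiableOn_inv.mono fun z hz => hz) fun z hz => inv_ne_zero hz
  have hgd : DifferentiableOn ℂ (fun z => theta (z ^ 2) q) {0}ᶜ := fun z hz =>
    ((differentiableAt_theta hq (pow_ne_zero 2 hz)).comp (f := fun z : ℂ => z ^ 2) z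
      (by fun_prop)).differentiableWithinAt
  have hMq : ∀ z : ℂ, z ≠ 0 → M (q * z) = M z / (q * z ^ 4) := fun z hz => by
    have h1 := breaker_mul hq hq0 hA hB hC hz
    have hne : (q * z)⁻¹ ≠ 0 := inv_ne_zero (mul_ne_zero hq0 hz)
    have h2 := breaker_mul hq hq0 hA hB hC hne
    rw [show q * (q * z)⁻¹ = z⁻¹ by field_simp] at h2
    simp only [hM]
    rw [h1, h2]
    field_simp
  have hMzero : ∀ z : ℂ, z ≠ 0 → ∀ n : ℕ, M (z * q ^ n) = 0 ↔ M z = 0 := fun z hz n => by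
    induction n with
    | zero => simp
    | succ n ih =>
      have hne : z * q ^ n ≠ 0 := mul_ne_zero hz (pow_ne_zero _ hq0)
      rw [← ih, pow_succ, ← mul_assoc, mul_comm _ q, hMq _ hne, div_eq_zero_iff]
      simp [hq0, hne]
  have hMzero' : ∀ z : ℂ, z ≠ 0 → ∀ n : ℤ, M (z * q ^ n) = 0 ↔ M z = 0 := fun z hz n => by
    obtain ⟨m, rfl | rfl⟩ := n.eq_nat_or_neg
    · exact_mod_cast hMzero z hz m
    · rw [← hMzero (z * q ^ (-(m : ℤ))) (mul_ne_zero hz (zpow_ne_zero _ hq0)) m, zpow_neg,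
        zpow_natCast, mul_assoc, inv_mul_cancel₀ (pow_ne_zero _ hq0), mul_one]
  have hgder : ∀ z : ℂ, z ≠ 0 → theta (z ^ 2) q = 0 →
      ∃ d : ℂ, d ≠ 0 ∧ HasDerivAt (fun z => theta (z ^ 2) q) d z := fun z hz h0 => by
    obtain ⟨n, hn⟩ := (theta_eq_zero_iff hq hq0 (pow_ne_zero 2 hz)).1 h0
    obtain ⟨d, hd, hder⟩ := exists_hasDerivAt_theta hq hq0 n
    rw [← hn] at hder
    have h2 : HasDerivAt (fun z : ℂ => z ^ 2) (2 * z) z := by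
      simpa using hasDerivAt_pow 2 z
    exact ⟨d * (2 * z), by simp [hd, hz],
      HasDerivAt.comp (h₂ := fun y => theta y q) z hder h2⟩
  obtain ⟨k, hk, hkM⟩ := exists_differentiableOn_eq_mul hMd hgd fun z hz h0 => by
    obtain ⟨n, hn⟩ := (theta_eq_zero_iff hq hq0 (pow_ne_zero 2 hz)).1 h0
    refine ⟨?_, ?_⟩
    -- Here z² = q^n. A shift by a power of q reduces to y² = 1, where 1/y = y and the two terms
    -- coincide, or to y² = q, where q/y = y and quasi-periodicity relates them.
    · obtain ⟨m, rfl | rfl⟩ := Int.even_or_odd' n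
      · have hy : (z * q ^ (-m)) ^ 2 = 1 := by
          rw [mul_pow, hn, ← zpow_natCast (q ^ (-m)), ← zpow_mul, ← zpow_add₀ hq0]
          simp [mul_comm]
        rw [← hMzero' z hz (-m)]
        have hyi : (z * q ^ (-m))⁻¹ = z * q ^ (-m) :=
          (eq_inv_of_mul_eq_one_left (by rw [← sq, hy])).symm
        simp only [hM]
        rw [hyi, hy]
        ring
      · have hne : z * q ^ (-m) ≠ 0 := mul_ne_zero hz (zpow_ne_zero _ hq0)
        have hy : (z * q ^ (-m)) ^ 2 = q := by
          rw [mul_pow, hn, ← zpow_natCast (q ^ (-m)), ← zpow_mul, ← zpow_add₀ hq0]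
          have : 2 * m + 1 + -m * ((2 : ℕ) : ℤ) = 1 := by push_cast; ring
          rw [this, zpow_one]
        rw [← hMzero' z hz (-m)]
        set y := z * q ^ (-m) with hydef
        have h1 := breaker_mul hq hq0 hA hB hC (inv_ne_zero hne)
        have e : q * y⁻¹ = y := by rw [← hy]; field_simp
        rw [e] at h1
        simp only [hM]
        rw [h1, ← hy]
        field_simp
        ring
    · obtain ⟨d, hd, hder⟩ := hgder z hz h0
      rwa [hder.deriv]
  have hk1 : ∀ z : ℂ, z ≠ 0 → theta (z ^ 2) q ≠ 0 → k (q * z) = k z := fun z hz h0 => by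
    have h1 := hkM (q * z) (mul_ne_zero hq0 hz)
    have h2 : theta ((q * z) ^ 2) q = theta (z ^ 2) q / (q * z ^ 4) := by
      have hz2 := pow_ne_zero 2 hz
      rw [show (q * z) ^ 2 = q * (q * z ^ 2) by ring,
        theta_mul_self hq hq0 (mul_ne_zero hq0 hz2), theta_mul_self hq hq0 hz2]
      field_simp
    rw [hMq z hz, hkM z hz, h2] at h1
    field_simp at h1
    rw [mul_comm q z]
    exact h1.symm
  -- At the zeros of θ(z²;q), which are isolated, periodicity follows by continuity.
  have hk2 : ∀ z : ℂ, z ≠ 0 → k (q * z) = k z := fun z hz => by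
    by_cases h0 : theta (z ^ 2) q = 0
    · obtain ⟨d, hd, hder⟩ := hgder z hz h0
      have hU : ({0}ᶜ : Set ℂ) ∈ 𝓝 z := isOpen_compl_singleton.mem_nhds hz
      have hU' : ({0}ᶜ : Set ℂ) ∈ 𝓝 (q * z) :=
        isOpen_compl_singleton.mem_nhds (mul_ne_zero hq0 hz)
      have c1 : ContinuousAt k z := (hk.differentiableAt hU).continuousAt
      have c2 : ContinuousAt (fun z => k (q * z)) z :=
        ContinuousAt.comp (g := k) (f := fun z => q * z) (hk.differentiableAt hU').continuousAt
          (by fun_prop)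
      refine tendsto_nhds_unique_of_eventuallyEq (l := 𝓝[≠] z)
        (c2.tendsto.mono_left nhdsWithin_le_nhds) (c1.tendsto.mono_left nhdsWithin_le_nhds) ?_
      filter_upwards [hder.eventually_ne (c := 0) hd, mem_nhdsWithin_of_mem_nhds hU]
        with y hy hy0 using hk1 y hy0 hy
    · exact hk1 z hz h0
  have hAi : A⁻¹ ≠ 0 := inv_ne_zero hA
  have h1 := hkM A⁻¹ hAi
  have h2 : breaker q A B C A⁻¹ = 0 := by
    rw [breaker, mul_inv_cancel₀ hA, theta_one hq hq0]
    ring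
  have h3 : breaker q A B C A =
      theta (A ^ 2) q * theta (A * B) q * theta (A * C) q * theta (B * C) q := by
    rw [breaker, ← sq, mul_comm B A, mul_comm C A, mul_assoc A B C, mul_div_cancel_left₀ _ hA]
  have h4 : theta (A⁻¹ ^ 2) q = -(A ^ 2)⁻¹ * theta (A ^ 2) q := by
    rw [inv_pow, theta_inv hq hq0 (pow_ne_zero 2 hA)]
  simp only [hM] at h1
  rw [h2, inv_inv, h3, h4] at h1
  have h5 : k A⁻¹ = theta (A * B) q * theta (A * C) q * theta (B * C) q := by
    have h0 : -(A ^ 2)⁻¹ * theta (A ^ 2) q ≠ 0 :=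
      mul_ne_zero (neg_ne_zero.2 (inv_ne_zero (pow_ne_zero 2 hA))) hA2
    refine mul_right_cancel₀ h0 ?_
    rw [← h1, inv_pow]
    ring
  have h6 := hkM z hz
  rw [eq_of_mul_periodic hq hq0 hk hk2 hz hAi, h5] at h6
  exact h6

end breaker

end EllipticPairing

end

noncomputable section

namespace EllipticPairing

/-! ### Cauchy's theorem for chains of circles -/

/-- The integral of `g dz` over a chain. -/
def chainSum (C : List WeightedCircle) (g : ℂ → ℂ) : ℂ :=
  (C.map fun c => (c.mult : ℂ) * circleIntegral g c.center c.radius).sum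

lemma chainIntegral_eq (C : List WeightedCircle) (h : ℂ → ℂ) :
    chainIntegral C h = (2 * Real.pi * Complex.I)⁻¹ * chainSum C fun z => h z / z := by
  simp only [chainIntegral, chainSum, ← List.sum_map_mul_left]
  congr 1
  exact List.map_congr_left fun c _ => by ring

lemma chainSum_congr {C : List WeightedCircle} {g g' : ℂ → ℂ}
    (h : ∀ c ∈ C, circleIntegral g c.center c.radius = circleIntegral g' c.center c.radius) :
    chainSum C g = chainSum C g' := by
  rw [chainSum, chainSum]
  congr 1
  exact List.map_congr_left fun c hc => by rw [h c hc]

lemma chainSum_eq_zero {C : List WeightedCircle} {g : ℂ → ℂ}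
    (h : ∀ c ∈ C, circleIntegral g c.center c.radius = 0) : chainSum C g = 0 :=
  List.sum_eq_zero fun x hx => by
    obtain ⟨c, hc, rfl⟩ := List.mem_map.1 hx
    rw [h c hc, mul_zero]

lemma chainSum_add {C : List WeightedCircle} {g g' : ℂ → ℂ}
    (h : ∀ c ∈ C, CircleIntegrable g c.center c.radius)
    (h' : ∀ c ∈ C, CircleIntegrable g' c.center c.radius) :
    chainSum C (fun z => g z + g' z) = chainSum C g + chainSum C g' := by
  rw [chainSum, chainSum, chainSum, ← List.sum_map_add]
  congr 1
  exact List.map_congr_left fun c hc => by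
    rw [circleIntegral.integral_add (h c hc) (h' c hc), mul_add]

lemma chainSum_const_mul (C : List WeightedCircle) (a : ℂ) (g : ℂ → ℂ) :
    chainSum C (fun z => a * g z) = a * chainSum C g := by
  rw [chainSum, chainSum, ← List.sum_map_mul_left]
  congr 1
  exact List.map_congr_left fun c _ => by
    rw [circleIntegral.integral_const_mul]; ring

lemma chainSum_append (C C' : List WeightedCircle) (g : ℂ → ℂ) :
    chainSum (C ++ C') g = chainSum C g + chainSum C' g := by
  simp [chainSum]

lemma windingNumber_append (C C' : List WeightedCircle) (x : ℂ) :
    windingNumber (C ++ C') x = windingNumber C x + windingNumber C' x := by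
  simp [windingNumber]

/-- Turns knowledge about single circles into a winding number. It is applied at the origin and at
simple poles and takes the place of a homology argument. -/
lemma chainSum_eq_windingNumber_mul {C : List WeightedCircle} {g : ℂ → ℂ} {x J : ℂ}
    (h : ∀ c ∈ C, circleIntegral g c.center c.radius =
      if dist x c.center < c.radius then J else 0) :
    chainSum C g = windingNumber C x * J := by
  induction C with
  | nil => simp [chainSum, windingNumber]
  | cons c C ih =>
    have h1 := ih fun c' hc' => h c' (List.mem_cons_of_mem _ hc')
    have h2 := h c List.mem_cons_self
    simp only [chainSum, windingNumber, List.map_cons, List.sum_cons, Int.cast_add] at h1 ⊢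
    rw [h1, h2, add_mul]
    split_ifs <;> simp

/-- The open annulus `r₁ < ‖z‖ < r₂`. -/
def annulus (r₁ r₂ : ℝ) : Set ℂ := {z | r₁ < ‖z‖ ∧ ‖z‖ < r₂}

lemma isOpen_annulus (r₁ r₂ : ℝ) : IsOpen (annulus r₁ r₂) :=
  (isOpen_lt continuous_const continuous_norm).inter (isOpen_lt continuous_norm continuous_const)

/-- The circles of the chain are circles about the origin, or do not enclose it, and lie in the
annulus `r₁ < ‖z‖ < r₂`. -/
def ChainIn (C : List WeightedCircle) (r₁ r₂ : ℝ) : Prop :=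
  ∀ c ∈ C, 0 < c.radius ∧ ‖c.center‖ + c.radius < r₂ ∧
    ((c.center = 0 ∧ r₁ < c.radius) ∨ (c.center ≠ 0 ∧ r₁ + c.radius < ‖c.center‖))

section chain

variable {C : List WeightedCircle} {r₁ r₂ : ℝ}

lemma ChainIn.sphere_subset (hC : ChainIn C r₁ r₂) {c : WeightedCircle}
    (hc : c ∈ C) : Metric.sphere c.center c.radius ⊆ annulus r₁ r₂ := by
  intro z hz
  rw [mem_sphere_iff_norm] at hz
  obtain ⟨h0, h1, h2⟩ := hC c hc
  have h3 : ‖z‖ ≤ ‖c.center‖ + c.radius := by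
    have := norm_add_le (z - c.center) c.center
    rw [sub_add_cancel, hz] at this
    linarith
  refine ⟨?_, h3.trans_lt h1⟩
  rcases h2 with ⟨h, h'⟩ | ⟨h, h'⟩
  · rw [h, sub_zero] at hz
    rwa [hz]
  · have := norm_sub_norm_le c.center (c.center - z)
    rw [sub_sub_cancel, norm_sub_rev, hz] at this
    linarith

lemma ChainIn.closedBall_subset (hC : ChainIn C r₁ r₂) {c : WeightedCircle}
    (hc : c ∈ C) (hc0 : c.center ≠ 0) : Metric.closedBall c.center c.radius ⊆ annulus r₁ r₂ := by
  intro z hz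
  rw [mem_closedBall_iff_norm] at hz
  obtain ⟨h0, h1, h2⟩ := hC c hc
  rcases h2 with ⟨h, h'⟩ | ⟨h, h'⟩
  · exact absurd h hc0
  · constructor
    · have := norm_sub_norm_le c.center (c.center - z)
      rw [sub_sub_cancel, norm_sub_rev] at this
      linarith
    · have := norm_add_le (z - c.center) c.center
      rw [sub_add_cancel] at this
      linarith

lemma ChainIn.dist_zero_lt_iff (hr : 0 < r₁) (hC : ChainIn C r₁ r₂) {c : WeightedCircle}
    (hc : c ∈ C) : dist 0 c.center < c.radius ↔ c.center = 0 := by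
  obtain ⟨h0, h1, h2⟩ := hC c hc
  rw [dist_zero_left]
  rcases h2 with ⟨h, h'⟩ | ⟨h, h'⟩
  · simp [h, h0]
  · simp only [h, iff_false, not_lt]
    linarith

/-- Cauchy's theorem for a function that is holomorphic on the annulus. -/
lemma chainSum_eq_zero_of_differentiableOn (hr : 0 < r₁) (hC : ChainIn C r₁ r₂)
    (hw0 : windingNumber C 0 = 0) {H : ℂ → ℂ} (hH : DifferentiableOn ℂ H (annulus r₁ r₂)) :
    chainSum C H = 0 := by
  have hΩ := isOpen_annulus r₁ r₂
  have hdisc : ∀ c ∈ C, c.center ≠ 0 → circleIntegral H c.center c.radius = 0 := by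
    intro c hc hc0
    have hs := hC.closedBall_subset hc hc0
    refine Complex.circleIntegral_eq_zero_of_differentiable_on_off_countable (hC c hc).1.le
      Set.countable_empty (hH.continuousOn.mono hs) fun z hz => ?_
    exact hH.differentiableAt (hΩ.mem_nhds (hs (Metric.ball_subset_closedBall hz.1)))
  have hcent : ∀ c ∈ C, c.center = 0 → ∀ c' ∈ C, c'.center = 0 → c.radius ≤ c'.radius →
      circleIntegral H 0 c.radius = circleIntegral H 0 c'.radius := by
    intro c hc hc0 c' hc' hc0' hle
    have hs : Metric.closedBall (0 : ℂ) c'.radius \ Metric.ball 0 c.radius ⊆ annulus r₁ r₂ := by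
      rintro z ⟨h1, h2⟩
      simp only [Metric.mem_closedBall, Metric.mem_ball, dist_zero_right, not_lt] at h1 h2
      have h3 := (hC c' hc').2.1
      rw [hc0', norm_zero, zero_add] at h3
      rcases (hC c hc).2.2 with ⟨-, h4⟩ | ⟨h4, -⟩
      · exact ⟨h4.trans_le h2, h1.trans_lt h3⟩
      · exact absurd hc0 h4
    refine (Complex.circleIntegral_eq_of_differentiable_on_annulus_off_countable (hC c hc).1 hle
      Set.countable_empty (hH.continuousOn.mono hs) fun z hz => ?_).symm
    refine hH.differentiableAt (hΩ.mem_nhds (hs ⟨Metric.ball_subset_closedBall hz.1.1, ?_⟩))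
    exact fun h => hz.1.2 (Metric.ball_subset_closedBall h)
  by_cases hex : ∃ c₀ ∈ C, c₀.center = 0
  · obtain ⟨c₀, hc₀, h0⟩ := hex
    rw [chainSum_eq_windingNumber_mul (x := 0) (J := circleIntegral H 0 c₀.radius), hw0,
      Int.cast_zero, zero_mul]
    intro c hc
    simp only [hC.dist_zero_lt_iff hr hc]
    split_ifs with h
    · rw [h]
      rcases le_total c.radius c₀.radius with hle | hle
      · exact hcent c hc h c₀ hc₀ h0 hle
      · exact (hcent c₀ hc₀ h0 c hc h hle).symm
    · exact hdisc c hc h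
  · push Not at hex
    exact chainSum_eq_zero fun c hc => hdisc c hc (hex c hc)

lemma chainSum_inv_sub {x : ℂ} (hC : ChainIn C r₁ r₂)
    (hx : ∀ c ∈ C, dist x c.center ≠ c.radius) (hw : windingNumber C x = 0) :
    chainSum C (fun z => (z - x)⁻¹) = 0 := by
  rw [chainSum_eq_windingNumber_mul (x := x) (J := 2 * Real.pi * Complex.I), hw, Int.cast_zero,
    zero_mul]
  intro c hc
  split_ifs with h
  · exact circleIntegral.integral_sub_inv_of_mem_ball h
  · have hlt : c.radius < dist x c.center := lt_of_le_of_ne (not_lt.1 h) (hx c hc).symm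
    have hne : ∀ z ∈ Metric.closedBall c.center c.radius, z - x ≠ 0 := fun z hz h0 => by
      rw [sub_eq_zero.1 h0] at hz
      exact absurd (Metric.mem_closedBall.1 hz) (not_le.2 hlt)
    refine Complex.circleIntegral_eq_zero_of_differentiable_on_off_countable (hC c hc).1.le
      Set.countable_empty ?_ fun z hz => ?_
    · exact ContinuousOn.inv₀ (by fun_prop) hne
    · exact (differentiableAt_id.sub_const x).inv (hne z (Metric.ball_subset_closedBall hz.1))

/-- The polynomial function with the given roots. -/
def rootProd (s : Multiset ℂ) (z : ℂ) : ℂ := (s.map fun x => z - x).prod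

lemma rootProd_cons (x : ℂ) (s : Multiset ℂ) (z : ℂ) :
    rootProd (x ::ₘ s) z = (z - x) * rootProd s z := by
  rw [rootProd, rootProd, Multiset.map_cons, Multiset.prod_cons]

lemma rootProd_ne_zero {s : Multiset ℂ} {z : ℂ} (h : z ∉ s) : rootProd s z ≠ 0 := by
  rw [rootProd, Ne, Multiset.prod_eq_zero_iff, Multiset.mem_map]
  rintro ⟨x, hx, h0⟩
  rw [sub_eq_zero.1 h0] at h
  exact h hx

lemma differentiable_rootProd (s : Multiset ℂ) : Differentiable ℂ (rootProd s) := by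
  induction s using Multiset.induction_on with
  | empty => exact differentiable_const 1
  | cons x s ih =>
    have : rootProd (x ::ₘ s) = fun z => (z - x) * rootProd s z := funext (rootProd_cons x s)
    rw [this]
    fun_prop

lemma circleIntegrable_div_rootProd (hC : ChainIn C r₁ r₂) {s : Multiset ℂ}
    (hs : ∀ x ∈ s, ∀ c ∈ C, dist x c.center ≠ c.radius) {H : ℂ → ℂ}
    (hH : ContinuousOn H (annulus r₁ r₂)) {c : WeightedCircle} (hc : c ∈ C) :
    CircleIntegrable (fun z => H z / rootProd s z) c.center c.radius := by
  refine ContinuousOn.circleIntegrable (hC c hc).1.le ?_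
  refine (hH.mono (hC.sphere_subset hc)).div (differentiable_rootProd s).continuous.continuousOn
    fun z hz => rootProd_ne_zero fun hzs => hs z hzs c hc hz

/-- Partial fractions: two distinct roots x, y allow 1/((z−x)(z−y)) to be split with coefficient
1/(x−y), which lowers the number of roots. If all roots coincide, the integrand is a power of z − x:
it has a primitive if there are at least two roots, and a single root is a matter of the winding
number. -/
lemma chainSum_inv_rootProd (hr : 0 < r₁) (hC : ChainIn C r₁ r₂) (hw0 : windingNumber C 0 = 0)
    (n : ℕ) : ∀ s : Multiset ℂ, s.card = n →
    (∀ x ∈ s, (∀ c ∈ C, dist x c.center ≠ c.radius) ∧ windingNumber C x = 0) →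
    chainSum C (fun z => 1 / rootProd s z) = 0 := by
  induction n with
  | zero =>
    intro s hs _
    rw [Multiset.card_eq_zero.1 hs]
    refine chainSum_eq_zero_of_differentiableOn hr hC hw0 ?_
    simp only [rootProd, Multiset.map_zero, Multiset.prod_zero]
    fun_prop
  | succ n ih =>
    intro s hs h
    obtain ⟨x, hxs⟩ := Multiset.card_pos_iff_exists_mem.1 (show 0 < s.card by omega)
    obtain ⟨s', rfl⟩ := Multiset.exists_cons_of_mem hxs
    rw [Multiset.card_cons, add_left_inj] at hs
    by_cases hall : ∀ y ∈ s', y = x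
    · rw [Multiset.eq_replicate.2 ⟨hs, hall⟩]
      have e : (fun z => 1 / rootProd (x ::ₘ Multiset.replicate n x) z) =
          fun z => (z - x) ^ (-((n : ℤ) + 1)) := by
        funext z
        rw [rootProd_cons, rootProd, Multiset.map_replicate, Multiset.prod_replicate, ← pow_succ',
          zpow_neg, one_div]
        norm_cast
      rw [e]
      cases n with
      | zero =>
        have hx := h x (Multiset.mem_cons_self _ _)
        simpa using chainSum_inv_sub hC hx.1 hx.2
      | succ m =>
        exact chainSum_eq_zero fun c _ =>
          circleIntegral.integral_sub_zpow_of_ne (by push_cast; omega) _ _ _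
    · push Not at hall
      obtain ⟨y, hy, hyx⟩ := hall
      obtain ⟨s'', rfl⟩ := Multiset.exists_cons_of_mem hy
      have hx1 : ∀ u ∈ x ::ₘ s'', (∀ c ∈ C, dist u c.center ≠ c.radius) ∧
          windingNumber C u = 0 := fun u hu => h u (by
        rcases Multiset.mem_cons.1 hu with rfl | hu
        · exact Multiset.mem_cons_self _ _
        · exact Multiset.mem_cons_of_mem (Multiset.mem_cons_of_mem hu))
      have hy1 : ∀ u ∈ y ::ₘ s'', (∀ c ∈ C, dist u c.center ≠ c.radius) ∧
          windingNumber C u = 0 := fun u hu => h u (Multiset.mem_cons_of_mem hu)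
      have hc1 : (x ::ₘ s'').card = n := by simpa using hs
      have hc2 : (y ::ₘ s'').card = n := by simpa using hs
      have hint : ∀ u ∈ x ::ₘ y ::ₘ s'', ∀ c ∈ C, dist u c.center ≠ c.radius :=
        fun u hu => (h u hu).1
      have key : chainSum C (fun z => 1 / rootProd (x ::ₘ y ::ₘ s'') z) =
          chainSum C (fun z => (x - y)⁻¹ * (1 / rootProd (x ::ₘ s'') z) +
            (-(x - y)⁻¹) * (1 / rootProd (y ::ₘ s'') z)) := by
        refine chainSum_congr fun c hc => ?_
        refine circleIntegral.integral_congr (hC c hc).1.le fun z hz => ?_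
        have hz' : z ∉ x ::ₘ y ::ₘ s'' := fun hzs => hint z hzs c hc hz
        have h1 : z - x ≠ 0 := sub_ne_zero.2 fun h0 => hz' (by simp [h0])
        have h2 : z - y ≠ 0 := sub_ne_zero.2 fun h0 => hz' (by simp [h0])
        have h3 : rootProd s'' z ≠ 0 := rootProd_ne_zero fun h0 => hz' (by simp [h0])
        have h4 : x - y ≠ 0 := sub_ne_zero.2 hyx.symm
        simp only [rootProd_cons]
        field_simp
        ring
      have hi : ∀ (u : ℂ) (a : ℂ), (∀ v ∈ u ::ₘ s'', (∀ c ∈ C, dist v c.center ≠ c.radius) ∧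
          windingNumber C v = 0) → ∀ c ∈ C,
          CircleIntegrable (fun z => a * (1 / rootProd (u ::ₘ s'') z)) c.center c.radius :=
        fun u a hu c hc => (circleIntegrable_div_rootProd hC (fun v hv => (hu v hv).1)
          (H := fun _ => 1) continuousOn_const hc).const_smul (a := a)
      rw [key, chainSum_add (hi x _ hx1) (hi y _ hy1), chainSum_const_mul, chainSum_const_mul,
        ih _ hc1 hx1, ih _ hc2 hy1]
      simp

/-- Cauchy's theorem for a chain that has winding number zero about the origin and the poles of the
integrand. -/
lemma chainSum_div_rootProd (hr : 0 < r₁) (hC : ChainIn C r₁ r₂) (hw0 : windingNumber C 0 = 0)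
    {s : Multiset ℂ}
    (hs : ∀ x ∈ s, x ∈ annulus r₁ r₂ ∧
      (∀ c ∈ C, dist x c.center ≠ c.radius) ∧ windingNumber C x = 0)
    {H : ℂ → ℂ} (hH : DifferentiableOn ℂ H (annulus r₁ r₂)) :
    chainSum C (fun z => H z / rootProd s z) = 0 := by
  induction s using Multiset.induction_on generalizing H with
  | empty =>
    simpa [rootProd] using chainSum_eq_zero_of_differentiableOn hr hC hw0 hH
  | cons x s ih =>
    have hx := (hs x (Multiset.mem_cons_self _ _)).1
    have hd := (Complex.differentiableOn_dslope ((isOpen_annulus r₁ r₂).mem_nhds hx)).2 hH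
    have hs' : ∀ y ∈ s, y ∈ annulus r₁ r₂ ∧
      (∀ c ∈ C, dist y c.center ≠ c.radius) ∧ windingNumber C y = 0 :=
      fun y hy => hs y (Multiset.mem_cons_of_mem hy)
    -- In H(z) = (z − x)·`dslope` + H(x) the first part cancels a root, and the second leaves a
    -- constant over the full product.
    have key : chainSum C (fun z => H z / rootProd (x ::ₘ s) z) =
        chainSum C (fun z => dslope H x z / rootProd s z +
          H x * (1 / rootProd (x ::ₘ s) z)) := by
      refine chainSum_congr fun c hc => ?_
      refine circleIntegral.integral_congr (hC c hc).1.le fun z hz => ?_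
      have hz' : z ∉ x ::ₘ s := fun hzs => (hs z hzs).2.1 c hc hz
      have h1 : z - x ≠ 0 := sub_ne_zero.2 fun h0 => hz' (by simp [h0])
      have h3 : rootProd s z ≠ 0 := rootProd_ne_zero fun h0 => hz' (by simp [h0])
      have h4 := sub_smul_dslope H x z
      rw [smul_eq_mul] at h4
      have h5 : H z = (z - x) * dslope H x z + H x := by rw [h4]; ring
      simp only [rootProd_cons]
      rw [h5]
      field_simp
    rw [key, chainSum_add, chainSum_const_mul, ih hs' hd,
      chainSum_inv_rootProd hr hC hw0 _ _ rfl fun y hy => (hs y hy).2]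
    · simp
    · exact fun c hc => circleIntegrable_div_rootProd hC (fun v hv => (hs' v hv).2.1)
        hd.continuousOn hc
    · exact fun c hc => (circleIntegrable_div_rootProd hC (fun v hv => (hs v hv).2.1)
          (H := fun _ => 1) continuousOn_const hc).const_smul (a := H x)

end chain

/-- On `Ω` the function `d` is a polynomial, all of whose roots are zeros of `d` in `Ω`, times a
holomorphic function without zeros. -/
def HasFactorization (Ω : Set ℂ) (d : ℂ → ℂ) : Prop :=
  ∃ (s : Multiset ℂ) (U : ℂ → ℂ), (∀ x ∈ s, x ∈ Ω ∧ d x = 0) ∧ DifferentiableOn ℂ U Ω ∧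
    (∀ z ∈ Ω, U z ≠ 0) ∧ ∀ z ∈ Ω, d z = U z * rootProd s z

lemma HasFactorization.mul {Ω : Set ℂ} {d e : ℂ → ℂ} (hd : HasFactorization Ω d)
    (he : HasFactorization Ω e) : HasFactorization Ω fun z => d z * e z := by
  obtain ⟨s, U, h1, h2, h3, h4⟩ := hd
  obtain ⟨s', U', h1', h2', h3', h4'⟩ := he
  refine ⟨s + s', fun z => U z * U' z, fun x hx => ?_, h2.mul h2',
    fun z hz => mul_ne_zero (h3 z hz) (h3' z hz), fun z hz => ?_⟩
  · rcases Multiset.mem_add.1 hx with hx | hx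
    · exact ⟨(h1 x hx).1, mul_eq_zero_of_left (h1 x hx).2 _⟩
    · exact ⟨(h1' x hx).1, mul_eq_zero_of_right _ (h1' x hx).2⟩
  · dsimp only
    rw [h4 z hz, h4' z hz]
    simp only [rootProd, Multiset.map_add, Multiset.prod_add]
    ring

lemma HasFactorization.of_ne_zero {Ω : Set ℂ} {d : ℂ → ℂ} (h : DifferentiableOn ℂ d Ω)
    (h0 : ∀ z ∈ Ω, d z ≠ 0) : HasFactorization Ω d :=
  ⟨0, d, by simp, h, h0, by simp [rootProd]⟩

lemma HasFactorization.congr {Ω : Set ℂ} {d e : ℂ → ℂ} (hd : HasFactorization Ω d)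
    (h : ∀ z ∈ Ω, e z = d z) : HasFactorization Ω e := by
  obtain ⟨s, U, h1, h2, h3, h4⟩ := hd
  exact ⟨s, U, fun x hx => ⟨(h1 x hx).1, by rw [h x (h1 x hx).1, (h1 x hx).2]⟩, h2, h3,
    fun z hz => by rw [h z hz, h4 z hz]⟩

lemma HasFactorization.prod {Ω : Set ℂ} {ι : Type*} (s : Finset ι) {d : ι → ℂ → ℂ}
    (h : ∀ i ∈ s, HasFactorization Ω (d i)) : HasFactorization Ω fun z => ∏ i ∈ s, d i z := by
  classical
  induction s using Finset.induction_on with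
  | empty => simpa using HasFactorization.of_ne_zero (Ω := Ω) (d := fun _ => 1) (by fun_prop) (by simp)
  | insert i s hi ih =>
    simp only [Finset.prod_insert hi]
    exact (h i (Finset.mem_insert_self _ _)).mul
      (ih fun j hj => h j (Finset.mem_insert_of_mem hj))

lemma HasFactorization.linear {Ω : Set ℂ} (α β : ℂ) (h : α ≠ 0 ∨ β ≠ 0) :
    HasFactorization Ω fun z => α - β * z := by
  by_cases h0 : ∀ z ∈ Ω, α - β * z ≠ 0
  · exact .of_ne_zero (by fun_prop) h0
  · push Not at h0
    obtain ⟨x, hx, hx0⟩ := h0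
    have hβ : β ≠ 0 := by
      rintro rfl
      rw [zero_mul, sub_zero] at hx0
      simp [hx0] at h
    refine ⟨{x}, fun _ => -β, by simp [hx, hx0], by fun_prop, by simp [hβ], fun z _ => ?_⟩
    simp only [rootProd, Multiset.map_singleton, Multiset.prod_singleton]
    linear_combination hx0

/-- On a region where m is bounded, |m(z) c_i| < 1 for all but finitely many i. The product of those
factors has no zeros; the finitely many others factor by assumption. -/
lemma HasFactorization.eprod_comp {Ω : Set ℂ} {ι : Type*} {c : ι → ℂ}
    (hc : Summable fun i => ‖c i‖) {m : ℂ → ℂ} (hm : DifferentiableOn ℂ m Ω) {R : ℝ}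
    (hR : ∀ z ∈ Ω, ‖m z‖ ≤ R) (hfac : ∀ i, HasFactorization Ω fun z => 1 - m z * c i) :
    HasFactorization Ω fun z => eprod c (m z) := by
  have hfin : {i | ¬ R * ‖c i‖ < 1}.Finite := by
    have := (hc.mul_left R).tendsto_cofinite_zero.eventually_lt_const (zero_lt_one' ℝ)
    exact this
  have hsc : Summable fun i : ((hfin.toFinset : Set ι)ᶜ : Set ι) => ‖c i‖ := hc.subtype _
  refine HasFactorization.congr (HasFactorization.mul (HasFactorization.prod hfin.toFinset
    fun i _ => hfac i) (HasFactorization.of_ne_zero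
      (d := fun z => eprod (fun i : ((hfin.toFinset : Set ι)ᶜ : Set ι) => c i) (m z)) ?_ ?_))
      fun z _ => eprod_eq_prod_mul hc _ _
  · exact (differentiable_eprod hsc).comp_differentiableOn hm
  · intro z hz
    refine eprod_ne_zero hsc fun i h => ?_
    have hi : R * ‖c i‖ < 1 := by simpa using i.2
    have : ‖m z * c i‖ ≤ R * ‖c i‖ := by rw [norm_mul]; gcongr; exact hR z hz
    rw [h, norm_one] at this
    linarith

lemma HasFactorization.dPoch_mul {p q : ℂ} (hp : ‖p‖ < 1) (hq : ‖q‖ < 1) (r₁ r₂ : ℝ) (c : ℂ) :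
    HasFactorization (annulus r₁ r₂) fun z => dPoch p q (c * z) := by
  refine HasFactorization.eprod_comp (summable_norm_pow_mul_pow hp hq) (R := ‖c‖ * r₂)
    (by fun_prop) (fun z hz => ?_) fun i => ?_
  · rw [norm_mul]; gcongr; exact hz.2.le
  · refine (HasFactorization.linear 1 (c * (p ^ i.1 * q ^ i.2)) (Or.inl one_ne_zero)).congr
      fun z _ => ?_
    ring

lemma HasFactorization.dPoch_div {p q : ℂ} (hp : ‖p‖ < 1) (hq : ‖q‖ < 1) {r₁ : ℝ} (hr : 0 < r₁)
    (r₂ : ℝ) (c : ℂ) : HasFactorization (annulus r₁ r₂) fun z => dPoch p q (c / z) := by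
  have hne : ∀ z ∈ annulus r₁ r₂, z ≠ 0 := fun z hz => norm_pos_iff.1 (hr.trans hz.1)
  have hinv : DifferentiableOn ℂ (fun z : ℂ => z⁻¹) (annulus r₁ r₂) := fun z hz =>
    (differentiableAt_inv (hne z hz)).differentiableWithinAt
  refine HasFactorization.eprod_comp (summable_norm_pow_mul_pow hp hq) (R := ‖c‖ / r₁)
    (m := fun z => c / z) ?_ (fun z hz => ?_) fun i => ?_
  · simpa only [div_eq_mul_inv] using hinv.const_mul c
  · rw [norm_div]; gcongr; exact hz.1.le
  · refine ((HasFactorization.of_ne_zero hinv fun z hz => inv_ne_zero (hne z hz)).mul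
      (HasFactorization.linear (-(c * (p ^ i.1 * q ^ i.2))) (-1) (Or.inr (by simp)))).congr
      fun z hz => ?_
    have := hne z hz
    field_simp
    ring

/-- Cauchy's theorem for quotients of holomorphic functions on an annulus. -/
lemma chainSum_div_eq_zero {C : List WeightedCircle} {r₁ r₂ : ℝ} (hr : 0 < r₁)
    (hC : ChainIn C r₁ r₂) (hw0 : windingNumber C 0 = 0) {H d : ℂ → ℂ}
    (hH : DifferentiableOn ℂ H (annulus r₁ r₂)) (hd : HasFactorization (annulus r₁ r₂) d)
    (hs : ∀ x ∈ annulus r₁ r₂, d x = 0 →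
      (∀ c ∈ C, dist x c.center ≠ c.radius) ∧ windingNumber C x = 0) :
    chainSum C (fun z => H z / d z) = 0 := by
  obtain ⟨s, U, h1, h2, h3, h4⟩ := hd
  rw [← chainSum_div_rootProd (s := s) (H := fun z => H z / U z) hr hC hw0
    (fun x hx => ⟨(h1 x hx).1, hs x (h1 x hx).1 (h1 x hx).2⟩) (hH.div h2 h3)]
  refine chainSum_congr fun c hc => circleIntegral.integral_congr (hC c hc).1.le fun z hz => ?_
  rw [h4 z (hC.sphere_subset hc hz), div_div]

end EllipticPairing

end

noncomputable section

namespace EllipticPairing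

/-! ### Residues and contours -/

/-- Circles of multiplicity `m` about the points of a finite set. -/
def smallCircles (m : ℤ) (E : Finset ℂ) (δ : ℂ → ℝ) : List WeightedCircle :=
  E.toList.map fun u => ⟨m, u, δ u⟩

lemma mem_smallCircles {m : ℤ} {E : Finset ℂ} {δ : ℂ → ℝ} {c : WeightedCircle} :
    c ∈ smallCircles m E δ ↔ ∃ u ∈ E, c = ⟨m, u, δ u⟩ := by
  simp [smallCircles, eq_comm]

lemma windingNumber_smallCircles (m : ℤ) (E : Finset ℂ) {δ : ℂ → ℝ} (x : ℂ)
    (h : ∀ u ∈ E, dist x u < δ u ↔ x = u) :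
    windingNumber (smallCircles m E δ) x = if x ∈ E then m else 0 := by
  have : windingNumber (smallCircles m E δ) x = ∑ u ∈ E, if x = u then m else 0 := by
    rw [windingNumber, smallCircles, List.map_map, ← Finset.sum_map_toList]
    congr 1
    refine List.map_congr_left fun u hu => ?_
    simp only [Function.comp_apply]
    exact if_congr (h u (Finset.mem_toList.1 hu)) rfl rfl
  rw [this, Finset.sum_ite_eq]

lemma chainSum_smallCircles (m : ℤ) (E : Finset ℂ) (δ : ℂ → ℝ) (g : ℂ → ℂ) :
    chainSum (smallCircles m E δ) g = m * ∑ u ∈ E, circleIntegral g u (δ u) := by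
  rw [chainSum, smallCircles, List.map_map, Finset.mul_sum, ← Finset.sum_map_toList]
  rfl

/-- The circles of the chain are circles about the origin, or do not enclose it. -/
def ChainAllowed (C : List WeightedCircle) : Prop :=
  ∀ c ∈ C, 0 < c.radius ∧ (c.center = 0 ∨ c.radius < ‖c.center‖)

lemma ChainAllowed.exists_chainIn {C : List WeightedCircle} (hC : ChainAllowed C) :
    ∃ r₁ r₂ : ℝ, 0 < r₁ ∧ ChainIn C r₁ r₂ := by
  induction C with
  | nil => exact ⟨1, 1, one_pos, by simp [ChainIn]⟩
  | cons c C ih =>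
    obtain ⟨r₁, r₂, hr, h⟩ := ih fun c' hc' => hC c' (List.mem_cons_of_mem _ hc')
    obtain ⟨h0, h1⟩ := hC c List.mem_cons_self
    obtain ⟨s, hs, hs'⟩ : ∃ s : ℝ, 0 < s ∧ ((c.center = 0 ∧ s < c.radius) ∨
        (c.center ≠ 0 ∧ s + c.radius < ‖c.center‖)) := by
      rcases h1 with h1 | h1
      · exact ⟨c.radius / 2, by linarith, Or.inl ⟨h1, by linarith⟩⟩
      · refine ⟨(‖c.center‖ - c.radius) / 2, by linarith, Or.inr ⟨?_, by linarith⟩⟩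
        rintro h
        rw [h, norm_zero] at h1
        linarith
    refine ⟨min r₁ s, max r₂ (‖c.center‖ + c.radius + 1), lt_min hr hs, fun c' hc' => ?_⟩
    have hm1 := min_le_left r₁ s
    have hm2 := min_le_right r₁ s
    rcases List.mem_cons.1 hc' with rfl | hc'
    · refine ⟨h0, lt_of_lt_of_le (by linarith) (le_max_right _ _), ?_⟩
      exact hs'.imp (fun h => ⟨h.1, by linarith [h.2]⟩) fun h => ⟨h.1, by linarith [h.2]⟩
    · obtain ⟨g0, g1, g2⟩ := h c' hc'
      refine ⟨g0, g1.trans_le (le_max_left _ _), ?_⟩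
      exact g2.imp (fun h => ⟨h.1, by linarith [h.2]⟩) fun h => ⟨h.1, by linarith [h.2]⟩

/-- The residue theorem for a chain of circles, in terms of winding numbers. -/
lemma chainSum_eq_circle_add {C : List WeightedCircle} (hC : ChainAllowed C)
    (hw0 : windingNumber C 0 = 1) {H d : ℂ → ℂ} (hH : DifferentiableOn ℂ H {0}ᶜ)
    (hd : ∀ r₁ r₂ : ℝ, 0 < r₁ → HasFactorization (annulus r₁ r₂) d) {ρ : ℝ} (hρ : 0 < ρ)
    (m : ℤ) (E : Finset ℂ) {δ : ℂ → ℝ} (hδ : ∀ u ∈ E, 0 < δ u ∧ δ u < ‖u‖)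
    (hEδ : ∀ x : ℂ, x ≠ 0 → d x = 0 → ∀ u ∈ E, dist x u ≠ δ u ∧ (dist x u < δ u → x = u))
    (hx : ∀ x : ℂ, x ≠ 0 → d x = 0 → (∀ c ∈ C, dist x c.center ≠ c.radius) ∧ ‖x‖ ≠ ρ ∧
      windingNumber C x = (if ‖x‖ < ρ then 1 else 0) + if x ∈ E then m else 0) :
    chainSum C (fun z => H z / d z) = circleIntegral (fun z => H z / d z) 0 ρ +
      m * ∑ u ∈ E, circleIntegral (fun z => H z / d z) u (δ u) := by
  -- The chain, minus the circle of radius ρ, minus m times the small circles, has winding number 0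
  -- about the origin and about every zero of d, so Cauchy's theorem applies to it.
  set C' : List WeightedCircle := C ++ ([⟨-1, 0, ρ⟩] ++ smallCircles (-m) E δ) with hC'
  have hmem : ∀ c ∈ C', c ∈ C ∨ c = ⟨-1, 0, ρ⟩ ∨ ∃ u ∈ E, c = ⟨-m, u, δ u⟩ := fun c hc => by
    simpa [hC', mem_smallCircles] using hc
  have hall : ChainAllowed C' := fun c hc => by
    rcases hmem c hc with h | rfl | ⟨u, hu, rfl⟩
    · exact hC c h
    · exact ⟨hρ, Or.inl rfl⟩
    · exact ⟨(hδ u hu).1, Or.inr (hδ u hu).2⟩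
  obtain ⟨r₁, r₂, hr, hin⟩ := hall.exists_chainIn
  have hw : ∀ x, (∀ u ∈ E, dist x u < δ u ↔ x = u) → windingNumber C' x = windingNumber C x +
      ((if ‖x‖ < ρ then -1 else 0) + if x ∈ E then -m else 0) := fun x h => by
    rw [hC', windingNumber_append, windingNumber_append, windingNumber_smallCircles _ _ _ h]
    simp [windingNumber]
  have hz := chainSum_div_eq_zero hr hin (H := H) (d := d) ?_ ?_ (hd r₁ r₂ hr) ?_
  · rw [hC', chainSum_append, chainSum_append, chainSum_smallCircles] at hz
    simp only [chainSum, List.map_cons, List.map_nil, List.sum_cons, List.sum_nil] at hz ⊢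
    push_cast at hz
    linear_combination hz
  · rw [hw, hw0, norm_zero, if_pos hρ, if_neg]
    · rfl
    · intro h
      have := hδ 0 h
      rw [norm_zero] at this
      linarith [this.1, this.2]
    · intro u hu
      rw [dist_zero_left]
      constructor
      · intro h; linarith [(hδ u hu).2]
      · rintro rfl
        have := hδ 0 hu
        rw [norm_zero] at this ⊢
        exact this.1
  · exact hH.mono fun z hz => norm_pos_iff.1 (hr.trans hz.1)
  · intro x hxa hdx
    have hx0 : x ≠ 0 := norm_pos_iff.1 (hr.trans hxa.1)
    obtain ⟨h1, h2, h3⟩ := hx x hx0 hdx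
    have h4 := hEδ x hx0 hdx
    refine ⟨fun c hc => ?_, ?_⟩
    · rcases hmem c hc with h | rfl | ⟨u, hu, rfl⟩
      · exact h1 c h
      · rw [dist_zero_right]; exact h2
      · exact (h4 u hu).1
    · rw [hw x fun u hu => ⟨(h4 u hu).2, fun h => by
        rw [h, dist_self]; exact (hδ u hu).1⟩, h3]
      split_ifs <;> omega

/-- In polar coordinates dz/z is i dθ, and inversion turns radius 1/ρ and angle θ into radius ρ and
angle −θ; the reversed interval is again a full period. -/
lemma circleIntegral_inv {ρ : ℝ} (hρ : 0 < ρ) (k : ℂ → ℂ) :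
    circleIntegral (fun z => k z⁻¹ / z) 0 ρ⁻¹ = circleIntegral (fun z => k z / z) 0 ρ := by
  have h1 : ∀ (R : ℝ), 0 < R → ∀ g : ℂ → ℂ, circleIntegral (fun z => g z / z) 0 R =
      ∫ θ in (0 : ℝ)..2 * Real.pi, Complex.I * g (circleMap 0 R θ) := fun R hR g => by
    rw [circleIntegral]
    refine intervalIntegral.integral_congr fun θ _ => ?_
    have : circleMap 0 R θ ≠ 0 := circleMap_ne_center hR.ne'
    simp only [deriv_circleMap, smul_eq_mul]
    field_simp
  rw [h1 _ hρ k, h1 _ (inv_pos.2 hρ) fun z => k z⁻¹]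
  have h2 : ∀ θ : ℝ, (circleMap 0 ρ⁻¹ θ)⁻¹ = circleMap 0 ρ (-θ) := fun θ => by
    simp [circleMap, Complex.exp_neg, mul_comm]
  simp only [h2]
  rw [intervalIntegral.integral_comp_neg fun θ => Complex.I * k (circleMap 0 ρ θ)]
  have hper : Function.Periodic (fun θ => Complex.I * k (circleMap 0 ρ θ)) (2 * Real.pi) :=
    fun θ => by simp only [periodic_circleMap 0 ρ θ]
  have := hper.intervalIntegral_add_eq (-(2 * Real.pi)) 0
  simpa using this

/-- The set `X` accumulates at most at the origin and at infinity. -/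
lemma exists_isolating_radius {Z : Set ℂ}
    (hZ : ∀ r₁ r₂ : ℝ, 0 < r₁ → {x ∈ Z | r₁ ≤ ‖x‖ ∧ ‖x‖ ≤ r₂}.Finite) {u : ℂ} (hu : u ≠ 0)
    {η : ℝ} (hη : 0 < η) : ∃ δ : ℝ, 0 < δ ∧ δ < ‖u‖ ∧ δ < η ∧ ∀ x ∈ Z, dist x u ≠ δ ∧ (dist x u < δ → x = u) := by
  have hu' := norm_pos_iff.2 hu
  have hf : ({x ∈ Z | ‖u‖ / 2 ≤ ‖x‖ ∧ ‖x‖ ≤ 2 * ‖u‖} \ {u}).Finite :=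
    (hZ (‖u‖ / 2) (2 * ‖u‖) (by linarith)).subset Set.sdiff_subset
  obtain ⟨ε, hε, hball⟩ := Metric.isOpen_iff.1 hf.isClosed.isOpen_compl u (by simp)
  refine ⟨min (min (ε / 2) (η / 2)) (‖u‖ / 2), by positivity, ?_, ?_, fun x hx => ?_⟩
  · exact (min_le_right _ _).trans_lt (by linarith)
  · exact ((min_le_left _ _).trans (min_le_right _ _)).trans_lt (by linarith)
  · have key : dist x u ≤ min (min (ε / 2) (η / 2)) (‖u‖ / 2) → x = u := fun h => by
      have h1 := h.trans ((min_le_left _ _).trans (min_le_left _ _))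
      have h2 := h.trans (min_le_right _ _)
      rw [dist_eq_norm] at h2
      have h3 := norm_sub_norm_le u (u - x)
      have h4 := norm_add_le (x - u) u
      rw [sub_sub_cancel, norm_sub_rev] at h3
      rw [sub_add_cancel] at h4
      have h5 := hball (Metric.mem_ball.2 (h1.trans_lt (by linarith)))
      by_contra hne
      exact h5 ⟨⟨hx, by linarith, by linarith⟩, hne⟩
    refine ⟨fun h => ?_, fun h => key h.le⟩
    have hxu := key h.le
    rw [hxu, dist_self] at h
    have : 0 < min (min (ε / 2) (η / 2)) (‖u‖ / 2) := by positivity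
    linarith

/-- A circle about the origin that avoids all points is corrected by small circles: multiplicity 1
about the points of X that it fails to enclose, multiplicity −1 about the reciprocals that it does
enclose. Non-resonance makes X and the set of reciprocals disjoint, so that the corrections do not
interfere. -/
lemma exists_contour {X : Set ℂ} (h0 : ∀ x ∈ X, x ≠ 0)
    (hX : ∀ r : ℝ, 0 < r → {x ∈ X | r ≤ ‖x‖}.Finite) (hXX : ∀ x ∈ X, ∀ y ∈ X, x * y ≠ 1) :
    ∃ C : List WeightedCircle, ChainAllowed C ∧
      ∀ x ∈ X, (∀ c ∈ C, dist x c.center ≠ c.radius ∧ dist x⁻¹ c.center ≠ c.radius) ∧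
        windingNumber C x = 1 ∧ windingNumber C x⁻¹ = 0 := by
  classical
  set Z : Set ℂ := X ∪ (·⁻¹) '' X with hZdef
  have hZ0 : ∀ x ∈ Z, x ≠ 0 := by
    rintro _ (hx | ⟨x, hx, rfl⟩)
    exacts [h0 _ hx, inv_ne_zero (h0 x hx)]
  have hZ : ∀ r₁ r₂ : ℝ, 0 < r₁ → {x ∈ Z | r₁ ≤ ‖x‖ ∧ ‖x‖ ≤ r₂}.Finite := fun r₁ r₂ hr => by
    by_cases hr2 : 0 < r₂
    · refine ((hX r₁ hr).union ((hX r₂⁻¹ (inv_pos.2 hr2)).image (·⁻¹))).subset ?_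
      rintro _ ⟨hx | ⟨x, hx, rfl⟩, h1, h2⟩
      · exact Or.inl ⟨hx, h1⟩
      · refine Or.inr ⟨x, ⟨hx, ?_⟩, rfl⟩
        rw [norm_inv] at h2
        exact inv_le_of_inv_le₀ (norm_pos_iff.2 (h0 x hx)) h2
    · refine Set.finite_empty.subset ?_
      rintro x ⟨-, h1, h2⟩
      linarith
  -- Only finitely many points have modulus in [1, 2], so some radius in this interval is free.
  obtain ⟨ρ, hρ, hρZ⟩ : ∃ ρ ∈ Set.Icc (1 : ℝ) 2, ∀ x ∈ Z, ‖x‖ ≠ ρ := by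
    obtain ⟨ρ, h1, h2⟩ := (Set.Icc_infinite (one_lt_two (α := ℝ))).exists_notMem_finite
      ((hZ 1 2 one_pos).image (‖·‖))
    exact ⟨ρ, h1, fun x hx h => h2 ⟨x, ⟨hx, h ▸ h1⟩, h⟩⟩
  have hρ0 : 0 < ρ := by linarith [hρ.1]
  have hfin := hX ρ hρ0
  have hfout : ((·⁻¹) '' {x ∈ X | ρ⁻¹ ≤ ‖x‖}).Finite := (hX ρ⁻¹ (inv_pos.2 hρ0)).image _
  choose! δ hδ using fun u => fun h : u ≠ 0 => exists_isolating_radius hZ h one_pos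
  set Ei := hfin.toFinset with hEi
  set Eo := hfout.toFinset with hEo
  have mEi : ∀ u, u ∈ Ei ↔ u ∈ X ∧ ρ ≤ ‖u‖ := fun u => by simp [hEi]
  have mEo : ∀ u, u ∈ Eo ↔ u⁻¹ ∈ X ∧ ‖u‖ ≤ ρ := fun u => by
    simp only [hEo, Set.Finite.mem_toFinset, Set.mem_image, Set.mem_ofPred_eq]
    constructor
    · rintro ⟨x, ⟨hx, hle⟩, rfl⟩
      refine ⟨by simpa using hx, ?_⟩
      rw [norm_inv]
      exact inv_le_of_inv_le₀ hρ0 hle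
    · rintro ⟨hx, hle⟩
      refine ⟨u⁻¹, ⟨hx, ?_⟩, inv_inv u⟩
      rw [norm_inv]
      exact inv_anti₀ (norm_pos_iff.2 (fun h => h0 _ hx (by simp [h]))) hle
  have hEiZ : ∀ u ∈ Ei, u ∈ Z := fun u hu => Or.inl ((mEi u).1 hu).1
  have hEoZ : ∀ u ∈ Eo, u ∈ Z := fun u hu => Or.inr ⟨u⁻¹, ((mEo u).1 hu).1, inv_inv u⟩
  set C : List WeightedCircle := [⟨1, 0, ρ⟩] ++ (smallCircles 1 Ei δ ++ smallCircles (-1) Eo δ)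
    with hC
  have hmem : ∀ c ∈ C, c = ⟨1, 0, ρ⟩ ∨ (∃ u ∈ Ei, c = ⟨1, u, δ u⟩) ∨
      ∃ u ∈ Eo, c = ⟨-1, u, δ u⟩ := fun c hc => by
    simpa [hC, mem_smallCircles] using hc
  have hδE : ∀ u ∈ Z, ∀ x ∈ Z, dist x u < δ u ↔ x = u := fun u hu x hx =>
    ⟨((hδ u (hZ0 u hu)).2.2.2 x hx).2, fun h => by
      rw [h, dist_self]; exact (hδ u (hZ0 u hu)).1⟩
  have hw : ∀ x ∈ Z, windingNumber C x = (if ‖x‖ < ρ then 1 else 0) +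
      ((if x ∈ Ei then 1 else 0) + if x ∈ Eo then -1 else 0) := fun x hx => by
    rw [hC, windingNumber_append, windingNumber_append,
      windingNumber_smallCircles _ _ _ fun u hu => hδE u (hEiZ u hu) x hx,
      windingNumber_smallCircles _ _ _ fun u hu => hδE u (hEoZ u hu) x hx]
    simp [windingNumber]
  have havoid : ∀ x ∈ Z, ∀ c ∈ C, dist x c.center ≠ c.radius := fun x hx c hc => by
    rcases hmem c hc with rfl | ⟨u, hu, rfl⟩ | ⟨u, hu, rfl⟩
    · simpa using hρZ x hx
    · exact ((hδ u (hZ0 u (hEiZ u hu))).2.2.2 x hx).1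
    · exact ((hδ u (hZ0 u (hEoZ u hu))).2.2.2 x hx).1
  refine ⟨C, fun c hc => ?_, fun x hx => ?_⟩
  · rcases hmem c hc with rfl | ⟨u, hu, rfl⟩ | ⟨u, hu, rfl⟩
    · exact ⟨hρ0, Or.inl rfl⟩
    · have := hδ u (hZ0 u (hEiZ u hu))
      exact ⟨this.1, Or.inr this.2.1⟩
    · have := hδ u (hZ0 u (hEoZ u hu))
      exact ⟨this.1, Or.inr this.2.1⟩
  · have hxZ : x ∈ Z := Or.inl hx
    have hxZ' : x⁻¹ ∈ Z := Or.inr ⟨x, hx, rfl⟩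
    have hnx : x⁻¹ ∉ X := fun h => hXX x hx _ h (mul_inv_cancel₀ (h0 x hx))
    refine ⟨fun c hc => ⟨havoid x hxZ c hc, havoid _ hxZ' c hc⟩, ?_, ?_⟩
    · rw [hw x hxZ, if_neg (c := x ∈ Eo) fun h => hnx ((mEo x).1 h).1]
      have := hρZ x hxZ
      simp only [mEi, hx, true_and]
      split_ifs with h1 h2 h2
      · linarith
      · simp
      · simp
      · exact absurd (not_lt.1 h1) h2
    · rw [hw _ hxZ', if_neg (c := x⁻¹ ∈ Ei) fun h => hnx ((mEi _).1 h).1]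
      have := hρZ _ hxZ'
      simp only [mEo, inv_inv, hx, true_and]
      split_ifs with h1 h2 h2
      · simp
      · exact absurd h1.le h2
      · exact absurd (lt_of_le_of_ne h2 this) h1
      · simp

/-- The function `g` has at most a simple pole at `u`, with residue `R`. -/
def SimplePole (g : ℂ → ℂ) (u R : ℂ) : Prop :=
  ∃ N : ℂ → ℂ, (∀ᶠ z in 𝓝 u, DifferentiableAt ℂ N z) ∧ N u = R ∧
    ∀ᶠ z in 𝓝[≠] u, g z = N z / (z - u)

lemma SimplePole.circleIntegral_eq {g : ℂ → ℂ} {u R : ℂ} (h : SimplePole g u R) :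
    ∃ ε : ℝ, 0 < ε ∧ ∀ δ : ℝ, 0 < δ → δ < ε →
      circleIntegral g u δ = 2 * Real.pi * Complex.I * R := by
  obtain ⟨N, hN, rfl, hg⟩ := h
  obtain ⟨ε₁, hε₁, h1⟩ := Metric.eventually_nhds_iff_ball.1 hN
  obtain ⟨ε₂, hε₂, h2⟩ := Metric.eventually_nhds_iff_ball.1 (eventually_nhdsWithin_iff.1 hg)
  refine ⟨min ε₁ ε₂, lt_min hε₁ hε₂, fun δ hδ hlt => ?_⟩
  have hs : Metric.closedBall u δ ⊆ Metric.ball u ε₁ :=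
    Metric.closedBall_subset_ball (hlt.trans_le (min_le_left _ _))
  have hs2 : Metric.closedBall u δ ⊆ Metric.ball u ε₂ :=
    Metric.closedBall_subset_ball (hlt.trans_le (min_le_right _ _))
  have h3 := Complex.circleIntegral_sub_inv_smul_of_differentiable_on_off_countable (f := N)
    Set.countable_empty (Metric.mem_ball_self hδ)
    (fun z hz => (h1 z (hs hz)).continuousAt.continuousWithinAt)
    (fun z hz => h1 z (hs (Metric.ball_subset_closedBall hz.1)))
  rw [← smul_eq_mul, ← h3]
  refine circleIntegral.integral_congr hδ.le fun z hz => ?_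
  have hzu : z ≠ u := by
    rintro rfl
    rw [mem_sphere_iff_norm, sub_self, norm_zero] at hz
    linarith
  rw [h2 z (hs2 (Metric.sphere_subset_closedBall hz)) hzu, smul_eq_mul, div_eq_inv_mul]

/-- The form dz/z changes sign under inversion, and so does the residue. -/
lemma SimplePole.comp_inv {k : ℂ → ℂ} {u R : ℂ} (hu : u ≠ 0)
    (h : SimplePole (fun z => k z / z) u R) :
    SimplePole (fun z => k z⁻¹ / z) u⁻¹ (-R) := by
  obtain ⟨N, hN, rfl, hg⟩ := h
  have hui : u⁻¹ ≠ 0 := inv_ne_zero hu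
  have hc : Tendsto (fun z : ℂ => z⁻¹) (𝓝 u⁻¹) (𝓝 u) := by
    have := (continuousAt_inv₀ hui).tendsto
    rwa [inv_inv] at this
  have hne := isOpen_compl_singleton.mem_nhds (s := {(0 : ℂ)}ᶜ) hui
  refine ⟨fun z => -(N z⁻¹ / (u * z)), ?_, ?_, ?_⟩
  · filter_upwards [hc.eventually hN, hne] with z hz hz0
    refine (DifferentiableAt.div ?_ (by fun_prop) (mul_ne_zero hu hz0)).neg
    exact hz.comp z (differentiableAt_inv hz0)
  · simp only [inv_inv, mul_inv_cancel₀ hu, div_one]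
  · rw [eventually_nhdsWithin_iff] at hg ⊢
    filter_upwards [hc.eventually hg, hne] with z hz hz0 hzu
    have hz0' : z ≠ 0 := hz0
    have h1 : z⁻¹ ≠ u := fun h => hzu (by rw [Set.mem_singleton_iff, ← h, inv_inv])
    have h2 := hz h1
    have h3 : z⁻¹ - u ≠ 0 := sub_ne_zero.2 h1
    have h4 : z - u⁻¹ ≠ 0 := sub_ne_zero.2 hzu
    have h5 : 1 - u * z ≠ 0 := fun h => h3 (by field_simp; linear_combination h)
    have h6 : k z⁻¹ = N z⁻¹ / (z⁻¹ - u) * z⁻¹ := by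
      rw [← h2, div_mul_cancel₀ _ (inv_ne_zero hz0')]
    rw [h6]
    have h7 : z⁻¹ - u = (1 - u * z) / z := by field_simp
    have h8 : z - u⁻¹ = -(1 - u * z) / u := by field_simp; ring
    rw [h7, h8]
    field_simp

/-- Reduction of the integral of a function of the form `k(z) + k(1/z)` over a contour to residues
and an integral over a circle. -/
lemma chainSum_symm {C : List WeightedCircle} (hC : ChainAllowed C) {X : Set ℂ}
    (hX : ∀ x ∈ X, (∀ c ∈ C, dist x c.center ≠ c.radius ∧ dist x⁻¹ c.center ≠ c.radius) ∧
      windingNumber C x = 1 ∧ windingNumber C x⁻¹ = 0)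
    (hw0 : windingNumber C 0 = 1) {H d : ℂ → ℂ} (hH : DifferentiableOn ℂ H {0}ᶜ)
    (hdd : DifferentiableOn ℂ d {0}ᶜ)
    (hd : ∀ r₁ r₂ : ℝ, 0 < r₁ → HasFactorization (annulus r₁ r₂) d)
    (hd' : ∀ r₁ r₂ : ℝ, 0 < r₁ → HasFactorization (annulus r₁ r₂) fun z => d z⁻¹)
    {ρ : ℝ} (hρ : 0 < ρ) (E : Finset ℂ) (hE : ∀ u ∈ E, u ∈ X ∧ ρ < ‖u‖) {R : ℂ → ℂ}
    (hR : ∀ u ∈ E, SimplePole (fun z => H z / d z / z) u (R u))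
    (hz : ∀ x : ℂ, x ≠ 0 → d x = 0 →
      (x ∈ X ∧ (‖x‖ < ρ ∨ x ∈ E)) ∨ (x⁻¹ ∈ X ∧ ρ < ‖x‖)) :
    chainSum C (fun z => H z / d z / z + H z⁻¹ / d z⁻¹ / z) =
      2 * (circleIntegral (fun z => H z / d z / z) 0 ρ +
        2 * Real.pi * Complex.I * ∑ u ∈ E, R u) := by
  classical
  have hE0 : ∀ u ∈ E, u ≠ 0 := fun u hu => norm_pos_iff.1 (hρ.trans (hE u hu).2)
  have hXY : ∀ x ∈ X, x⁻¹ ∉ X := fun x hx hx' => by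
    have h1 := (hX x hx).2.2
    have h2 := (hX _ hx').2.1
    omega
  have hfin : ∀ e : ℂ → ℂ, (∀ r₁ r₂ : ℝ, 0 < r₁ → HasFactorization (annulus r₁ r₂) e) →
      ∀ r₁ r₂ : ℝ, 0 < r₁ → {x ∈ {x : ℂ | x ≠ 0 ∧ e x = 0} | r₁ ≤ ‖x‖ ∧ ‖x‖ ≤ r₂}.Finite := by
    intro e he r₁ r₂ hr
    obtain ⟨s, U, h1, h2, h3, h4⟩ := he (r₁ / 2) (r₂ + 1) (by linarith)
    refine s.toFinset.finite_toSet.subset ?_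
    rintro x ⟨⟨-, hx⟩, hx1, hx2⟩
    have hxa : x ∈ annulus (r₁ / 2) (r₂ + 1) := ⟨by linarith, by linarith⟩
    rw [Finset.mem_coe, Multiset.mem_toFinset]
    by_contra hns
    rw [h4 x hxa] at hx
    exact mul_ne_zero (h3 x hxa) (rootProd_ne_zero hns) hx
  have havoid : ∀ x : ℂ, x ≠ 0 → d x = 0 → ∀ c ∈ C, dist x c.center ≠ c.radius ∧
      dist x⁻¹ c.center ≠ c.radius := fun x hx0 hdx c hc => by
    rcases hz x hx0 hdx with ⟨hx, -⟩ | ⟨hx, -⟩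
    · exact (hX x hx).1 c hc
    · have := (hX _ hx).1 c hc
      rw [inv_inv] at this
      exact this.symm
  -- First half: the points of E lie inside the contour but outside the circle of radius ρ, so their
  -- residues are added.
  have hA : chainSum C (fun z => H z / d z / z) =
      circleIntegral (fun z => H z / d z / z) 0 ρ + 2 * Real.pi * Complex.I * ∑ u ∈ E, R u := by
    have hε : ∀ u ∈ E, ∃ δ : ℝ, (0 < δ ∧ δ < ‖u‖) ∧ (∀ x, x ≠ 0 → d x = 0 →
        dist x u ≠ δ ∧ (dist x u < δ → x = u)) ∧
        circleIntegral (fun z => H z / d z / z) u δ = 2 * Real.pi * Complex.I * R u := fun u hu => by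
      obtain ⟨ε, hε, h⟩ := (hR u hu).circleIntegral_eq
      obtain ⟨δ, h1, h2, h3, h4⟩ := exists_isolating_radius (hfin d hd) (hE0 u hu) hε
      exact ⟨δ, ⟨h1, h2⟩, fun x hx hdx => h4 x ⟨hx, hdx⟩, h δ h1 h3⟩
    choose! δ h1 h2 h3 using hε
    have e : (fun z => H z / d z / z) = fun z => (H z / z) / d z := by
      funext z; rw [div_right_comm]
    have key := chainSum_eq_circle_add hC hw0 (H := fun z => H z / z) (d := d)
      (hH.div (differentiableOn_id) fun z hz => hz) hd hρ 1 E h1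
      (fun x hx hdx u hu => h2 u hu x hx hdx) ?_
    · rw [e] at h3 ⊢
      rw [key, Finset.sum_congr rfl h3, ← Finset.mul_sum, Int.cast_one, one_mul]
    · intro x hx hdx
      refine ⟨fun c hc => (havoid x hx hdx c hc).1, ?_⟩
      rcases hz x hx hdx with ⟨hxX, h | h⟩ | ⟨hxX, h⟩
      · have hnE : x ∉ E := fun hxE => absurd (hE x hxE).2 h.not_gt
        exact ⟨h.ne, by rw [(hX x hxX).2.1, if_pos h, if_neg hnE, add_zero]⟩
      · exact ⟨(hE x h).2.ne', by rw [(hX x hxX).2.1, if_neg (hE x h).2.not_gt, if_pos h, zero_add]⟩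
      · have hnE : x ∉ E := fun hxE => hXY x (hE x hxE).1 hxX
        have := (hX _ hxX).2.2
        rw [inv_inv] at this
        exact ⟨h.ne', by rw [this, if_neg h.not_gt, if_neg hnE, add_zero]⟩
  -- Second half: compared with the circle of radius 1/ρ, the reciprocals of the points of E are
  -- enclosed by the circle but not by the contour, so they enter with multiplicity −1. This sign
  -- cancels the one from `SimplePole.comp_inv`, and both halves give the same value.
  have hB : chainSum C (fun z => H z⁻¹ / d z⁻¹ / z) =
      circleIntegral (fun z => H z / d z / z) 0 ρ + 2 * Real.pi * Complex.I * ∑ u ∈ E, R u := by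
    have hε : ∀ u ∈ E.image (·⁻¹), ∃ δ : ℝ, (0 < δ ∧ δ < ‖u‖) ∧ (∀ x, x ≠ 0 → d x⁻¹ = 0 →
        dist x u ≠ δ ∧ (dist x u < δ → x = u)) ∧
        circleIntegral (fun z => H z⁻¹ / d z⁻¹ / z) u δ =
          2 * Real.pi * Complex.I * -R u⁻¹ := fun u hu => by
      obtain ⟨v, hv, rfl⟩ := Finset.mem_image.1 hu
      obtain ⟨ε, hε, h⟩ := SimplePole.circleIntegral_eq
        (SimplePole.comp_inv (k := fun z => H z / d z) (hE0 v hv) (hR v hv))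
      obtain ⟨δ, h1, h2, h3, h4⟩ := exists_isolating_radius (hfin _ hd')
        (inv_ne_zero (hE0 v hv)) hε
      exact ⟨δ, ⟨h1, h2⟩, fun x hx hdx => h4 x ⟨hx, hdx⟩, by rw [h δ h1 h3, inv_inv]⟩
    choose! δ h1 h2 h3 using hε
    have e : (fun z => H z⁻¹ / d z⁻¹ / z) = fun z => (H z⁻¹ / z) / d z⁻¹ := by
      funext z; rw [div_right_comm]
    have hmemE : ∀ x, x ∈ E.image (·⁻¹) ↔ x⁻¹ ∈ E := fun x => by
      rw [Finset.mem_image]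
      exact ⟨fun ⟨v, hv, h⟩ => by rwa [← h, inv_inv], fun h => ⟨_, h, inv_inv x⟩⟩
    have key := chainSum_eq_circle_add hC hw0 (H := fun z => H z⁻¹ / z) (d := fun z => d z⁻¹)
      ((hH.comp (differentiableOn_inv.mono fun z hz => hz) fun z hz => inv_ne_zero hz).div
        (differentiableOn_id) fun z hz => hz) hd' (inv_pos.2 hρ) (-1) (E.image (·⁻¹)) h1
      (fun x hx hdx u hu => h2 u hu x hx hdx) ?_
    · rw [← circleIntegral_inv hρ fun z => H z / d z]
      rw [e] at h3 ⊢
      rw [key, Finset.sum_congr rfl h3, Finset.sum_image fun x _ y _ h => inv_injective h,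
        Finset.mul_sum, Finset.mul_sum]
      simp
    · intro x hx hdx
      have hxi := inv_ne_zero hx
      have hlt : ‖x‖ < ρ⁻¹ ↔ ρ < ‖x⁻¹‖ := by
        rw [norm_inv]; exact lt_inv_comm₀ (norm_pos_iff.2 hx) hρ
      have hne : ‖x⁻¹‖ ≠ ρ → ‖x‖ ≠ ρ⁻¹ := fun h h' => h (by rw [norm_inv, h', inv_inv])
      refine ⟨fun c hc => ?_, ?_⟩
      · have := (havoid _ hxi hdx c hc).2
        rwa [inv_inv] at this
      simp only [hlt, hmemE]
      rcases hz _ hxi hdx with ⟨hxX, h | h⟩ | ⟨hxX, h⟩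
      · have hnE : x⁻¹ ∉ E := fun hxE => absurd (hE _ hxE).2 h.not_gt
        have := (hX _ hxX).2.2
        rw [inv_inv] at this
        exact ⟨hne h.ne, by rw [this, if_neg h.not_gt, if_neg hnE, add_zero]⟩
      · have := (hX _ hxX).2.2
        rw [inv_inv] at this
        exact ⟨hne (hE _ h).2.ne', by rw [this, if_pos (hE _ h).2, if_pos h]; rfl⟩
      · have hnE : x⁻¹ ∉ E := fun hxE => hXY _ (hE _ hxE).1 hxX
        rw [inv_inv] at hxX
        exact ⟨hne h.ne', by rw [(hX _ hxX).2.1, if_pos h, if_neg hnE, add_zero]⟩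
  have hs0 : ∀ c ∈ C, ∀ z ∈ Metric.sphere c.center c.radius, z ≠ 0 := by
    rintro c hc z hz rfl
    obtain ⟨h1, h2 | h2⟩ := hC c hc
    · rw [h2, mem_sphere_iff_norm, sub_zero, norm_zero] at hz
      exact h1.ne hz
    · rw [mem_sphere_iff_norm, zero_sub, norm_neg] at hz
      exact h2.ne' hz
  have hinv : ContinuousOn (fun z : ℂ => z⁻¹) {0}ᶜ := continuousOn_inv₀
  have hmaps : Set.MapsTo (fun z : ℂ => z⁻¹) {0}ᶜ {0}ᶜ := fun z hz => inv_ne_zero hz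
  rw [chainSum_add, hA, hB]
  · ring
  · refine fun c hc => ContinuousOn.circleIntegrable (hC c hc).1.le ?_
    refine ((hH.continuousOn.mono (hs0 c hc)).div (hdd.continuousOn.mono (hs0 c hc)) ?_).div
      continuousOn_id (hs0 c hc)
    exact fun z hz h0 => (havoid z (hs0 c hc z hz) h0 c hc).1 hz
  · refine fun c hc => ContinuousOn.circleIntegrable (hC c hc).1.le ?_
    refine (((hH.continuousOn.comp hinv hmaps).mono (hs0 c hc)).div
      ((hdd.continuousOn.comp hinv hmaps).mono (hs0 c hc)) ?_).div continuousOn_id (hs0 c hc)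
    intro z hz h0
    have := (havoid _ (inv_ne_zero (hs0 c hc z hz)) h0 c hc).2
    rw [inv_inv] at this
    exact this hz

end EllipticPairing

end

noncomputable section

namespace EllipticPairing

/-! ### The integrand and its asymmetric half -/

/-- The symmetric integrand, in terms of holomorphic functions `F`, `G` and the parameters `S`. -/
def symmKernel (p q : ℂ) (S : Fin 6 → ℂ) (F G : ℂ → ℂ) (z : ℂ) : ℂ :=
  F z * G z * (∏ r, ellGamma (S r * z) p q * ellGamma (S r * z⁻¹) p q) *
    (theta (z ^ 2) p * theta (z⁻¹ ^ 2) q)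

/-- The parameters after removal of the poles at `1/(S_a q^k)` and `1/(S_b q^k)`. -/
def shiftParam (p : ℂ) (S : Fin 6 → ℂ) (a b r : Fin 6) : ℂ :=
  if r = a ∨ r = b then p * S r else S r

/-- The constant `θ(S_a S_b, S_a c, S_b c; q)`. -/
def halfConst (q : ℂ) (S : Fin 6 → ℂ) (a b : Fin 6) (c : ℂ) : ℂ :=
  theta (S a * S b) q * theta (S a * c) q * theta (S b * c) q

/-- The numerator of the asymmetric half of the integrand. -/
def halfNum (p q : ℂ) (S : Fin 6 → ℂ) (a b : Fin 6) (c : ℂ) (F G : ℂ → ℂ) (z : ℂ) : ℂ :=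
  -z⁻¹ ^ 2 * theta (z ^ 2) p * (theta (c * z) q * theta (S a * S b * c / z) q) /
    halfConst q S a b c * (F z * G z) *
    ∏ r, dPoch p q (p * q / (S r * z)) * dPoch p q (p * q / (S r * z⁻¹)) *
      if r = a ∨ r = b then qPoch (q / (S r * z)) q else 1

/-- The denominator of the asymmetric half of the integrand. -/
def halfDen (p q : ℂ) (S : Fin 6 → ℂ) (a b : Fin 6) (z : ℂ) : ℂ :=
  ∏ r, dPoch p q (shiftParam p S a b r * z) * dPoch p q (S r / z)

lemma prod_ite_two {ι : Type*} [Fintype ι] [DecidableEq ι] {a b : ι} (hab : a ≠ b) (x : ι → ℂ) :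
    ∏ r, (if r = a ∨ r = b then x r else 1) = x a * x b := by
  rw [Finset.prod_eq_mul a b hab]
  · simp
  · intro r _ h
    rw [if_neg (by tauto)]
  · simp
  · simp

section kernel

variable {p q : ℂ} (hp : ‖p‖ < 1) (hq : ‖q‖ < 1) (hp0 : p ≠ 0) (hq0 : q ≠ 0)
  {S : Fin 6 → ℂ} (hS : ∀ r, S r ≠ 0) {a b : Fin 6} (hab : a ≠ b) {c : ℂ} (hc : c ≠ 0)
  {F G : ℂ → ℂ}

include hp hq in
lemma dPoch_shiftParam_ne_zero {z : ℂ} {r : Fin 6} (h : dPoch p q (S r * z) ≠ 0) :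
    dPoch p q (shiftParam p S a b r * z) ≠ 0 := by
  rw [shiftParam]
  split_ifs
  · rw [dPoch_left hp hq] at h
    convert right_ne_zero_of_mul h using 2
    ring
  · exact h

include hp hq hab in
-- For r = a, b the factor θ(S_r z;q) of the breaker cancels the poles of Γ(S_r z) with i = 0, which
-- leaves a denominator with pS_r instead of S_r. This is what `shiftParam` records.
lemma halfNum_div_halfDen {z : ℂ} (h1 : ∀ r, dPoch p q (S r * z) ≠ 0) :
    halfNum p q S a b c F G z / halfDen p q S a b z =
      -z⁻¹ ^ 2 * theta (z ^ 2) p * breaker q (S a) (S b) c z / halfConst q S a b c *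
        (F z * G z * ∏ r, ellGamma (S r * z) p q * ellGamma (S r * z⁻¹) p q) := by
  have hr : ∀ r, dPoch p q (p * q / (S r * z)) * dPoch p q (p * q / (S r * z⁻¹)) *
      (if r = a ∨ r = b then qPoch (q / (S r * z)) q else 1) /
      (dPoch p q (shiftParam p S a b r * z) * dPoch p q (S r / z)) =
      (ellGamma (S r * z) p q * ellGamma (S r * z⁻¹) p q) *
        (if r = a ∨ r = b then theta (S r * z) q else 1) := fun r => by
    rw [ellGamma_eq hp hq, ellGamma_eq hp hq, shiftParam, ← div_eq_mul_inv (S r)]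
    split_ifs
    · have h := h1 r
      rw [dPoch_left hp hq (S r * z)] at h ⊢
      have h3 := left_ne_zero_of_mul h
      rw [show S r * z * p = p * S r * z by ring] at h ⊢
      have h4 := right_ne_zero_of_mul h
      rw [theta]
      field_simp
    · field_simp
  rw [halfNum, halfDen, mul_div_assoc, ← Finset.prod_div_distrib, Finset.prod_congr rfl fun r _ => hr r,
    Finset.prod_mul_distrib, prod_ite_two hab, breaker]
  ring

include hp hq hp0 hq0 hS hab hc in
-- `breaker_sub_eq`, divided by its constant, expresses θ(z²;q) by the breaker at z and at 1/z. The
-- quasi-periods of θ(z^{±2}) make the second summand the value of the first at 1/z.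
lemma symmKernel_eq {z : ℂ} (hz : z ≠ 0) (hF : F z⁻¹ = F z) (hG : G z⁻¹ = G z)
    (h1 : ∀ r, dPoch p q (S r * z) ≠ 0) (h2 : ∀ r, dPoch p q (S r * z⁻¹) ≠ 0)
    (hκ : halfConst q S a b c ≠ 0) (hT : theta (S a ^ 2) q ≠ 0) :
    symmKernel p q S F G z = halfNum p q S a b c F G z / halfDen p q S a b z +
      halfNum p q S a b c F G z⁻¹ / halfDen p q S a b z⁻¹ := by
  rw [halfNum_div_halfDen hp hq hab h1, halfNum_div_halfDen hp hq hab h2, inv_inv, hF, hG,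
    inv_pow, theta_inv hp hp0 (pow_ne_zero 2 hz), symmKernel, inv_pow,
    theta_inv hq hq0 (pow_ne_zero 2 hz)]
  have hb := breaker_sub_eq hq hq0 (hS a) (hS b) hc hT hz
  rw [← halfConst] at hb
  have e : ∏ r, ellGamma (S r * z⁻¹) p q * ellGamma (S r * z) p q =
      ∏ r, ellGamma (S r * z) p q * ellGamma (S r * z⁻¹) p q :=
    Finset.prod_congr rfl fun r _ => mul_comm _ _
  rw [e]
  have h3 : theta (z ^ 2) q = (breaker q (S a) (S b) c z - z ^ 2 * breaker q (S a) (S b) c z⁻¹) /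
      halfConst q S a b c := by rw [hb]; field_simp
  rw [h3]
  generalize ∏ r, ellGamma (S r * z) p q * ellGamma (S r * z⁻¹) p q = X
  field_simp
  ring

include hp hq hS hc in
lemma differentiableOn_halfNum (hF : DifferentiableOn ℂ F {0}ᶜ) (hG : DifferentiableOn ℂ G {0}ᶜ) :
    DifferentiableOn ℂ (halfNum p q S a b c F G) {0}ᶜ := by
  have hS' := hS
  have hd := differentiable_dPoch hp hq
  have hqP := differentiable_qPoch hq
  have hdiv : ∀ (x : ℂ) (r : Fin 6), DifferentiableOn ℂ (fun z => x / (S r * z)) {0}ᶜ :=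
    fun x r => DifferentiableOn.div (by fun_prop) (by fun_prop) fun z hz => mul_ne_zero (hS r) hz
  have hdiv' : ∀ (x : ℂ) (r : Fin 6), DifferentiableOn ℂ (fun z => x / (S r * z⁻¹)) {0}ᶜ :=
    fun x r => (differentiableOn_const x).div
      (differentiableOn_inv.const_mul (S r)) fun z hz => mul_ne_zero (hS r) (inv_ne_zero hz)
  have hth : ∀ (x : ℂ) (m : ℂ → ℂ), DifferentiableOn ℂ m {0}ᶜ → (∀ z ∈ ({0}ᶜ : Set ℂ), m z ≠ 0) →
      ‖x‖ < 1 → DifferentiableOn ℂ (fun z => theta (m z) x) {0}ᶜ := fun x m hm hm0 hx z hz =>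
    ((differentiableAt_theta hx (hm0 z hz)).comp z
      ((hm z hz).differentiableAt (isOpen_compl_singleton.mem_nhds hz))).differentiableWithinAt
  have hinv2 : DifferentiableOn ℂ (fun z : ℂ => -z⁻¹ ^ 2) {0}ᶜ := (differentiableOn_inv.pow 2).neg
  refine ((((hinv2.mul (hth p _ (by fun_prop) (fun z hz => pow_ne_zero 2 hz) hp)).mul
    ((hth q (fun z => c * z) (by fun_prop) (fun z hz => mul_ne_zero hc hz) hq).mul
      (hth q (fun z => S a * S b * c / z) ?_ (fun z hz => div_ne_zero ?_ hz) hq))).div_const _).mul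
        (hF.mul hG)).mul ?_
  · exact DifferentiableOn.div (by fun_prop) differentiableOn_id fun z hz => hz
  · exact mul_ne_zero (mul_ne_zero (hS a) (hS b)) hc
  · refine DifferentiableOn.fun_finsetProd fun r _ => ?_
    refine ((hd.comp_differentiableOn (hdiv _ r)).mul (hd.comp_differentiableOn (hdiv' _ r))).mul ?_
    by_cases h : r = a ∨ r = b
    · simp only [if_pos h]
      exact hqP.comp_differentiableOn (hdiv _ r)
    · simp only [if_neg h]
      fun_prop

include hp hq in
lemma differentiableOn_halfDen : DifferentiableOn ℂ (halfDen p q S a b) {0}ᶜ := by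
  have hd := differentiable_dPoch hp hq
  refine DifferentiableOn.fun_finsetProd fun r _ => ?_
  refine (hd.comp_differentiableOn (by fun_prop)).mul (hd.comp_differentiableOn ?_)
  exact DifferentiableOn.div (by fun_prop) differentiableOn_id fun z hz => hz

include hp hq in
lemma halfDen_hasFactorization {r₁ : ℝ} (hr : 0 < r₁) (r₂ : ℝ) :
    HasFactorization (annulus r₁ r₂) (halfDen p q S a b) :=
  HasFactorization.prod _ fun _ _ => (HasFactorization.dPoch_mul hp hq r₁ r₂ _).mul
    (HasFactorization.dPoch_div hp hq hr r₂ _)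

include hp hq in
lemma halfDen_inv_hasFactorization {r₁ : ℝ} (hr : 0 < r₁) (r₂ : ℝ) :
    HasFactorization (annulus r₁ r₂) fun z => halfDen p q S a b z⁻¹ := by
  refine HasFactorization.congr (HasFactorization.prod Finset.univ fun r _ =>
    (HasFactorization.dPoch_div hp hq hr r₂ (shiftParam p S a b r)).mul
      (HasFactorization.dPoch_mul hp hq r₁ r₂ (S r))) fun z _ => ?_
  simp only [halfDen, div_eq_mul_inv, inv_inv]

include hp hq in
lemma halfDen_eq_zero {x : ℂ} (hx : x ≠ 0) (h : halfDen p q S a b x = 0) :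
    (∃ r i j, x = p ^ i * q ^ j * S r) ∨ ∃ r i j, x⁻¹ = p ^ i * q ^ j * shiftParam p S a b r := by
  obtain ⟨r, -, hr⟩ := Finset.prod_eq_zero_iff.1 h
  rcases mul_eq_zero.1 hr with hr | hr
  · obtain ⟨i, j, hij⟩ := (dPoch_eq_zero_iff hp hq).1 hr
    exact Or.inr ⟨r, i, j, inv_eq_of_mul_eq_one_left (by linear_combination hij)⟩
  · obtain ⟨i, j, hij⟩ := (dPoch_eq_zero_iff hp hq).1 hr
    refine Or.inl ⟨r, i, j, ?_⟩
    field_simp at hij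
    linear_combination -hij

/-- The residue of `Γ(T/z) dz/z` at `z = T q^k`. -/
def gammaResidue (p q : ℂ) (k : ℕ) : ℂ :=
  dPoch p q (p * q / (q ^ k)⁻¹) /
    (qPochFin (q ^ k)⁻¹ q k * qPoch q q * dPoch p q ((q ^ k)⁻¹ * p))

/-- The residue of the integrand at `S_a q^k`. -/
def kernelResidue (p q : ℂ) (S : Fin 6 → ℂ) (a : Fin 6) (F G : ℂ → ℂ) (k : ℕ) : ℂ :=
  let u := S a * q ^ k
  F u * G u * (theta (u ^ 2) p * theta (u⁻¹ ^ 2) q) * ellGamma (S a * u) p q *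
    (∏ r ∈ Finset.univ.erase a, ellGamma (S r * u) p q * ellGamma (S r * u⁻¹) p q) *
    gammaResidue p q k

include hp hq hq0 hS hab hc in
-- Only one factor of the denominator vanishes at u = S_a q^k, namely 1 − u/z. Since the breaker
-- vanishes at 1/u, the addition formula converts its value at u into θ(u⁻²;q). So the half has the
-- residue of the whole symmetric integrand, and the auxiliary parameters b and c drop out.
lemma simplePole_half (hF : DifferentiableOn ℂ F {0}ᶜ) (hG : DifferentiableOn ℂ G {0}ᶜ) (k : ℕ)
    (h1 : ∀ r, dPoch p q (S r * (S a * q ^ k)) ≠ 0)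
    (h2 : ∀ r, r ≠ a → dPoch p q (S r * (S a * q ^ k)⁻¹) ≠ 0)
    (h3 : dPoch p q ((q ^ k)⁻¹ * p) ≠ 0)
    (hκ : halfConst q S a b c ≠ 0) (hT : theta (S a ^ 2) q ≠ 0) :
    SimplePole (fun z => halfNum p q S a b c F G z / halfDen p q S a b z / z) (S a * q ^ k)
      (kernelResidue p q S a F G k) := by
  set u := S a * q ^ k with hu
  have hqk : q ^ k ≠ 0 := pow_ne_zero k hq0
  have hu0 : u ≠ 0 := mul_ne_zero (hS a) hqk
  have hTu : S a / u = (q ^ k)⁻¹ := by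
    have := hS a
    rw [hu]; field_simp
  have hpf : qPochFin (q ^ k)⁻¹ q k ≠ 0 := by
    rw [qPochFin, Finset.prod_ne_zero_iff]
    intro i hi h
    have hik := Finset.mem_range.1 hi
    have h4 : q ^ i = q ^ k := by
      have : (q ^ k)⁻¹ * q ^ i = 1 := by linear_combination -h
      field_simp at this
      exact this
    have h5 : ‖q‖ ^ i = ‖q‖ ^ k := by rw [← norm_pow, h4, norm_pow]
    exact absurd h5 (pow_lt_pow_right_of_lt_one₀ (norm_pos_iff.2 hq0) hq hik).ne'
  have hqq : qPoch q q ≠ 0 := fun h => by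
    obtain ⟨r, hr⟩ := (qPoch_eq_zero_iff hq).1 h
    have : ‖q ^ (r + 1)‖ < 1 := by rw [norm_pow]; exact pow_lt_one₀ (norm_nonneg _) hq (by omega)
    rw [pow_succ', hr, norm_one] at this
    exact lt_irrefl _ this
  -- the denominator without the vanishing factor
  set e : ℂ → ℂ := fun z => (qPochFin (S a / z) q k * qPoch (S a * q ^ (k + 1) / z) q *
    dPoch p q (S a / z * p)) * ((∏ r, dPoch p q (shiftParam p S a b r * z)) *
      ∏ r ∈ Finset.univ.erase a, dPoch p q (S r / z)) with he
  have hden : ∀ z : ℂ, halfDen p q S a b z = (1 - u / z) * e z := fun z => by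
    rw [halfDen, Finset.prod_mul_distrib,
      ← Finset.mul_prod_erase Finset.univ (fun r => dPoch p q (S r / z)) (Finset.mem_univ a),
      dPoch_left hp hq (S a / z), qPoch_eq_qPochFin_mul hq (S a / z) k,
      qPoch_succ hq (S a / z * q ^ k)]
    simp only [he, hu]
    rw [show S a / z * q ^ k = S a * q ^ k / z by ring,
      show S a * q ^ k / z * q = S a * q ^ (k + 1) / z by ring]
    ring
  have hdiv : ∀ x : ℂ, DifferentiableOn ℂ (fun z : ℂ => x / z) {0}ᶜ := fun x =>
    DifferentiableOn.div (by fun_prop) differentiableOn_id fun z hz => hz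
  have hed : DifferentiableOn ℂ e {0}ᶜ := by
    have hd := differentiable_dPoch hp hq
    have hqP := differentiable_qPoch hq
    refine (((DifferentiableOn.fun_finsetProd fun i _ => ?_).mul
      (hqP.comp_differentiableOn (hdiv _))).mul
      (hd.comp_differentiableOn ((hdiv _).mul_const _))).mul
        ((DifferentiableOn.fun_finsetProd fun r _ => ?_).mul
          (DifferentiableOn.fun_finsetProd fun r _ => hd.comp_differentiableOn (hdiv _)))
    · exact ((hdiv _).mul_const _).const_sub 1
    · exact hd.comp_differentiableOn (by fun_prop)
  have hUn : ({0}ᶜ : Set ℂ) ∈ 𝓝 u := isOpen_compl_singleton.mem_nhds hu0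
  have heu : e u = (qPochFin (q ^ k)⁻¹ q k * qPoch q q * dPoch p q ((q ^ k)⁻¹ * p)) *
      ((∏ r, dPoch p q (shiftParam p S a b r * u)) *
      ∏ r ∈ Finset.univ.erase a, dPoch p q (S r / u)) := by
    simp only [he]
    rw [hTu, show S a * q ^ (k + 1) / u = q by have := hS a; rw [hu, pow_succ]; field_simp]
  have heu0 : e u ≠ 0 := by
    rw [heu]
    refine mul_ne_zero (mul_ne_zero (mul_ne_zero hpf hqq) h3) (mul_ne_zero ?_ ?_)
    · exact Finset.prod_ne_zero_iff.2 fun r _ => dPoch_shiftParam_ne_zero hp hq (h1 r)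
    · exact Finset.prod_ne_zero_iff.2 fun r hr => by
        simpa [div_eq_mul_inv] using h2 r (Finset.ne_of_mem_erase hr)
  refine ⟨fun z => halfNum p q S a b c F G z / e z, ?_, ?_, ?_⟩
  · have hne := (hed.differentiableAt hUn).continuousAt.eventually_ne heu0
    filter_upwards [hne, hUn] with z hz hz0
    have hUz : ({0}ᶜ : Set ℂ) ∈ 𝓝 z := isOpen_compl_singleton.mem_nhds hz0
    exact ((differentiableOn_halfNum hp hq hS hc hF hG).differentiableAt hUz).div
      (hed.differentiableAt hUz) hz
  · -- evaluate the residue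
    have hbr : breaker q (S a) (S b) c u⁻¹ = 0 := by
      have : theta (S a * u⁻¹) q = 0 := by
        rw [← div_eq_mul_inv, hTu, theta_eq_zero_iff hq hq0 (inv_ne_zero hqk)]
        exact ⟨-k, by rw [zpow_neg, zpow_natCast]⟩
      rw [breaker, this]
      ring
    have hb := breaker_sub_eq hq hq0 (hS a) (hS b) hc hT hu0
    rw [hbr, mul_zero, sub_zero, ← halfConst] at hb
    have hth : theta (u⁻¹ ^ 2) q =
        -u⁻¹ ^ 2 * breaker q (S a) (S b) c u / halfConst q S a b c := by
      rw [inv_pow, theta_inv hq hq0 (pow_ne_zero 2 hu0), hb]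
      field_simp
    have hr : ∀ r, dPoch p q (p * q / (S r * u)) *
        (if r = a ∨ r = b then qPoch (q / (S r * u)) q else 1) /
        dPoch p q (shiftParam p S a b r * u) =
        ellGamma (S r * u) p q * (if r = a ∨ r = b then theta (S r * u) q else 1) := fun r => by
      rw [ellGamma_eq hp hq, shiftParam]
      split_ifs
      · have h := h1 r
        rw [dPoch_left hp hq (S r * u)] at h ⊢
        have h3 := left_ne_zero_of_mul h
        rw [show S r * u * p = p * S r * u by ring] at h ⊢
        have h4 := right_ne_zero_of_mul h
        rw [theta]
        field_simp
      · rw [mul_one, mul_one]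
    have hP : (∏ r, dPoch p q (p * q / (S r * u)) *
        (if r = a ∨ r = b then qPoch (q / (S r * u)) q else 1)) /
        ∏ r, dPoch p q (shiftParam p S a b r * u) =
        (∏ r, ellGamma (S r * u) p q) * (theta (S a * u) q * theta (S b * u) q) := by
      rw [← Finset.prod_div_distrib, Finset.prod_congr rfl fun r _ => hr r,
        Finset.prod_mul_distrib, prod_ite_two hab]
    have hG2 : (∏ r ∈ Finset.univ.erase a, dPoch p q (p * q / (S r * u⁻¹))) /
        ∏ r ∈ Finset.univ.erase a, dPoch p q (S r / u) =
        ∏ r ∈ Finset.univ.erase a, ellGamma (S r * u⁻¹) p q := by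
      rw [← Finset.prod_div_distrib]
      exact Finset.prod_congr rfl fun r _ => by rw [ellGamma_eq hp hq, ← div_eq_mul_inv (S r)]
    have hnum : halfNum p q S a b c F G u = -u⁻¹ ^ 2 * theta (u ^ 2) p *
        (theta (c * u) q * theta (S a * S b * c / u) q) / halfConst q S a b c * (F u * G u) *
        ((∏ r, dPoch p q (p * q / (S r * u)) *
          (if r = a ∨ r = b then qPoch (q / (S r * u)) q else 1)) *
          (dPoch p q (p * q / (q ^ k)⁻¹) *
            ∏ r ∈ Finset.univ.erase a, dPoch p q (p * q / (S r * u⁻¹)))) := by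
      rw [← hTu, div_eq_mul_inv (S a),
        Finset.mul_prod_erase Finset.univ (fun r => dPoch p q (p * q / (S r * u⁻¹)))
          (Finset.mem_univ a), ← Finset.prod_mul_distrib, halfNum]
      congr 1
      exact Finset.prod_congr rfl fun r _ => by ring
    have hbig : halfNum p q S a b c F G u / e u = -u⁻¹ ^ 2 * theta (u ^ 2) p *
        (theta (c * u) q * theta (S a * S b * c / u) q) / halfConst q S a b c * (F u * G u) *
        (((∏ r, dPoch p q (p * q / (S r * u)) *
          (if r = a ∨ r = b then qPoch (q / (S r * u)) q else 1)) /
            ∏ r, dPoch p q (shiftParam p S a b r * u)) *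
          ((∏ r ∈ Finset.univ.erase a, dPoch p q (p * q / (S r * u⁻¹))) /
            ∏ r ∈ Finset.univ.erase a, dPoch p q (S r / u))) * gammaResidue p q k := by
      rw [hnum, heu, gammaResidue]
      ring
    change halfNum p q S a b c F G u / e u = _
    rw [hbig, hP, hG2, kernelResidue, ← hu, hth, breaker, Finset.prod_mul_distrib,
      ← Finset.mul_prod_erase Finset.univ (fun r => ellGamma (S r * u) p q) (Finset.mem_univ a)]
    ring
  · rw [eventually_nhdsWithin_iff]
    filter_upwards [hUn] with z hz0 hzu
    have hz0' : z ≠ 0 := hz0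
    have h4 : z - u ≠ 0 := sub_ne_zero.2 hzu
    have h5 : 1 - u / z = (z - u) / z := by field_simp
    rw [hden, h5, div_div, div_div]
    congr 1
    field_simp

end kernel

end EllipticPairing

end

noncomputable section

namespace EllipticPairing

/-! ### The pairing as a sum of residues and a circle integral -/

/-- Countably many points of a circle have measure zero. The values of the integrand at poles, or at
zeros of auxiliary factors, can thus be ignored. -/
lemma circleIntegral_congr_countable {g g' : ℂ → ℂ} {B : Set ℂ} (hB : B.Countable) {c : ℂ} {r : ℝ}
    (hr : 0 < r) (h : ∀ z ∈ Metric.sphere c r, z ∉ B → g z = g' z) :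
    circleIntegral g c r = circleIntegral g' c r := by
  rw [circleIntegral, circleIntegral]
  refine intervalIntegral.integral_congr_ae ?_
  have h0 := (hB.preimage_circleMap c hr.ne').ae_notMem MeasureTheory.volume
  filter_upwards [h0] with x hx _
  rw [h _ (circleMap_mem_sphere c hr.le x) hx]

lemma countable_setOf_sq_mem {B : Set ℂ} (hB : B.Countable) : {z : ℂ | z ^ 2 ∈ B}.Countable := by
  choose s hs using fun x : ℂ => IsAlgClosed.exists_pow_nat_eq x (n := 2) two_pos
  refine ((hB.image s).union (hB.image fun x => -s x)).mono fun z hz => ?_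
  rcases sq_eq_sq_iff_eq_or_eq_neg.1 (hs (z ^ 2)) with h | h
  · exact Or.inl ⟨_, hz, h⟩
  · exact Or.inr ⟨_, hz, by simp only [h, neg_neg]⟩

lemma countable_setOf_inv_mem {B : Set ℂ} (hB : B.Countable) : {z : ℂ | z⁻¹ ∈ B}.Countable :=
  hB.preimage inv_injective

lemma countable_setOf_mul_mem {B : Set ℂ} (hB : B.Countable) {x : ℂ} (hx : x ≠ 0) :
    {z : ℂ | x * z ∈ B}.Countable :=
  hB.preimage (mul_right_injective₀ hx)

lemma poleFactor_inv (u p q : ℂ) (m : ℕ) (z : ℂ) :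
    poleFactor u p q m z⁻¹ = poleFactor u p q m z := by
  rw [poleFactor, poleFactor, inv_inv, mul_comm]

section pairing

variable {p q : ℂ} (hp : ‖p‖ < 1) (hq : ‖q‖ < 1) (hp0 : p ≠ 0) (hq0 : q ≠ 0)

include hp0 hq0 in
-- By θ(p/x;p) = θ(x;p) and a reversal of the product, the pole factor takes the form that the
-- m-fold shift equation of Γ produces from u q^{-m}.
lemma poleFactor_eq {u z : ℂ} (hu : u ≠ 0) (hz : z ≠ 0) (m : ℕ) :
    poleFactor u p q m z = (∏ j ∈ Finset.range m, theta (u / q ^ m * z * q ^ j) p) *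
      ∏ j ∈ Finset.range m, theta (u / q ^ m * z⁻¹ * q ^ j) p := by
  have key : ∀ y : ℂ, y ≠ 0 → thetaFin (p * q * y / u) q p m =
      ∏ j ∈ Finset.range m, theta (u / q ^ m * y⁻¹ * q ^ j) p := fun y hy => by
    rw [thetaFin, ← Finset.prod_range_reflect]
    refine Finset.prod_congr rfl fun j hj => ?_
    have hj' : q ^ m = q ^ (m - 1 - j) * q ^ j * q := by
      rw [← pow_add, ← pow_succ]; congr 1; have := Finset.mem_range.1 hj; omega
    rw [← theta_div hp0]
    congr 1
    rw [hj']
    field_simp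
  rw [poleFactor, key z hz, key _ (inv_ne_zero hz), inv_inv, mul_comm]

include hp hp0 in
lemma countable_theta_eq_zero : {x : ℂ | x = 0 ∨ theta x p = 0}.Countable := by
  refine ((Set.countable_singleton (0 : ℂ)).union
    (Set.countable_range fun n : ℤ => p ^ n)).mono fun x hx => ?_
  by_cases h0 : x = 0
  · exact Or.inl h0
  · obtain ⟨n, hn⟩ := (theta_eq_zero_iff hp hp0 h0).1 (hx.resolve_left h0)
    exact Or.inr ⟨n, hn.symm⟩

include hp hp0 hq0 in
lemma countable_poleFactor_eq_zero {u : ℂ} (hu : u ≠ 0) (m : ℕ) :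
    {z : ℂ | z = 0 ∨ poleFactor u p q m z = 0}.Countable := by
  have hB := countable_theta_eq_zero hp hp0
  have hx : ∀ j : ℕ, u / q ^ m * q ^ j ≠ 0 := fun j =>
    mul_ne_zero (div_ne_zero hu (pow_ne_zero _ hq0)) (pow_ne_zero _ hq0)
  have h1 : (⋃ j : ℕ, {z : ℂ | u / q ^ m * q ^ j * z ∈ {x : ℂ | x = 0 ∨ theta x p = 0}}).Countable :=
    Set.countable_iUnion fun j => countable_setOf_mul_mem hB (hx j)
  refine (((Set.countable_singleton (0 : ℂ)).union h1).union (countable_setOf_inv_mem h1)).mono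
    fun z hz => ?_
  by_cases h0 : z = 0
  · exact Or.inl (Or.inl h0)
  have h := hz.resolve_left h0
  rw [poleFactor_eq hp0 hq0 hu h0, mul_eq_zero, Finset.prod_eq_zero_iff,
    Finset.prod_eq_zero_iff] at h
  rcases h with ⟨j, -, h⟩ | ⟨j, -, h⟩
  · refine Or.inl (Or.inr (Set.mem_iUnion.2 ⟨j, Or.inr ?_⟩))
    rwa [mul_right_comm] at h
  · refine Or.inr (Set.mem_iUnion.2 ⟨j, Or.inr ?_⟩)
    rwa [mul_right_comm] at h

include hp hp0 hq0 in
-- The symmetry is given only off the zeros of the pole factor. These are countable, so their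
-- complement is dense, and F is continuous.
lemma MemA.symm_of_eq {u : ℂ} (hu : u ≠ 0) {m : ℕ} {f F : ℂ → ℂ} (hf : MemA u p q m f)
    (hF : DifferentiableOn ℂ F {0}ᶜ)
    (hFf : ∀ z : ℂ, z ≠ 0 → poleFactor u p q m z ≠ 0 → F z = poleFactor u p q m z * f z)
    {z : ℂ} (hz : z ≠ 0) : F z⁻¹ = F z := by
  have hd := (countable_poleFactor_eq_zero hp hp0 hq0 hu m).dense_compl ℂ
  have hc : ContinuousOn (fun z => F z⁻¹ - F z) {0}ᶜ :=
    (hF.continuousOn.comp continuousOn_inv₀ fun z hz => inv_ne_zero hz).sub hF.continuousOn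
  have hcl : z ∈ closure ({0}ᶜ ∩ {z : ℂ | z = 0 ∨ poleFactor u p q m z = 0}ᶜ) :=
    hd.open_subset_closure_inter isOpen_compl_singleton hz
  have : Set.EqOn (fun z => F z⁻¹ - F z) 0
      ({0}ᶜ ∩ {z : ℂ | z = 0 ∨ poleFactor u p q m z = 0}ᶜ) := by
    rintro y ⟨hy, hy'⟩
    have h2 : poleFactor u p q m y ≠ 0 := fun h => hy' (Or.inr h)
    have h3 : poleFactor u p q m y⁻¹ ≠ 0 := by rwa [poleFactor_inv]
    simp only [Pi.zero_apply]
    rw [hFf y hy h2, hFf _ (inv_ne_zero hy) h3, poleFactor_inv, (hf.1 y hy h2).1, sub_self]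
  have hcw : ContinuousWithinAt (fun z => F z⁻¹ - F z)
      ({0}ᶜ ∩ {z : ℂ | z = 0 ∨ poleFactor u p q m z = 0}ᶜ) z :=
    (hc z hz).mono Set.inter_subset_left
  have hmem := hcw.mem_closure_image hcl
  have hsub : (fun z => F z⁻¹ - F z) '' ({0}ᶜ ∩ {z : ℂ | z = 0 ∨ poleFactor u p q m z = 0}ᶜ) ⊆
      {0} := by
    rintro _ ⟨y, hy, rfl⟩
    exact this hy
  have := closure_mono hsub hmem
  rw [closure_singleton] at this
  exact sub_eq_zero.1 this

include hp hq hp0 hq0 in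
-- The m-fold shift equation at z and at 1/z trades Γ(u z^{±1}) for Γ(u q^{-m} z^{±1}). In the
-- integrand this replaces f by its numerator and t_r by t̃_r.
lemma ellGamma_mul_ellGamma_eq {u z : ℂ} (hu : u ≠ 0) (hz : z ≠ 0) {m : ℕ}
    (h : poleFactor u p q m z ≠ 0) :
    ellGamma (u * z) p q * ellGamma (u * z⁻¹) p q = poleFactor u p q m z *
      (ellGamma (u / q ^ m * z) p q * ellGamma (u / q ^ m * z⁻¹) p q) := by
  have hqm := pow_ne_zero m hq0
  have hv : u / q ^ m ≠ 0 := div_ne_zero hu hqm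
  rw [poleFactor_eq hp0 hq0 hu hz] at h ⊢
  have h1 := Finset.prod_ne_zero_iff.1 (left_ne_zero_of_mul h)
  have h2 := Finset.prod_ne_zero_iff.1 (right_ne_zero_of_mul h)
  have e1 := ellGamma_mul_pow hp hq hq0 (mul_ne_zero hv hz) m
    fun j hj => h1 j (Finset.mem_range.2 hj)
  have e2 := ellGamma_mul_pow hp hq hq0 (mul_ne_zero hv (inv_ne_zero hz)) m
    fun j hj => h2 j (Finset.mem_range.2 hj)
  rw [show u / q ^ m * z * q ^ m = u * z by field_simp] at e1
  rw [show u / q ^ m * z⁻¹ * q ^ m = u * z⁻¹ by field_simp] at e2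
  rw [e1, e2]
  ring

include hp hq in
lemma countable_dPoch_eq_zero : {x : ℂ | dPoch p q x = 0}.Countable := by
  refine (Set.countable_range fun n : ℕ × ℕ => (p ^ n.1 * q ^ n.2)⁻¹).mono fun x hx => ?_
  obtain ⟨i, j, h⟩ := (dPoch_eq_zero_iff hp hq).1 hx
  exact ⟨(i, j), inv_eq_of_mul_eq_one_left h⟩

variable {T : Fin 6 → ℂ} (hT : ∀ r, T r ≠ 0) {mf mg : ℕ}

include hT hq0 in
lemma tildeParam_ne_zero (r : Fin 6) : tildeParam q mf mg T r ≠ 0 := by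
  rw [tildeParam]
  split_ifs
  exacts [div_ne_zero (hT r) (pow_ne_zero _ hq0), div_ne_zero (hT r) (pow_ne_zero _ hq0), hT r]

include hp hq hT hp0 hq0 in
lemma countable_integrand_ne {f g F G : ℂ → ℂ}
    (hF : ∀ z : ℂ, z ≠ 0 → poleFactor (T 4) p q mf z ≠ 0 → F z = poleFactor (T 4) p q mf z * f z)
    (hG : ∀ z : ℂ, z ≠ 0 → poleFactor (T 5) p q mg z ≠ 0 →
      G z = poleFactor (T 5) p q mg z * g z) :
    {z : ℂ | f z * g z * (∏ r : Fin 6, ellGamma (T r * z) p q * ellGamma (T r * z⁻¹) p q) /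
        (ellGamma (z ^ 2) p q * ellGamma (z⁻¹ ^ 2) p q) ≠
      symmKernel p q (tildeParam q mf mg T) F G z}.Countable := by
  have hD := countable_dPoch_eq_zero hp hq
  have hD1 := countable_setOf_sq_mem (countable_setOf_mul_mem hD (mul_ne_zero hp0 hq0))
  refine ((((countable_poleFactor_eq_zero hp hp0 hq0 (hT 4) mf).union
    (countable_poleFactor_eq_zero hp hp0 hq0 (hT 5) mg)).union hD1).union
      (countable_setOf_inv_mem hD1)).mono fun z hz => ?_
  by_contra hn
  simp only [Set.mem_union, Set.mem_ofPred_eq, not_or] at hn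
  obtain ⟨⟨⟨⟨hz0, h4⟩, -, h5⟩, hd1⟩, hd2⟩ := hn
  refine hz ?_
  rw [symmKernel, hF z hz0 h4, hG z hz0 h5]
  have e := ellGamma_mul_ellGamma_inv hp hq (x := z ^ 2) hd1
    (by rwa [inv_pow, ← div_eq_mul_inv] at hd2)
  rw [← inv_pow] at e
  rw [e, div_inv_eq_mul]
  simp only [Fin.prod_univ_six]
  have e4 := ellGamma_mul_ellGamma_eq hp hq hp0 hq0 (hT 4) hz0 h4
  have e5 := ellGamma_mul_ellGamma_eq hp hq hp0 hq0 (hT 5) hz0 h5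
  have t4 : tildeParam q mf mg T 4 = T 4 / q ^ mf := by simp [tildeParam]
  have t5 : tildeParam q mf mg T 5 = T 5 / q ^ mg := by simp [tildeParam]
  have t0 : tildeParam q mf mg T 0 = T 0 := by simp [tildeParam]
  have t1 : tildeParam q mf mg T 1 = T 1 := by simp [tildeParam]
  have t2 : tildeParam q mf mg T 2 = T 2 := by simp [tildeParam]
  have t3 : tildeParam q mf mg T 3 = T 3 := by simp [tildeParam]
  rw [e4, e5, t0, t1, t2, t3, t4, t5]
  ring

include hp hq hq0 hT in
lemma innerPoints_finite {r : ℝ} (hr : 0 < r) :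
    {x ∈ innerPoints p q mf mg T | r ≤ ‖x‖}.Finite := by
  have hs := (summable_norm_pow_mul_pow hp hq).tendsto_cofinite_zero
  have hfin : ∀ s : Fin 6, {ij : ℕ × ℕ | r ≤ ‖p ^ ij.1 * q ^ ij.2 * tildeParam q mf mg T s‖}.Finite :=
    fun s => by
    have hpos := norm_pos_iff.2 (tildeParam_ne_zero hq0 hT (mf := mf) (mg := mg) s)
    have := hs.eventually (gt_mem_nhds (div_pos hr hpos))
    rw [eventually_cofinite] at this
    refine this.subset fun ij hij => ?_
    have hij : r ≤ ‖p ^ ij.1 * q ^ ij.2 * tildeParam q mf mg T s‖ := hij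
    rw [norm_mul] at hij
    rw [Set.mem_ofPred_eq, not_lt]
    exact (div_le_iff₀ hpos).2 hij
  refine (Set.finite_iUnion fun s => (hfin s).image
    fun ij => p ^ ij.1 * q ^ ij.2 * tildeParam q mf mg T s).subset ?_
  rintro x ⟨⟨s, i, j, rfl⟩, hx⟩
  exact Set.mem_iUnion.2 ⟨s, (i, j), hx, rfl⟩

include hp hp0 hq hq0 hT in
lemma exists_isContour (h : NonResonant p q mf mg T) : ∃ C, IsContour p q mf mg T C := by
  refine exists_contour (X := innerPoints p q mf mg T) ?_
    (fun r hr => innerPoints_finite hp hq hq0 hT hr) h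
  rintro x ⟨r, i, j, rfl⟩
  exact mul_ne_zero (mul_ne_zero (pow_ne_zero _ hp0) (pow_ne_zero _ hq0))
    (tildeParam_ne_zero hq0 hT r)

include hp in
-- The inner points p^i t̃_0 tend to 0, and the winding number is constant near 0 because no circle
-- of the chain passes through the origin.
lemma IsContour.windingNumber_zero {C : List WeightedCircle} (hC : IsContour p q mf mg T C) :
    windingNumber C 0 = 1 := by
  have h1 : ∀ c ∈ C, ∀ᶠ x in 𝓝 (0 : ℂ), dist x c.center < c.radius ↔
      dist 0 c.center < c.radius := fun c hc => by
    have hcont : Continuous fun x : ℂ => dist x c.center := by fun_prop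
    obtain ⟨h0, h | h⟩ := hC.1 c hc
    · have h2 : dist 0 c.center < c.radius := by rwa [h, dist_self]
      filter_upwards [hcont.continuousAt.eventually (gt_mem_nhds h2)] with x hx
      exact iff_of_true hx h2
    · have h2 : c.radius < dist 0 c.center := by rwa [dist_zero_left]
      filter_upwards [hcont.continuousAt.eventually (lt_mem_nhds h2)] with x hx
      exact iff_of_false hx.not_gt h2.not_gt
  have h2 : ∀ᶠ x in 𝓝 (0 : ℂ), ∀ c ∈ C, dist x c.center < c.radius ↔
      dist 0 c.center < c.radius := (eventually_all_finite (List.finite_toSet C)).2 h1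
  have h3 : ∀ᶠ x in 𝓝 (0 : ℂ), windingNumber C x = windingNumber C 0 := by
    filter_upwards [h2] with x hx
    rw [windingNumber, windingNumber]
    congr 1
    exact List.map_congr_left fun c hc => if_congr (hx c hc) rfl rfl
  have h4 : Tendsto (fun i : ℕ => p ^ i * q ^ 0 * tildeParam q mf mg T 0) atTop (𝓝 0) := by
    have := ((tendsto_pow_atTop_nhds_zero_of_norm_lt_one hp).mul_const (q ^ 0)).mul_const
      (tildeParam q mf mg T 0)
    simpa using this
  obtain ⟨i, hi⟩ := (h4.eventually h3).exists
  rw [← hi]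
  exact (hC.2 _ ⟨0, i, 0, rfl⟩).2.1

include hp hq hp0 hq0 hT in
/-- The pairing as a sum of residues and an integral over a circle. -/
lemma pairing_eq {C : List WeightedCircle} (hC : IsContour p q mf mg T C) {f g F G : ℂ → ℂ}
    (hf : MemA (T 4) p q mf f) (hg : MemA (T 5) p q mg g)
    (hFd : DifferentiableOn ℂ F {0}ᶜ) (hGd : DifferentiableOn ℂ G {0}ᶜ)
    (hF : ∀ z : ℂ, z ≠ 0 → poleFactor (T 4) p q mf z ≠ 0 → F z = poleFactor (T 4) p q mf z * f z)
    (hG : ∀ z : ℂ, z ≠ 0 → poleFactor (T 5) p q mg z ≠ 0 → G z = poleFactor (T 5) p q mg z * g z)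
    {S : Fin 6 → ℂ} (hS : S = tildeParam q mf mg T) {a b : Fin 6} (hab : a ≠ b) {c : ℂ}
    (hc : c ≠ 0) (hκ : halfConst q S a b c ≠ 0) (hTa : theta (S a ^ 2) q ≠ 0)
    {ρ : ℝ} (hρ : 0 < ρ) {K : ℕ} (h1 : ∀ r, r ≠ a → ‖S r‖ < ρ) (h2 : ‖p * S a‖ < ρ)
    (h3 : ‖S a * q ^ K‖ < ρ) (h4 : ∀ k < K, ρ < ‖S a * q ^ k‖)
    (h5 : ∀ r, ‖shiftParam p S a b r‖ * ρ < 1) :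
    pairing p q T C f g = qPoch q q * qPoch p p /
        (∏ rs : Fin 6 × Fin 6 with rs.1 < rs.2, ellGamma (T rs.1 * T rs.2) p q) *
      ((2 * Real.pi * Complex.I)⁻¹ * circleIntegral
          (fun z => halfNum p q S a b c F G z / halfDen p q S a b z / z) 0 ρ +
        ∑ k ∈ Finset.range K, kernelResidue p q S a F G k) := by
  have hS0 : ∀ r, S r ≠ 0 := fun r => hS ▸ tildeParam_ne_zero hq0 hT r
  have hX : ∀ (r : Fin 6) (i j : ℕ), p ^ i * q ^ j * S r ∈ innerPoints p q mf mg T :=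
    fun r i j => ⟨r, i, j, by rw [hS]⟩
  have hXX : ∀ x ∈ innerPoints p q mf mg T, ∀ y ∈ innerPoints p q mf mg T, x * y ≠ 1 :=
    fun x hx y hy hxy => by
      have e1 := (hC.2 x hx).2.2
      rw [inv_eq_of_mul_eq_one_right hxy, (hC.2 y hy).2.1] at e1
      exact one_ne_zero e1
  have hle : ∀ (i j : ℕ) (x : ℂ), ‖p ^ i * q ^ j * x‖ ≤ ‖x‖ := fun i j x => by
    rw [norm_mul, norm_mul, norm_pow, norm_pow]
    exact mul_le_of_le_one_left (norm_nonneg _)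
      (mul_le_one₀ (pow_le_one₀ (norm_nonneg _) hp.le) (by positivity)
        (pow_le_one₀ (norm_nonneg _) hq.le))
  have hinj : Function.Injective fun k : ℕ => S a * q ^ k := fun k l hkl => by
    have e : ‖q‖ ^ k = ‖q‖ ^ l := by
      rw [← norm_pow, ← norm_pow, mul_left_cancel₀ (hS0 a) hkl]
    exact pow_right_injective₀ (norm_pos_iff.2 hq0) hq.ne e
  -- The inner points outside the circle are among the S_a q^j with j < K: a factor p or q^K already
  -- brings S_a into the circle, and the other S_r are inside from the start.
  have hlarge : ∀ (r : Fin 6) (i j : ℕ),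
      ‖p ^ i * q ^ j * S r‖ < ρ ∨ (r = a ∧ i = 0 ∧ j < K) := fun r i j => by
    by_cases hr : r = a
    · subst hr
      rcases Nat.eq_zero_or_pos i with rfl | hi
      · rcases lt_or_ge j K with hj | hj
        · exact Or.inr ⟨rfl, rfl, hj⟩
        · refine Or.inl (lt_of_le_of_lt ?_ h3)
          rw [show p ^ 0 * q ^ j * S r = p ^ 0 * q ^ (j - K) * (S r * q ^ K) by
            rw [show q ^ j = q ^ (j - K) * q ^ K by rw [← pow_add, Nat.sub_add_cancel hj]]; ring]
          exact hle _ _ _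
      · refine Or.inl (lt_of_le_of_lt ?_ h2)
        rw [show p ^ i * q ^ j * S r = p ^ (i - 1) * q ^ j * (p * S r) by
          rw [show p ^ i = p ^ (i - 1) * p by rw [← pow_succ, Nat.sub_add_cancel hi]]; ring]
        exact hle _ _ _
    · exact Or.inl ((hle i j _).trans_lt (h1 r hr))
  have hFs : ∀ z : ℂ, z ≠ 0 → F z⁻¹ = F z := fun z hz =>
    hf.symm_of_eq hp hp0 hq0 (hT 4) hFd hF hz
  have hGs : ∀ z : ℂ, z ≠ 0 → G z⁻¹ = G z := fun z hz =>
    hg.symm_of_eq hp hp0 hq0 (hT 5) hGd hG hz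
  set H := halfNum p q S a b c F G with hH
  set d := halfDen p q S a b with hd
  -- `chainSum_symm` wants the residue as a function of the pole, so the index k is recovered from
  -- S_a q^k by injectivity.
  set R : ℂ → ℂ := fun u =>
    kernelResidue p q S a F G (Function.invFun (fun k : ℕ => S a * q ^ k) u) with hR
  have hRk : ∀ k : ℕ, R (S a * q ^ k) = kernelResidue p q S a F G k := fun k => by
    simp only [hR]
    congr 1
    exact Function.leftInverse_invFun hinj k
  have key := chainSum_symm (C := C) hC.1 (X := innerPoints p q mf mg T) hC.2
    (hC.windingNumber_zero hp) (H := H) (d := d)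
    (differentiableOn_halfNum hp hq hS0 hc hFd hGd) (differentiableOn_halfDen hp hq)
    (fun r₁ r₂ hr => halfDen_hasFactorization hp hq hr r₂)
    (fun r₁ r₂ hr => halfDen_inv_hasFactorization hp hq hr r₂) hρ
    ((Finset.range K).image fun k => S a * q ^ k) ?_ (R := R) ?_ ?_
  · rw [Finset.sum_image fun k _ l _ h => hinj h, Finset.sum_congr rfl fun k _ => hRk k] at key
    have e : chainSum C (fun z => (f z * g z *
        (∏ r : Fin 6, ellGamma (T r * z) p q * ellGamma (T r * z⁻¹) p q) /
        (ellGamma (z ^ 2) p q * ellGamma (z⁻¹ ^ 2) p q)) / z) =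
        chainSum C fun z => H z / d z / z + H z⁻¹ / d z⁻¹ / z := by
      refine chainSum_congr fun c hc' => ?_
      refine circleIntegral_congr_countable
        ((countable_integrand_ne hp hq hp0 hq0 hT hF hG).union (Set.countable_singleton 0))
        (hC.1 c hc').1 fun z hz hzB => ?_
      rw [Set.mem_union, not_or, Set.mem_ofPred_eq, not_not, ← hS] at hzB
      have hz0 : z ≠ 0 := hzB.2
      rw [hzB.1, symmKernel_eq hp hq hp0 hq0 hS0 hab hc hz0 (hFs z hz0) (hGs z hz0) ?_ ?_ hκ hTa,
        add_div]
      · intro r h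
        obtain ⟨i, j, hij⟩ := (dPoch_eq_zero_iff hp hq).1 h
        have := ((hC.2 _ (hX r i j)).1 c hc').2
        rw [inv_eq_of_mul_eq_one_right (b := z) (by linear_combination hij)] at this
        exact this hz
      · intro r h
        obtain ⟨i, j, hij⟩ := (dPoch_eq_zero_iff hp hq).1 h
        have := ((hC.2 _ (hX r i j)).1 c hc').1
        rw [show p ^ i * q ^ j * S r = z by field_simp at hij; linear_combination hij] at this
        exact this hz
    rw [pairing, chainIntegral_eq, e, key]
    have : (Real.pi : ℂ) ≠ 0 := Complex.ofReal_ne_zero.2 Real.pi_ne_zero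
    field_simp
  · intro u hu
    obtain ⟨k, hk, rfl⟩ := Finset.mem_image.1 hu
    refine ⟨?_, h4 k (Finset.mem_range.1 hk)⟩
    have := hX a 0 k
    rwa [pow_zero, one_mul, mul_comm] at this
  · intro u hu
    obtain ⟨k, hk, rfl⟩ := Finset.mem_image.1 hu
    have hk' := Finset.mem_range.1 hk
    rw [hRk]
    refine simplePole_half hp hq hq0 hS0 hab hc hFd hGd k ?_ ?_ ?_ hκ hTa
    · intro r h
      obtain ⟨i, j, hij⟩ := (dPoch_eq_zero_iff hp hq).1 h
      exact hXX _ (hX r i j) _ (hX a 0 k) (by linear_combination hij)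
    · intro r hr h
      obtain ⟨i, j, hij⟩ := (dPoch_eq_zero_iff hp hq).1 h
      have h6 : p ^ i * q ^ j * S r = S a * q ^ k := by
        have := mul_ne_zero (hS0 a) (pow_ne_zero k hq0)
        rw [mul_right_comm, ← div_eq_mul_inv, div_eq_iff this] at hij
        linear_combination hij
      have h7 := (hle i j (S r)).trans_lt (h1 r hr)
      rw [h6] at h7
      exact lt_asymm h7 (h4 k hk')
    · intro h
      obtain ⟨i, j, hij⟩ := (dPoch_eq_zero_iff hp hq).1 h
      have h6 : p ^ i * q ^ j * (p * S a) = S a * q ^ k := by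
        have := pow_ne_zero k hq0
        field_simp at hij
        linear_combination S a * hij
      have h7 := (hle i j (p * S a)).trans_lt h2
      rw [h6] at h7
      exact lt_asymm h7 (h4 k hk')
  · intro x hx hdx
    -- A zero of the denominator is an inner point, or the reciprocal of a point p^i q^j
    -- `shiftParam`; the bound on `shiftParam` places the latter outside the circle.
    rcases halfDen_eq_zero hp hq hx hdx with ⟨r, i, j, h⟩ | ⟨r, i, j, h⟩
    · left
      refine ⟨h ▸ hX r i j, ?_⟩
      rcases hlarge r i j with h' | ⟨rfl, rfl, hj⟩
      · left; rwa [h]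
      · right
        exact Finset.mem_image.2 ⟨j, Finset.mem_range.2 hj, by rw [h]; ring⟩
    · right
      constructor
      · rw [h, shiftParam]
        split_ifs
        · have := hX r (i + 1) j
          rwa [show p ^ i * q ^ j * (p * S r) = p ^ (i + 1) * q ^ j * S r by ring]
        · exact hX r i j
      · have h6 : ‖x⁻¹‖ * ρ < 1 := by
          rw [h]
          exact lt_of_le_of_lt (mul_le_mul_of_nonneg_right (hle i j _) hρ.le) (h5 r)
        rw [norm_inv, inv_mul_lt_iff₀ (norm_pos_iff.2 hx), mul_one] at h6
        exact h6

end pairing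

end EllipticPairing

end

noncomputable section

namespace EllipticPairing

/-! ### Estimates for small `p` -/

/-- A bound for `∑ |p^i q^j|` when `|p| ≤ 1/2`. -/
def sumBound (q : ℂ) : ℝ := 2 / (1 - ‖q‖)

section bounds

variable {p q : ℂ}

lemma norm_lt_one_of_le_half (hp : ‖p‖ ≤ 1 / 2) : ‖p‖ < 1 := by linarith

lemma sumBound_pos (hq : ‖q‖ < 1) : 0 < sumBound q := div_pos two_pos (by linarith)

lemma tsum_norm_pow_le (hp : ‖p‖ ≤ 1 / 2) : ∑' n : ℕ, ‖p ^ n‖ ≤ 2 := by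
  simp only [norm_pow]
  rw [tsum_geometric_of_lt_one (norm_nonneg _) (norm_lt_one_of_le_half hp),
    inv_le_comm₀ (by linarith) two_pos]
  linarith

lemma tsum_norm_pow_mul_pow_le (hp : ‖p‖ ≤ 1 / 2) (hq : ‖q‖ < 1) :
    ∑' ij : ℕ × ℕ, ‖p ^ ij.1 * q ^ ij.2‖ ≤ sumBound q := by
  have hp1 := norm_lt_one_of_le_half hp
  have h3 := summable_norm_pow_mul_pow hp1 hq
  simp only [norm_mul] at h3 ⊢
  rw [← Summable.tsum_mul_tsum (summable_norm_pow hp1) (summable_norm_pow hq) h3, sumBound,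
    div_eq_mul_inv]
  have h4 : ∑' n : ℕ, ‖q ^ n‖ = (1 - ‖q‖)⁻¹ := by
    simp only [norm_pow]
    exact tsum_geometric_of_lt_one (norm_nonneg _) hq
  rw [h4]
  exact mul_le_mul_of_nonneg_right (tsum_norm_pow_le hp) (inv_nonneg.2 (by linarith))

lemma norm_qPoch_sub_one_le (hp : ‖p‖ ≤ 1 / 2) (x : ℂ) :
    ‖qPoch x p - 1‖ ≤ Real.exp (‖x‖ * 2) - 1 := by
  rw [qPoch_eq_eprod]
  refine (norm_eprod_sub_one_le (summable_norm_pow (norm_lt_one_of_le_half hp)) x).trans ?_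
  gcongr
  exact tsum_norm_pow_le hp

lemma norm_qPoch_le (hp : ‖p‖ ≤ 1 / 2) (x : ℂ) : ‖qPoch x p‖ ≤ Real.exp (‖x‖ * 2) := by
  have h := norm_add_le (qPoch x p - 1) 1
  rw [sub_add_cancel, norm_one] at h
  linarith [norm_qPoch_sub_one_le hp x]

lemma norm_dPoch_sub_one_le (hp : ‖p‖ ≤ 1 / 2) (hq : ‖q‖ < 1) (x : ℂ) :
    ‖dPoch p q x - 1‖ ≤ Real.exp (‖x‖ * sumBound q) - 1 := by
  rw [dPoch]
  refine (norm_eprod_sub_one_le (summable_norm_pow_mul_pow (norm_lt_one_of_le_half hp) hq) x).trans ?_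
  gcongr
  exact tsum_norm_pow_mul_pow_le hp hq

lemma norm_dPoch_le (hp : ‖p‖ ≤ 1 / 2) (hq : ‖q‖ < 1) (x : ℂ) :
    ‖dPoch p q x‖ ≤ Real.exp (‖x‖ * sumBound q) := by
  have h := norm_add_le (dPoch p q x - 1) 1
  rw [sub_add_cancel, norm_one] at h
  linarith [norm_dPoch_sub_one_le hp hq x]

/-- The constant 1/3 serves because exp(1/3) ≤ 3/2, a consequence of 1 − x ≤ exp(−x); the product
stays within 1/2 of 1. -/
lemma half_le_norm_dPoch (hp : ‖p‖ ≤ 1 / 2) (hq : ‖q‖ < 1) {x : ℂ}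
    (hx : ‖x‖ * sumBound q ≤ 1 / 3) : 1 / 2 ≤ ‖dPoch p q x‖ := by
  have h1 : Real.exp (‖x‖ * sumBound q) ≤ 3 / 2 := by
    have h2 := Real.add_one_le_exp (-(‖x‖ * sumBound q))
    rw [Real.exp_neg] at h2
    have h3 : 2 / 3 ≤ (Real.exp (‖x‖ * sumBound q))⁻¹ := by linarith
    rw [le_inv_comm₀ (by norm_num) (Real.exp_pos _)] at h3
    linarith
  have h := norm_sub_norm_le 1 (1 - dPoch p q x)
  rw [sub_sub_cancel, norm_one, norm_sub_rev] at h
  linarith [norm_dPoch_sub_one_le hp hq x]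

lemma dPoch_ne_zero_of_small (hp : ‖p‖ ≤ 1 / 2) (hq : ‖q‖ < 1) {x : ℂ}
    (hx : ‖x‖ * sumBound q ≤ 1 / 3) : dPoch p q x ≠ 0 :=
  norm_pos_iff.1 (lt_of_lt_of_le (by norm_num) (half_le_norm_dPoch hp hq hx))

/-- The factor 1 − x is split off because x may be as large as a negative power of p. What remains
depends on px and p/x only. -/
lemma norm_theta_le (hp : ‖p‖ ≤ 1 / 2) {x : ℂ} {M : ℝ} (h1 : ‖p * x‖ ≤ M) (h2 : ‖p / x‖ ≤ M) :
    ‖theta x p‖ ≤ 2 * Real.exp (M * 2) ^ 2 * max 1 ‖x‖ := by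
  rw [theta, qPoch_succ (norm_lt_one_of_le_half hp) x, norm_mul, norm_mul]
  have e1 : ‖(1 : ℂ) - x‖ ≤ 2 * max 1 ‖x‖ := by
    have := norm_sub_le 1 x
    rw [norm_one] at this
    linarith [le_max_left 1 ‖x‖, le_max_right 1 ‖x‖]
  have e2 : ‖qPoch (x * p) p‖ ≤ Real.exp (M * 2) :=
    (norm_qPoch_le hp _).trans (Real.exp_le_exp.2 (by rw [mul_comm x]; linarith))
  have e3 : ‖qPoch (p / x) p‖ ≤ Real.exp (M * 2) :=
    (norm_qPoch_le hp _).trans (Real.exp_le_exp.2 (by linarith))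
  calc _ ≤ (2 * max 1 ‖x‖ * Real.exp (M * 2)) * Real.exp (M * 2) := by gcongr
    _ = _ := by ring

lemma norm_ellGamma_le (hp : ‖p‖ ≤ 1 / 2) (hq : ‖q‖ < 1) {x : ℂ} {M : ℝ}
    (h1 : ‖p * q / x‖ ≤ M) (h2 : ‖x‖ * sumBound q ≤ 1 / 3) :
    ‖ellGamma x p q‖ ≤ Real.exp (M * sumBound q) * 2 := by
  rw [ellGamma_eq (norm_lt_one_of_le_half hp) hq, norm_div, div_eq_mul_inv]
  have e1 := half_le_norm_dPoch hp hq h2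
  have e2 : ‖dPoch p q x‖⁻¹ ≤ 2 := by
    rw [inv_le_comm₀ (by linarith) two_pos]; linarith
  have e3 : ‖dPoch p q (p * q / x)‖ ≤ Real.exp (M * sumBound q) :=
    (norm_dPoch_le hp hq _).trans
      (Real.exp_le_exp.2 (mul_le_mul_of_nonneg_right h1 (sumBound_pos hq).le))
  gcongr

lemma norm_inv_ellGamma_le (hp : ‖p‖ ≤ 1 / 2) (hq : ‖q‖ < 1) {x : ℂ} {M : ℝ}
    (h1 : ‖x‖ ≤ M) (h2 : ‖p * q / x‖ * sumBound q ≤ 1 / 3) :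
    ‖(ellGamma x p q)⁻¹‖ ≤ Real.exp (M * sumBound q) * 2 := by
  rw [ellGamma_eq (norm_lt_one_of_le_half hp) hq, inv_div, norm_div, div_eq_mul_inv]
  have e1 := half_le_norm_dPoch hp hq h2
  have e2 : ‖dPoch p q (p * q / x)‖⁻¹ ≤ 2 := by
    rw [inv_le_comm₀ (by linarith) two_pos]; linarith
  have e3 : ‖dPoch p q x‖ ≤ Real.exp (M * sumBound q) :=
    (norm_dPoch_le hp hq _).trans
      (Real.exp_le_exp.2 (mul_le_mul_of_nonneg_right h1 (sumBound_pos hq).le))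
  gcongr

/-- The shift equation of the elliptic gamma function. -/
lemma ellGamma_mul_right_of_ne (hp : ‖p‖ < 1) (hq : ‖q‖ < 1) (hq0 : q ≠ 0) {x : ℂ} (hx : x ≠ 0)
    (h : dPoch p q x ≠ 0) : ellGamma (x * q) p q = theta x p * ellGamma x p q := by
  rw [ellGamma_eq hp hq, ellGamma_eq hp hq, dPoch_right hp hq x] 
  rw [dPoch_right hp hq x] at h
  have h1 := left_ne_zero_of_mul h
  have h2 := right_ne_zero_of_mul h
  rw [show p * q / (x * q) = p / x by field_simp, dPoch_right hp hq (p / x),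
    show p / x * q = p * q / x by ring, theta]
  field_simp

/-- In contrast to `ellGamma_mul_pow`, zeros of the theta factors are permitted; only poles of Γ are
excluded. -/
lemma ellGamma_mul_pow_of_ne (hp : ‖p‖ < 1) (hq : ‖q‖ < 1) (hq0 : q ≠ 0) {x : ℂ} (hx : x ≠ 0)
    (h : dPoch p q x ≠ 0) (n : ℕ) : ellGamma (x * q ^ n) p q =
      (∏ j ∈ Finset.range n, theta (x * q ^ j) p) * ellGamma x p q := by
  have h1 : ∀ n : ℕ, dPoch p q (x * q ^ n) ≠ 0 := fun n => by
    induction n with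
    | zero => simpa using h
    | succ n ih =>
      rw [dPoch_right hp hq] at ih
      rw [pow_succ, ← mul_assoc]
      exact right_ne_zero_of_mul ih
  induction n with
  | zero => simp
  | succ n ih =>
    rw [pow_succ, ← mul_assoc, ellGamma_mul_right_of_ne hp hq hq0
      (mul_ne_zero hx (pow_ne_zero n hq0)) (h1 n), ih, Finset.prod_range_succ]
    ring

lemma ellGamma_mul_left_of_ne (hp : ‖p‖ < 1) (hq : ‖q‖ < 1) (hp0 : p ≠ 0) {x : ℂ} (hx : x ≠ 0)
    (h : dPoch p q x ≠ 0) : ellGamma (x * p) p q = theta x q * ellGamma x p q := by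
  rw [ellGamma_comm hp hq, ellGamma_comm hp hq x,
    ellGamma_mul_right_of_ne hq hp hp0 hx (by rwa [dPoch_comm])]

end bounds

/-! ### Powers of `p` -/

/-- The neighbourhoods of `p = 0`, in terms of `w = log p`. -/
abbrev cusp : Filter ℂ := comap Complex.re atBot

lemma norm_pPow (w : ℂ) (s : ℝ) : ‖pPow w s‖ = Real.exp (s * w.re) := by
  rw [pPow, Complex.norm_exp, Complex.re_ofReal_mul]

lemma pPow_ne_zero (w : ℂ) (s : ℝ) : pPow w s ≠ 0 := Complex.exp_ne_zero _

lemma pPow_add (w : ℂ) (s t : ℝ) : pPow w (s + t) = pPow w s * pPow w t := by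
  rw [pPow, pPow, pPow, ← Complex.exp_add]; push_cast; ring_nf

lemma pPow_zero (w : ℂ) : pPow w 0 = 1 := by simp [pPow]

lemma pPow_one (w : ℂ) : pPow w 1 = Complex.exp w := by simp [pPow]

lemma pPow_neg (w : ℂ) (s : ℝ) : pPow w (-s) = (pPow w s)⁻¹ := by
  rw [pPow, pPow, ← Complex.exp_neg]; push_cast; ring_nf

lemma pPow_sub (w : ℂ) (s t : ℝ) : pPow w (s - t) = pPow w s / pPow w t := by
  rw [sub_eq_add_neg, pPow_add, pPow_neg, div_eq_mul_inv]

lemma pPow_nat_mul (w : ℂ) (s : ℝ) (n : ℕ) : pPow w (n * s) = pPow w s ^ n := by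
  rw [pPow, pPow, ← Complex.exp_nat_mul]; push_cast; ring_nf

lemma pPow_sum {ι : Type*} (w : ℂ) (s : Finset ι) (γ : ι → ℝ) :
    pPow w (∑ i ∈ s, γ i) = ∏ i ∈ s, pPow w (γ i) := by
  rw [pPow]
  simp only [pPow]
  rw [← Complex.exp_sum]; push_cast; rw [Finset.sum_mul]

lemma tendsto_exp_re_cusp {γ : ℝ} (hγ : 0 < γ) :
    Tendsto (fun w : ℂ => Real.exp (γ * w.re)) cusp (𝓝 0) :=
  Real.tendsto_exp_atBot.comp (tendsto_comap.const_mul_atBot hγ)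

lemma tendsto_pPow {γ : ℝ} (hγ : 0 < γ) : Tendsto (fun w => pPow w γ) cusp (𝓝 0) := by
  rw [tendsto_zero_iff_norm_tendsto_zero]
  simp only [norm_pPow]
  exact tendsto_exp_re_cusp hγ

lemma tendsto_exp_cusp : Tendsto Complex.exp cusp (𝓝 0) := by
  have := tendsto_pPow one_pos
  simpa only [pPow_one] using this

lemma eventually_norm_exp_le {ε : ℝ} (hε : 0 < ε) : ∀ᶠ w in cusp, ‖Complex.exp w‖ ≤ ε := by
  have := (tendsto_zero_iff_norm_tendsto_zero.1 tendsto_exp_cusp).eventually (ge_mem_nhds hε)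
  exact this

/-! ### Limits -/

section limits

variable {ι : Type*} {l : Filter ι} {p x : ι → ℂ} {q x₀ : ℂ}

lemma tendsto_dPoch_one (hq : ‖q‖ < 1) (hp : Tendsto p l (𝓝 0)) (hx : Tendsto x l (𝓝 0)) :
    Tendsto (fun i => dPoch (p i) q (x i)) l (𝓝 1) := by
  rw [tendsto_iff_norm_sub_tendsto_zero]
  have h1 : Tendsto (fun i => Real.exp (‖x i‖ * sumBound q) - 1) l (𝓝 0) := by
    have := (Real.continuous_exp.tendsto 0).comp
      ((tendsto_zero_iff_norm_tendsto_zero.1 hx).mul_const (sumBound q) |>.trans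
        (by rw [zero_mul]))
    simpa using this.sub_const 1
  refine squeeze_zero' (Eventually.of_forall fun _ => norm_nonneg _) ?_ h1
  filter_upwards [(tendsto_zero_iff_norm_tendsto_zero.1 hp).eventually
    (ge_mem_nhds (show (0 : ℝ) < 1 / 2 by norm_num))] with i hi
  exact norm_dPoch_sub_one_le hi hq _

/-- Only the factors with i = 0 survive; the others form a product in xp, which tends to 1. -/
lemma tendsto_dPoch (hq : ‖q‖ < 1) (hp : Tendsto p l (𝓝 0)) (hx : Tendsto x l (𝓝 x₀)) :
    Tendsto (fun i => dPoch (p i) q (x i)) l (𝓝 (qPoch x₀ q)) := by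
  have h1 := ((differentiable_qPoch hq).continuous.tendsto x₀).comp hx
  have h2 := tendsto_dPoch_one hq hp (by simpa using hx.mul hp)
  have h3 := h1.mul h2
  rw [mul_one] at h3
  refine h3.congr' ?_
  filter_upwards [(tendsto_zero_iff_norm_tendsto_zero.1 hp).eventually
    (ge_mem_nhds (show (0 : ℝ) < 1 / 2 by norm_num))] with i hi
  exact (dPoch_left (norm_lt_one_of_le_half hi) hq _).symm

lemma tendsto_qPoch (hp : Tendsto p l (𝓝 0)) (hx : Tendsto x l (𝓝 x₀)) :
    Tendsto (fun i => qPoch (x i) (p i)) l (𝓝 (1 - x₀)) := by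
  have h2 : Tendsto (fun i => qPoch (x i * p i) (p i)) l (𝓝 1) := by
    have hx : Tendsto (fun i => x i * p i) l (𝓝 0) := by simpa using hx.mul hp
    rw [tendsto_iff_norm_sub_tendsto_zero]
    have h1 : Tendsto (fun i => Real.exp (‖x i * p i‖ * 2) - 1) l (𝓝 0) := by
      have := (Real.continuous_exp.tendsto 0).comp
        ((tendsto_zero_iff_norm_tendsto_zero.1 hx).mul_const 2 |>.trans (by rw [zero_mul]))
      simpa using this.sub_const 1
    refine squeeze_zero' (Eventually.of_forall fun _ => norm_nonneg _) ?_ h1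
    filter_upwards [(tendsto_zero_iff_norm_tendsto_zero.1 hp).eventually
      (ge_mem_nhds (show (0 : ℝ) < 1 / 2 by norm_num))] with i hi
    exact norm_qPoch_sub_one_le hi _
  have h3 := (hx.const_sub 1).mul h2
  rw [mul_one] at h3
  refine h3.congr' ?_
  filter_upwards [(tendsto_zero_iff_norm_tendsto_zero.1 hp).eventually
    (ge_mem_nhds (show (0 : ℝ) < 1 / 2 by norm_num))] with i hi
  exact (qPoch_succ (norm_lt_one_of_le_half hi) _).symm

end limits

variable {q : ℂ}

/-- The limit of `y p^γ`. -/
def powLim (γ : ℝ) (y : ℂ) : ℂ := if γ = 0 then y else 0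

lemma tendsto_mul_pPow {γ : ℝ} (hγ : 0 ≤ γ) (y : ℂ) :
    Tendsto (fun w => y * pPow w γ) cusp (𝓝 (powLim γ y)) := by
  rw [powLim]
  split_ifs with h
  · simpa [h, pPow_zero] using tendsto_const_nhds
  · simpa using (tendsto_pPow (lt_of_le_of_ne hγ (Ne.symm h))).const_mul y

lemma exp_div_mul_pPow (w : ℂ) (γ : ℝ) (x y : ℂ) :
    Complex.exp w * x / (y * pPow w γ) = x / y * pPow w (1 - γ) := by
  rw [pPow_sub, pPow_one]; ring

/-- The limit of `Γ(y p^γ)` for `0 ≤ γ ≤ 1`. -/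
lemma tendsto_ellGamma (hq : ‖q‖ < 1) {γ : ℝ} (h0 : 0 ≤ γ) (h1 : γ ≤ 1) {y : ℂ}
    (h : qPoch (powLim γ y) q ≠ 0) :
    Tendsto (fun w => ellGamma (y * pPow w γ) (Complex.exp w) q) cusp
      (𝓝 (qPoch (powLim (1 - γ) (q / y)) q / qPoch (powLim γ y) q)) := by
  have e1 := tendsto_dPoch hq tendsto_exp_cusp (tendsto_mul_pPow h0 y)
  have e2 := tendsto_dPoch hq tendsto_exp_cusp (tendsto_mul_pPow (sub_nonneg.2 h1) (q / y))
  refine (e2.div e1 h).congr' ?_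
  filter_upwards [eventually_norm_exp_le (show (0 : ℝ) < 1 / 2 by norm_num)] with w hw
  rw [Pi.div_apply, ellGamma_eq (norm_lt_one_of_le_half hw) hq, exp_div_mul_pPow]

/-- The limit of `θ(y p^γ; p)` for `0 ≤ γ ≤ 1`. -/
lemma tendsto_theta {γ : ℝ} (h0 : 0 ≤ γ) (h1 : γ ≤ 1) (y : ℂ) :
    Tendsto (fun w => theta (y * pPow w γ) (Complex.exp w)) cusp
      (𝓝 ((1 - powLim γ y) * (1 - powLim (1 - γ) (1 / y)))) := by
  have e1 := tendsto_qPoch tendsto_exp_cusp (tendsto_mul_pPow h0 y)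
  have e2 := tendsto_qPoch tendsto_exp_cusp (tendsto_mul_pPow (sub_nonneg.2 h1) (1 / y))
  refine (e1.mul e2).congr fun w => ?_
  rw [theta, ← exp_div_mul_pPow, mul_one]

/-- The limit of `p^{-γ} θ(y p^γ; p)` for `-1 < γ < 0`. -/
lemma tendsto_theta_neg {γ : ℝ} (h0 : γ < 0) (h1 : -1 < γ) {y : ℂ} (hy : y ≠ 0) :
    Tendsto (fun w => pPow w (-γ) * theta (y * pPow w γ) (Complex.exp w)) cusp (𝓝 (-y)) := by
  have e := (tendsto_theta (γ := -γ) (by linarith) (by linarith) y⁻¹).const_mul (-y)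
  rw [powLim, powLim, if_neg (by linarith), if_neg (by linarith), sub_zero, mul_one, mul_one] at e
  refine e.congr' ?_
  filter_upwards [eventually_norm_exp_le (show (0 : ℝ) < 1 / 2 by norm_num)] with w hw
  have hne := mul_ne_zero hy (pPow_ne_zero w γ)
  rw [pPow_neg, ← mul_inv, theta_inv (norm_lt_one_of_le_half hw) (Complex.exp_ne_zero w) hne]
  have := pPow_ne_zero w γ
  field_simp

end EllipticPairing

end

noncomputable section

namespace EllipticPairing

/-! ### The exponents -/

/-- The index b minimises α away from a. If α_b + α_a were non-negative, the balancing sum would be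
empty and α_a would be 0. Then σ is the midpoint between max(0, −α_b) and the smallest of −α_a and
the remaining α_r; the interval is non-empty because α_a < α_b and α_r + α_b > 0. -/
lemma exists_smallest_exponent {α : Fin 6 → ℝ} {a : Fin 6} (hαa : α a < 0)
    (hαr : ∀ r, r ≠ a → α a < α r)
    (hαrs : ∀ r s, r ≠ a → s ≠ a → r ≠ s → 0 < α r + α s)
    (hαbal : 2 * α a = ∑ r : Fin 6 with r ≠ a ∧ α r + α a < 0, (α r + α a)) :
    ∃ b, b ≠ a ∧ α b + α a < 0 ∧ ∃ σ, 0 < σ ∧ -α b < σ ∧ σ < -α a ∧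
      ∀ r, r ≠ a → r ≠ b → σ < α r := by
  obtain ⟨b, hb, hmin⟩ := Finset.exists_min_image (Finset.univ.erase a) α
    (by rw [← Finset.card_pos, Finset.card_erase_of_mem (Finset.mem_univ a)]; simp)
  have hba := Finset.ne_of_mem_erase hb
  have hmin' : ∀ r, r ≠ a → α b ≤ α r := fun r hr =>
    hmin r (Finset.mem_erase.2 ⟨hr, Finset.mem_univ r⟩)
  have hpos : ∀ r, r ≠ a → r ≠ b → 0 < α r := fun r hr hrb => by
    linarith [hmin' r hr, hαrs r b hr hba hrb]
  refine ⟨b, hba, ?_, ?_⟩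
  · by_contra hneg
    rw [not_lt] at hneg
    rw [Finset.sum_eq_zero] at hαbal
    · linarith
    · intro r hr
      obtain ⟨h1, h2⟩ := (Finset.mem_filter.1 hr).2
      linarith [hmin' r h1]
  · set m := max 0 (-α b) with hm
    have h1 : m < -α a := max_lt (by linarith) (by linarith [hαr b hba])
    have h2 : ∀ r, r ≠ a → r ≠ b → m < α r := fun r hr hrb =>
      max_lt (hpos r hr hrb) (by linarith [hαrs r b hr hba hrb])
    have h3 : ∀ r ∈ (Finset.univ : Finset (Fin 6)),
        m < if r = a ∨ r = b then -α a else α r := fun r _ => by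
      split_ifs with h
      · exact h1
      · exact h2 r (by tauto) (by tauto)
    -- The entries at a and b are replaced by −α_a, the other upper bound required of σ.
    set u := Finset.univ.inf' ⟨a, Finset.mem_univ a⟩
      (fun r => if r = a ∨ r = b then -α a else α r) with hu
    have hmu : m < u := (Finset.lt_inf'_iff _).2 h3
    have hle : ∀ r, u ≤ if r = a ∨ r = b then -α a else α r := fun r =>
      Finset.inf'_le _ (Finset.mem_univ r)
    refine ⟨(m + u) / 2, ?_, ?_, ?_, fun r hr hrb => ?_⟩
    · linarith [le_max_left 0 (-α b)]
    · linarith [le_max_right 0 (-α b)]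
    · have := hle a
      simp only [true_or, if_true] at this
      linarith
    · have := hle r
      rw [if_neg (by tauto)] at this
      linarith

/-- The bound for the quotient of the residues at `t_a p^{α_a} q^{j+1}` and `t_a p^{α_a} q^j`. -/
def stepBound (q : ℂ) (α : Fin 6 → ℝ) (a : Fin 6) (w : ℂ) (j : ℕ) : ℝ :=
  ‖pPow w (-(2 * α a))‖ / ‖q‖ ^ (2 * j) *
    ∏ r ∈ Finset.univ.erase a, max 1 (‖pPow w (α r + α a)‖ * ‖q‖ ^ j)

lemma stepBound_nonneg (q : ℂ) (α : Fin 6 → ℝ) (a : Fin 6) (w : ℂ) (j : ℕ) :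
    0 ≤ stepBound q α a w j :=
  mul_nonneg (by positivity) (Finset.prod_nonneg fun _ _ => zero_le_one.trans (le_max_left _ _))

lemma norm_pow_eq_exp {q : ℂ} (hq0 : q ≠ 0) (j : ℕ) : ‖q‖ ^ j = Real.exp (-(j * -Real.log ‖q‖)) := by
  rw [mul_neg, neg_neg, Real.exp_nat_mul, Real.exp_log (norm_pos_iff.2 hq0)]

/-- With L = log(1/|p|) and x = j log(1/|q|), the logarithm of the step bound is 2α_a L + 2x + ∑
max(0, −(α_r+α_a)L − x), a convex function of x. At x = 0 it vanishes by the balancing condition. At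
x = κL with κ = −α_a − σ only r = b can contribute to the sum, and the value is −dL with d = 2σ −
max(0, σ − α_b) > 0. In between, the function lies below the chord −(d/κ)x. -/
lemma stepBound_le {q : ℂ} (hq0 : q ≠ 0) (hq : ‖q‖ < 1) {α : Fin 6 → ℝ} {a b : Fin 6}
    (hba : b ≠ a)
    (hαbal : 2 * α a = ∑ r : Fin 6 with r ≠ a ∧ α r + α a < 0, (α r + α a))
    {σ : ℝ} (h0 : 0 < σ) (hb : -α b < σ) (ha : σ < -α a) (hr : ∀ r, r ≠ a → r ≠ b → σ < α r) :
    ∃ c : ℝ, 0 < c ∧ c < 1 ∧ ∀ w : ℂ, w.re < 0 → ∀ j : ℕ, ‖pPow w (-α a - σ)‖ ≤ ‖q‖ ^ j →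
      stepBound q α a w j ≤ c ^ j := by
  set l := -Real.log ‖q‖ with hl
  have hl0 : 0 < l := neg_pos.2 (Real.log_neg (norm_pos_iff.2 hq0) hq)
  set κ := -α a - σ with hκ
  have hκ0 : 0 < κ := by linarith
  set d := 2 * σ - max 0 (σ - α b) with hd
  have hd0 : 0 < d := by
    have : max 0 (σ - α b) < 2 * σ := max_lt (by linarith) (by linarith)
    linarith
  -- This constant is |q|^{d/κ}.
  refine ⟨Real.exp (-(d / κ * l)), Real.exp_pos _, ?_, fun w hw j hj => ?_⟩
  · rw [Real.exp_lt_one_iff]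
    have := mul_pos (div_pos hd0 hκ0) hl0
    linarith
  rw [norm_pow_eq_exp hq0, norm_pPow, Real.exp_le_exp, ← hl] at hj
  set L := -w.re with hL
  have hwL : w.re = -L := by rw [hL, neg_neg]
  rw [hwL] at hj
  have hL0 : 0 < L := by linarith
  set x := (j : ℝ) * l with hx
  have hx0 : 0 ≤ x := by positivity
  -- the position of `x` in the interval `[0, κ L]`
  set s := x / (κ * L) with hs
  have hκL : 0 < κ * L := mul_pos hκ0 hL0
  have hs0 : 0 ≤ s := by positivity
  have hs1 : s ≤ 1 := (div_le_one hκL).2 (by linarith)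
  have hxs : x = s * (κ * L) := by rw [hs]; field_simp
  have hterm : ∀ r : Fin 6, max 1 (‖pPow w (α r + α a)‖ * ‖q‖ ^ j) =
      Real.exp (max 0 (-((α r + α a) * L) - x)) := fun r => by
    rw [norm_pow_eq_exp hq0, norm_pPow, ← Real.exp_add, ← hl, hwL,
      Real.exp_monotone.map_max, Real.exp_zero]
    congr 2
    ring
  -- Convexity of a single summand: x = sκL lies between the end points 0 and κL with weights 1 − s
  -- and s.
  have hconv : ∀ r : Fin 6, max 0 (-((α r + α a) * L) - x) ≤
      (1 - s) * (L * max 0 (-(α r + α a))) + s * (L * max 0 (σ - α r)) := fun r => by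
    have h1 := le_max_left 0 (-(α r + α a))
    have h2 := le_max_right 0 (-(α r + α a))
    have h3 := le_max_left 0 (σ - α r)
    have h4 := le_max_right 0 (σ - α r)
    have h5 := mul_nonneg (sub_nonneg.2 hs1) hL0.le
    have h6 := mul_nonneg hs0 hL0.le
    refine max_le ?_ ?_
    · have := mul_nonneg h5 h1
      have := mul_nonneg h6 h3
      linarith
    · have := mul_le_mul_of_nonneg_left h2 h5
      have := mul_le_mul_of_nonneg_left h4 h6
      rw [hxs, hκ]
      linarith
  have hsum1 : ∑ r ∈ Finset.univ.erase a, max 0 (-(α r + α a)) = -(2 * α a) := by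
    rw [hαbal, ← Finset.sum_neg_distrib, Finset.sum_filter, ← Finset.sum_erase_add _ _
      (Finset.mem_univ a)]
    rw [if_neg (by tauto), add_zero]
    refine Finset.sum_congr rfl fun r hra => ?_
    split_ifs with h
    · exact max_eq_right (by linarith [h.2])
    · refine max_eq_left ?_
      have : ¬ (α r + α a < 0) := fun h' => h ⟨Finset.ne_of_mem_erase hra, h'⟩
      linarith
  have hsum2 : ∑ r ∈ Finset.univ.erase a, max 0 (σ - α r) = max 0 (σ - α b) := by
    refine Finset.sum_eq_single_of_mem b (Finset.mem_erase.2 ⟨hba, Finset.mem_univ b⟩) ?_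
    intro r hra hrb
    exact max_eq_left (by linarith [hr r (Finset.ne_of_mem_erase hra) hrb])
  have htotal : ∑ r ∈ Finset.univ.erase a, max 0 (-((α r + α a) * L) - x) ≤
      (1 - s) * (L * -(2 * α a)) + s * (L * max 0 (σ - α b)) := by
    refine (Finset.sum_le_sum fun r _ => hconv r).trans_eq ?_
    rw [Finset.sum_add_distrib, ← Finset.mul_sum, ← Finset.mul_sum, ← Finset.mul_sum,
      ← Finset.mul_sum, hsum1, hsum2]
  rw [stepBound, Finset.prod_congr rfl fun r _ => hterm r, ← Real.exp_sum, norm_pow_eq_exp hq0,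
    norm_pPow, ← Real.exp_sub, ← Real.exp_add, ← Real.exp_nat_mul, Real.exp_le_exp, hwL, ← hl]
  push_cast
  have e : (j : ℝ) * -(d / κ * l) = -(s * L * d) := by
    rw [show (j : ℝ) * -(d / κ * l) = -(d / κ * x) by rw [hx]; ring, hxs]
    field_simp
  rw [e, hd]
  have e2 : (2 * (j : ℝ) * l) = 2 * (s * (κ * L)) := by rw [← hxs, hx]; ring
  have e3 : κ = -α a - σ := hκ
  rw [show -(2 * α a) * -L - -(2 * (j : ℝ) * l) = 2 * α a * L + 2 * (s * (κ * L)) by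
    rw [← e2]; ring]
  rw [e3]
  linarith

lemma prod_stepBound_le {q : ℂ} {α : Fin 6 → ℝ} {a : Fin 6} {w : ℂ} {c : ℝ} {k : ℕ}
    (h : ∀ j < k, stepBound q α a w j ≤ c ^ j) :
    ∏ j ∈ Finset.range k, stepBound q α a w j ≤ c ^ k.choose 2 := by
  refine (Finset.prod_le_prod (fun j _ => stepBound_nonneg q α a w j)
    fun j hj => h j (Finset.mem_range.1 hj)).trans_eq ?_
  rw [Finset.prod_pow_eq_pow_sum, Finset.sum_range_id, Nat.choose_two_right]

/-! ### The number of residues -/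

/-- The number of residues. -/
def cutoff (q : ℂ) (κ : ℝ) (w : ℂ) : ℕ := ⌊κ * -w.re / -Real.log ‖q‖⌋₊

section cutoff

variable {q : ℂ} (hq0 : q ≠ 0) (hq : ‖q‖ < 1) {κ : ℝ}

include hq0 hq in
-- The cutoff is the largest K with |p|^κ ≤ |q|^K. With `norm_pow_cutoff_le`, the converse up to one
-- factor |q|, the numbers |q|^K and |p|^κ are comparable.
lemma pPow_le_of_le_cutoff (hκ : 0 ≤ κ) {w : ℂ} (hw : w.re < 0) {k : ℕ} (hk : k ≤ cutoff q κ w) :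
    ‖pPow w κ‖ ≤ ‖q‖ ^ k := by
  have hl0 : 0 < -Real.log ‖q‖ := neg_pos.2 (Real.log_neg (norm_pos_iff.2 hq0) hq)
  have h1 : (k : ℝ) ≤ κ * -w.re / -Real.log ‖q‖ :=
    (Nat.cast_le.2 hk).trans (Nat.floor_le (div_nonneg (by nlinarith) hl0.le))
  rw [norm_pow_eq_exp hq0, norm_pPow, Real.exp_le_exp]
  rw [le_div_iff₀ hl0] at h1
  linarith

include hq0 hq in
lemma norm_pow_cutoff_le {w : ℂ} : ‖q‖ ^ (cutoff q κ w + 1) ≤ ‖pPow w κ‖ := by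
  have hl0 : 0 < -Real.log ‖q‖ := neg_pos.2 (Real.log_neg (norm_pos_iff.2 hq0) hq)
  have h1 := (Nat.lt_floor_add_one (κ * -w.re / -Real.log ‖q‖)).le
  rw [norm_pow_eq_exp hq0, norm_pPow, Real.exp_le_exp]
  rw [div_le_iff₀ hl0] at h1
  rw [cutoff]
  push_cast
  linarith

include hq0 hq in
lemma tendsto_cutoff (hκ : 0 < κ) : Tendsto (cutoff q κ) cusp atTop := by
  have hl0 : 0 < -Real.log ‖q‖ := neg_pos.2 (Real.log_neg (norm_pos_iff.2 hq0) hq)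
  refine tendsto_nat_floor_atTop.comp (Tendsto.atTop_div_const hl0 ?_)
  exact (tendsto_neg_atBot_atTop.comp tendsto_comap).const_mul_atTop hκ

end cutoff

/-- Faster than exponential decay. -/
lemma summable_pow_mul_pow_choose (C : ℝ) {c : ℝ} (h0 : 0 < c) (h1 : c < 1) :
    Summable fun k : ℕ => C ^ (k + 1) * c ^ k.choose 2 := by
  refine summable_of_ratio_norm_eventually_le (r := 1 / 2) (by norm_num) ?_
  have h2 : Tendsto (fun k : ℕ => |C| * c ^ k) atTop (𝓝 0) := by
    simpa using (tendsto_pow_atTop_nhds_zero_of_lt_one h0.le h1).const_mul |C|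
  filter_upwards [h2.eventually (ge_mem_nhds (show (0 : ℝ) < 1 / 2 by norm_num))] with k hk
  have e : C ^ (k + 1 + 1) * c ^ (k + 1).choose 2 = C * c ^ k * (C ^ (k + 1) * c ^ k.choose 2) := by
    rw [Nat.choose_succ_succ' k 1, Nat.choose_one_right, pow_add c, pow_succ C (k + 1)]; ring
  rw [e, norm_mul]
  refine mul_le_mul_of_nonneg_right ?_ (norm_nonneg _)
  rw [norm_mul, Real.norm_eq_abs, Real.norm_eq_abs, abs_of_pos (pow_pos h0 k)]
  exact hk

end EllipticPairing

end

noncomputable section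

namespace EllipticPairing

/-! ### Uniform bounds with geometric constants -/

/-- `|X(w,k,ω)| ≤ C^{k+1} Y(w,k)` for some constant `C`, all small `p = e^w` and `(k,ω) ∈ I(w)`. -/
def GeomBound (I : ℂ → Set (ℕ × ℂ)) (X : ℂ → ℕ → ℂ → ℂ) (Y : ℂ → ℕ → ℝ) : Prop :=
  ∃ C : ℝ, 1 ≤ C ∧ ∀ᶠ w in cusp, ∀ i ∈ I w, ‖X w i.1 i.2‖ ≤ C ^ (i.1 + 1) * Y w i.1

namespace GeomBound

variable {I : ℂ → Set (ℕ × ℂ)} {X X' : ℂ → ℕ → ℂ → ℂ} {Y Y' : ℂ → ℕ → ℝ}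

/-- Constants of the form C^{k+1} are stable under products and harmless beside c^{k(k-1)/2}. Hence
every factor of a residue can be estimated on its own, without care for the constants. -/
lemma mul (h : GeomBound I X Y) (h' : GeomBound I X' Y') :
    GeomBound I (fun w k ω => X w k ω * X' w k ω) fun w k => Y w k * Y' w k := by
  obtain ⟨C, hC, h⟩ := h
  obtain ⟨C', hC', h'⟩ := h'
  refine ⟨C * C', one_le_mul_of_one_le_of_one_le hC hC', ?_⟩
  filter_upwards [h, h'] with w hw hw' i hi
  rw [norm_mul]
  refine (mul_le_mul (hw i hi) (hw' i hi) (norm_nonneg _) ((norm_nonneg _).trans (hw i hi))).trans_eq ?_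
  rw [mul_pow]
  ring

lemma prod {κ : Type*} (s : Finset κ) {X : κ → ℂ → ℕ → ℂ → ℂ} {Y : κ → ℂ → ℕ → ℝ}
    (h : ∀ r ∈ s, GeomBound I (X r) (Y r)) :
    GeomBound I (fun w k ω => ∏ r ∈ s, X r w k ω) fun w k => ∏ r ∈ s, Y r w k := by
  classical
  induction s using Finset.induction_on with
  | empty =>
    refine ⟨1, le_rfl, Eventually.of_forall fun w i _ => ?_⟩
    simp
  | insert r s hr ih =>
    simp only [Finset.prod_insert hr]
    exact (h r (Finset.mem_insert_self r s)).mul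
      (ih fun r' hr' => h r' (Finset.mem_insert_of_mem hr'))

lemma of_const {C : ℝ} (h : ∀ᶠ w in cusp, ∀ i ∈ I w, ‖X w i.1 i.2‖ ≤ C) :
    GeomBound I X fun _ _ => 1 := by
  refine ⟨max 1 C, le_max_left _ _, ?_⟩
  filter_upwards [h] with w hw i hi
  rw [mul_one]
  exact (hw i hi).trans ((le_max_right 1 C).trans
    (le_self_pow₀ (le_max_left _ _) (Nat.succ_ne_zero _)))

lemma of_tendsto {x : ℂ → ℂ} {x₀ : ℂ} (h : Tendsto x cusp (𝓝 x₀)) :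
    GeomBound I (fun w _ _ => x w) fun _ _ => 1 := by
  refine of_const (C := ‖x₀‖ + 1) ?_
  filter_upwards [h.norm.eventually (ge_mem_nhds (lt_add_one _))] with w hw i _
  exact hw

/-- A constant for each of k factors becomes C^k, which is why the bounds have to allow geometric
constants. -/
lemma prod_range {C : ℝ} {x : ℂ → ℕ → ℂ → ℂ} {y : ℂ → ℕ → ℝ}
    (h : ∀ᶠ w in cusp, ∀ i ∈ I w, ∀ j < i.1, ‖x w j i.2‖ ≤ C * y w j) :
    GeomBound I (fun w k ω => ∏ j ∈ Finset.range k, x w j ω)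
      fun w k => ∏ j ∈ Finset.range k, |y w j| := by
  refine ⟨max 1 |C|, le_max_left _ _, ?_⟩
  filter_upwards [h] with w hw i hi
  rw [norm_prod, pow_succ, mul_assoc]
  have h1 : ∏ j ∈ Finset.range i.1, ‖x w j i.2‖ ≤
      ∏ j ∈ Finset.range i.1, max 1 |C| * |y w j| := by
    refine Finset.prod_le_prod (fun _ _ => norm_nonneg _) fun j hj => ?_
    refine (hw i hi j (Finset.mem_range.1 hj)).trans ((le_abs_self _).trans ?_)
    rw [abs_mul]
    exact mul_le_mul_of_nonneg_right (le_max_right _ _) (abs_nonneg _)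
  refine h1.trans ?_
  rw [Finset.prod_mul_distrib, Finset.prod_const, Finset.card_range]
  have h2 : 0 ≤ ∏ j ∈ Finset.range i.1, |y w j| := Finset.prod_nonneg fun _ _ => abs_nonneg _
  have h3 : 0 ≤ max 1 |C| ^ i.1 := pow_nonneg (zero_le_one.trans (le_max_left _ _)) _
  refine mul_le_mul_of_nonneg_left ?_ h3
  exact le_mul_of_one_le_left h2 (le_max_left _ _)

lemma congr_right (h : GeomBound I X Y) (e : ∀ w k, Y w k = Y' w k) : GeomBound I X Y' := by
  obtain rfl : Y = Y' := funext fun w => funext fun k => e w k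
  exact h

lemma congr_left (h : GeomBound I X Y)
    (e : ∀ᶠ w in cusp, ∀ i ∈ I w, ‖X' w i.1 i.2‖ ≤ ‖X w i.1 i.2‖) : GeomBound I X' Y := by
  obtain ⟨C, hC, h⟩ := h
  refine ⟨C, hC, ?_⟩
  filter_upwards [h, e] with w hw he i hi
  exact (he i hi).trans (hw i hi)

lemma mono {J : ℂ → Set (ℕ × ℂ)} (h : GeomBound I X Y) (hJ : ∀ w, J w ⊆ I w) :
    GeomBound J X Y := by
  obtain ⟨C, hC, h⟩ := h
  exact ⟨C, hC, h.mono fun w hw i hi => hw i (hJ w hi)⟩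

end GeomBound

lemma eventually_re_neg : ∀ᶠ w in cusp, w.re < 0 :=
  tendsto_comap.eventually (eventually_lt_atBot 0)

/-- The indices `k` up to the cutoff, together with a shift `ω`. -/
def fullIndex (q : ℂ) (κ : ℝ) (w : ℂ) : Set (ℕ × ℂ) :=
  {i | i.1 ≤ cutoff q κ w ∧ 1 ≤ ‖i.2‖ ∧ ‖i.2‖ ≤ ‖q‖⁻¹}

section factors

variable {q : ℂ} (hq0 : q ≠ 0) (hq : ‖q‖ < 1) {κ : ℝ} (hκ : 0 ≤ κ)

lemma norm_pPow_le_one {w : ℂ} (hw : w.re < 0) {γ : ℝ} (hγ : 0 ≤ γ) : ‖pPow w γ‖ ≤ 1 := by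
  rw [norm_pPow, Real.exp_le_one_iff]
  nlinarith

lemma norm_pPow_add (w : ℂ) (s t : ℝ) : ‖pPow w (s + t)‖ = ‖pPow w s‖ * ‖pPow w t‖ := by
  rw [pPow_add, norm_mul]

lemma norm_pPow_pos (w : ℂ) (s : ℝ) : 0 < ‖pPow w s‖ := norm_pos_iff.2 (pPow_ne_zero w s)

include hq0 hq hκ in
/-- Bounds for `|y p^γ q^k ω|`. -/
lemma norm_arg_inv_le {w : ℂ} (hw : w.re < 0) {y ω : ℂ} {γ : ℝ} {j : ℕ}
    (hj : j ≤ cutoff q κ w) (hω : 1 ≤ ‖ω‖) :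
    ‖y * pPow w γ / (q ^ j * ω)‖ ≤ ‖y‖ * ‖pPow w (γ - κ)‖ := by
  have h1 := pPow_le_of_le_cutoff hq0 hq hκ hw hj
  have h2 := norm_pPow_pos w κ
  rw [norm_div, norm_mul, norm_mul, norm_pow, pPow_sub, norm_div, ← mul_div_assoc]
  refine div_le_div_of_nonneg_left (by positivity) h2 ?_
  calc ‖pPow w κ‖ ≤ ‖q‖ ^ j := h1
    _ ≤ ‖q‖ ^ j * ‖ω‖ := le_mul_of_one_le_right (by positivity) hω

include hq0 hq in
lemma norm_arg_cutoff_le {w : ℂ} {y ω : ℂ} {γ : ℝ} (hω : ‖ω‖ ≤ ‖q‖⁻¹) :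
    ‖y * pPow w γ * q ^ cutoff q κ w * ω‖ ≤ ‖y‖ * (‖q‖⁻¹ ^ 2) * ‖pPow w (γ + κ)‖ := by
  have h1 := norm_pow_cutoff_le hq0 hq (κ := κ) (w := w)
  have hq' := norm_pos_iff.2 hq0
  have h2 : ‖q‖ ^ cutoff q κ w ≤ ‖q‖⁻¹ * ‖pPow w κ‖ := by
    rw [pow_succ] at h1
    rw [inv_mul_eq_div, le_div_iff₀ hq']
    exact h1
  rw [norm_mul, norm_mul, norm_mul, norm_pow, norm_pPow_add]
  calc ‖y‖ * ‖pPow w γ‖ * ‖q‖ ^ cutoff q κ w * ‖ω‖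
      ≤ ‖y‖ * ‖pPow w γ‖ * (‖q‖⁻¹ * ‖pPow w κ‖) * ‖q‖⁻¹ := by gcongr
    _ = _ := by ring

lemma norm_arg_le {w : ℂ} {y ω : ℂ} {γ : ℝ} {j : ℕ} (hω : ‖ω‖ ≤ ‖q‖⁻¹) :
    ‖y * pPow w γ * q ^ j * ω‖ ≤ ‖y‖ * ‖q‖⁻¹ * (‖pPow w γ‖ * ‖q‖ ^ j) := by
  rw [norm_mul, norm_mul, norm_mul, norm_pow]
  calc _ ≤ ‖y‖ * ‖pPow w γ‖ * ‖q‖ ^ j * ‖q‖⁻¹ := by gcongr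
    _ = _ := by ring

include hq0 hq hκ in
/-- Products of theta functions `θ(y p^γ q^j ω; p)`. -/
lemma geomBound_theta {y : ℂ} (hy : y ≠ 0) {γ : ℝ} (h1 : -1 ≤ γ) (h2 : γ + κ ≤ 1) :
    GeomBound (fullIndex q κ)
      (fun w k ω => ∏ j ∈ Finset.range k, theta (y * pPow w γ * q ^ j * ω) (Complex.exp w))
      fun w k => ∏ j ∈ Finset.range k, max 1 (‖pPow w γ‖ * ‖q‖ ^ j) := by
  have hq' := norm_pos_iff.2 hq0
  set M := ‖y‖ * ‖q‖⁻¹ + ‖1 / y‖ with hM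
  refine GeomBound.congr_right (GeomBound.prod_range
    (C := 2 * Real.exp (M * 2) ^ 2 * max 1 (‖y‖ * ‖q‖⁻¹))
    (y := fun w j => max 1 (‖pPow w γ‖ * ‖q‖ ^ j)) ?_) fun w k =>
      Finset.prod_congr rfl fun j _ => abs_of_nonneg (zero_le_one.trans (le_max_left _ _))
  filter_upwards [eventually_norm_exp_le (show (0 : ℝ) < 1 / 2 by norm_num), eventually_re_neg]
    with w hp hw i hi j hj
  have hx := norm_arg_le (w := w) (y := y) (γ := γ) (j := j) hi.2.2
  have hm := norm_theta_le (x := y * pPow w γ * q ^ j * i.2) (M := M) hp ?_ ?_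
  · refine hm.trans ?_
    rw [mul_assoc (2 * Real.exp (M * 2) ^ 2)]
    refine mul_le_mul_of_nonneg_left ?_ (by positivity)
    refine max_le ?_ (hx.trans ?_)
    · exact one_le_mul_of_one_le_of_one_le (le_max_left _ _) (le_max_left _ _)
    · exact mul_le_mul (le_max_right _ _) (le_max_right _ _) (by positivity) (by positivity)
  · rw [norm_mul, ← pPow_one]
    calc ‖pPow w 1‖ * ‖y * pPow w γ * q ^ j * i.2‖
        ≤ ‖pPow w 1‖ * (‖y‖ * ‖q‖⁻¹ * (‖pPow w γ‖ * ‖q‖ ^ j)) := by gcongr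
      _ = ‖y‖ * ‖q‖⁻¹ * (‖pPow w (1 + γ)‖ * ‖q‖ ^ j) := by rw [norm_pPow_add]; ring
      _ ≤ ‖y‖ * ‖q‖⁻¹ * (1 * 1) := by
        gcongr
        · exact norm_pPow_le_one hw (by linarith)
        · exact pow_le_one₀ (norm_nonneg _) hq.le
      _ ≤ M := by rw [hM]; linarith [norm_nonneg (1 / y)]
  -- Up to the cutoff, division by q^j costs at most |p|^{-κ}, and γ + κ ≤ 1 pays for it.
  · have e : Complex.exp w / (y * pPow w γ * q ^ j * i.2) =
        1 / y * pPow w (1 - γ) / (q ^ j * i.2) := by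
      rw [pPow_sub, pPow_one]
      have := pPow_ne_zero w γ
      have : i.2 ≠ 0 := norm_pos_iff.1 (one_pos.trans_le hi.2.1)
      field_simp
    rw [e]
    refine (norm_arg_inv_le hq0 hq hκ hw (hj.le.trans hi.1) hi.2.1).trans ?_
    have := norm_pPow_le_one hw (γ := 1 - γ - κ) (by linarith)
    calc _ ≤ ‖1 / y‖ * 1 := by gcongr
      _ ≤ M := by rw [hM, mul_one]; linarith [show 0 ≤ ‖y‖ * ‖q‖⁻¹ by positivity]

lemma eventually_mul_norm_pPow_le (M : ℝ) {γ : ℝ} (hγ : 0 < γ) {ε : ℝ} (hε : 0 < ε) :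
    ∀ᶠ w in cusp, M * ‖pPow w γ‖ ≤ ε := by
  have := (tendsto_pPow hγ).norm.const_mul M
  rw [norm_zero, mul_zero] at this
  exact this.eventually (ge_mem_nhds hε)

include hq0 hq hκ in
-- Since κ < γ, the argument tends to 0 uniformly up to the cutoff and the denominator of Γ stays
-- near 1; since γ ≤ 1, the argument pq/x of the numerator stays bounded.
lemma ellGamma_div_bound (y : ℂ) {γ : ℝ} (h1 : κ < γ) (h2 : γ ≤ 1) :
    ∃ C : ℝ, ∀ᶠ w in cusp, ∀ i ∈ fullIndex q κ w,
      ‖ellGamma (y * pPow w γ / (q ^ i.1 * i.2)) (Complex.exp w) q‖ ≤ C := by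
  have hs := sumBound_pos hq
  refine ⟨Real.exp (‖1 / y‖ * sumBound q) * 2, ?_⟩
  filter_upwards [eventually_norm_exp_le (show (0 : ℝ) < 1 / 2 by norm_num), eventually_re_neg,
    eventually_mul_norm_pPow_le (‖y‖ * sumBound q) (sub_pos.2 h1)
      (show (0 : ℝ) < 1 / 3 by norm_num)] with w hp hw hsmall i hi
  refine norm_ellGamma_le hp hq ?_ ?_
  · have e : Complex.exp w * q / (y * pPow w γ / (q ^ i.1 * i.2)) =
        1 / y * pPow w (1 - γ) * q ^ i.1 * (q * i.2) := by
      rw [pPow_sub, pPow_one]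
      have := pPow_ne_zero w γ
      field_simp
    rw [e, norm_mul, norm_mul, norm_mul]
    have h3 : ‖q * i.2‖ ≤ 1 := by
      rw [norm_mul]
      calc ‖q‖ * ‖i.2‖ ≤ ‖q‖ * ‖q‖⁻¹ := by gcongr; exact hi.2.2
        _ = 1 := mul_inv_cancel₀ (norm_pos_iff.2 hq0).ne'
    have h4 : ‖q ^ i.1‖ ≤ 1 := by rw [norm_pow]; exact pow_le_one₀ (norm_nonneg _) hq.le
    calc _ ≤ ‖1 / y‖ * 1 * 1 * 1 := by
          gcongr
          exact norm_pPow_le_one hw (by linarith)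
      _ = _ := by ring
  · refine le_trans ?_ hsmall
    rw [mul_right_comm ‖y‖]
    exact mul_le_mul_of_nonneg_right (norm_arg_inv_le hq0 hq hκ hw hi.1 hi.2.1) hs.le

include hq0 hq hκ in
lemma norm_div_arg_cutoff_le {w : ℂ} (hw : w.re < 0) {y ω : ℂ} {γ : ℝ} (hω : 1 ≤ ‖ω‖) :
    ‖Complex.exp w * q / (y * pPow w γ * q ^ cutoff q κ w * ω)‖ ≤
      ‖q / y‖ * ‖pPow w (1 - γ - κ)‖ := by
  have e : Complex.exp w * q / (y * pPow w γ * q ^ cutoff q κ w * ω) =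
      q / y * pPow w (1 - γ) / (q ^ cutoff q κ w * ω) := by
    rw [pPow_sub, pPow_one]
    have := pPow_ne_zero w γ
    have : ω ≠ 0 := norm_pos_iff.1 (one_pos.trans_le hω)
    field_simp
  rw [e]
  exact norm_arg_inv_le hq0 hq hκ hw le_rfl hω

include hq0 hq hκ in
-- At the cutoff the argument x has the size of |p|^{γ+κ}. The denominator of Γ needs it to be
-- small, the numerator only needs pq/x to be bounded. For the inverse of Γ
-- (`inv_ellGamma_cutoff_bound`) strict and weak inequality change places.
lemma ellGamma_cutoff_bound (y : ℂ) {γ : ℝ} (h1 : -κ < γ) (h2 : γ + κ ≤ 1) :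
    ∃ C : ℝ, ∀ᶠ w in cusp, ∀ ω : ℂ, 1 ≤ ‖ω‖ → ‖ω‖ ≤ ‖q‖⁻¹ →
      ‖ellGamma (y * pPow w γ * q ^ cutoff q κ w * ω) (Complex.exp w) q‖ ≤ C := by
  have hs := sumBound_pos hq
  refine ⟨Real.exp (‖q / y‖ * sumBound q) * 2, ?_⟩
  filter_upwards [eventually_norm_exp_le (show (0 : ℝ) < 1 / 2 by norm_num), eventually_re_neg,
    eventually_mul_norm_pPow_le (‖y‖ * (‖q‖⁻¹ ^ 2) * sumBound q) (show 0 < γ + κ by linarith)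
      (show (0 : ℝ) < 1 / 3 by norm_num)] with w hp hw hsmall ω hω hω'
  refine norm_ellGamma_le hp hq ?_ ?_
  · refine (norm_div_arg_cutoff_le hq0 hq hκ hw hω).trans ?_
    exact mul_le_of_le_one_right (norm_nonneg _) (norm_pPow_le_one hw (by linarith))
  · refine le_trans ?_ hsmall
    rw [mul_right_comm _ (sumBound q)]
    exact mul_le_mul_of_nonneg_right (norm_arg_cutoff_le hq0 hq hω') hs.le

include hq0 hq hκ in
lemma inv_ellGamma_cutoff_bound (y : ℂ) {γ : ℝ} (h1 : -κ ≤ γ) (h2 : γ + κ < 1) :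
    ∃ C : ℝ, ∀ᶠ w in cusp, ∀ ω : ℂ, 1 ≤ ‖ω‖ → ‖ω‖ ≤ ‖q‖⁻¹ →
      ‖(ellGamma (y * pPow w γ * q ^ cutoff q κ w * ω) (Complex.exp w) q)⁻¹‖ ≤ C := by
  have hs := sumBound_pos hq
  refine ⟨Real.exp (‖y‖ * (‖q‖⁻¹ ^ 2) * sumBound q) * 2, ?_⟩
  filter_upwards [eventually_norm_exp_le (show (0 : ℝ) < 1 / 2 by norm_num), eventually_re_neg,
    eventually_mul_norm_pPow_le (‖q / y‖ * sumBound q) (show 0 < 1 - γ - κ by linarith)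
      (show (0 : ℝ) < 1 / 3 by norm_num)] with w hp hw hsmall ω hω hω'
  refine norm_inv_ellGamma_le hp hq ?_ ?_
  · refine (norm_arg_cutoff_le hq0 hq hω').trans ?_
    exact mul_le_of_le_one_right (by positivity) (norm_pPow_le_one hw (by linarith))
  · refine le_trans ?_ hsmall
    rw [mul_right_comm _ (sumBound q)]
    exact mul_le_mul_of_nonneg_right (norm_div_arg_cutoff_le hq0 hq hκ hw hω) hs.le

include hq0 hq hκ in
/-- The factor `θ(z⁻²; p)`. -/
lemma theta_inv_sq_bound {y : ℂ} (hy : y ≠ 0) {γ : ℝ} (h1 : 2 * κ ≤ γ) (h2 : γ ≤ 1) :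
    ∃ C : ℝ, ∀ᶠ w in cusp, ∀ i ∈ fullIndex q κ w,
      ‖theta (y * pPow w γ / (q ^ i.1 * i.2) ^ 2) (Complex.exp w)‖ ≤ C := by
  have hq' := norm_pos_iff.2 hq0
  set M := ‖y‖ + ‖1 / y‖ * ‖q‖⁻¹ ^ 2 with hM
  refine ⟨2 * Real.exp (M * 2) ^ 2 * (1 + ‖y‖), ?_⟩
  filter_upwards [eventually_norm_exp_le (show (0 : ℝ) < 1 / 2 by norm_num), eventually_re_neg]
    with w hp hw i hi
  have hx : ‖y * pPow w γ / (q ^ i.1 * i.2) ^ 2‖ ≤ ‖y‖ := by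
    have h3 := norm_arg_inv_le hq0 hq hκ hw (y := 1) (γ := γ / 2) hi.1 hi.2.1
    have h4 := norm_pPow_le_one hw (γ := γ / 2 - κ) (by linarith)
    have e : y * pPow w γ / (q ^ i.1 * i.2) ^ 2 =
        y * (1 * pPow w (γ / 2) / (q ^ i.1 * i.2)) ^ 2 := by
      have : pPow w γ = pPow w (γ / 2) ^ 2 := by
        rw [← pPow_nat_mul]; congr 1; push_cast; ring
      rw [this]; ring
    rw [e, norm_mul, norm_pow]
    refine mul_le_of_le_one_right (norm_nonneg _) (pow_le_one₀ (norm_nonneg _) ?_)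
    rw [norm_one, one_mul (‖pPow w (γ / 2 - κ)‖)] at h3
    exact h3.trans h4
  have hm := norm_theta_le (x := y * pPow w γ / (q ^ i.1 * i.2) ^ 2) (M := M) hp ?_ ?_
  · refine hm.trans (mul_le_mul_of_nonneg_left ?_ (by positivity))
    exact max_le (by linarith [norm_nonneg y]) (hx.trans (by linarith))
  · rw [norm_mul]
    calc _ ≤ 1 * ‖y‖ := by gcongr; linarith
      _ ≤ M := by rw [hM, one_mul]; linarith [show 0 ≤ ‖1 / y‖ * ‖q‖⁻¹ ^ 2 by positivity]
  · have e : Complex.exp w / (y * pPow w γ / (q ^ i.1 * i.2) ^ 2) =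
        1 / y * pPow w (1 - γ) * (q ^ i.1) ^ 2 * i.2 ^ 2 := by
      rw [pPow_sub, pPow_one]
      have := pPow_ne_zero w γ
      field_simp
    have h3 := norm_pPow_le_one hw (γ := 1 - γ) (by linarith)
    have h4 : ‖(q ^ i.1) ^ 2‖ ≤ 1 := by
      rw [norm_pow, norm_pow]
      exact pow_le_one₀ (by positivity) (pow_le_one₀ (norm_nonneg _) hq.le)
    rw [e, norm_mul, norm_mul, norm_mul, norm_pow i.2]
    calc _ ≤ ‖1 / y‖ * 1 * 1 * ‖q‖⁻¹ ^ 2 := by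
          gcongr
          exact hi.2.2
      _ ≤ M := by rw [hM]; linarith [norm_nonneg y]

end factors

end EllipticPairing

end

noncomputable section

namespace EllipticPairing

/-! ### Theta functions on annuli -/

/-- For |γ| ≤ 1 the products in px and p/x remain bounded, and the factor 1 − x is responsible for
the power p^{min(0,γ)}. -/
lemma theta_annulus_bound {γ : ℝ} (h1 : -1 ≤ γ) (h2 : γ ≤ 1) {r : ℝ} (hr : 0 < r) (R : ℝ) :
    ∃ C : ℝ, 0 ≤ C ∧ ∀ᶠ w in cusp, ∀ x : ℂ, r ≤ ‖x‖ → ‖x‖ ≤ R →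
      ‖theta (x * pPow w γ) (Complex.exp w)‖ ≤ C * ‖pPow w (-max 0 (-γ))‖ := by
  set M := max 1 R + r⁻¹ with hM
  have hr' : 0 < r⁻¹ := inv_pos.2 hr
  have hR1 : 1 ≤ max 1 R := le_max_left _ _
  refine ⟨2 * Real.exp (M * 2) ^ 2 * max 1 R, by positivity, ?_⟩
  filter_upwards [eventually_norm_exp_le (show (0 : ℝ) < 1 / 2 by norm_num), eventually_re_neg]
    with w hp hw x hx hx'
  have hx0 : x ≠ 0 := norm_pos_iff.1 (hr.trans_le hx)
  have hxR : ‖x‖ ≤ max 1 R := hx'.trans (le_max_right _ _)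
  refine (norm_theta_le (M := M) hp ?_ ?_).trans ?_
  · have e : Complex.exp w * (x * pPow w γ) = x * pPow w (1 + γ) := by
      rw [pPow_add, pPow_one]; ring
    rw [e, norm_mul]
    have := norm_pPow_le_one hw (γ := 1 + γ) (by linarith)
    calc _ ≤ max 1 R * 1 := by gcongr
      _ ≤ M := by linarith
  · have e : Complex.exp w / (x * pPow w γ) = x⁻¹ * pPow w (1 - γ) := by
      rw [pPow_sub, pPow_one]
      have := pPow_ne_zero w γ
      field_simp
    rw [e, norm_mul, norm_inv]
    have := norm_pPow_le_one hw (γ := 1 - γ) (by linarith)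
    calc _ ≤ r⁻¹ * 1 := by gcongr
      _ ≤ M := by linarith
  · rw [mul_assoc (2 * Real.exp (M * 2) ^ 2)]
    refine mul_le_mul_of_nonneg_left ?_ (by positivity)
    have h3 : 1 ≤ ‖pPow w (-max 0 (-γ))‖ := by
      rw [norm_pPow, Real.one_le_exp_iff]
      nlinarith [le_max_left 0 (-γ)]
    have h4 : ‖pPow w γ‖ ≤ ‖pPow w (-max 0 (-γ))‖ := by
      rw [norm_pPow, norm_pPow, Real.exp_le_exp]
      nlinarith [le_max_right 0 (-γ)]
    refine max_le (one_le_mul_of_one_le_of_one_le hR1 h3) ?_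
    rw [norm_mul]
    exact mul_le_mul hxR h4 (norm_nonneg _) (zero_le_one.trans hR1)

lemma exp_zpow_eq_pPow (w : ℂ) (n : ℤ) : Complex.exp w ^ n = pPow w n := by
  rw [pPow, ← Complex.exp_int_mul]; push_cast; rfl

/-- A zero means |x| = |p|^{n−γ} for an integer n. As p → 0 this leaves every fixed annulus unless n
= γ, and then x = 1. -/
lemma theta_annulus_ne_zero (γ : ℝ) {r : ℝ} (hr : 0 < r) (R : ℝ) :
    ∀ᶠ w in cusp, ∀ x : ℂ, r ≤ ‖x‖ → ‖x‖ ≤ R → ((∃ n : ℤ, γ = n) → x ≠ 1) →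
      theta (x * pPow w γ) (Complex.exp w) ≠ 0 := by
  have h1 : 0 < (⌊γ⌋ : ℝ) + 1 - γ := by linarith [Int.lt_floor_add_one γ]
  have h2 : 0 < γ - ((⌈γ⌉ : ℝ) - 1) := by linarith [Int.ceil_lt_add_one γ]
  filter_upwards [eventually_norm_exp_le (show (0 : ℝ) < 1 / 2 by norm_num), eventually_re_neg,
    eventually_mul_norm_pPow_le 1 h1 (half_pos hr),
    eventually_mul_norm_pPow_le (max 1 R + 1) h2 one_pos] with w hp hw hs1 hs2 x hx hx' hx1 h0
  have hx0 : x ≠ 0 := norm_pos_iff.1 (hr.trans_le hx)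
  obtain ⟨n, hn⟩ := (theta_eq_zero_iff (norm_lt_one_of_le_half hp) (Complex.exp_ne_zero w)
    (mul_ne_zero hx0 (pPow_ne_zero w γ))).1 h0
  have hxn : x = pPow w (n - γ) := by
    rw [pPow_sub, ← exp_zpow_eq_pPow, ← hn, mul_div_cancel_right₀ _ (pPow_ne_zero w γ)]
  have hmono : ∀ s t : ℝ, s ≤ t → ‖pPow w t‖ ≤ ‖pPow w s‖ := fun s t hst => by
    rw [norm_pPow, norm_pPow, Real.exp_le_exp]
    exact mul_le_mul_of_nonpos_right hst hw.le
  rcases lt_trichotomy (n : ℝ) γ with h | h | h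
  · have h3 : (n : ℝ) ≤ ⌈γ⌉ - 1 := by
      have : n < ⌈γ⌉ := Int.lt_ceil.2 h
      exact_mod_cast Int.le_sub_one_of_lt this
    have h4 := hmono (n - γ) (-(γ - ((⌈γ⌉ : ℝ) - 1))) (by linarith)
    rw [pPow_neg, norm_inv, ← hxn] at h4
    have h5 := norm_pPow_pos w (γ - ((⌈γ⌉ : ℝ) - 1))
    have h6 : max 1 R + 1 ≤ ‖pPow w (γ - ((⌈γ⌉ : ℝ) - 1))‖⁻¹ := by
      rw [le_inv_comm₀ (by positivity) h5, ← one_div, le_div_iff₀ (by positivity)]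
      linarith
    linarith [le_max_right 1 R]
  · refine hx1 ⟨n, h.symm⟩ ?_
    rw [hxn, h, sub_self, pPow_zero]
  · have h3 : (⌊γ⌋ : ℝ) + 1 ≤ n := by
      have : ⌊γ⌋ < n := Int.floor_lt.2 h
      exact_mod_cast this
    have h4 := hmono ((⌊γ⌋ : ℝ) + 1 - γ) (n - γ) (by linarith)
    rw [← hxn] at h4
    linarith

/-! ### Expansions -/

lemma ratEval_eq (r : RatFunc ℂ) (z : ℂ) : ratEval r z = r.num.eval z / r.denom.eval z := by
  simp only [ratEval, RatFunc.eval, Polynomial.eval₂_id]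

lemma ratEval_continuousOn {r : RatFunc ℂ} {K : Set ℂ} (h : ∀ z ∈ K, r.denom.eval z ≠ 0) :
    ContinuousOn (ratEval r) K := by
  have : ratEval r = fun z => r.num.eval z / r.denom.eval z := funext fun z => ratEval_eq r z
  rw [this]
  exact r.num.continuous.continuousOn.div r.denom.continuous.continuousOn h

/-- A finite partial sum is uniformly close to the function. Apart from the leading one, its terms
with non-zero coefficient carry positive powers of p and tend to 0 uniformly on K. -/
lemma HasExpansion.tendstoUniformlyOn {ζ : ℝ} {f : ℂ → ℂ → ℂ} {c : HahnSeries ℝ (RatFunc ℂ)}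
    (h : HasExpansion ζ f c) : ∃ P : Polynomial ℂ, P ≠ 0 ∧
      (∀ z, P.eval z ≠ 0 → c.leadingCoeff.denom.eval z ≠ 0) ∧
      ∀ K : Set ℂ, IsCompact K → (∀ z ∈ K, z ≠ 0 ∧ P.eval z ≠ 0) →
        ∀ ε : ℝ, 0 < ε → ∀ᶠ w in cusp, ∀ z ∈ K,
          ‖pPow w (-c.order) * f w (z * pPow w ζ) - ratEval c.leadingCoeff z‖ ≤ ε := by
  obtain ⟨-, -, P, hP, hPd, hK⟩ := h
  refine ⟨P, hP, fun z hz => by rw [HahnSeries.leadingCoeff_eq]; exact hPd _ z hz,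
    fun K hKc hK0 ε hε => ?_⟩
  classical
  obtain ⟨δ, hδ, hsum⟩ := hK K hKc hK0
  rw [hasSumUniformlyOn_iff_tendstoUniformlyOn, Metric.tendstoUniformlyOn_iff] at hsum
  obtain ⟨I, hI⟩ := eventually_atTop.1 (hsum (ε / 2) (half_pos hε))
  -- The leading exponent is added to the partial sum so that it can be split off.
  set J := insert c.order I with hJ
  have hJ1 := hI J (Finset.subset_insert _ _)
  have hterm : ∀ s ∈ J.erase c.order, ∀ᶠ w in cusp, ∀ z ∈ K,
      ‖ratEval (c.coeff s) z * pPow w (s - c.order)‖ ≤ ε / 2 / (J.card + 1) := fun s hs => by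
    have hne := Finset.ne_of_mem_erase hs
    have hη : 0 < ε / 2 / ((J.card : ℝ) + 1) := by positivity
    rcases lt_or_gt_of_ne hne with hlt | hgt
    · refine Eventually.of_forall fun w z _ => ?_
      rw [HahnSeries.coeff_eq_zero_of_lt_order hlt, ratEval, RatFunc.eval_zero, zero_mul, norm_zero]
      exact hη.le
    · obtain ⟨B, hB⟩ := hKc.exists_bound_of_continuousOn
        (ratEval_continuousOn fun z hz => hPd s z (hK0 z hz).2)
      filter_upwards [eventually_mul_norm_pPow_le B (sub_pos.2 hgt) hη] with w hw z hz
      rw [norm_mul]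
      exact (mul_le_mul_of_nonneg_right (hB z hz) (norm_nonneg _)).trans hw
  filter_upwards [(Finset.eventually_all (J.erase c.order)).2 hterm, eventually_norm_exp_le hδ]
    with w hw hwδ z hz
  have h1 := hJ1 (w, z) ⟨hwδ, hz⟩
  rw [dist_eq_norm, ← Finset.add_sum_erase J _ (Finset.mem_insert_self _ _), sub_self, pPow_zero,
    mul_one, ← HahnSeries.leadingCoeff_eq] at h1
  have h2 : ‖∑ s ∈ J.erase c.order, ratEval (c.coeff s) z * pPow w (s - c.order)‖ ≤ ε / 2 := by
    refine (norm_sum_le_of_le _ fun s hs => hw s hs z hz).trans ?_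
    rw [Finset.sum_const, nsmul_eq_mul]
    have h3 : ((J.erase c.order).card : ℝ) ≤ J.card + 1 := by
      have := Finset.card_erase_le (s := J) (a := c.order)
      have : ((J.erase c.order).card : ℝ) ≤ J.card := by exact_mod_cast this
      linarith
    calc _ ≤ ((J.card : ℝ) + 1) * (ε / 2 / (J.card + 1)) := by gcongr
      _ = ε / 2 := by field_simp
  have h4 := norm_add_le (pPow w (-c.order) * f w (z * pPow w ζ) -
    (ratEval c.leadingCoeff z + ∑ s ∈ J.erase c.order, ratEval (c.coeff s) z *
      pPow w (s - c.order))) (∑ s ∈ J.erase c.order, ratEval (c.coeff s) z * pPow w (s - c.order))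
  rw [show pPow w (-c.order) * f w (z * pPow w ζ) -
    (ratEval c.leadingCoeff z + ∑ s ∈ J.erase c.order, ratEval (c.coeff s) z *
      pPow w (s - c.order)) + (∑ s ∈ J.erase c.order, ratEval (c.coeff s) z *
        pPow w (s - c.order)) = pPow w (-c.order) * f w (z * pPow w ζ) -
          ratEval c.leadingCoeff z by ring] at h4
  linarith

lemma norm_le_on_closedBall {f : ℂ → ℂ} {z₀ : ℂ} {δ C : ℝ} (hδ : 0 < δ)
    (hf : DifferentiableOn ℂ f (Metric.closedBall z₀ δ))
    (h : ∀ z ∈ Metric.sphere z₀ δ, ‖f z‖ ≤ C) {z : ℂ} (hz : z ∈ Metric.closedBall z₀ δ) :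
    ‖f z‖ ≤ C := by
  have hcl : closure (Metric.ball z₀ δ) = Metric.closedBall z₀ δ := closure_ball _ hδ.ne'
  refine Complex.norm_le_of_forall_mem_frontier_norm_le (U := Metric.ball z₀ δ)
    Metric.isBounded_ball (DifferentiableOn.diffContOnCl (hcl ▸ hf)) ?_ (hcl ▸ hz)
  rwa [frontier_ball _ hδ.ne']

lemma norm_le_on_annulus {f : ℂ → ℂ} {r R C : ℝ} (hr : 0 < r)
    (hf : DifferentiableOn ℂ f {0}ᶜ) (h : ∀ z : ℂ, ‖z‖ = r ∨ ‖z‖ = R → ‖f z‖ ≤ C)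
    {z : ℂ} (h1 : r ≤ ‖z‖) (h2 : ‖z‖ ≤ R) : ‖f z‖ ≤ C := by
  rcases h1.eq_or_lt with h1 | h1
  · exact h z (Or.inl h1.symm)
  rcases h2.eq_or_lt with h2 | h2
  · exact h z (Or.inr h2)
  have hcl : closure (annulus r R) ⊆ {z | r ≤ ‖z‖ ∧ ‖z‖ ≤ R} :=
    closure_minimal (fun z hz => ⟨hz.1.le, hz.2.le⟩)
      ((isClosed_le continuous_const continuous_norm).inter
        (isClosed_le continuous_norm continuous_const))
  refine Complex.norm_le_of_forall_mem_frontier_norm_le (U := annulus r R) ?_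
    (DifferentiableOn.diffContOnCl (hf.mono fun z hz => ?_)) ?_ (subset_closure ⟨h1, h2⟩)
  · exact (Metric.isBounded_ball (x := (0 : ℂ)) (r := R)).subset fun z hz => by
      rw [mem_ball_zero_iff]; exact hz.2
  · exact norm_pos_iff.1 (hr.trans_le (hcl hz).1)
  · intro z hz
    rw [(isOpen_annulus r R).frontier_eq] at hz
    have h3 := hcl hz.1
    have h4 : ¬ (r < ‖z‖ ∧ ‖z‖ < R) := hz.2
    refine h z ?_
    by_contra h5
    rw [not_or] at h5
    exact h4 ⟨lt_of_le_of_ne h3.1 (Ne.symm h5.1), lt_of_le_of_ne h3.2 h5.2⟩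

lemma norm_le_of_countable {f : ℂ → ℂ} {U B : Set ℂ} (hU : IsOpen U) (hf : ContinuousOn f U)
    (hB : B.Countable) {C : ℝ} (h : ∀ z ∈ U, z ∉ B → ‖f z‖ ≤ C) {z : ℂ} (hz : z ∈ U) :
    ‖f z‖ ≤ C := by
  have hcl : z ∈ closure (U ∩ Bᶜ) := (hB.dense_compl ℂ).open_subset_closure_inter hU hz
  have hmem := ((hf z hz).mono Set.inter_subset_left : ContinuousWithinAt f (U ∩ Bᶜ) z).norm
    |>.mem_closure_image hcl
  have hsub : (fun z => ‖f z‖) '' (U ∩ Bᶜ) ⊆ Set.Iic C := by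
    rintro _ ⟨y, hy, rfl⟩
    exact h y hy.1 hy.2
  have := closure_mono hsub hmem
  rwa [closure_Iic] at this

end EllipticPairing

end

noncomputable section

namespace EllipticPairing

/-! ### Families in the spaces `A(u;p,q)` with expansions -/

section family

variable {q : ℂ} (hq0 : q ≠ 0) (hq : ‖q‖ < 1) {y : ℂ} (hy : y ≠ 0) {τ ζ : ℝ} {m : ℕ}
  {f F : ℂ → ℂ → ℂ} {c : HahnSeries ℝ (RatFunc ℂ)}

include hq0 hy in
lemma poleFactor_scaled (w : ℂ) {x : ℂ} (hx : x ≠ 0) :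
    poleFactor (y * pPow w τ) (Complex.exp w) q m (x * pPow w ζ) =
      (∏ j ∈ Finset.range m, theta (y / q ^ m * q ^ j * x * pPow w (τ + ζ)) (Complex.exp w)) *
      ∏ j ∈ Finset.range m, theta (y / q ^ m * q ^ j * x⁻¹ * pPow w (τ - ζ)) (Complex.exp w) := by
  have h1 := pPow_ne_zero w τ
  have h2 := pPow_ne_zero w ζ
  rw [poleFactor_eq (Complex.exp_ne_zero w) hq0 (mul_ne_zero hy h1) (mul_ne_zero hx h2),
    pPow_add, pPow_sub]
  congr 1
  · refine Finset.prod_congr rfl fun j _ => ?_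
    congr 1
    ring
  · refine Finset.prod_congr rfl fun j _ => ?_
    congr 1
    rw [mul_inv]
    ring

include hq in
lemma norm_shifted_mem {m : ℕ} {x : ℂ} {j : ℕ} (hj : j ∈ Finset.range m) :
    ‖y / q ^ m‖ * ‖q‖ ^ m * ‖x‖ ≤ ‖y / q ^ m * q ^ j * x‖ ∧
      ‖y / q ^ m * q ^ j * x‖ ≤ ‖y / q ^ m‖ * ‖x‖ := by
  have h := pow_le_pow_of_le_one (norm_nonneg q) hq.le (Finset.mem_range.1 hj).le
  have h' : ‖q‖ ^ j ≤ 1 := pow_le_one₀ (norm_nonneg _) hq.le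
  rw [norm_mul, norm_mul, norm_pow]
  constructor
  · gcongr
  · exact mul_le_mul_of_nonneg_right (mul_le_of_le_one_right (norm_nonneg _) h') (norm_nonneg _)

include hq0 hq hy in
-- The arguments of the theta functions have sizes |p|^{τ+ζ} and |p|^{τ−ζ}. Only τ + ζ may be
-- negative, and each of its m factors then contributes |p|^{τ+ζ}.
lemma poleFactor_scaled_bound (h1 : -1 ≤ τ + ζ) (h2 : τ + ζ ≤ 1) (h3 : 0 ≤ τ - ζ) (h4 : τ - ζ ≤ 1)
    {r R : ℝ} (hr : 0 < r) (hrR : r ≤ R) :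
    ∃ C : ℝ, 0 ≤ C ∧ ∀ᶠ w in cusp, ∀ x : ℂ, r ≤ ‖x‖ → ‖x‖ ≤ R →
      ‖poleFactor (y * pPow w τ) (Complex.exp w) q m (x * pPow w ζ)‖ ≤
        C * ‖pPow w (-max 0 (-(τ + ζ)))‖ ^ m := by
  have hyq : 0 < ‖y / q ^ m‖ := norm_pos_iff.2 (div_ne_zero hy (pow_ne_zero m hq0))
  have hqm : 0 < ‖q‖ ^ m := pow_pos (norm_pos_iff.2 hq0) m
  obtain ⟨C₁, hC₁, e₁⟩ := theta_annulus_bound h1 h2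
    (r := ‖y / q ^ m‖ * ‖q‖ ^ m * r) (by positivity) (‖y / q ^ m‖ * R)
  obtain ⟨C₂, hC₂, e₂⟩ := theta_annulus_bound (γ := τ - ζ) (by linarith) h4
    (r := ‖y / q ^ m‖ * ‖q‖ ^ m * R⁻¹)
    (mul_pos (by positivity) (inv_pos.2 (hr.trans_le hrR))) (‖y / q ^ m‖ * r⁻¹)
  refine ⟨C₁ ^ m * C₂ ^ m, by positivity, ?_⟩
  filter_upwards [e₁, e₂] with w hw₁ hw₂ x hx hx'
  have hx0 : 0 < ‖x‖ := hr.trans_le hx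
  rw [poleFactor_scaled hq0 hy w (norm_pos_iff.1 hx0), norm_mul, norm_prod, norm_prod]
  have hP : ∏ j ∈ Finset.range m, ‖theta (y / q ^ m * q ^ j * x * pPow w (τ + ζ)) (Complex.exp w)‖ ≤
      (C₁ * ‖pPow w (-max 0 (-(τ + ζ)))‖) ^ m := by
    refine (Finset.prod_le_prod (fun _ _ => norm_nonneg _)
      (g := fun _ => C₁ * ‖pPow w (-max 0 (-(τ + ζ)))‖) fun j hj => ?_).trans_eq
      (by rw [Finset.prod_const, Finset.card_range])
    obtain ⟨h5, h6⟩ := norm_shifted_mem hq (y := y) (x := x) hj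
    refine hw₁ _ (le_trans ?_ h5) (h6.trans ?_) <;> gcongr
  have hQ : ∏ j ∈ Finset.range m,
      ‖theta (y / q ^ m * q ^ j * x⁻¹ * pPow w (τ - ζ)) (Complex.exp w)‖ ≤ C₂ ^ m := by
    refine (Finset.prod_le_prod (fun _ _ => norm_nonneg _) (g := fun _ => C₂)
      fun j hj => ?_).trans_eq (by rw [Finset.prod_const, Finset.card_range])
    obtain ⟨h5, h6⟩ := norm_shifted_mem hq (y := y) (x := x⁻¹) hj
    rw [norm_inv] at h5 h6
    have := hw₂ (y / q ^ m * q ^ j * x⁻¹) (le_trans (by gcongr) h5) (h6.trans (by gcongr))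
    rwa [max_eq_left (by linarith), neg_zero, pPow_zero, norm_one, mul_one] at this
  calc _ ≤ (C₁ * ‖pPow w (-max 0 (-(τ + ζ)))‖) ^ m * C₂ ^ m := by
        refine mul_le_mul hP hQ (Finset.prod_nonneg fun _ _ => norm_nonneg _) (by positivity)
    _ = _ := by rw [mul_pow]; ring

lemma exists_radius_forall_eval_ne_zero {P : Polynomial ℂ} (hP : P ≠ 0) (R₀ : ℝ) :
    ∃ R : ℝ, R₀ ≤ R ∧ 1 ≤ R ∧ ∀ z : ℂ, R ≤ ‖z‖ → P.eval z ≠ 0 := by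
  obtain ⟨B, hB⟩ := (P.roots.toFinset.finite_toSet.image fun z : ℂ => ‖z‖).bddAbove
  refine ⟨max R₀ (max 1 (B + 1)), le_max_left _ _, (le_max_left _ _).trans (le_max_right _ _),
    fun z hz h0 => ?_⟩
  have h1 : ‖z‖ ≤ B := hB ⟨z, by simpa [hP] using h0, rfl⟩
  linarith [(le_max_right 1 (B + 1)).trans (le_max_right R₀ _)]

include hq0 hq hy in
/-- The numerators of a family with an expansion are bounded on large annuli. -/
lemma HasExpansion.bound (h : HasExpansion ζ f c)
    (hFd : ∀ᶠ w in cusp, DifferentiableOn ℂ (F w) {0}ᶜ)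
    (hFf : ∀ᶠ w in cusp, ∀ z : ℂ, z ≠ 0 →
      poleFactor (y * pPow w τ) (Complex.exp w) q m z ≠ 0 →
        F w z = poleFactor (y * pPow w τ) (Complex.exp w) q m z * f w z)
    (hFs : ∀ᶠ w in cusp, ∀ z : ℂ, z ≠ 0 → F w z⁻¹ = F w z)
    (h1 : -1 ≤ τ + ζ) (h2 : τ + ζ ≤ 1) (h3 : 0 ≤ τ - ζ) (h4 : τ - ζ ≤ 1) {R₀ : ℝ} (hR₀ : 0 < R₀) :
    ∃ C : ℝ, ∀ᶠ w in cusp, ∀ z : ℂ, (R₀ * ‖pPow w ζ‖)⁻¹ ≤ ‖z‖ → ‖z‖ ≤ R₀ * ‖pPow w ζ‖ →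
      ‖F w z‖ ≤ C * (‖pPow w c.order‖ * ‖pPow w (-max 0 (-(τ + ζ)))‖ ^ m) := by
  obtain ⟨P, hP, hPd, hK⟩ := h.tendstoUniformlyOn
  -- Beyond R there are no exceptional points, so the expansion can be used on the compact annulus R
  -- ≤ |x| ≤ R + 2.
  obtain ⟨R, hRR, hR1, hR⟩ := exists_radius_forall_eval_ne_zero hP R₀
  set K : Set ℂ := {z | R ≤ ‖z‖ ∧ ‖z‖ ≤ R + 2} with hKdef
  have hKc : IsCompact K := by
    refine (isCompact_closedBall (0 : ℂ) (R + 2)).of_isClosed_subset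
      ((isClosed_le continuous_const continuous_norm).inter
        (isClosed_le continuous_norm continuous_const)) fun z hz => ?_
    rw [mem_closedBall_zero_iff]; exact hz.2
  have hK0 : ∀ z ∈ K, z ≠ 0 ∧ P.eval z ≠ 0 := fun z hz =>
    ⟨norm_pos_iff.1 (by linarith [hz.1]), hR z hz.1⟩
  obtain ⟨B, hB⟩ := hKc.exists_bound_of_continuousOn
    (ratEval_continuousOn fun z hz => hPd z (hK0 z hz).2)
  obtain ⟨D, hD, hPF⟩ := poleFactor_scaled_bound hq0 hq hy (m := m) h1 h2 h3 h4
    (r := R) (R := R + 2) (by linarith) (by linarith)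
  refine ⟨D * (B + 1), ?_⟩
  filter_upwards [hFd, hFf, hFs, hK K hKc hK0 1 one_pos, hPF,
    eventually_norm_exp_le (show (0 : ℝ) < 1 / 2 by norm_num), eventually_re_neg] with
    w hFd hFf hFs hlim hPF hp hw z hz hz'
  set N := ‖pPow w (-max 0 (-(τ + ζ)))‖ ^ m with hN
  have hN0 : 0 ≤ N := by positivity
  have hζ0 := pPow_ne_zero w ζ
  have hcount : {x : ℂ | x * pPow w ζ ∈ {z : ℂ | z = 0 ∨
      poleFactor (y * pPow w τ) (Complex.exp w) q m z = 0}}.Countable :=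
    (countable_poleFactor_eq_zero (norm_lt_one_of_le_half hp) (Complex.exp_ne_zero w) hq0
      (mul_ne_zero hy (pPow_ne_zero w τ)) m).preimage (mul_left_injective₀ hζ0)
  -- Where the pole factor vanishes, F is not given by f. These points are countable, and the bound
  -- reaches them by continuity from the open annulus.
  have hmid : ∀ x : ℂ, ‖x‖ = R + 1 → ‖F w (x * pPow w ζ)‖ ≤
      D * (B + 1) * (‖pPow w c.order‖ * N) := fun x hx => by
    refine norm_le_of_countable (f := fun x => F w (x * pPow w ζ)) (isOpen_annulus R (R + 2)) ?_
      hcount (fun x hx hxB => ?_) (z := x) ⟨by linarith, by linarith⟩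
    · refine hFd.continuousOn.comp (by fun_prop) fun x hx => ?_
      exact mul_ne_zero (norm_pos_iff.1 (by linarith [hx.1])) hζ0
    · have hxK : x ∈ K := ⟨hx.1.le, hx.2.le⟩
      have hx0 := mul_ne_zero (hK0 x hxK).1 hζ0
      have hne : poleFactor (y * pPow w τ) (Complex.exp w) q m (x * pPow w ζ) ≠ 0 :=
        fun h => hxB (Or.inr h)
      rw [hFf _ hx0 hne, norm_mul]
      have e1 : ‖f w (x * pPow w ζ)‖ ≤ ‖pPow w c.order‖ * (B + 1) := by
        have e2 := norm_add_le (pPow w (-c.order) * f w (x * pPow w ζ) - ratEval c.leadingCoeff x)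
          (ratEval c.leadingCoeff x)
        rw [sub_add_cancel, pPow_neg, norm_mul, norm_inv] at e2
        have e3 := hlim x hxK
        rw [pPow_neg] at e3
        have e4 := hB x hxK
        have e5 := norm_pPow_pos w c.order
        rw [← div_le_iff₀' e5, div_eq_inv_mul]
        linarith
      calc _ ≤ (D * N) * (‖pPow w c.order‖ * (B + 1)) :=
            mul_le_mul (hPF x hxK.1 hxK.2) e1 (norm_nonneg _) (by positivity)
        _ = _ := by ring
  have hpos := norm_pPow_pos w ζ
  have hpos' : 0 < (R + 1) * ‖pPow w ζ‖ := by positivity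
  have hbig : ∀ z : ℂ, ‖z‖ = (R + 1) * ‖pPow w ζ‖ → ‖F w z‖ ≤
      D * (B + 1) * (‖pPow w c.order‖ * N) := fun z hz => by
    have := hmid (z / pPow w ζ) (by rw [norm_div, hz]; field_simp)
    rwa [div_mul_cancel₀ _ hζ0] at this
  -- The symmetry of F supplies the bound on the reciprocal circle, and the maximum principle fills
  -- the annulus in between.
  refine norm_le_on_annulus (r := ((R + 1) * ‖pPow w ζ‖)⁻¹) (R := (R + 1) * ‖pPow w ζ‖)
    (inv_pos.2 hpos') hFd ?_ ?_ ?_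
  · rintro z (h | h)
    · have hz0 : z ≠ 0 := norm_pos_iff.1 (by rw [h]; exact inv_pos.2 hpos')
      rw [← hFs z hz0]
      exact hbig _ (by rw [norm_inv, h, inv_inv])
    · exact hbig z h
  · refine le_trans ?_ hz
    have : 0 < R₀ * ‖pPow w ζ‖ := by positivity
    gcongr
    linarith
  · refine hz'.trans ?_
    gcongr
    linarith

end family

end EllipticPairing

end

/-! ### Limits of the families at single points -/

noncomputable section

namespace EllipticPairing

instance cusp_neBot : cusp.NeBot :=
  Filter.NeBot.comap_of_surj inferInstance fun x => ⟨x, Complex.ofReal_re x⟩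

section family

variable {q : ℂ} (hq0 : q ≠ 0) (hq : ‖q‖ < 1) {y : ℂ} (hy : y ≠ 0) {τ ζ : ℝ} {m : ℕ}
  {f F : ℂ → ℂ → ℂ} {c : HahnSeries ℝ (RatFunc ℂ)}

include hq0 hq hy in
-- By `theta_annulus_ne_zero`, for small p a zero near x₀ could only come from y q^{j−m} x^{±1} = 1,
-- which the hypotheses exclude at x₀ and therefore in a neighbourhood.
lemma poleFactor_scaled_ne_zero {x₀ : ℂ} (hx₀ : x₀ ≠ 0) (h1 : ∀ n : ℤ, y * x₀ ≠ q ^ n)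
    (h2 : ∀ n : ℤ, y / x₀ ≠ q ^ n) :
    ∀ᶠ δ in 𝓝[>] (0 : ℝ), ∀ᶠ w in cusp, ∀ x ∈ Metric.closedBall x₀ δ,
      poleFactor (y * pPow w τ) (Complex.exp w) q m (x * pPow w ζ) ≠ 0 := by
  have hyq : 0 < ‖y / q ^ m‖ := norm_pos_iff.2 (div_ne_zero hy (pow_ne_zero m hq0))
  have hqm : 0 < ‖q‖ ^ m := pow_pos (norm_pos_iff.2 hq0) m
  have hx₀' : 0 < ‖x₀‖ := norm_pos_iff.2 hx₀
  have hne : ∀ᶠ x in 𝓝 x₀, (‖x₀‖ / 2 ≤ ‖x‖ ∧ ‖x‖ ≤ 2 * ‖x₀‖) ∧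
      ∀ j ∈ Finset.range m, y / q ^ m * q ^ j * x ≠ 1 ∧ y / q ^ m * q ^ j * x⁻¹ ≠ 1 := by
    refine ((continuous_norm.continuousAt.eventually (le_mem_nhds (half_lt_self hx₀'))).and
      (continuous_norm.continuousAt.eventually
        (ge_mem_nhds (show ‖x₀‖ < 2 * ‖x₀‖ by linarith)))).and ?_
    · refine (Finset.eventually_all _).2 fun j _ => ?_
      have hqj : q ^ m ≠ 0 := pow_ne_zero m hq0
      refine (ContinuousAt.eventually_ne (by fun_prop) fun h => h1 ((m : ℤ) - j) ?_).and
        (ContinuousAt.eventually_ne (continuousAt_const.mul (continuousAt_inv₀ hx₀))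
          fun h => h2 ((m : ℤ) - j) ?_)
      · rw [zpow_sub₀ hq0, zpow_natCast, zpow_natCast, eq_div_iff (pow_ne_zero j hq0)]
        field_simp at h
        linear_combination h
      · rw [zpow_sub₀ hq0, zpow_natCast, zpow_natCast, eq_div_iff (pow_ne_zero j hq0)]
        field_simp at h ⊢
        linear_combination h
  obtain ⟨δ₀, hδ₀, hball⟩ := Metric.nhds_basis_closedBall.eventually_iff.1 hne
  filter_upwards [Ioc_mem_nhdsGT hδ₀] with δ hδ
  filter_upwards [theta_annulus_ne_zero (τ + ζ)
      (r := ‖y / q ^ m‖ * ‖q‖ ^ m * (‖x₀‖ / 2)) (by positivity) (‖y / q ^ m‖ * (2 * ‖x₀‖)),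
    theta_annulus_ne_zero (τ - ζ)
      (r := ‖y / q ^ m‖ * ‖q‖ ^ m * (2 * ‖x₀‖)⁻¹) (by positivity)
      (‖y / q ^ m‖ * (‖x₀‖ / 2)⁻¹)] with w hw₁ hw₂ x hx
  obtain ⟨⟨h3, h4⟩, h5⟩ := hball (Metric.closedBall_subset_closedBall hδ.2 hx)
  have hx0 : 0 < ‖x‖ := lt_of_lt_of_le (by positivity) h3
  rw [poleFactor_scaled hq0 hy w (norm_pos_iff.1 hx0)]
  refine mul_ne_zero (Finset.prod_ne_zero_iff.2 fun j hj => ?_)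
    (Finset.prod_ne_zero_iff.2 fun j hj => ?_)
  · obtain ⟨h6, h7⟩ := norm_shifted_mem hq (y := y) (x := x) hj
    exact hw₁ _ (le_trans (by gcongr) h6) (h7.trans (by gcongr)) fun _ => (h5 j hj).1
  · obtain ⟨h6, h7⟩ := norm_shifted_mem hq (y := y) (x := x⁻¹) hj
    rw [norm_inv] at h6 h7
    exact hw₂ _ (le_trans (by gcongr) h6) (h7.trans (by gcongr)) fun _ => (h5 j hj).2

lemma differentiableAt_comp_mul {g : ℂ → ℂ} {a x : ℂ} (h : DifferentiableAt ℂ g (x * a)) :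
    DifferentiableAt ℂ (fun x => g (x * a)) x :=
  h.comp (f := fun x => x * a) x (by fun_prop)

include hq0 in
lemma differentiableAt_poleFactor {p u : ℂ} (hp : ‖p‖ < 1) (hp0 : p ≠ 0) (hu : u ≠ 0) {z : ℂ}
    (hz : z ≠ 0) : DifferentiableAt ℂ (poleFactor u p q m) z := by
  have hmul : ∀ v : ℂ, v ≠ 0 → DifferentiableAt ℂ (fun z => theta (v * z) p) z := fun v hv =>
    (differentiableAt_theta hp (mul_ne_zero hv hz)).comp (f := fun z => v * z) z (by fun_prop)
  have hdiv : ∀ v : ℂ, v ≠ 0 → DifferentiableAt ℂ (fun z => theta (v * z⁻¹) p) z := fun v hv =>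
    (differentiableAt_theta hp (mul_ne_zero hv (inv_ne_zero hz))).comp (f := fun z => v * z⁻¹) z
      ((differentiableAt_inv hz).const_mul v)
  have he : poleFactor u p q m =ᶠ[𝓝 z] fun z =>
      (∏ j ∈ Finset.range m, theta (u / q ^ m * q ^ j * z) p) *
      ∏ j ∈ Finset.range m, theta (u / q ^ m * q ^ j * z⁻¹) p := by
    filter_upwards [isOpen_compl_singleton.mem_nhds hz] with x hx
    rw [poleFactor_eq hp0 hq0 hu hx]
    congr 1 <;> exact Finset.prod_congr rfl fun j _ => by rw [mul_right_comm]
  have hv : ∀ j : ℕ, u / q ^ m * q ^ j ≠ 0 := fun j =>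
    mul_ne_zero (div_ne_zero hu (pow_ne_zero m hq0)) (pow_ne_zero j hq0)
  refine DifferentiableAt.congr_of_eventuallyEq ?_ he
  exact (DifferentiableAt.fun_finsetProd fun j _ => hmul _ (hv j)).mul
    (DifferentiableAt.fun_finsetProd fun j _ => hdiv _ (hv j))

include hq0 hq hy in
/-- The limit of a family with an expansion, at a point where the members of the family are
holomorphic. -/
lemma HasExpansion.tendsto_div (h : HasExpansion ζ f c)
    (hFd : ∀ᶠ w in cusp, DifferentiableOn ℂ (F w) {0}ᶜ)
    (hFf : ∀ᶠ w in cusp, ∀ z : ℂ, z ≠ 0 →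
      poleFactor (y * pPow w τ) (Complex.exp w) q m z ≠ 0 →
        F w z = poleFactor (y * pPow w τ) (Complex.exp w) q m z * f w z)
    {x₀ : ℂ} (hx₀ : x₀ ≠ 0) (h1 : ∀ n : ℤ, y * x₀ ≠ q ^ n) (h2 : ∀ n : ℤ, y / x₀ ≠ q ^ n) :
    (∀ᶠ w in cusp, poleFactor (y * pPow w τ) (Complex.exp w) q m (x₀ * pPow w ζ) ≠ 0) ∧
    Tendsto (fun w => pPow w (-c.order) * (F w (x₀ * pPow w ζ) /
      poleFactor (y * pPow w τ) (Complex.exp w) q m (x₀ * pPow w ζ))) cusp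
      (𝓝 (ratEval c.leadingCoeff x₀)) := by
  obtain ⟨P, hP, hPd, hK⟩ := h.tendstoUniformlyOn
  -- The point x₀ may itself be a zero of P. The zeros are isolated, so the expansion converges on a
  -- small sphere about x₀, and the maximum principle brings the information to the centre.
  have hPne : ∀ᶠ x in 𝓝[≠] x₀, P.eval x ≠ 0 := by
    have : {x | P.eval x = 0}.Finite := by
      refine P.roots.toFinset.finite_toSet.subset fun x hx => ?_
      simpa [hP] using hx
    have h3 := (this.subset (Set.sdiff_subset (t := {x₀}))).isClosed.isOpen_compl.mem_nhds
      (show x₀ ∈ ({x | P.eval x = 0} \ {x₀})ᶜ by simp)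
    rw [eventually_nhdsWithin_iff]
    filter_upwards [h3] with x hx hne h0
    exact hx ⟨h0, hne⟩
  rw [eventually_nhdsWithin_iff] at hPne
  obtain ⟨δ₀, hδ₀, hball⟩ := Metric.nhds_basis_closedBall.eventually_iff.1 hPne
  obtain ⟨δ, hPF, hδ, hδx⟩ := ((poleFactor_scaled_ne_zero hq0 hq hy (τ := τ) (ζ := ζ) (m := m)
    hx₀ h1 h2).and (Ioo_mem_nhdsGT (lt_min hδ₀ (norm_pos_iff.2 hx₀)))).exists
  have hx₀b : x₀ ∈ Metric.closedBall x₀ δ := Metric.mem_closedBall_self hδ.le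
  refine ⟨hPF.mono fun w hw => hw x₀ hx₀b, ?_⟩
  have hP' : ∀ x ∈ Metric.closedBall x₀ δ, x ≠ x₀ → P.eval x ≠ 0 := fun x hx hne =>
    hball (Metric.closedBall_subset_closedBall (hδx.le.trans (min_le_left _ _)) hx) hne
  have h0 : ∀ x ∈ Metric.closedBall x₀ δ, x ≠ 0 := by
    rintro x hx rfl
    rw [mem_closedBall_iff_norm, zero_sub, norm_neg] at hx
    linarith [min_le_right δ₀ ‖x₀‖]
  set φ : ℂ → ℂ → ℂ := fun w x => pPow w (-c.order) * (F w (x * pPow w ζ) /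
      poleFactor (y * pPow w τ) (Complex.exp w) q m (x * pPow w ζ)) with hφ
  have hφd : ∀ᶠ w in cusp, DifferentiableOn ℂ (φ w) (Metric.closedBall x₀ δ) := by
    filter_upwards [hFd, hPF, eventually_norm_exp_le (show (0 : ℝ) < 1 / 2 by norm_num)]
      with w hFd hPF hp x hx
    have hxζ := mul_ne_zero (h0 x hx) (pPow_ne_zero w ζ)
    have h3 := differentiableAt_comp_mul
      (hFd.differentiableAt (isOpen_compl_singleton.mem_nhds hxζ))
    have h4 := differentiableAt_comp_mul (differentiableAt_poleFactor (m := m) hq0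
      (norm_lt_one_of_le_half hp) (Complex.exp_ne_zero w)
      (mul_ne_zero hy (pPow_ne_zero w τ)) hxζ)
    exact ((h3.div h4 (hPF x hx)).const_mul _).differentiableWithinAt
  have hφf : ∀ᶠ w in cusp, ∀ x ∈ Metric.closedBall x₀ δ,
      φ w x = pPow w (-c.order) * f w (x * pPow w ζ) := by
    filter_upwards [hFf, hPF] with w hFf hPF x hx
    have hne := hPF x hx
    simp only [hφ]
    rw [hFf _ (mul_ne_zero (h0 x hx) (pPow_ne_zero w ζ)) hne, mul_div_cancel_left₀ _ hne]
  have hS : ∀ x ∈ Metric.sphere x₀ δ, x ≠ 0 ∧ P.eval x ≠ 0 := fun x hx => by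
    refine ⟨h0 x (Metric.sphere_subset_closedBall hx), hP' x (Metric.sphere_subset_closedBall hx) ?_⟩
    rintro rfl
    rw [mem_sphere_iff_norm, sub_self, norm_zero] at hx
    exact hδ.ne hx
  obtain ⟨B, hB⟩ := (isCompact_sphere x₀ δ).exists_bound_of_continuousOn
    (ratEval_continuousOn fun z hz => hPd z (hS z hz).2)
  have hconv := hK _ (isCompact_sphere x₀ δ) hS
  have hbound : ∀ᶠ w in cusp, ∀ x ∈ Metric.closedBall x₀ δ, ‖φ w x‖ ≤ B + 1 := by
    filter_upwards [hφd, hφf, hconv 1 one_pos] with w hφd hφf hc x hx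
    refine norm_le_on_closedBall hδ hφd (fun z hz => ?_) hx
    rw [hφf z (Metric.sphere_subset_closedBall hz)]
    have h3 := norm_add_le (pPow w (-c.order) * f w (z * pPow w ζ) - ratEval c.leadingCoeff z)
      (ratEval c.leadingCoeff z)
    rw [sub_add_cancel] at h3
    linarith [hc z hz, hB z hz]
  have hlc : ∀ x ∈ Metric.closedBall x₀ δ, x ≠ x₀ → ‖ratEval c.leadingCoeff x‖ ≤ B + 2 :=
    fun x hx hne => by
    have h3 := hK {x} isCompact_singleton (fun z hz => by
      rw [Set.mem_singleton_iff.1 hz]; exact ⟨h0 x hx, hP' x hx hne⟩) 1 one_pos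
    obtain ⟨w, hw1, hw2, hw3⟩ := (h3.and (hbound.and hφf)).exists
    have h4 := hw1 x rfl
    rw [← hw3 x hx] at h4
    have h5 := norm_sub_norm_le (ratEval c.leadingCoeff x) (φ w x)
    rw [norm_sub_rev] at h5
    linarith [hw2 x hx]
  -- The leading coefficient is bounded near x₀ as a limit of functions bounded there. Numerator and
  -- denominator are coprime, so it has no pole at x₀.
  have hden₀ : c.leadingCoeff.denom.eval x₀ ≠ 0 := fun hd0 => by
    obtain ⟨a, b, hab⟩ := RatFunc.isCoprime_num_denom c.leadingCoeff
    have hn0 : c.leadingCoeff.num.eval x₀ ≠ 0 := fun hn => by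
      have := congrArg (Polynomial.eval x₀) hab
      simp [hn, hd0] at this
    have hle : ∀ᶠ x in 𝓝[≠] x₀, ‖c.leadingCoeff.num.eval x‖ ≤
        (B + 2) * ‖c.leadingCoeff.denom.eval x‖ := by
      rw [eventually_nhdsWithin_iff]
      filter_upwards [Metric.closedBall_mem_nhds x₀ hδ] with x hx hne
      have h3 := hlc x hx hne
      have h4 := norm_pos_iff.2 (hPd x (hP' x hx hne))
      rwa [ratEval_eq, norm_div, div_le_iff₀ h4] at h3
    have hc1 : Tendsto (fun x => ‖c.leadingCoeff.num.eval x‖) (𝓝[≠] x₀)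
        (𝓝 ‖c.leadingCoeff.num.eval x₀‖) :=
      (c.leadingCoeff.num.continuous.norm.tendsto x₀).mono_left nhdsWithin_le_nhds
    have hc2 : Tendsto (fun x => (B + 2) * ‖c.leadingCoeff.denom.eval x‖) (𝓝[≠] x₀)
        (𝓝 ((B + 2) * ‖c.leadingCoeff.denom.eval x₀‖)) :=
      ((c.leadingCoeff.denom.continuous.norm.tendsto x₀).const_mul _).mono_left nhdsWithin_le_nhds
    have := le_of_tendsto_of_tendsto hc1 hc2 hle
    rw [hd0, norm_zero, mul_zero] at this
    exact hn0 (norm_le_zero_iff.1 this)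
  have hden : ∀ x ∈ Metric.closedBall x₀ δ, c.leadingCoeff.denom.eval x ≠ 0 := fun x hx => by
    rcases eq_or_ne x x₀ with rfl | hne
    · exact hden₀
    · exact hPd x (hP' x hx hne)
  have hlcd : DifferentiableOn ℂ (ratEval c.leadingCoeff) (Metric.closedBall x₀ δ) := by
    have : ratEval c.leadingCoeff = fun z => c.leadingCoeff.num.eval z / c.leadingCoeff.denom.eval z :=
      funext fun z => ratEval_eq _ z
    rw [this]
    exact c.leadingCoeff.num.differentiable.differentiableOn.div
      c.leadingCoeff.denom.differentiable.differentiableOn hden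
  rw [Metric.tendsto_nhds]
  intro ε hε
  filter_upwards [hφd, hφf, hconv (ε / 2) (half_pos hε)] with w hφd hφf hc
  rw [dist_eq_norm]
  refine lt_of_le_of_lt ?_ (half_lt_self hε)
  -- The difference to the leading coefficient is holomorphic on the ball and small on the sphere,
  -- hence small at the centre.
  refine norm_le_on_closedBall (f := fun x => φ w x - ratEval c.leadingCoeff x) hδ
    (hφd.sub hlcd) (fun z hz => ?_) hx₀b
  rw [hφf z (Metric.sphere_subset_closedBall hz)]
  exact hc z hz

end family

end EllipticPairing

end

noncomputable section

namespace EllipticPairing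

/-! ### The residues -/

/-- The pairs that contain a combine with the gamma functions of the residue at S_a q^k; the other
pairs have a limit of their own. -/
lemma prod_pairs {g : Fin 6 → Fin 6 → ℂ} (hg : ∀ r s, g r s = g s r) (a : Fin 6) :
    ∏ rs : Fin 6 × Fin 6 with rs.1 < rs.2, g rs.1 rs.2 =
      (∏ r ∈ Finset.univ.erase a, g r a) *
        ∏ rs : Fin 6 × Fin 6 with rs.1 < rs.2 ∧ rs.1 ≠ a ∧ rs.2 ≠ a, g rs.1 rs.2 := by
  rw [← Finset.prod_filter_mul_prod_filter_not _ fun rs : Fin 6 × Fin 6 => rs.1 ≠ a ∧ rs.2 ≠ a,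
    Finset.filter_filter, mul_comm]
  congr 1
  rw [Finset.filter_filter]
  refine (Finset.prod_bij (fun r _ => (min r a, max r a)) ?_ ?_ ?_ ?_).symm
  · intro r hr
    have hra := Finset.ne_of_mem_erase hr
    simp only [Finset.mem_filter, Finset.mem_univ, true_and]
    rcases lt_or_gt_of_ne hra with h | h
    · simp [min_eq_left h.le, max_eq_right h.le, h]
    · simp [min_eq_right h.le, max_eq_left h.le, h]
  · intro r hr s hs h
    have hra := Finset.ne_of_mem_erase hr
    have hsa := Finset.ne_of_mem_erase hs
    rw [Prod.mk.injEq] at h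
    grind
  · rintro ⟨r, s⟩ h
    simp only [Finset.mem_filter, Finset.mem_univ, true_and] at h
    by_cases hr : r = a
    · refine ⟨s, Finset.mem_erase.2 ⟨fun hs => ?_, Finset.mem_univ s⟩, ?_⟩
      · rw [hr, hs] at h; exact lt_irrefl _ h.1
      · rw [← hr, min_eq_right h.1.le, max_eq_left h.1.le]
    · have hs : s = a := by tauto
      refine ⟨r, Finset.mem_erase.2 ⟨hr, Finset.mem_univ r⟩, ?_⟩
      rw [← hs, min_eq_left h.1.le, max_eq_right h.1.le]
  · intro r hr
    rcases le_total r a with h | h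
    · rw [min_eq_left h, max_eq_right h]
    · rw [min_eq_right h, max_eq_left h, hg]

lemma qPochFin_inv_pow {q : ℂ} (hq0 : q ≠ 0) (k : ℕ) :
    qPochFin (q ^ k)⁻¹ q k * q ^ (k + 1).choose 2 = (-1) ^ k * qPochFin q q k := by
  rw [qPochFin, qPochFin, ← Finset.prod_range_reflect]
  have h1 : q ^ (k + 1).choose 2 = ∏ j ∈ Finset.range k, q ^ (j + 1) := by
    have h := Finset.sum_range_succ' (fun i => i) k
    rw [add_zero] at h
    rw [Finset.prod_pow_eq_pow_sum, ← h, Finset.sum_range_id, Nat.choose_two_right]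
  have h2 : ((-1 : ℂ)) ^ k = ∏ j ∈ Finset.range k, (-1) := by simp
  rw [h1, h2, ← Finset.prod_mul_distrib, ← Finset.prod_mul_distrib]
  refine Finset.prod_congr rfl fun j hj => ?_
  have hj' : q ^ k = q ^ (k - 1 - j) * q ^ (j + 1) := by
    rw [← pow_add]; congr 1; have := Finset.mem_range.1 hj; omega
  rw [hj']
  have := pow_ne_zero (k - 1 - j) hq0
  field_simp
  ring

lemma dPoch_mul_pow_ne_zero {p q : ℂ} (hp : ‖p‖ < 1) (hq : ‖q‖ < 1) {x : ℂ}
    (h : dPoch p q x ≠ 0) (n : ℕ) : dPoch p q (x * q ^ n) ≠ 0 := by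
  induction n with
  | zero => simpa using h
  | succ n ih =>
    rw [dPoch_right hp hq] at ih
    rw [pow_succ, ← mul_assoc]
    exact right_ne_zero_of_mul ih

section residue

variable {p q : ℂ} (hp : ‖p‖ < 1) (hq : ‖q‖ < 1) (hp0 : p ≠ 0) (hq0 : q ≠ 0)

include hp hq hp0 hq0 in
-- For u = xq^k the values θ(u²;q) and θ(xu;q) differ by a monomial, and Γ(pxu) = θ(xu;q) Γ(xu). So
-- the theta function with nome q, whose argument tends to 0 or infinity, is absorbed. The remaining
-- Γ has an argument of size |p|^{1+2α_a}, while the monomial contains the power p^{-2kα_a}.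
lemma theta_mul_theta_mul_ellGamma {x : ℂ} (hx : x ≠ 0) (k : ℕ)
    (h : dPoch p q (x * (x * q ^ k)) ≠ 0) :
    theta ((x * q ^ k) ^ 2) p * theta ((x * q ^ k)⁻¹ ^ 2) q * ellGamma (x * (x * q ^ k)) p q =
      theta ((x * q ^ k)⁻¹ ^ 2) p * ellGamma (x * (x * q ^ k) * p) p q *
        ((-(x * (x * q ^ k))) ^ k * q ^ k.choose 2)⁻¹ := by
  have hqk := pow_ne_zero k hq0
  have hu := mul_ne_zero hx hqk
  have hxu := mul_ne_zero hx hu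
  have hu2 := pow_ne_zero 2 hu
  rw [inv_pow, theta_inv hp hp0 hu2, theta_inv hq hq0 hu2, ellGamma_mul_left_of_ne hp hq hp0 hxu h,
    ← theta_mul_pow hq hq0 hxu k, show x * (x * q ^ k) * q ^ k = (x * q ^ k) ^ 2 by ring]
  have h1 : (-(x * (x * q ^ k))) ^ k ≠ 0 := pow_ne_zero k (neg_ne_zero.2 hxu)
  have h2 := pow_ne_zero (k.choose 2) hq0
  field_simp

include hq0 in
lemma gammaResidue_eq (k : ℕ) : gammaResidue p q k =
    (-1) ^ k * q ^ (k + 1).choose 2 / (qPochFin q q k * qPoch q q) *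
      (dPoch p q (p * q * q ^ k) / dPoch p q ((q ^ k)⁻¹ * p)) := by
  rw [gammaResidue, div_inv_eq_mul]
  have h := qPochFin_inv_pow hq0 k
  have h1 := pow_ne_zero ((k + 1).choose 2) hq0
  have h2 : qPochFin (q ^ k)⁻¹ q k = (-1) ^ k * qPochFin q q k / q ^ (k + 1).choose 2 := by
    rw [eq_div_iff h1, h]
  rw [h2]
  have h3 : (((-1 : ℂ)) ^ k)⁻¹ = (-1) ^ k := by rw [← inv_pow]; norm_num
  simp only [div_eq_mul_inv, mul_inv, inv_inv, h3]
  ring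

/-- The residues of the integrand, multiplied by the factor in front of the integral. -/
lemma prefactor_mul_kernelResidue (T S : Fin 6 → ℂ) (a : Fin 6) (F G : ℂ → ℂ) (k : ℕ)
    (hp : ‖p‖ < 1) (hq : ‖q‖ < 1) (hp0 : p ≠ 0) (hq0 : q ≠ 0) (hSa : S a ≠ 0)
    (h : dPoch p q (S a * (S a * q ^ k)) ≠ 0) :
    qPoch q q * qPoch p p /
        (∏ rs : Fin 6 × Fin 6 with rs.1 < rs.2, ellGamma (T rs.1 * T rs.2) p q) *
      kernelResidue p q S a F G k =
    F (S a * q ^ k) * G (S a * q ^ k) *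
      (∏ r ∈ Finset.univ.erase a, ellGamma (S r * (S a * q ^ k)) p q / ellGamma (T r * T a) p q *
        ellGamma (S r * (S a * q ^ k)⁻¹) p q) *
      (theta ((S a * q ^ k)⁻¹ ^ 2) p * ellGamma (S a * (S a * q ^ k) * p) p q) *
      (((-(S a * (S a * q ^ k))) ^ k * q ^ k.choose 2)⁻¹ *
        ((-1) ^ k * q ^ (k + 1).choose 2 / qPochFin q q k)) *
      (qPoch p p * (dPoch p q (p * q * q ^ k) / dPoch p q ((q ^ k)⁻¹ * p))) *
      ∏ rs : Fin 6 × Fin 6 with rs.1 < rs.2 ∧ rs.1 ≠ a ∧ rs.2 ≠ a,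
        (ellGamma (T rs.1 * T rs.2) p q)⁻¹ := by
  have hqq : qPoch q q ≠ 0 := fun h => by
    obtain ⟨r, hr⟩ := (qPoch_eq_zero_iff hq).1 h
    have : ‖q ^ (r + 1)‖ < 1 := by rw [norm_pow]; exact pow_lt_one₀ (norm_nonneg _) hq (by omega)
    rw [pow_succ', hr, norm_one] at this
    exact lt_irrefl _ this
  have e := theta_mul_theta_mul_ellGamma hp hq hp0 hq0 hSa k h
  have e' : qPoch q q * gammaResidue p q k = ((-1) ^ k * q ^ (k + 1).choose 2 / qPochFin q q k) *
      (dPoch p q (p * q * q ^ k) / dPoch p q ((q ^ k)⁻¹ * p)) := by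
    rw [gammaResidue_eq hq0]
    field_simp
  rw [prod_pairs (g := fun r s => ellGamma (T r * T s) p q) (fun r s => by rw [mul_comm]) a]
  simp only [kernelResidue]
  simp only [Finset.prod_mul_distrib, Finset.prod_div_distrib, Finset.prod_inv_distrib]
  rw [mul_assoc (F (S a * q ^ k) * G (S a * q ^ k)), e]
  generalize ((-(S a * (S a * q ^ k))) ^ k * q ^ k.choose 2)⁻¹ = Z
  generalize (-1) ^ k * q ^ (k + 1).choose 2 / qPochFin q q k = W at e' ⊢
  generalize dPoch p q (p * q * q ^ k) / dPoch p q ((q ^ k)⁻¹ * p) = D at e' ⊢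
  generalize gammaResidue p q k = R at e' ⊢
  generalize ∏ r ∈ Finset.univ.erase a, ellGamma (T r * T a) p q = X
  generalize (∏ rs : Fin 6 × Fin 6 with rs.1 < rs.2 ∧ rs.1 ≠ a ∧ rs.2 ≠ a,
    ellGamma (T rs.1 * T rs.2) p q) = Y
  generalize ∏ r ∈ Finset.univ.erase a, ellGamma (S r * (S a * q ^ k)) p q = M₁
  generalize ∏ r ∈ Finset.univ.erase a, ellGamma (S r * (S a * q ^ k)⁻¹) p q = M₂
  generalize theta ((S a * q ^ k)⁻¹ ^ 2) p * ellGamma (S a * (S a * q ^ k) * p) p q = M₃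
  generalize F (S a * q ^ k) * G (S a * q ^ k) = M₄
  rw [div_mul_eq_div_div]
  calc _ = qPoch p p / X / Y * (M₄ * (M₃ * Z) * (M₁ * M₂)) * (qPoch q q * R) := by ring
    _ = _ := by rw [e']; ring

end residue

end EllipticPairing

end

noncomputable section

namespace EllipticPairing

/-! ### The limits of the residues -/

/-- The hypotheses on the parameters and their exponents. -/
structure Admissible (q : ℂ) (t : Fin 6 → ℂ) (α : Fin 6 → ℝ) (a : Fin 6) : Prop where
  q_ne : q ≠ 0
  q_lt : ‖q‖ < 1
  t_ne : ∀ r, t r ≠ 0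
  generic : Generic q t
  a_le : a ≤ 3
  half_le : -1 / 2 ≤ α a
  neg : α a < 0
  lt : ∀ r, r ≠ a → α a < α r
  le : ∀ r, r ≠ a → α r ≤ 1 + α a
  pos : ∀ r s, r ≠ a → s ≠ a → r ≠ s → 0 < α r + α s
  le_one : ∀ r s, r ≠ a → s ≠ a → r ≠ s → α r + α s ≤ 1
  bal : 2 * α a = ∑ r : Fin 6 with r ≠ a ∧ α r + α a < 0, (α r + α a)

/-- The limit of `p^{max(0,-γ)} θ(y p^γ; p)`. -/
def thetaLim (γ : ℝ) (y : ℂ) : ℂ := if γ < 0 then -y else 1 - powLim γ y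

/-- The limit of `Γ(y p^γ)` for `0 < γ ≤ 1`. -/
def gammaLim (q : ℂ) (γ : ℝ) (y : ℂ) : ℂ := qPoch (powLim (1 - γ) (q / y)) q

lemma tendsto_thetaLim {γ : ℝ} (h1 : -1 < γ) (h2 : γ < 1) {y : ℂ} (hy : y ≠ 0) :
    Tendsto (fun w => pPow w (max 0 (-γ)) * theta (y * pPow w γ) (Complex.exp w)) cusp
      (𝓝 (thetaLim γ y)) := by
  rw [thetaLim]
  split_ifs with h
  · rw [max_eq_right (by linarith)]
    exact tendsto_theta_neg h h1 hy
  · rw [max_eq_left (by linarith)]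
    have := tendsto_theta (not_lt.1 h) h2.le y
    rw [powLim, powLim, if_neg (show 1 - γ ≠ 0 by linarith), sub_zero, mul_one] at this
    simpa only [pPow_zero, one_mul, powLim] using this

lemma tendsto_gammaLim {q : ℂ} (hq : ‖q‖ < 1) {γ : ℝ} (h1 : 0 < γ) (h2 : γ ≤ 1) (y : ℂ) :
    Tendsto (fun w => ellGamma (y * pPow w γ) (Complex.exp w) q) cusp (𝓝 (gammaLim q γ y)) := by
  have h : powLim γ y = 0 := if_neg h1.ne'
  have := tendsto_ellGamma hq h1.le h2 (y := y) (by rw [h, qPoch_zero_left]; exact one_ne_zero)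
  rwa [h, qPoch_zero_left, div_one] at this

lemma gammaLim_eq_ite (q : ℂ) (γ : ℝ) (y : ℂ) :
    gammaLim q γ y = if γ = 1 then qPoch (q / y) q else 1 := by
  rw [gammaLim, powLim]
  by_cases h : γ = 1
  · rw [if_pos h, if_pos (by linarith)]
  · rw [if_neg h, if_neg fun h' => h (by linarith), qPoch_zero_left]

lemma qPoch_ne_zero_of_forall {q x : ℂ} (hq : ‖q‖ < 1) (h : ∀ n : ℕ, x * q ^ n ≠ 1) :
    qPoch x q ≠ 0 := fun h0 => by
  obtain ⟨n, hn⟩ := (qPoch_eq_zero_iff hq).1 h0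
  exact h n hn

lemma prod_erase_ite (a : Fin 6) (P : Fin 6 → Prop) [DecidablePred P] (f : Fin 6 → ℂ) :
    (∏ r ∈ Finset.univ.erase a, if P r then f r else 1) = ∏ r : Fin 6 with r ≠ a ∧ P r, f r := by
  rw [← Finset.prod_filter]
  refine Finset.prod_congr ?_ fun _ _ => rfl
  ext r
  simp

namespace Admissible

variable {q : ℂ} {t : Fin 6 → ℂ} {α : Fin 6 → ℝ} {a : Fin 6} (h : Admissible q t α a)

include h

lemma prod_ne_zpow (r s : Fin 6) (n : ℤ) : t r * t s ≠ q ^ n := h.generic.1 r s n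

lemma div_ne_zpow {r s : Fin 6} (hrs : r ≠ s) (n : ℤ) : t r / t s ≠ q ^ n := h.generic.2 r s n hrs

lemma qPoch_mul_ne_zero (r s : Fin 6) : qPoch (t r * t s) q ≠ 0 :=
  qPoch_ne_zero_of_forall h.q_lt fun n hn => h.prod_ne_zpow r s (-n) (by
    rw [zpow_neg, zpow_natCast]; exact eq_inv_of_mul_eq_one_left hn)

lemma qPoch_mul_div_ne_zero {r s : Fin 6} (hrs : r ≠ s) : qPoch (q * t r / t s) q ≠ 0 :=
  qPoch_ne_zero_of_forall h.q_lt fun n hn => h.div_ne_zpow hrs (-(n + 1)) (by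
    rw [zpow_neg, zpow_add_one₀ h.q_ne, zpow_natCast]
    refine eq_inv_of_mul_eq_one_left ?_
    rw [← hn]; ring)

lemma qPoch_div_mul_ne_zero (r s : Fin 6) : qPoch (q / (t r * t s)) q ≠ 0 :=
  qPoch_ne_zero_of_forall h.q_lt fun n hn => h.prod_ne_zpow r s (n + 1) (by
    have := mul_ne_zero (h.t_ne r) (h.t_ne s)
    rw [zpow_add_one₀ h.q_ne, zpow_natCast]
    rw [div_mul_eq_mul_div, div_eq_one_iff_eq this] at hn
    rw [← hn]; ring)

lemma qPoch_mul_sq_ne_zero : qPoch (q * t a ^ 2) q ≠ 0 :=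
  qPoch_ne_zero_of_forall h.q_lt fun n hn => h.prod_ne_zpow a a (-(n + 1)) (by
    rw [zpow_neg, zpow_add_one₀ h.q_ne, zpow_natCast]
    refine eq_inv_of_mul_eq_one_left ?_
    rw [← hn]; ring)

lemma ne_four : a ≠ 4 := fun h' => absurd h.a_le (by rw [h']; decide)

lemma ne_five : a ≠ 5 := fun h' => absurd h.a_le (by rw [h']; decide)

lemma ne_of_eq_neg {r : Fin 6} (hr : α r = -α a) : r ≠ a := by
  rintro rfl; linarith [h.neg]

lemma ne_of_eq_add_one {r : Fin 6} (hr : α r = α a + 1) : r ≠ a := by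
  rintro rfl; linarith [h.neg]

/-- There are three cases. If α_r + α_a < 0, the limits are the monomials −t_r t_a q^j, whose
product contains (−1)^k q^{k(k-1)/2}; if the sum is 0 they form (t_r t_a;q)_k; otherwise they are 1.
-/
lemma prod_thetaLim (k : ℕ) :
    ∏ r ∈ Finset.univ.erase a, ∏ j ∈ Finset.range k, thetaLim (α r + α a) (t r * t a * q ^ j) =
      (∏ r : Fin 6 with α r = -α a, qPochFin (t r * t a) q k) *
        ((∏ r : Fin 6 with r ≠ a ∧ α r + α a < 0, t r) ^ k * (t a ^ countN α a) ^ k *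
          ((-1) ^ k * q ^ k.choose 2) ^ countN α a) := by
  have e1 : ∀ r ∈ Finset.univ.erase a,
      ∏ j ∈ Finset.range k, thetaLim (α r + α a) (t r * t a * q ^ j) =
      (if α r = -α a then qPochFin (t r * t a) q k else 1) *
        if α r + α a < 0 then t r ^ k * t a ^ k * ((-1) ^ k * q ^ k.choose 2) else 1 :=
    fun r _ => by
    by_cases h1 : α r + α a < 0
    · rw [if_neg (by linarith), if_pos h1, one_mul, Nat.choose_two_right, ← Finset.sum_range_id,
        ← Finset.prod_pow_eq_pow_sum]
      have h2 : ∀ x : ℂ, x ^ k = ∏ j ∈ Finset.range k, x := fun x => by simp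
      rw [h2 (t r), h2 (t a), h2 (-1), ← Finset.prod_mul_distrib, ← Finset.prod_mul_distrib,
        ← Finset.prod_mul_distrib]
      refine Finset.prod_congr rfl fun j _ => ?_
      rw [thetaLim, if_pos h1]
      ring
    · rw [if_neg h1, mul_one]
      split_ifs with h2
      · refine Finset.prod_congr rfl fun j _ => ?_
        rw [thetaLim, if_neg h1, powLim, if_pos (by linarith)]
      · refine Finset.prod_eq_one fun j _ => ?_
        rw [thetaLim, if_neg h1, powLim, if_neg fun h3 => h2 (by linarith), sub_zero]
  have e2 : (Finset.univ.filter fun r : Fin 6 => r ≠ a ∧ α r = -α a) =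
      Finset.univ.filter fun r : Fin 6 => α r = -α a :=
    Finset.filter_congr fun r _ => ⟨fun h' => h'.2, fun h' => ⟨h.ne_of_eq_neg h', h'⟩⟩
  have e3 : (Finset.univ.filter fun r : Fin 6 => r ≠ a ∧ α r + α a < 0).card = countN α a := by
    rw [countN]
    congr 1
    exact Finset.filter_congr fun r _ => by rw [lt_neg_iff_add_neg]
  rw [Finset.prod_congr rfl e1, Finset.prod_mul_distrib, prod_erase_ite, prod_erase_ite, e2,
    Finset.prod_mul_distrib, Finset.prod_mul_distrib, Finset.prod_const, Finset.prod_const,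
    Finset.prod_pow, e3, pow_right_comm (t a)]

lemma prod_gammaLim (k : ℕ) :
    ∏ r ∈ Finset.univ.erase a, gammaLim q (α r - α a) (t r / (t a * q ^ k)) =
      (∏ r : Fin 6 with α r = α a + 1, qPoch (q * t a / t r) q) /
        ∏ r : Fin 6 with α r = α a + 1, qPochFin (q * t a / t r) q k := by
  have e2 : (Finset.univ.filter fun r : Fin 6 => r ≠ a ∧ α r = α a + 1) =
      Finset.univ.filter fun r : Fin 6 => α r = α a + 1 :=
    Finset.filter_congr fun r _ => ⟨fun h' => h'.2, fun h' => ⟨h.ne_of_eq_add_one h', h'⟩⟩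
  have e1 : ∀ r ∈ Finset.univ.erase a, gammaLim q (α r - α a) (t r / (t a * q ^ k)) =
      if α r = α a + 1 then qPoch (q * t a / t r) q / qPochFin (q * t a / t r) q k else 1 :=
    fun r hr => by
    rw [gammaLim_eq_ite]
    refine if_congr (by constructor <;> intro <;> linarith) ?_ rfl
    have h1 := qPoch_eq_qPochFin_mul h.q_lt (q * t a / t r) k
    have h2 := h.qPoch_mul_div_ne_zero (Finset.ne_of_mem_erase hr).symm
    rw [h1] at h2 ⊢
    rw [mul_div_cancel_left₀ _ (left_ne_zero_of_mul h2)]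
    congr 1
    have := h.t_ne r
    field_simp
  rw [Finset.prod_congr rfl e1, prod_erase_ite, e2, Finset.prod_div_distrib]

/-- Pairs without a have a positive sum of exponents, so sum 0 occurs only together with a, and
these factors cancel the ones in the denominator. Pairs with a have α_r + α_a ≤ 1 + 2α_a < 1, so sum
1 occurs only without a. -/
lemma limitPrefactor_eq : limitPrefactor q t α a =
    (∏ r : Fin 6 with α r = α a + 1, qPoch (q * t a / t r) q) *
      (∏ rs : Fin 6 × Fin 6 with rs.1 < rs.2 ∧ rs.1 ≠ a ∧ rs.2 ≠ a,
        (gammaLim q (α rs.1 + α rs.2) (t rs.1 * t rs.2))⁻¹) *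
      (if α a = -1 / 2 then 1 / qPoch (q * t a ^ 2) q else 1) := by
  have e0 : (Finset.univ.filter fun r : Fin 6 => r ≠ a ∧ α r = -α a) =
      Finset.univ.filter fun r : Fin 6 => α r = -α a :=
    Finset.filter_congr fun r _ => ⟨fun h' => h'.2, fun h' => ⟨h.ne_of_eq_neg h', h'⟩⟩
  have e1 : ∏ rs : Fin 6 × Fin 6 with rs.1 < rs.2 ∧ α rs.1 + α rs.2 = 0,
      qPoch (t rs.1 * t rs.2) q = ∏ r : Fin 6 with α r = -α a, qPoch (t r * t a) q := by
    have e5 : (∏ rs : Fin 6 × Fin 6 with rs.1 < rs.2 ∧ rs.1 ≠ a ∧ rs.2 ≠ a,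
        if α rs.1 + α rs.2 = 0 then qPoch (t rs.1 * t rs.2) q else 1) = 1 :=
      Finset.prod_eq_one fun rs hrs => by
        obtain ⟨h1, h2, h3⟩ := (Finset.mem_filter.1 hrs).2
        exact if_neg (h.pos _ _ h2 h3 h1.ne).ne'
    rw [← Finset.filter_filter, Finset.prod_filter,
      prod_pairs (g := fun r s => if α r + α s = 0 then qPoch (t r * t s) q else 1)
        (fun r s => by rw [add_comm, mul_comm]) a, prod_erase_ite, e5, mul_one, ← e0]
    refine Finset.prod_congr (Finset.filter_congr fun r _ => ?_) fun _ _ => rfl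
    rw [add_eq_zero_iff_eq_neg]
  have e2 : ∏ rs : Fin 6 × Fin 6 with rs.1 < rs.2 ∧ α rs.1 + α rs.2 = 1,
      qPoch (q / (t rs.1 * t rs.2)) q =
      ∏ rs : Fin 6 × Fin 6 with rs.1 < rs.2 ∧ rs.1 ≠ a ∧ rs.2 ≠ a,
        gammaLim q (α rs.1 + α rs.2) (t rs.1 * t rs.2) := by
    rw [← Finset.filter_filter, Finset.prod_filter,
      prod_pairs (g := fun r s => if α r + α s = 1 then qPoch (q / (t r * t s)) q else 1)
        (fun r s => by rw [add_comm, mul_comm]) a]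
    have e4 : ∏ r ∈ Finset.univ.erase a,
        (if α r + α a = 1 then qPoch (q / (t r * t a)) q else 1) = 1 :=
      Finset.prod_eq_one fun r hr =>
        if_neg (by linarith [h.le r (Finset.ne_of_mem_erase hr), h.neg])
    rw [e4, one_mul]
    exact Finset.prod_congr rfl fun rs _ => (gammaLim_eq_ite _ _ _).symm
  have e3 : ∏ r : Fin 6 with α r = -α a, qPoch (t r * t a) q ≠ 0 :=
    Finset.prod_ne_zero_iff.2 fun r _ => h.qPoch_mul_ne_zero r a
  rw [limitPrefactor, e1, e2, Finset.prod_inv_distrib, mul_comm (∏ r : Fin 6 with α r = -α a, _),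
    mul_div_mul_right _ _ e3, div_eq_mul_inv]

lemma limitPrefactor_ne_zero : limitPrefactor q t α a ≠ 0 := by
  rw [h.limitPrefactor_eq]
  refine mul_ne_zero (mul_ne_zero (Finset.prod_ne_zero_iff.2 fun r hr => ?_)
    (Finset.prod_ne_zero_iff.2 fun rs _ => inv_ne_zero ?_)) ?_
  · exact h.qPoch_mul_div_ne_zero (h.ne_of_eq_add_one (Finset.mem_filter.1 hr).2).symm
  · rw [gammaLim_eq_ite]
    split_ifs
    exacts [h.qPoch_div_mul_ne_zero _ _, one_ne_zero]
  · split_ifs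
    exacts [one_div_ne_zero h.qPoch_mul_sq_ne_zero, one_ne_zero]

/-- Exactly for α_a = −1/2 the exponent 1 + 2α_a is 0 and the very-well-poised factor survives. -/
lemma one_sub_powLim_div (k : ℕ) :
    (1 - powLim (1 + 2 * α a) ((t a * q ^ k) ^ 2)) *
      (1 / qPoch (powLim (1 + 2 * α a) (t a * (t a * q ^ k))) q) =
    (if α a = -1 / 2 then
      (1 - t a ^ 2 * q ^ (2 * k)) / (1 - t a ^ 2) * qPochFin (t a ^ 2) q k else 1) *
      (if α a = -1 / 2 then 1 / qPoch (q * t a ^ 2) q else 1) := by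
  rw [powLim, powLim]
  by_cases h1 : α a = -1 / 2
  · have h2 : 1 + 2 * α a = 0 := by rw [h1]; norm_num
    rw [if_pos h2, if_pos h2, if_pos h1, if_pos h1]
    have e1 := qPoch_eq_qPochFin_mul h.q_lt (t a ^ 2) k
    have e2 := qPoch_succ h.q_lt (t a ^ 2)
    have e3 : qPoch (t a ^ 2) q ≠ 0 := by rw [pow_two]; exact h.qPoch_mul_ne_zero a a
    have e4 := e3
    rw [e1] at e3
    rw [e2] at e4
    have n1 := left_ne_zero_of_mul e3
    have n2 := right_ne_zero_of_mul e3
    have n3 := left_ne_zero_of_mul e4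
    have n4 := right_ne_zero_of_mul e4
    rw [e2] at e1
    rw [show t a * (t a * q ^ k) = t a ^ 2 * q ^ k by ring, mul_comm q (t a ^ 2)]
    field_simp
    linear_combination (1 - t a ^ 2 * (q ^ k) ^ 2) * e1
  · have h2 : 1 + 2 * α a ≠ 0 := fun h2 => h1 (by linarith)
    rw [if_neg h2, if_neg h2, if_neg h1, if_neg h1, qPoch_zero_left]
    norm_num

/-- The exponent N − 2 arises as follows: each of the N theta products with a negative exponent
supplies one power of (−1)^k q^{k(k-1)/2}, and the quasi-period together with the residue of
Γ(S_a/z) removes two. The same holds for the powers of t_a^k. -/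
lemma limit_eq (k : ℕ) :
    (∏ r ∈ Finset.univ.erase a,
      (∏ j ∈ Finset.range k, thetaLim (α r + α a) (t r * t a * q ^ j)) *
        gammaLim q (α r - α a) (t r / (t a * q ^ k))) *
      ((1 - powLim (1 + 2 * α a) ((t a * q ^ k) ^ 2)) *
        (1 / qPoch (powLim (1 + 2 * α a) (t a * (t a * q ^ k))) q)) *
      (((-(t a * (t a * q ^ k))) ^ k * q ^ k.choose 2)⁻¹ *
        ((-1) ^ k * q ^ (k + 1).choose 2 / qPochFin q q k)) *
      (∏ rs : Fin 6 × Fin 6 with rs.1 < rs.2 ∧ rs.1 ≠ a ∧ rs.2 ≠ a,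
        (gammaLim q (α rs.1 + α rs.2) (t rs.1 * t rs.2))⁻¹) =
    limitPrefactor q t α a * limitWeight q t α a k := by
  have hq := h.q_ne
  have hta := h.t_ne a
  have hk : q ^ (k * k) = (q ^ k.choose 2) ^ 2 * q ^ k := by
    rw [← pow_mul, ← pow_add]
    congr 1
    induction k with
    | zero => rfl
    | succ k ih => rw [Nat.choose_succ_succ' k 1, Nat.choose_one_right]; linarith
  have hk' : q ^ (k + 1).choose 2 = q ^ k * q ^ k.choose 2 := by
    rw [Nat.choose_succ_succ' k 1, Nat.choose_one_right, pow_add]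
  have hs : ((-1 : ℂ) ^ k) ^ 2 = 1 := by rw [← pow_mul, mul_comm, pow_mul]; simp
  have hs' : (-1 : ℂ) ^ k ≠ 0 := pow_ne_zero _ (by norm_num)
  have hz : (-1) ^ k * q ^ k.choose 2 ≠ 0 := mul_ne_zero hs' (pow_ne_zero _ hq)
  have n1 := pow_ne_zero k hq
  have n2 := pow_ne_zero (k.choose 2) hq
  have n3 := pow_ne_zero k hta
  have e : ((-(t a * (t a * q ^ k))) ^ k * q ^ k.choose 2)⁻¹ *
      ((-1) ^ k * q ^ (k + 1).choose 2 / qPochFin q q k) =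
      (((-1) ^ k * q ^ k.choose 2) ^ 2)⁻¹ * ((t a ^ 2) ^ k)⁻¹ * (qPochFin q q k)⁻¹ := by
    rw [neg_pow (t a * (t a * q ^ k)), mul_pow (t a), mul_pow (t a), ← pow_mul q k k, hk, hk',
      mul_pow ((-1) ^ k) _ 2, hs, pow_right_comm (t a) 2 k]
    field_simp
  have hz2 : ((-1) ^ k * q ^ k.choose 2) ^ ((countN α a : ℤ) - 2) =
      ((-1) ^ k * q ^ k.choose 2) ^ countN α a * (((-1) ^ k * q ^ k.choose 2) ^ 2)⁻¹ := by
    rw [zpow_sub₀ hz, zpow_natCast, div_eq_mul_inv]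
    norm_cast
  have ht2 : t a ^ ((countN α a : ℤ) - 2) = t a ^ countN α a * (t a ^ 2)⁻¹ := by
    rw [zpow_sub₀ hta, zpow_natCast, div_eq_mul_inv]
    norm_cast
  rw [e, Finset.prod_mul_distrib, h.prod_thetaLim, h.prod_gammaLim, h.one_sub_powLim_div,
    h.limitPrefactor_eq, limitWeight, hz2, ht2, mul_pow _ _ k, mul_pow _ _ k, inv_pow,
    div_eq_mul_inv, div_eq_mul_inv (∏ r : Fin 6 with α r = -α a, qPochFin (t r * t a) q k), mul_inv]
  ring

end Admissible

end EllipticPairing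

end

/-! ### Residues in terms of the scaled parameters, and their limits -/

noncomputable section

namespace EllipticPairing

/-- The numerator `F` of a family `f` of elements of `A(y p^τ)` with an expansion `c` at `ζ`. -/
structure IsFamily (q y : ℂ) (τ ζ : ℝ) (m : ℕ) (f F : ℂ → ℂ → ℂ) (c : HahnSeries ℝ (RatFunc ℂ)) :
    Prop where
  expansion : HasExpansion ζ f c
  diff : ∀ᶠ w in cusp, DifferentiableOn ℂ (F w) {0}ᶜ
  eq : ∀ᶠ w in cusp, ∀ z : ℂ, z ≠ 0 → poleFactor (y * pPow w τ) (Complex.exp w) q m z ≠ 0 →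
    F w z = poleFactor (y * pPow w τ) (Complex.exp w) q m z * f w z
  symm : ∀ᶠ w in cusp, ∀ z : ℂ, z ≠ 0 → F w z⁻¹ = F w z

/-- The number of factors `q` by which `t̃_r` differs from `t_r`. -/
def shiftExp (mf mg : ℕ) (r : Fin 6) : ℕ := if r = 4 then mf else if r = 5 then mg else 0

lemma tildeParam_eq (q : ℂ) (mf mg : ℕ) (T : Fin 6 → ℂ) (r : Fin 6) :
    tildeParam q mf mg T r = T r / q ^ shiftExp mf mg r := by
  rw [tildeParam, shiftExp]
  split_ifs <;> simp

lemma tildeParam_mul_pow {q : ℂ} (hq0 : q ≠ 0) (mf mg : ℕ) (T : Fin 6 → ℂ) (r : Fin 6) :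
    tildeParam q mf mg T r * q ^ shiftExp mf mg r = T r := by
  rw [tildeParam_eq, div_mul_cancel₀ _ (pow_ne_zero _ hq0)]

lemma tildeParam_scaledParam (q : ℂ) (mf mg : ℕ) (t : Fin 6 → ℂ) (α : Fin 6 → ℝ) (w : ℂ)
    (r : Fin 6) :
    tildeParam q mf mg (scaledParam t α w) r = tildeParam q mf mg t r * pPow w (α r) := by
  rw [tildeParam_eq, tildeParam_eq, scaledParam]
  ring

lemma NonResonant.dPoch_ne_zero {p q : ℂ} {mf mg : ℕ} {T : Fin 6 → ℂ}
    (h : NonResonant p q mf mg T) (hp : ‖p‖ < 1) (hq : ‖q‖ < 1) (r s : Fin 6) :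
    dPoch p q (tildeParam q mf mg T r * tildeParam q mf mg T s) ≠ 0 := fun h0 => by
  obtain ⟨i, j, hij⟩ := (dPoch_eq_zero_iff hp hq).1 h0
  refine h _ ⟨r, i, j, rfl⟩ _ ⟨s, 0, 0, rfl⟩ ?_
  rw [← hij]
  ring

lemma poleFactor_zero (u p q z : ℂ) : poleFactor u p q 0 z = 1 := by
  simp [poleFactor, thetaFin]

section

variable {p q : ℂ} {mf mg : ℕ} {T : Fin 6 → ℂ} {a : Fin 6}

lemma prod_poleFactor (ha4 : a ≠ 4) (ha5 : a ≠ 5) (z : ℂ) :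
    ∏ r ∈ Finset.univ.erase a, poleFactor (T r) p q (shiftExp mf mg r) z =
      poleFactor (T 4) p q mf z * poleFactor (T 5) p q mg z := by
  have e : shiftExp mf mg a = 0 := by rw [shiftExp, if_neg ha4, if_neg ha5]
  have h := Finset.mul_prod_erase Finset.univ
    (fun r => poleFactor (T r) p q (shiftExp mf mg r) z) (Finset.mem_univ a)
  simp only [e, poleFactor_zero, one_mul] at h
  rw [h, Fin.prod_univ_six]
  simp [shiftExp, poleFactor_zero]

lemma tildeParam_self (ha4 : a ≠ 4) (ha5 : a ≠ 5) : tildeParam q mf mg T a = T a := by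
  rw [tildeParam, if_neg ha4, if_neg ha5]

lemma NonResonant.dPoch_mul_pow_ne_zero (h : NonResonant p q mf mg T) (hp : ‖p‖ < 1) (hq : ‖q‖ < 1)
    (hq0 : q ≠ 0) (r s : Fin 6) (k : ℕ) : dPoch p q (T r * T s * q ^ k) ≠ 0 := by
  have := EllipticPairing.dPoch_mul_pow_ne_zero hp hq (h.dPoch_ne_zero hp hq r s)
    (shiftExp mf mg r + shiftExp mf mg s + k)
  rwa [pow_add, pow_add, ← mul_assoc, ← mul_assoc, mul_right_comm _ (tildeParam q mf mg T s),
    tildeParam_mul_pow hq0, mul_assoc (T r), tildeParam_mul_pow hq0] at this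

/-- The shift equations return from t̃_r to t_r. The pole factors that arise divide F and G, which
restores f and g where they are holomorphic. The quotients Γ(T_r u)/Γ(T_r T_a) become products of k
theta functions. -/
lemma prefactor_mul_kernelResidue_eq (hp : ‖p‖ < 1) (hq : ‖q‖ < 1) (hp0 : p ≠ 0) (hq0 : q ≠ 0)
    (hT : ∀ r, T r ≠ 0) (ha4 : a ≠ 4) (ha5 : a ≠ 5) (hN : NonResonant p q mf mg T)
    (F G : ℂ → ℂ) (k : ℕ) (h4 : poleFactor (T 4) p q mf (T a * q ^ k) ≠ 0)
    (h5 : poleFactor (T 5) p q mg (T a * q ^ k) ≠ 0)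
    (hΓ : ∀ r, r ≠ a → ellGamma (T r * T a) p q ≠ 0) :
    qPoch q q * qPoch p p /
        (∏ rs : Fin 6 × Fin 6 with rs.1 < rs.2, ellGamma (T rs.1 * T rs.2) p q) *
      kernelResidue p q (tildeParam q mf mg T) a F G k =
    F (T a * q ^ k) / poleFactor (T 4) p q mf (T a * q ^ k) *
      (G (T a * q ^ k) / poleFactor (T 5) p q mg (T a * q ^ k)) *
      (∏ r ∈ Finset.univ.erase a, (∏ j ∈ Finset.range k, theta (T r * T a * q ^ j) p) *
        ellGamma (T r * (T a * q ^ k)⁻¹) p q) *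
      (theta ((T a * q ^ k)⁻¹ ^ 2) p * ellGamma (T a * (T a * q ^ k) * p) p q) *
      (((-(T a * (T a * q ^ k))) ^ k * q ^ k.choose 2)⁻¹ *
        ((-1) ^ k * q ^ (k + 1).choose 2 / qPochFin q q k)) *
      (qPoch p p * (dPoch p q (p * q * q ^ k) / dPoch p q ((q ^ k)⁻¹ * p))) *
      ∏ rs : Fin 6 × Fin 6 with rs.1 < rs.2 ∧ rs.1 ≠ a ∧ rs.2 ≠ a,
        (ellGamma (T rs.1 * T rs.2) p q)⁻¹ := by
  have hu : T a * q ^ k ≠ 0 := mul_ne_zero (hT a) (pow_ne_zero k hq0)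
  have hd : dPoch p q (tildeParam q mf mg T a * (tildeParam q mf mg T a * q ^ k)) ≠ 0 := by
    rw [tildeParam_self ha4 ha5, ← mul_assoc]
    exact hN.dPoch_mul_pow_ne_zero hp hq hq0 a a k
  rw [prefactor_mul_kernelResidue T _ a F G k hp hq hp0 hq0 (tildeParam_ne_zero hq0 hT a) hd,
    tildeParam_self ha4 ha5]
  congr 4
  set u := T a * q ^ k with hu'
  have hP : ∀ r, poleFactor (T r) p q (shiftExp mf mg r) u ≠ 0 := fun r => by
    by_cases hr4 : r = 4
    · rw [hr4]; exact h4
    by_cases hr5 : r = 5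
    · rw [hr5]; exact h5
    rw [shiftExp, if_neg hr4, if_neg hr5, poleFactor_zero]
    exact one_ne_zero
  have e1 : ∀ r ∈ Finset.univ.erase a,
      (∏ j ∈ Finset.range k, theta (T r * T a * q ^ j) p) * ellGamma (T r * u⁻¹) p q =
      poleFactor (T r) p q (shiftExp mf mg r) u *
        (ellGamma (tildeParam q mf mg T r * u) p q / ellGamma (T r * T a) p q *
          ellGamma (tildeParam q mf mg T r * u⁻¹) p q) := fun r hr => by
    have e2 := ellGamma_mul_ellGamma_eq hp hq hp0 hq0 (hT r) hu (hP r)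
    have e3 := ellGamma_mul_pow_of_ne hp hq hq0 (mul_ne_zero (hT r) (hT a))
      (by simpa using hN.dPoch_mul_pow_ne_zero hp hq hq0 r a 0) k
    rw [mul_assoc (T r), ← hu'] at e3
    rw [tildeParam_eq]
    have := hΓ r (Finset.ne_of_mem_erase hr)
    refine mul_right_cancel₀ this ?_
    calc _ = (∏ j ∈ Finset.range k, theta (T r * T a * q ^ j) p) * ellGamma (T r * T a) p q *
          ellGamma (T r * u⁻¹) p q := by ring
      _ = _ := by rw [← e3, e2]; field_simp
  have e := (Finset.prod_congr rfl e1).trans Finset.prod_mul_distrib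
  rw [prod_poleFactor ha4 ha5] at e
  rw [e]
  generalize (∏ x ∈ Finset.univ.erase a, ellGamma (tildeParam q mf mg T x * u) p q /
    ellGamma (T x * T a) p q * ellGamma (tildeParam q mf mg T x * u⁻¹) p q) = X
  field_simp

end

lemma scaledParam_mul_div (q : ℂ) (t : Fin 6 → ℂ) (α : Fin 6 → ℝ) (a : Fin 6) (w : ℂ) (r : Fin 6) (k : ℕ) :
    scaledParam t α w r * (scaledParam t α w a * q ^ k)⁻¹ =
      t r / (t a * q ^ k) * pPow w (α r - α a) := by
  rw [scaledParam, scaledParam, pPow_sub]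
  have := pPow_ne_zero w (α a)
  field_simp

lemma scaledParam_mul (t : Fin 6 → ℂ) (α : Fin 6 → ℝ) (w : ℂ) (r s : Fin 6) :
    scaledParam t α w r * scaledParam t α w s = t r * t s * pPow w (α r + α s) := by
  rw [scaledParam, scaledParam, pPow_add]
  ring

/-- The residue at `T_a q^k`, multiplied by the factor in front of the integral. -/
def residueTerm (q : ℂ) (t : Fin 6 → ℂ) (α : Fin 6 → ℝ) (a : Fin 6) (mf mg : ℕ)
    (F G : ℂ → ℂ → ℂ) (k : ℕ) (w : ℂ) : ℂ :=
  qPoch q q * qPoch (Complex.exp w) (Complex.exp w) /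
      (∏ rs : Fin 6 × Fin 6 with rs.1 < rs.2,
        ellGamma (scaledParam t α w rs.1 * scaledParam t α w rs.2) (Complex.exp w) q) *
    kernelResidue (Complex.exp w) q (tildeParam q mf mg (scaledParam t α w)) a (F w) (G w) k

namespace Admissible

variable {q : ℂ} {t : Fin 6 → ℂ} {α : Fin 6 → ℝ} {a : Fin 6} (h : Admissible q t α a)

include h

/-- The balancing condition in the form in which it is used: the powers of p that normalise the
theta functions of one step multiply to p^{-2α_a}. -/
lemma neg_two_mul_eq : -(2 * α a) = ∑ r ∈ Finset.univ.erase a, max 0 (-(α r + α a)) := by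
  have e : ∀ r ∈ Finset.univ.erase a, max 0 (-(α r + α a)) =
      if α r + α a < 0 then -(α r + α a) else 0 := fun r _ => by
    split_ifs with h1
    · exact max_eq_right (by linarith)
    · exact max_eq_left (by linarith)
  rw [Finset.sum_congr rfl e, ← Finset.sum_filter, h.bal, ← Finset.sum_neg_distrib]
  refine Finset.sum_congr ?_ fun _ _ => rfl
  ext r
  simp

lemma add_lt_one {r : Fin 6} (hr : r ≠ a) : α r + α a < 1 := by
  linarith [h.le r hr, h.neg]

lemma neg_one_lt_add {r : Fin 6} (hr : r ≠ a) : -1 < α r + α a := by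
  linarith [h.lt r hr, h.half_le]

lemma tendsto_inv_ellGamma_pair {r s : Fin 6} (hr : r ≠ a) (hs : s ≠ a) (hrs : r ≠ s) :
    Tendsto (fun w => (ellGamma (scaledParam t α w r * scaledParam t α w s) (Complex.exp w) q)⁻¹)
      cusp (𝓝 (gammaLim q (α r + α s) (t r * t s))⁻¹) := by
  simp only [scaledParam_mul]
  refine (tendsto_gammaLim h.q_lt (h.pos r s hr hs hrs) (h.le_one r s hr hs hrs) _).inv₀ ?_
  rw [gammaLim_eq_ite]
  split_ifs
  exacts [h.qPoch_div_mul_ne_zero _ _, one_ne_zero]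

lemma eventually_ellGamma_ne_zero {r : Fin 6} (hr : r ≠ a) : ∀ᶠ w in cusp,
    dPoch (Complex.exp w) q (scaledParam t α w r * scaledParam t α w a) ≠ 0 →
    ellGamma (scaledParam t α w r * scaledParam t α w a) (Complex.exp w) q ≠ 0 := by
  have h1 := tendsto_dPoch_one h.q_lt tendsto_exp_cusp
    (by simpa using (tendsto_pPow (sub_pos.2 (h.add_lt_one hr))).const_mul (q / (t r * t a)))
  filter_upwards [eventually_norm_exp_le (show (0 : ℝ) < 1 / 2 by norm_num),
    h1.eventually_ne one_ne_zero] with w hp hw hd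
  rw [ellGamma_eq (norm_lt_one_of_le_half hp) h.q_lt]
  refine div_ne_zero ?_ hd
  rwa [scaledParam_mul, exp_div_mul_pPow]

lemma tendsto_residue_tail (k : ℕ) :
    Tendsto (fun w => qPoch (Complex.exp w) (Complex.exp w) *
      (dPoch (Complex.exp w) q (Complex.exp w * q * q ^ k) /
        dPoch (Complex.exp w) q ((q ^ k)⁻¹ * Complex.exp w))) cusp (𝓝 1) := by
  have h1 := tendsto_qPoch tendsto_exp_cusp tendsto_exp_cusp
  have h2 := tendsto_dPoch_one h.q_lt tendsto_exp_cusp (x := fun w => Complex.exp w * q * q ^ k)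
    (by simpa using (tendsto_exp_cusp.mul_const q).mul_const (q ^ k))
  have h3 := tendsto_dPoch_one h.q_lt tendsto_exp_cusp (x := fun w => (q ^ k)⁻¹ * Complex.exp w)
    (by simpa using tendsto_exp_cusp.const_mul (q ^ k)⁻¹)
  simpa using h1.mul (h2.div h3 one_ne_zero)

lemma tendsto_theta_mul_ellGamma (k : ℕ) :
    Tendsto (fun w => theta ((scaledParam t α w a * q ^ k)⁻¹ ^ 2) (Complex.exp w) *
      ellGamma (scaledParam t α w a * (scaledParam t α w a * q ^ k) * Complex.exp w)
        (Complex.exp w) q) cusp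
      (𝓝 ((1 - powLim (1 + 2 * α a) ((t a * q ^ k) ^ 2)) *
        (1 / qPoch (powLim (1 + 2 * α a) (t a * (t a * q ^ k))) q))) := by
  have hneg := h.neg
  have hhalf := h.half_le
  have h1 := tendsto_theta (γ := -(2 * α a)) (by linarith) (by linarith) (((t a * q ^ k) ^ 2)⁻¹)
  have h2 := tendsto_ellGamma h.q_lt (γ := 1 + 2 * α a) (by linarith) (by linarith)
    (y := t a * (t a * q ^ k)) (by
      rw [powLim]
      split_ifs
      · refine qPoch_ne_zero_of_forall h.q_lt fun n hn => h.prod_ne_zpow a a (-(n + k : ℕ)) ?_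
        rw [zpow_neg, zpow_natCast]
        refine eq_inv_of_mul_eq_one_left ?_
        rw [← hn]; ring
      · rw [qPoch_zero_left]; exact one_ne_zero)
  have e1 : powLim (-(2 * α a)) (((t a * q ^ k) ^ 2)⁻¹) = 0 := if_neg (by linarith)
  have e2 : powLim (1 - (1 + 2 * α a)) (q / (t a * (t a * q ^ k))) = 0 := if_neg (by linarith)
  rw [e1, sub_zero, one_mul, sub_neg_eq_add, one_div, inv_inv] at h1
  rw [e2, qPoch_zero_left] at h2
  refine (h1.mul h2).congr fun w => ?_
  have := pPow_ne_zero w (α a)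
  congr 2
  · rw [scaledParam, show 2 * α a = α a + α a by ring, pPow_neg, pPow_add]
    simp only [mul_pow, mul_inv]
    field_simp
  · rw [scaledParam, show 2 * α a = α a + α a by ring, pPow_add, pPow_add, pPow_one]
    ring

variable {mf mg : ℕ} {f g F G : ℂ → ℂ → ℂ} {cf cg : HahnSeries ℝ (RatFunc ℂ)}

lemma _root_.EllipticPairing.IsFamily.tendsto_div {r : Fin 6} (hr : r ≠ a) {m : ℕ}
    (hf : IsFamily q (t r) (α r) (α a) m f F cf) (k : ℕ) :
    (∀ᶠ w in cusp, poleFactor (scaledParam t α w r) (Complex.exp w) q m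
      (scaledParam t α w a * q ^ k) ≠ 0) ∧
    Tendsto (fun w => pPow w (-cf.order) * (F w (scaledParam t α w a * q ^ k) /
      poleFactor (scaledParam t α w r) (Complex.exp w) q m (scaledParam t α w a * q ^ k))) cusp
      (𝓝 (ratEval cf.leadingCoeff (t a * q ^ k))) := by
  have hqk := pow_ne_zero k h.q_ne
  have := hf.expansion.tendsto_div h.q_ne h.q_lt (h.t_ne r) hf.diff hf.eq
    (mul_ne_zero (h.t_ne a) hqk) (fun n hn => h.prod_ne_zpow r a (n - k) (by
      rw [zpow_sub₀ h.q_ne, zpow_natCast, eq_div_iff hqk, ← hn]; ring))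
    (fun n hn => h.div_ne_zpow hr (n + k) (by
      rw [zpow_add₀ h.q_ne, zpow_natCast, ← hn, ← div_div, div_mul_cancel₀ _ hqk]))
  simp only [mul_right_comm _ (q ^ k)] at this
  exact this

/-- Each theta function is multiplied by p^{max(0,−(α_r+α_a))} to have a finite limit. For the
residue with index k these powers amount to p^{-2kα_a}, and that is what the quasi-period monomial
provides. -/
lemma tendsto_residueTerm (hf : IsFamily q (t 4) (α 4) (α a) mf f F cf)
    (hg : IsFamily q (t 5) (α 5) (α a) mg g G cg) (k : ℕ) :
    Tendsto (fun w => pPow w (-cf.order - cg.order) * residueTerm q t α a mf mg F G k w)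
      (cusp ⊓ 𝓟 {w | NonResonant (Complex.exp w) q mf mg (scaledParam t α w)})
      (𝓝 (limitPrefactor q t α a * (ratEval cf.leadingCoeff (t a * q ^ k) *
        ratEval cg.leadingCoeff (t a * q ^ k) * limitWeight q t α a k))) := by
  obtain ⟨h4, hf'⟩ := hf.tendsto_div h h.ne_four.symm k
  obtain ⟨h5, hg'⟩ := hg.tendsto_div h h.ne_five.symm k
  have h1 : Tendsto (fun w => ∏ r ∈ Finset.univ.erase a,
      (∏ j ∈ Finset.range k, pPow w (max 0 (-(α r + α a))) *
        theta (t r * t a * q ^ j * pPow w (α r + α a)) (Complex.exp w)) *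
        ellGamma (t r / (t a * q ^ k) * pPow w (α r - α a)) (Complex.exp w) q) cusp
      (𝓝 (∏ r ∈ Finset.univ.erase a,
        (∏ j ∈ Finset.range k, thetaLim (α r + α a) (t r * t a * q ^ j)) *
          gammaLim q (α r - α a) (t r / (t a * q ^ k)))) :=
    tendsto_finsetProd _ fun r hr => by
    have hr' := Finset.ne_of_mem_erase hr
    refine Tendsto.mul (tendsto_finsetProd _ fun j _ => ?_) (tendsto_gammaLim h.q_lt ?_ ?_ _)
    · exact tendsto_thetaLim (h.neg_one_lt_add hr') (h.add_lt_one hr')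
        (mul_ne_zero (mul_ne_zero (h.t_ne r) (h.t_ne a)) (pow_ne_zero j h.q_ne))
    · linarith [h.lt r hr']
    · linarith [h.le r hr']
  have h2 := h.tendsto_theta_mul_ellGamma k
  have h3 := h.tendsto_residue_tail k
  have h6 : Tendsto (fun w => ∏ rs : Fin 6 × Fin 6 with rs.1 < rs.2 ∧ rs.1 ≠ a ∧ rs.2 ≠ a,
      (ellGamma (scaledParam t α w rs.1 * scaledParam t α w rs.2) (Complex.exp w) q)⁻¹) cusp
      (𝓝 (∏ rs : Fin 6 × Fin 6 with rs.1 < rs.2 ∧ rs.1 ≠ a ∧ rs.2 ≠ a,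
        (gammaLim q (α rs.1 + α rs.2) (t rs.1 * t rs.2))⁻¹)) :=
    tendsto_finsetProd _ fun rs hrs => by
    obtain ⟨e1, e2, e3⟩ := (Finset.mem_filter.1 hrs).2
    exact h.tendsto_inv_ellGamma_pair e2 e3 e1.ne
  have hlim := ((((hf'.mul hg').mul ((h1.mul h2).mul_const
    (((-(t a * (t a * q ^ k))) ^ k * q ^ k.choose 2)⁻¹ *
        ((-1) ^ k * q ^ (k + 1).choose 2 / qPochFin q q k)))).mul h3).mul h6)
  have hval := h.limit_eq k
  rw [mul_one, mul_assoc, hval] at hlim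
  rw [mul_left_comm (limitPrefactor q t α a)]
  refine (hlim.mono_left inf_le_left).congr' ?_
  have hΓ : ∀ᶠ w in cusp, ∀ r, r ≠ a →
      dPoch (Complex.exp w) q (scaledParam t α w r * scaledParam t α w a) ≠ 0 →
      ellGamma (scaledParam t α w r * scaledParam t α w a) (Complex.exp w) q ≠ 0 :=
    eventually_all.2 fun r => by
    by_cases hr : r = a
    · exact Eventually.of_forall fun _ h' => absurd hr h'
    · exact (h.eventually_ellGamma_ne_zero hr).mono fun w hw _ => hw
  have hev : ∀ᶠ w in cusp ⊓ 𝓟 {w | NonResonant (Complex.exp w) q mf mg (scaledParam t α w)},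
      NonResonant (Complex.exp w) q mf mg (scaledParam t α w) :=
    mem_inf_of_right (mem_principal_self _)
  filter_upwards [hev, mem_inf_of_left h4, mem_inf_of_left h5, mem_inf_of_left hΓ,
    mem_inf_of_left (eventually_norm_exp_le (show (0 : ℝ) < 1 / 2 by norm_num))]
    with w hN h4 h5 hΓ hp
  have hp1 := norm_lt_one_of_le_half hp
  have hp0 := Complex.exp_ne_zero w
  have hT : ∀ r, scaledParam t α w r ≠ 0 := fun r => mul_ne_zero (h.t_ne r) (pPow_ne_zero _ _)
  rw [residueTerm, prefactor_mul_kernelResidue_eq hp1 h.q_lt hp0 h.q_ne hT h.ne_four h.ne_five hN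
    (F w) (G w) k h4 h5 fun r hr => hΓ r hr (by
      simpa using hN.dPoch_mul_pow_ne_zero hp1 h.q_lt h.q_ne r a 0)]
  -- Balancing is applied here: the normalising powers are collected into one power p^{-2kα_a}.
  have e1 : (∏ r ∈ Finset.univ.erase a,
      (∏ j ∈ Finset.range k, pPow w (max 0 (-(α r + α a))) *
        theta (t r * t a * q ^ j * pPow w (α r + α a)) (Complex.exp w)) *
        ellGamma (t r / (t a * q ^ k) * pPow w (α r - α a)) (Complex.exp w) q) =
      pPow w (-(2 * α a)) ^ k * ∏ r ∈ Finset.univ.erase a, (∏ j ∈ Finset.range k,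
        theta (scaledParam t α w r * scaledParam t α w a * q ^ j) (Complex.exp w)) *
        ellGamma (scaledParam t α w r * (scaledParam t α w a * q ^ k)⁻¹) (Complex.exp w) q := by
    rw [h.neg_two_mul_eq, pPow_sum, ← Finset.prod_pow, ← Finset.prod_mul_distrib]
    refine Finset.prod_congr rfl fun r _ => ?_
    rw [Finset.prod_mul_distrib, Finset.prod_const, Finset.card_range, scaledParam_mul_div,
      scaledParam_mul, mul_assoc]
    simp only [mul_right_comm _ (pPow w (α r + α a))]
  -- The matching power of p from S_a^{-2k}.
  have e2 : ((-(scaledParam t α w a * (scaledParam t α w a * q ^ k))) ^ k * q ^ k.choose 2)⁻¹ =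
      pPow w (-(2 * α a)) ^ k * ((-(t a * (t a * q ^ k))) ^ k * q ^ k.choose 2)⁻¹ := by
    rw [← mul_assoc, scaledParam_mul, ← two_mul, pPow_neg, mul_right_comm, ← neg_mul, mul_pow,
      inv_pow, mul_assoc (t a)]
    simp only [mul_inv]
    ring
  rw [e1, e2, pPow_sub, pPow_neg w cg.order]
  ring

end Admissible

end EllipticPairing

end

noncomputable section

namespace EllipticPairing

/-! ### Bounds for the residues -/

lemma GeomBound.mono_right {I : ℂ → Set (ℕ × ℂ)} {X : ℂ → ℕ → ℂ → ℂ} {Y Y' : ℂ → ℕ → ℝ}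
    (h : GeomBound I X Y) (e : ∀ᶠ w in cusp, ∀ k, Y w k ≤ Y' w k) : GeomBound I X Y' := by
  obtain ⟨C, hC, h⟩ := h
  refine ⟨C, hC, ?_⟩
  filter_upwards [h, e] with w hw he i hi
  exact (hw i hi).trans (mul_le_mul_of_nonneg_left (he i.1) (by positivity))

/-- An exponent `σ` such that the circle of radius `|p|^{-σ}` separates the poles near
`t_a p^{α_a}` from those near `t_r p^{α_r}`, `r ≠ a`. -/
structure SeparatingExponent (α : Fin 6 → ℝ) (a b : Fin 6) (σ : ℝ) : Prop where
  ne : b ≠ a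
  add_neg : α b + α a < 0
  pos : 0 < σ
  neg_lt : -α b < σ
  lt_neg : σ < -α a
  lt : ∀ r, r ≠ a → r ≠ b → σ < α r

/-- The factors that the residues and the remaining integral have in common, at
`z = t_a p^{α_a} q^k ω`. -/
def commonFactor (q : ℂ) (t : Fin 6 → ℂ) (α : Fin 6 → ℝ) (a : Fin 6) (mf mg : ℕ)
    (F G : ℂ → ℂ → ℂ) (w : ℂ) (k : ℕ) (ω : ℂ) : ℂ :=
  let S := tildeParam q mf mg (scaledParam t α w)
  let p := Complex.exp w
  let z := S a * (q ^ k * ω)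
  F w z * G w z * (∏ r ∈ Finset.univ.erase a, ellGamma (S r * z⁻¹) p q) *
    (∏ r ∈ Finset.univ.erase a, ∏ j ∈ Finset.range (shiftExp mf mg r),
      theta (S r * S a * q ^ j) p)⁻¹ *
    theta (z⁻¹ ^ 2) p * ((S a ^ 2) ^ k * (q ^ k.choose 2) ^ 2)⁻¹ * qPoch p p *
    ∏ rs : Fin 6 × Fin 6 with rs.1 < rs.2 ∧ rs.1 ≠ a ∧ rs.2 ≠ a,
      (ellGamma (scaledParam t α w rs.1 * scaledParam t α w rs.2) p q)⁻¹

lemma pow_choose_two_sq (x : ℂ) (k : ℕ) : x ^ (k * k) = (x ^ k.choose 2) ^ 2 * x ^ k := by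
  rw [← pow_mul, ← pow_add]
  congr 1
  induction k with
  | zero => rfl
  | succ k ih => rw [Nat.choose_succ_succ' k 1, Nat.choose_one_right]; linarith

lemma pow_succ_choose_two (x : ℂ) (k : ℕ) : x ^ (k + 1).choose 2 = x ^ k * x ^ k.choose 2 := by
  rw [Nat.choose_succ_succ' k 1, Nat.choose_one_right, pow_add]

lemma exists_inv_qPochFin_bound {q : ℂ} (hq : ‖q‖ < 1) : ∃ C : ℝ, ∀ k, ‖(qPochFin q q k)⁻¹‖ ≤ C := by
  have hqq : qPoch q q ≠ 0 := fun h => by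
    obtain ⟨r, hr⟩ := (qPoch_eq_zero_iff hq).1 h
    have : ‖q ^ (r + 1)‖ < 1 := by rw [norm_pow]; exact pow_lt_one₀ (norm_nonneg _) hq (by omega)
    rw [pow_succ', hr, norm_one] at this
    exact lt_irrefl _ this
  have h1 : Tendsto (fun k : ℕ => q * q ^ k) atTop (𝓝 0) := by
    simpa using (tendsto_pow_atTop_nhds_zero_of_norm_lt_one hq).const_mul q
  have h2 := (((differentiable_qPoch hq).continuous.tendsto 0).comp h1).norm.bddAbove_range
  obtain ⟨C, hC⟩ := h2
  refine ⟨C * ‖(qPoch q q)⁻¹‖, fun k => ?_⟩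
  have h3 := qPoch_eq_qPochFin_mul hq q k
  have h4 := hqq
  rw [h3] at h4
  have h5 : (qPochFin q q k)⁻¹ = qPoch (q * q ^ k) q * (qPoch q q)⁻¹ := by
    have := left_ne_zero_of_mul h4
    have := right_ne_zero_of_mul h4
    rw [h3]
    field_simp
  rw [h5, norm_mul]
  exact mul_le_mul_of_nonneg_right (hC ⟨k, rfl⟩) (norm_nonneg _)

namespace Admissible

variable {q : ℂ} {t : Fin 6 → ℂ} {α : Fin 6 → ℝ} {a : Fin 6} (h : Admissible q t α a)

include h

lemma exists_separatingExponent : ∃ b σ, SeparatingExponent α a b σ := by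
  obtain ⟨b, h1, h2, σ, h3, h4, h5, h6⟩ := exists_smallest_exponent h.neg h.lt h.pos h.bal
  exact ⟨b, σ, h1, h2, h3, h4, h5, h6⟩

lemma tilde_ne_zero (mf mg : ℕ) (r : Fin 6) : tildeParam q mf mg t r ≠ 0 :=
  tildeParam_ne_zero h.q_ne h.t_ne r

lemma tilde_mul_ne_zpow (mf mg : ℕ) (r s : Fin 6) (n : ℤ) :
    tildeParam q mf mg t r * tildeParam q mf mg t s ≠ q ^ n := fun hn => by
  have h1 := pow_ne_zero (shiftExp mf mg r) h.q_ne
  have h2 := pow_ne_zero (shiftExp mf mg s) h.q_ne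
  refine h.prod_ne_zpow r s (n + shiftExp mf mg r + shiftExp mf mg s) ?_
  rw [zpow_add₀ h.q_ne, zpow_add₀ h.q_ne, ← hn, zpow_natCast, zpow_natCast, tildeParam_eq,
    tildeParam_eq]
  field_simp

/-- Separates what the residue shares with the integrand on the circle (at ω = 1) from its own theta
products, so that one estimate of the common part serves both. -/
lemma residueTerm_eq (mf mg : ℕ) (F G : ℂ → ℂ → ℂ) : ∀ᶠ w in cusp,
    NonResonant (Complex.exp w) q mf mg (scaledParam t α w) → ∀ k : ℕ,
    residueTerm q t α a mf mg F G k w = commonFactor q t α a mf mg F G w k 1 *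
      ((∏ r ∈ Finset.univ.erase a, ∏ j ∈ Finset.range k,
        theta (tildeParam q mf mg (scaledParam t α w) r *
          tildeParam q mf mg (scaledParam t α w) a * q ^ j) (Complex.exp w)) *
        ((qPochFin q q k)⁻¹ * (ellGamma (scaledParam t α w a * (scaledParam t α w a * q ^ k) *
          Complex.exp w) (Complex.exp w) q *
        (dPoch (Complex.exp w) q (Complex.exp w * q * q ^ k) /
          dPoch (Complex.exp w) q ((q ^ k)⁻¹ * Complex.exp w))))) := by
  have hΓ : ∀ᶠ w in cusp, ∀ r, r ≠ a →
      dPoch (Complex.exp w) q (scaledParam t α w r * scaledParam t α w a) ≠ 0 →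
      ellGamma (scaledParam t α w r * scaledParam t α w a) (Complex.exp w) q ≠ 0 :=
    eventually_all.2 fun r => by
    by_cases hr : r = a
    · exact Eventually.of_forall fun _ h' => absurd hr h'
    · exact (h.eventually_ellGamma_ne_zero hr).mono fun w hw _ => hw
  filter_upwards [hΓ, eventually_norm_exp_le (show (0 : ℝ) < 1 / 2 by norm_num)] with w hΓ hp hN k
  have hp1 := norm_lt_one_of_le_half hp
  have hp0 := Complex.exp_ne_zero w
  have hT : ∀ r, scaledParam t α w r ≠ 0 := fun r => mul_ne_zero (h.t_ne r) (pPow_ne_zero _ _)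
  have hSa : tildeParam q mf mg (scaledParam t α w) a = scaledParam t α w a :=
    tildeParam_self h.ne_four h.ne_five
  have hd : dPoch (Complex.exp w) q (tildeParam q mf mg (scaledParam t α w) a *
      (tildeParam q mf mg (scaledParam t α w) a * q ^ k)) ≠ 0 := by
    rw [hSa, ← mul_assoc]
    exact hN.dPoch_mul_pow_ne_zero hp1 h.q_lt h.q_ne a a k
  rw [residueTerm, prefactor_mul_kernelResidue _ _ a (F w) (G w) k hp1 h.q_lt hp0 h.q_ne
    (by rw [hSa]; exact hT a) hd, commonFactor]
  have e1 : ∀ r ∈ Finset.univ.erase a,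
      ellGamma (tildeParam q mf mg (scaledParam t α w) r *
        (tildeParam q mf mg (scaledParam t α w) a * q ^ k)) (Complex.exp w) q /
        ellGamma (scaledParam t α w r * scaledParam t α w a) (Complex.exp w) q *
        ellGamma (tildeParam q mf mg (scaledParam t α w) r *
        (tildeParam q mf mg (scaledParam t α w) a * q ^ k)⁻¹) (Complex.exp w) q =
      (∏ j ∈ Finset.range k, theta (tildeParam q mf mg (scaledParam t α w) r *
          tildeParam q mf mg (scaledParam t α w) a * q ^ j) (Complex.exp w)) *
        (∏ j ∈ Finset.range (shiftExp mf mg r), theta (tildeParam q mf mg (scaledParam t α w) r *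
          tildeParam q mf mg (scaledParam t α w) a * q ^ j) (Complex.exp w))⁻¹ *
        ellGamma (tildeParam q mf mg (scaledParam t α w) r *
        (tildeParam q mf mg (scaledParam t α w) a * q ^ k)⁻¹) (Complex.exp w) q := fun r hr => by
    have hr' := hΓ r (Finset.ne_of_mem_erase hr)
      (by simpa using hN.dPoch_mul_pow_ne_zero hp1 h.q_lt h.q_ne r a 0)
    have hxy : tildeParam q mf mg (scaledParam t α w) r *
      tildeParam q mf mg (scaledParam t α w) a ≠ 0 :=
        mul_ne_zero (tildeParam_ne_zero h.q_ne hT r) (tildeParam_ne_zero h.q_ne hT a)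
    have e3 := fun n => ellGamma_mul_pow_of_ne hp1 h.q_lt h.q_ne hxy
      (hN.dPoch_ne_zero hp1 h.q_lt r a) n
    have e4 : ellGamma (scaledParam t α w r * scaledParam t α w a) (Complex.exp w) q =
        ellGamma (tildeParam q mf mg (scaledParam t α w) r *
          tildeParam q mf mg (scaledParam t α w) a * q ^ shiftExp mf mg r) (Complex.exp w) q := by
      rw [hSa, mul_right_comm, tildeParam_mul_pow h.q_ne]
    rw [e4, e3] at hr' ⊢
    rw [← mul_assoc (tildeParam q mf mg (scaledParam t α w) r), e3,
      mul_div_mul_right _ _ (right_ne_zero_of_mul hr'), div_eq_mul_inv]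
  rw [Finset.prod_congr rfl e1]
  simp only [Finset.prod_mul_distrib, Finset.prod_inv_distrib, mul_one, hSa]
  have e5 : ((-(scaledParam t α w a * (scaledParam t α w a * q ^ k))) ^ k * q ^ k.choose 2)⁻¹ *
      ((-1) ^ k * q ^ (k + 1).choose 2 / qPochFin q q k) =
      ((scaledParam t α w a ^ 2) ^ k * (q ^ k.choose 2) ^ 2)⁻¹ * (qPochFin q q k)⁻¹ := by
    have n1 := pow_ne_zero k h.q_ne
    have n2 := pow_ne_zero (k.choose 2) h.q_ne
    have n3 := pow_ne_zero k (hT a)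
    have n4 : (-1 : ℂ) ^ k ≠ 0 := pow_ne_zero _ (by norm_num)
    rw [neg_pow (scaledParam t α w a * (scaledParam t α w a * q ^ k)), mul_pow (scaledParam t α w a),
      mul_pow (scaledParam t α w a), ← pow_mul q k k, pow_choose_two_sq, pow_succ_choose_two,
      pow_right_comm (scaledParam t α w a) 2 k]
    field_simp
  rw [e5]
  ring

variable {mf mg : ℕ} {f g F G : ℂ → ℂ → ℂ} {cf cg : HahnSeries ℝ (RatFunc ℂ)} {b : Fin 6} {σ : ℝ}
  (hσ : SeparatingExponent α a b σ)

/-- The inverses of the theta functions that compare `t_r` with `t̃_r`. -/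
lemma inv_prod_theta_bound {r : Fin 6} (hr : r ≠ a) : ∃ C : ℝ, 0 ≤ C ∧ ∀ᶠ w in cusp,
    ‖(∏ j ∈ Finset.range (shiftExp mf mg r), theta (tildeParam q mf mg (scaledParam t α w) r *
      tildeParam q mf mg (scaledParam t α w) a * q ^ j) (Complex.exp w))⁻¹‖ ≤
    C * ‖pPow w (max 0 (-(α r + α a)))‖ ^ shiftExp mf mg r := by
  set y := tildeParam q mf mg t r * tildeParam q mf mg t a with hy
  have hy0 : y ≠ 0 := mul_ne_zero (h.tilde_ne_zero mf mg r) (h.tilde_ne_zero mf mg a)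
  have h1 := tendsto_finsetProd (Finset.range (shiftExp mf mg r)) fun j _ =>
    tendsto_thetaLim (h.neg_one_lt_add hr) (h.add_lt_one hr)
      (mul_ne_zero hy0 (pow_ne_zero j h.q_ne))
  have h2 : ∏ j ∈ Finset.range (shiftExp mf mg r), thetaLim (α r + α a) (y * q ^ j) ≠ 0 :=
    Finset.prod_ne_zero_iff.2 fun j _ => by
    rw [thetaLim, powLim]
    split_ifs
    · exact neg_ne_zero.2 (mul_ne_zero hy0 (pow_ne_zero j h.q_ne))
    · refine sub_ne_zero.2 fun h' => h.tilde_mul_ne_zpow mf mg r a (-j) ?_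
      rw [zpow_neg, zpow_natCast]
      exact eq_inv_of_mul_eq_one_left h'.symm
    · simp
  refine ⟨‖(∏ j ∈ Finset.range (shiftExp mf mg r), thetaLim (α r + α a) (y * q ^ j))⁻¹‖ + 1,
    by positivity, ?_⟩
  filter_upwards [(h1.inv₀ h2).norm.eventually (ge_mem_nhds (lt_add_one _))] with w hw
  rw [Finset.prod_mul_distrib, Finset.prod_const, Finset.card_range, mul_inv, norm_mul, norm_inv,
    norm_pow, inv_mul_le_iff₀ (pow_pos (norm_pPow_pos _ _) _), mul_comm] at hw
  refine (le_of_eq ?_).trans hw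
  congr 2
  refine Finset.prod_congr rfl fun j _ => ?_
  rw [tildeParam_scaledParam, tildeParam_scaledParam, hy, pPow_add]
  congr 1
  ring

include hσ in
-- The numerator grows at most like |p|^{val} times m copies of |p|^{min(0,α_r+α_a)}, and the
-- inverse theta functions have the opposite power. The point t_a p^{α_a} q^k ω stays in the annulus
-- of `HasExpansion.bound`: up to the cutoff its modulus is at least |t_a| |p|^{-σ} ≥ |t_a|.
lemma family_bound {r : Fin 6} (hr : r ≠ a) {m : ℕ} (hm : shiftExp mf mg r = m)
    (hf : IsFamily q (t r) (α r) (α a) m f F cf) :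
    GeomBound (fullIndex q (-α a - σ)) (fun w k ω => pPow w (-cf.order) *
      F w (tildeParam q mf mg (scaledParam t α w) a * (q ^ k * ω)) *
      (∏ j ∈ Finset.range m, theta (tildeParam q mf mg (scaledParam t α w) r *
        tildeParam q mf mg (scaledParam t α w) a * q ^ j) (Complex.exp w))⁻¹) fun _ _ => 1 := by
  have hneg := h.neg
  have hq' := norm_pos_iff.2 h.q_ne
  have hta := norm_pos_iff.2 (h.t_ne a)
  set R := ‖t a‖ * ‖q‖⁻¹ + ‖t a‖⁻¹ with hR
  have hR0 : 0 < R := by positivity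
  obtain ⟨C, hC⟩ := hf.expansion.bound h.q_ne h.q_lt (h.t_ne r) hf.diff hf.eq hf.symm
    (h.neg_one_lt_add hr).le (h.add_lt_one hr).le (by linarith [h.lt r hr]) (by linarith [h.le r hr])
    hR0
  obtain ⟨C', hC0, hC'⟩ := h.inv_prod_theta_bound (mf := mf) (mg := mg) hr
  refine GeomBound.of_const (C := C * C') ?_
  filter_upwards [hC, hC', eventually_re_neg] with w hC hC' hw i hi
  have hκ : 0 ≤ -α a - σ := by linarith [hσ.lt_neg]
  have hk := pPow_le_of_le_cutoff h.q_ne h.q_lt hκ hw hi.1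
  have hz : ‖tildeParam q mf mg (scaledParam t α w) a * (q ^ i.1 * i.2)‖ =
      ‖t a‖ * ‖pPow w (α a)‖ * (‖q‖ ^ i.1 * ‖i.2‖) := by
    rw [tildeParam_self h.ne_four h.ne_five, scaledParam, norm_mul, norm_mul, norm_mul, norm_pow]
  have h1 := hC (tildeParam q mf mg (scaledParam t α w) a * (q ^ i.1 * i.2)) ?_ ?_
  · rw [hm] at hC'
    rw [norm_mul, norm_mul]
    have hX : 0 < ‖pPow w (max 0 (-(α r + α a)))‖ ^ m := pow_pos (norm_pPow_pos _ _) _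
    have hY := norm_pPow_pos w cf.order
    rw [pPow_neg, norm_inv, norm_inv, inv_pow] at *
    calc _ ≤ ‖pPow w cf.order‖⁻¹ * (C * (‖pPow w cf.order‖ *
          (‖pPow w (max 0 (-(α r + α a)))‖ ^ m)⁻¹)) *
          (C' * ‖pPow w (max 0 (-(α r + α a)))‖ ^ m) := by
          exact mul_le_mul (mul_le_mul_of_nonneg_left h1 (by positivity)) hC' (by positivity)
            (mul_nonneg (by positivity) ((norm_nonneg _).trans h1))
      _ = C * C' := by field_simp
  · rw [hz, mul_inv, ← norm_inv, ← pPow_neg]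
    calc R⁻¹ * ‖pPow w (-α a)‖ ≤ ‖t a‖ * 1 := by
          gcongr
          · rw [inv_le_comm₀ hR0 hta, hR]
            linarith [show 0 ≤ ‖t a‖ * ‖q‖⁻¹ by positivity]
          · exact norm_pPow_le_one hw (by linarith)
      _ ≤ ‖t a‖ * (‖pPow w (α a)‖ * (‖pPow w (-α a - σ)‖ * 1)) := by
          rw [mul_one (‖pPow w (-α a - σ)‖), ← norm_pPow_add,
            show α a + (-α a - σ) = -σ by ring, pPow_neg, norm_inv]
          gcongr
          exact (one_le_inv₀ (norm_pPow_pos _ _)).2 (norm_pPow_le_one hw hσ.pos.le)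
      _ ≤ _ := by
          rw [mul_assoc]
          gcongr
          exact hi.2.1
  · rw [hz]
    calc _ ≤ ‖t a‖ * ‖pPow w (α a)‖ * (1 * ‖q‖⁻¹) := by
          gcongr
          · exact pow_le_one₀ (norm_nonneg _) h.q_lt.le
          · exact hi.2.2
      _ = ‖t a‖ * ‖q‖⁻¹ * ‖pPow w (α a)‖ := by ring
      _ ≤ _ := by gcongr; rw [hR]; linarith [show 0 ≤ ‖t a‖⁻¹ by positivity]

include hσ in
-- Apart from the monomial all factors are bounded: α_r − α_a > κ follows from α_r > −σ, and −2α_a ≥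
-- 2κ from σ > 0. The monomial gives the first part of `stepBound`.
lemma commonFactor_bound (hf : IsFamily q (t 4) (α 4) (α a) mf f F cf)
    (hg : IsFamily q (t 5) (α 5) (α a) mg g G cg) :
    GeomBound (fullIndex q (-α a - σ))
      (fun w k ω => pPow w (-cf.order - cg.order) * commonFactor q t α a mf mg F G w k ω)
      fun w k => ∏ j ∈ Finset.range k, ‖pPow w (-(2 * α a))‖ / ‖q‖ ^ (2 * j) := by
  have hneg := h.neg
  have hhalf := h.half_le
  have hκ : 0 ≤ -α a - σ := by linarith [hσ.lt_neg]
  have hta := h.t_ne a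
  have b1 := h.family_bound hσ (mf := mf) (mg := mg) h.ne_four.symm (by simp [shiftExp]) hf
  have b2 := h.family_bound hσ (mf := mf) (mg := mg) h.ne_five.symm (by simp [shiftExp]) hg
  have b3 := GeomBound.prod (I := fullIndex q (-α a - σ)) (Finset.univ.erase a)
    (X := fun r w k ω => ellGamma (tildeParam q mf mg t r / t a * pPow w (α r - α a) /
      (q ^ k * ω)) (Complex.exp w) q) (Y := fun _ _ _ => 1) fun r hr => by
    have hr' := Finset.ne_of_mem_erase hr
    obtain ⟨C, hC⟩ := ellGamma_div_bound h.q_ne h.q_lt hκ (tildeParam q mf mg t r / t a)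
      (γ := α r - α a) (by
        by_cases hb : r = b
        · rw [hb]; linarith [hσ.neg_lt]
        · linarith [hσ.lt r hr' hb, hσ.pos]) (by linarith [h.le r hr'])
    exact GeomBound.of_const hC
  obtain ⟨C4, hC4⟩ := theta_inv_sq_bound h.q_ne h.q_lt hκ (y := (t a ^ 2)⁻¹)
    (inv_ne_zero (pow_ne_zero 2 hta)) (γ := -(2 * α a)) (by linarith [hσ.pos]) (by linarith)
  have b4 := GeomBound.of_const (I := fullIndex q (-α a - σ))
    (X := fun w k ω => theta ((t a ^ 2)⁻¹ * pPow w (-(2 * α a)) / (q ^ k * ω) ^ 2) (Complex.exp w))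
    hC4
  have b5 : GeomBound (fullIndex q (-α a - σ))
      (fun w k _ => ∏ j ∈ Finset.range k, ((t a ^ 2)⁻¹ * pPow w (-(2 * α a)) * (q ^ (2 * j))⁻¹))
      fun w k => ∏ j ∈ Finset.range k, |‖pPow w (-(2 * α a))‖ / ‖q‖ ^ (2 * j)| :=
    GeomBound.prod_range (C := ‖(t a ^ 2)⁻¹‖) <| Eventually.of_forall fun w i _ j _ => by
      rw [norm_mul, norm_mul, norm_inv (q ^ (2 * j)), norm_pow, div_eq_mul_inv, mul_assoc]
  have b6 := GeomBound.of_tendsto (I := fullIndex q (-α a - σ))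
    (tendsto_qPoch tendsto_exp_cusp tendsto_exp_cusp)
  have b7 := GeomBound.of_tendsto (I := fullIndex q (-α a - σ))
    (tendsto_finsetProd (Finset.univ.filter
      fun rs : Fin 6 × Fin 6 => rs.1 < rs.2 ∧ rs.1 ≠ a ∧ rs.2 ≠ a) fun rs hrs =>
    h.tendsto_inv_ellGamma_pair (Finset.mem_filter.1 hrs).2.2.1 (Finset.mem_filter.1 hrs).2.2.2
      (Finset.mem_filter.1 hrs).2.1.ne)
  refine GeomBound.congr_right (((((((b1.mul b2).mul b3).mul b4).mul b5).mul b6).mul b7).congr_left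
    (Eventually.of_forall fun w i hi => le_of_eq ?_)) fun w k => ?_
  · congr 1
    have hz : tildeParam q mf mg (scaledParam t α w) a = t a * pPow w (α a) := by
      rw [tildeParam_self h.ne_four h.ne_five, scaledParam]
    have hp := pPow_ne_zero w (α a)
    have e1 : (∏ r ∈ Finset.univ.erase a, ∏ j ∈ Finset.range (shiftExp mf mg r),
        theta (tildeParam q mf mg (scaledParam t α w) r *
          tildeParam q mf mg (scaledParam t α w) a * q ^ j) (Complex.exp w)) =
        (∏ j ∈ Finset.range mf, theta (tildeParam q mf mg (scaledParam t α w) 4 *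
          tildeParam q mf mg (scaledParam t α w) a * q ^ j) (Complex.exp w)) *
        ∏ j ∈ Finset.range mg, theta (tildeParam q mf mg (scaledParam t α w) 5 *
          tildeParam q mf mg (scaledParam t α w) a * q ^ j) (Complex.exp w) := by
      have e : shiftExp mf mg a = 0 := by rw [shiftExp, if_neg h.ne_four, if_neg h.ne_five]
      have e' := Finset.mul_prod_erase Finset.univ
        (fun r => ∏ j ∈ Finset.range (shiftExp mf mg r),
          theta (tildeParam q mf mg (scaledParam t α w) r *
          tildeParam q mf mg (scaledParam t α w) a * q ^ j) (Complex.exp w)) (Finset.mem_univ a)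
      simp only [e, Finset.range_zero, Finset.prod_empty, one_mul] at e'
      rw [e', Fin.prod_univ_six]
      simp [shiftExp]
    have e2 : ∀ r, tildeParam q mf mg (scaledParam t α w) r *
        (tildeParam q mf mg (scaledParam t α w) a * (q ^ i.1 * i.2))⁻¹ =
        tildeParam q mf mg t r / t a * pPow w (α r - α a) / (q ^ i.1 * i.2) := fun r => by
      rw [hz, tildeParam_scaledParam, pPow_sub]
      field_simp
    have e3 : (tildeParam q mf mg (scaledParam t α w) a * (q ^ i.1 * i.2))⁻¹ ^ 2 =
        (t a ^ 2)⁻¹ * pPow w (-(2 * α a)) / (q ^ i.1 * i.2) ^ 2 := by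
      rw [hz, show 2 * α a = α a + α a by ring, pPow_neg, pPow_add]
      simp only [mul_pow, mul_inv, inv_pow]
      field_simp
    have e4 : ((tildeParam q mf mg (scaledParam t α w) a ^ 2) ^ i.1 *
        (q ^ i.1.choose 2) ^ 2)⁻¹ =
        ∏ j ∈ Finset.range i.1, ((t a ^ 2)⁻¹ * pPow w (-(2 * α a)) * (q ^ (2 * j))⁻¹) := by
      rw [Finset.prod_mul_distrib, Finset.prod_const, Finset.card_range, Finset.prod_inv_distrib,
        hz, show 2 * α a = α a + α a by ring, pPow_neg, pPow_add, mul_inv, ← inv_pow]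
      congr 2
      · field_simp
      · simp only [pow_mul']
        rw [Finset.prod_pow, Finset.prod_pow_eq_pow_sum, Finset.sum_range_id, Nat.choose_two_right]
    simp only [commonFactor]
    rw [e1, e3, e4]
    simp only [e2]
    rw [mul_inv, sub_eq_add_neg, pPow_add]
    ring
  · simp only [Finset.prod_const_one, one_mul, mul_one]
    exact Finset.prod_congr rfl fun j _ => abs_of_nonneg (by positivity)

/-- The indices of the residues. -/
def _root_.EllipticPairing.residueIndex (q : ℂ) (t : Fin 6 → ℂ) (α : Fin 6 → ℝ) (mf mg : ℕ) (κ : ℝ)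
    (w : ℂ) : Set (ℕ × ℂ) :=
  {i ∈ fullIndex q κ w | i.2 = 1 ∧ NonResonant (Complex.exp w) q mf mg (scaledParam t α w)}

include hσ in
-- To the common factor, which gives |p^{-2α_a}|/|q|^{2j} for each step, the theta products add the
-- maxima in `stepBound`. Everything else is bounded up to geometric constants.
lemma residueTerm_bound (hf : IsFamily q (t 4) (α 4) (α a) mf f F cf)
    (hg : IsFamily q (t 5) (α 5) (α a) mg g G cg) :
    GeomBound (residueIndex q t α mf mg (-α a - σ))
      (fun w k _ => pPow w (-cf.order - cg.order) * residueTerm q t α a mf mg F G k w)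
      fun w k => ∏ j ∈ Finset.range k, stepBound q α a w j := by
  have hneg := h.neg
  have hhalf := h.half_le
  have hσ0 := hσ.pos
  have hκ : 0 ≤ -α a - σ := by linarith [hσ.lt_neg]
  have hta := h.t_ne a
  have b1 := h.commonFactor_bound hσ hf hg
  have b2 := GeomBound.prod (I := fullIndex q (-α a - σ)) (Finset.univ.erase a)
    (X := fun r w k ω => ∏ j ∈ Finset.range k, theta (tildeParam q mf mg t r *
      tildeParam q mf mg t a * pPow w (α r + α a) * q ^ j * ω) (Complex.exp w))
    (Y := fun r w k => ∏ j ∈ Finset.range k, max 1 (‖pPow w (α r + α a)‖ * ‖q‖ ^ j)) fun r hr => by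
    have hr' := Finset.ne_of_mem_erase hr
    exact geomBound_theta h.q_ne h.q_lt hκ
      (mul_ne_zero (h.tilde_ne_zero mf mg r) (h.tilde_ne_zero mf mg a))
      (h.neg_one_lt_add hr').le (by linarith [h.le r hr'])
  obtain ⟨C3, hC3⟩ := exists_inv_qPochFin_bound h.q_lt
  have b3 := GeomBound.of_const (I := fullIndex q (-α a - σ))
    (X := fun _ k _ => (qPochFin q q k)⁻¹) (Eventually.of_forall fun _ i _ => hC3 i.1)
  -- These theta functions come from shifting Γ(pS_a² q^k) back to k = 0. Their exponent 1 + 2α_a is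
  -- non-negative, so the maxima are 1.
  have b4 := geomBound_theta h.q_ne h.q_lt hκ (pow_ne_zero 2 hta) (γ := 1 + 2 * α a)
    (by linarith) (by linarith) |>.mono_right (Y' := fun _ _ => 1) (eventually_re_neg.mono
      fun w hw k => Finset.prod_le_one (fun _ _ => by positivity) fun j _ => max_le le_rfl
        (mul_le_one₀ (norm_pPow_le_one hw (by linarith)) (by positivity)
          (pow_le_one₀ (norm_nonneg _) h.q_lt.le)))
  have hq0 : qPoch (powLim (1 + 2 * α a) (t a ^ 2)) q ≠ 0 := by
    rw [powLim]
    split_ifs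
    · rw [pow_two]; exact h.qPoch_mul_ne_zero a a
    · rw [qPoch_zero_left]; exact one_ne_zero
  have b5 := GeomBound.of_tendsto (I := fullIndex q (-α a - σ))
    (tendsto_ellGamma h.q_lt (γ := 1 + 2 * α a) (by linarith) (by linarith) hq0)
  have b6 : GeomBound (fullIndex q (-α a - σ)) (fun w k _ =>
      dPoch (Complex.exp w) q (Complex.exp w * q * q ^ k) /
          dPoch (Complex.exp w) q ((q ^ k)⁻¹ * Complex.exp w)) fun _ _ => 1 := by
    refine GeomBound.of_const (C := Real.exp (1 * sumBound q) * 2) ?_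
    filter_upwards [eventually_norm_exp_le (show (0 : ℝ) < 1 / 2 by norm_num), eventually_re_neg,
      eventually_mul_norm_pPow_le (sumBound q) (γ := 1 - (-α a - σ)) (by linarith)
      (show (0 : ℝ) < 1 / 3 by norm_num)] with w hp hw hsmall i hi
    have hs := sumBound_pos h.q_lt
    rw [norm_div, div_eq_mul_inv]
    refine mul_le_mul ((norm_dPoch_le hp h.q_lt _).trans ?_) ?_ (by positivity) (by positivity)
    · gcongr
      rw [norm_mul, norm_mul, norm_pow]
      exact mul_le_one₀ (mul_le_one₀ (by linarith) (norm_nonneg _) h.q_lt.le) (by positivity)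
        (pow_le_one₀ (norm_nonneg _) h.q_lt.le)
    · have h1 := norm_arg_inv_le h.q_ne h.q_lt hκ hw (y := 1) (ω := 1) (γ := 1) hi.1 (by simp)
      rw [pPow_one, one_mul, mul_one, norm_one, one_mul, ← inv_mul_eq_div] at h1
      have h2 := half_le_norm_dPoch hp h.q_lt
        ((mul_le_mul_of_nonneg_right h1 hs.le).trans ((mul_comm _ _).trans_le hsmall))
      calc _ ≤ ((1 : ℝ) / 2)⁻¹ := inv_anti₀ (by norm_num) h2
        _ = 2 := by norm_num
  refine GeomBound.congr_right ((((b1.mul (b2.mul (b3.mul ((b4.mul b5).mul b6))))).mono (fun w i hi => hi.1)).congr_left ?_) fun w k => ?_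
  · have hd := ((tendsto_dPoch h.q_lt tendsto_exp_cusp (tendsto_mul_pPow (γ := 1 + 2 * α a)
      (by linarith) (t a ^ 2))).eventually_ne hq0)
    filter_upwards [h.residueTerm_eq mf mg F G, hd,
      eventually_norm_exp_le (show (0 : ℝ) < 1 / 2 by norm_num)] with w hw hd hp i hi
    refine le_of_eq ?_
    congr 1
    have hp1 := norm_lt_one_of_le_half hp
    have hx := mul_ne_zero (pow_ne_zero 2 hta) (pPow_ne_zero w (1 + 2 * α a))
    have e : scaledParam t α w a * (scaledParam t α w a * q ^ i.1) * Complex.exp w =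
        t a ^ 2 * pPow w (1 + 2 * α a) * q ^ i.1 := by
      rw [scaledParam, show 2 * α a = α a + α a by ring, pPow_add, pPow_add, pPow_one]
      ring
    have e' : ∏ r ∈ Finset.univ.erase a, ∏ j ∈ Finset.range i.1,
        theta (tildeParam q mf mg (scaledParam t α w) r *
          tildeParam q mf mg (scaledParam t α w) a * q ^ j) (Complex.exp w) =
        ∏ r ∈ Finset.univ.erase a, ∏ j ∈ Finset.range i.1, theta (tildeParam q mf mg t r *
      tildeParam q mf mg t a * pPow w (α r + α a) * q ^ j) (Complex.exp w) := by
      refine Finset.prod_congr rfl fun r _ => Finset.prod_congr rfl fun j _ => ?_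
      rw [tildeParam_scaledParam, tildeParam_scaledParam, pPow_add]
      congr 1
      ring
    rw [hw hi.2.2, hi.2.1, e, e', ellGamma_mul_pow_of_ne hp1 h.q_lt h.q_ne hx hd]
    simp only [mul_one]
    ring
  · simp only [mul_one]
    rw [Finset.prod_comm, ← Finset.prod_mul_distrib]
    rfl

end Admissible

end EllipticPairing

end

noncomputable section

namespace EllipticPairing

/-! ### The remaining integral -/

/-- The quotient of theta functions in the remaining integral. -/
def thetaRatio (q γ y ω : ℂ) : ℂ :=
  theta (γ * ω) q * theta (γ * y / ω) q / (theta γ q * theta (γ * y) q * theta ω⁻¹ q)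

section algebra

variable {p q : ℂ} (hp : ‖p‖ < 1) (hq : ‖q‖ < 1) (hp0 : p ≠ 0) (hq0 : q ≠ 0)

include hp hp0 hq0 in
lemma prod_theta_mul_self {x : ℂ} (hx : x ≠ 0) (K : ℕ) :
    ∏ j ∈ Finset.range K, theta (p * x * q ^ j) p =
      ((-x) ^ K * q ^ K.choose 2)⁻¹ * ∏ j ∈ Finset.range K, theta (x * q ^ j) p := by
  have h1 : ∀ j ∈ Finset.range K, theta (p * x * q ^ j) p =
      ((-x) * q ^ j)⁻¹ * theta (x * q ^ j) p := fun j _ => by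
    rw [mul_assoc, theta_mul_self hp hp0 (mul_ne_zero hx (pow_ne_zero j hq0)), neg_mul x, inv_neg]
  rw [Finset.prod_congr rfl h1, Finset.prod_mul_distrib, Finset.prod_inv_distrib,
    Finset.prod_mul_distrib, Finset.prod_const, Finset.card_range, Finset.prod_pow_eq_pow_sum,
    Finset.sum_range_id, Nat.choose_two_right]

include hq hq0 in
lemma theta_mul_pow_eq {x : ℂ} (hx : x ≠ 0) (K : ℕ) :
    theta (x * q ^ K) q = ((-x) ^ K * q ^ K.choose 2)⁻¹ * theta x q := by
  have h := theta_mul_pow hq hq0 hx K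
  have h1 := pow_ne_zero K (neg_ne_zero.2 hx)
  have h2 := pow_ne_zero (K.choose 2) hq0
  rw [← h]
  field_simp

include hq hq0 in
lemma theta_div_pow_eq {x : ℂ} (hx : x ≠ 0) (K : ℕ) :
    theta (x / q ^ K) q = (-x) ^ K * q ^ K.choose 2 / q ^ (K * K) * theta x q := by
  have hqK := pow_ne_zero K hq0
  have h := theta_mul_pow hq hq0 (div_ne_zero hx hqK) K
  rw [div_mul_cancel₀ _ hqK] at h
  rw [← h, ← neg_div, div_pow, ← pow_mul]
  ring

include hp hq hp0 hq0 in
/-- The factors with quasi-periods. -/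
lemma quasiPeriodic_factor {x y γ ω s : ℂ} (hx : x ≠ 0) (hy : y ≠ 0) (hγ : γ ≠ 0) (hω : ω ≠ 0)
    (hs : s ≠ 0) (hxy : x = s ^ 2 * y) (K : ℕ) :
    (∏ j ∈ Finset.range K, theta (p * (x * ω) * q ^ j) p) * theta (γ * (q ^ K * ω)) q *
      theta (γ * y / (q ^ K * ω)) q / (theta γ q * theta (γ * y) q * theta (q ^ K * ω)⁻¹ q) =
    ((s ^ 2) ^ K * (q ^ K.choose 2) ^ 2)⁻¹ * ((ω ^ 2) ^ K)⁻¹ *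
      (∏ j ∈ Finset.range K, theta (x * q ^ j * ω) p) * thetaRatio q γ y ω := by
  have hqK := pow_ne_zero K hq0
  have hC := pow_ne_zero (K.choose 2) hq0
  have n1 : (-1 : ℂ) ^ K ≠ 0 := pow_ne_zero _ (by norm_num)
  -- All theta functions are reduced to K = 0. Of the multipliers, γ and y cancel, and what remains
  -- is the monomial of the residue with index K together with ω^{-2K}.
  rw [prod_theta_mul_self hp hp0 hq0 (mul_ne_zero hx hω),
    show γ * (q ^ K * ω) = γ * ω * q ^ K by ring,
    show γ * y / (q ^ K * ω) = γ * y / ω / q ^ K by field_simp,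
    show (q ^ K * ω)⁻¹ = ω⁻¹ / q ^ K by field_simp,
    theta_mul_pow_eq hq hq0 (mul_ne_zero hγ hω),
    theta_div_pow_eq hq hq0 (div_ne_zero (mul_ne_zero hγ hy) hω),
    theta_div_pow_eq hq hq0 (inv_ne_zero hω), thetaRatio]
  simp only [mul_right_comm x _ ω]
  generalize ∏ j ∈ Finset.range K, theta (x * ω * q ^ j) p = P
  generalize theta (γ * ω) q = A
  generalize theta (γ * y / ω) q = B
  generalize theta γ q = D
  generalize theta (γ * y) q = E
  generalize theta ω⁻¹ q = H
  have hK2 := pow_ne_zero (K * K) hq0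
  have e1 : (-(x * ω)) ^ K = (-1) ^ K * ((s ^ 2) ^ K * y ^ K * ω ^ K) := by
    rw [neg_pow, mul_pow, hxy, mul_pow]
  have e2 : (-(γ * ω)) ^ K = (-1) ^ K * (γ ^ K * ω ^ K) := by rw [neg_pow, mul_pow]
  have e3 : (-(γ * y / ω)) ^ K = (-1) ^ K * (γ ^ K * y ^ K / ω ^ K) := by
    rw [neg_pow, div_pow, mul_pow]
  have e4 : (-ω⁻¹) ^ K = (-1) ^ K * (ω ^ K)⁻¹ := by rw [neg_pow, inv_pow]
  have m1 := pow_ne_zero K hω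
  have m2 := pow_ne_zero K hγ
  have m3 := pow_ne_zero K hy
  have m4 := pow_ne_zero K (pow_ne_zero 2 hs)
  rw [e1, e2, e3, e4, pow_right_comm ω 2 K]
  simp only [div_eq_mul_inv, mul_inv, inv_inv]
  field_simp
  rw [show ((-1 : ℂ) ^ K) ^ 2 = 1 by rw [← pow_mul, mul_comm, pow_mul]; simp, one_mul]

end algebra

/-- The factors of the remaining integral that are not factors of the residues. -/
def remainderFactor (p q : ℂ) (S : Fin 6 → ℂ) (a b : Fin 6) (γ : ℂ) (K : ℕ) (ω : ℂ) : ℂ :=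
  ((ω ^ 2) ^ K)⁻¹ * (∏ j ∈ Finset.range K, theta (S b * S a * q ^ j * ω) p) *
    thetaRatio q γ (S b / S a) ω *
    (ellGamma (S a * (S a * q ^ K * ω) * p) p q * ellGamma ((q ^ K * ω)⁻¹ * p) p q) *
    (ellGamma (S b * S a * p * ω) p q * (ellGamma (S b * S a * p) p q)⁻¹) *
    ∏ r ∈ (Finset.univ.erase a).erase b, ((∏ j ∈ Finset.range K, theta (S r * S a * q ^ j) p) *
      (ellGamma (S r * S a * q ^ K * ω) p q * (ellGamma (S r * S a * q ^ K) p q)⁻¹))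

/-- The gamma functions of S_a z, S_b z and S_a/z could be close to poles on the circle. The first
two absorb theta functions of the breaker and the third one yields θ(S_a/z;q) in the denominator,
all through Γ(px) = θ(x;q) Γ(x). The quasi-periods then produce the same monomial as in the residue
with index K. -/
lemma prefactor_mul_half {q : ℂ} {t : Fin 6 → ℂ} {α : Fin 6 → ℝ} {a b : Fin 6} {mf mg : ℕ}
    {w : ℂ} {F G : ℂ → ℂ → ℂ} {K : ℕ} {S : Fin 6 → ℂ} {p γ ω z : ℂ}
    (hSe : S = tildeParam q mf mg (scaledParam t α w)) (hpe : p = Complex.exp w)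
    (hp : ‖p‖ < 1) (hq : ‖q‖ < 1) (hq0 : q ≠ 0) (ht : ∀ r, t r ≠ 0)
    (ha4 : a ≠ 4) (ha5 : a ≠ 5) (hab : a ≠ b) (hω : ω ≠ 0) (hγ : γ ≠ 0)
    (hN : NonResonant p q mf mg (scaledParam t α w)) (hz : z = S a * (q ^ K * ω))
    (h1 : ∀ r, dPoch p q (S r * z) ≠ 0) (h2 : dPoch p q (q ^ K * ω)⁻¹ ≠ 0)
    (h3 : theta (q ^ K * ω)⁻¹ q ≠ 0)
    (h4 : dPoch p q (S b * S a * p * ω) ≠ 0)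
    (h6 : ∀ r, r ≠ a → r ≠ b → ellGamma (S r * S a * q ^ K) p q ≠ 0) :
    qPoch q q * qPoch p p / (∏ rs : Fin 6 × Fin 6 with rs.1 < rs.2,
        ellGamma (scaledParam t α w rs.1 * scaledParam t α w rs.2) p q) *
      (halfNum p q S a b (γ / S a) (F w) (G w) z / halfDen p q S a b z) =
    qPoch q q * (commonFactor q t α a mf mg F G w K ω * remainderFactor p q S a b γ K ω) := by
  have hp0 : p ≠ 0 := hpe ▸ Complex.exp_ne_zero w
  have hT : ∀ r, scaledParam t α w r ≠ 0 := fun r => mul_ne_zero (ht r) (pPow_ne_zero _ _)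
  have hS : ∀ r, S r ≠ 0 := fun r => hSe ▸ tildeParam_ne_zero hq0 hT r
  have hSa : S a = scaledParam t α w a := hSe ▸ tildeParam_self ha4 ha5
  have hqK := pow_ne_zero K hq0
  have hz0 : z ≠ 0 := hz ▸ mul_ne_zero (hS a) (mul_ne_zero hqK hω)
  have hd : ∀ r s, dPoch p q (S r * S s) ≠ 0 := fun r s => hSe ▸ hN.dPoch_ne_zero hp hq r s
  have hqp := quasiPeriodic_factor hp hq hp0 hq0 (mul_ne_zero (hS b) (hS a))
    (div_ne_zero (hS b) (hS a)) hγ hω (hS a) (by have := hS a; field_simp) K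
  have e1 : theta (S a * z) q * ellGamma (S a * z) p q =
      ellGamma (S a * (S a * q ^ K * ω) * p) p q := by
    rw [← ellGamma_mul_left_of_ne hp hq hp0 (mul_ne_zero (hS a) hz0) (h1 a), hz]
    congr 1
    ring
  have e2 : ellGamma (S a * z⁻¹) p q =
      ellGamma ((q ^ K * ω)⁻¹ * p) p q / theta (q ^ K * ω)⁻¹ q := by
    have : S a * z⁻¹ = (q ^ K * ω)⁻¹ := by
      have := hS a
      rw [hz]; field_simp
    rw [ellGamma_mul_left_of_ne hp hq hp0 (inv_ne_zero (mul_ne_zero hqK hω)) h2,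
      mul_div_cancel_left₀ _ h3, this]
  have e3 : theta (S b * z) q * ellGamma (S b * z) p q =
      (∏ j ∈ Finset.range K, theta (p * (S b * S a * ω) * q ^ j) p) *
        ellGamma (S b * S a * p * ω) p q := by
    have n1 := mul_ne_zero (mul_ne_zero (mul_ne_zero (hS b) (hS a)) hp0) hω
    have := ellGamma_mul_pow_of_ne hp hq hq0 n1 h4 K
    rw [← ellGamma_mul_left_of_ne hp hq hp0 (mul_ne_zero (hS b) hz0) (h1 b), hz,
      show S b * (S a * (q ^ K * ω)) * p = S b * S a * p * ω * q ^ K by ring, this]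
    congr 1
    refine Finset.prod_congr rfl fun j _ => ?_
    congr 1
    ring
  have e4 : ellGamma (S b * S a * p) p q = theta (S a * S b) q * ellGamma (S b * S a) p q := by
    rw [ellGamma_mul_left_of_ne hp hq hp0 (mul_ne_zero (hS b) (hS a)) (hd b a), mul_comm (S b)]
  have e5 : ∀ r, r ≠ a → r ≠ b → (ellGamma (S r * S a) p q)⁻¹ =
      (∏ j ∈ Finset.range K, theta (S r * S a * q ^ j) p) *
        (ellGamma (S r * S a * q ^ K) p q)⁻¹ := fun r hra hrb => by
    have := h6 r hra hrb
    rw [ellGamma_mul_pow_of_ne hp hq hq0 (mul_ne_zero (hS r) (hS a)) (hd r a)] at this ⊢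
    have := left_ne_zero_of_mul this
    field_simp
  have e6 : ∏ r ∈ Finset.univ.erase a, ellGamma (scaledParam t α w r * scaledParam t α w a) p q =
      (∏ r ∈ Finset.univ.erase a, ∏ j ∈ Finset.range (shiftExp mf mg r),
        theta (S r * S a * q ^ j) p) * ∏ r ∈ Finset.univ.erase a, ellGamma (S r * S a) p q := by
    rw [← Finset.prod_mul_distrib]
    refine Finset.prod_congr rfl fun r _ => ?_
    rw [← ellGamma_mul_pow_of_ne hp hq hq0 (mul_ne_zero (hS r) (hS a)) (hd r a), hSa, hSe,
      mul_right_comm, tildeParam_mul_pow hq0]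
  have e7 : -z⁻¹ ^ 2 * theta (z ^ 2) p = theta (z⁻¹ ^ 2) p := by
    rw [inv_pow, theta_inv hp hp0 (pow_ne_zero 2 hz0)]
  have hba : b ∈ Finset.univ.erase a := Finset.mem_erase.2 ⟨hab.symm, Finset.mem_univ b⟩
  have e8 : ∏ r, ellGamma (S r * z) p q * ellGamma (S r * z⁻¹) p q =
      (ellGamma (S a * z) p q * ellGamma (S a * z⁻¹) p q) *
        (ellGamma (S b * z) p q * ∏ r ∈ (Finset.univ.erase a).erase b, ellGamma (S r * z) p q) *
        ∏ r ∈ Finset.univ.erase a, ellGamma (S r * z⁻¹) p q := by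
    rw [← Finset.mul_prod_erase _ _ (Finset.mem_univ a), Finset.prod_mul_distrib,
      Finset.mul_prod_erase _ (fun r => ellGamma (S r * z) p q) hba]
    ring
  have e9 : (∏ r ∈ Finset.univ.erase a, ellGamma (S r * S a) p q)⁻¹ =
      (ellGamma (S b * S a) p q)⁻¹ * ∏ r ∈ (Finset.univ.erase a).erase b,
        ((∏ j ∈ Finset.range K, theta (S r * S a * q ^ j) p) *
        (ellGamma (S r * S a * q ^ K) p q)⁻¹) := by
    rw [← Finset.mul_prod_erase _ _ hba, mul_inv, ← Finset.prod_inv_distrib]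
    congr 1
    refine Finset.prod_congr rfl fun r hr => ?_
    exact e5 r (Finset.ne_of_mem_erase (Finset.mem_of_mem_erase hr)) (Finset.ne_of_mem_erase hr)
  have e10 : ∏ r ∈ (Finset.univ.erase a).erase b, ellGamma (S r * z) p q =
      ∏ r ∈ (Finset.univ.erase a).erase b, ellGamma (S r * S a * q ^ K * ω) p q := by
    refine Finset.prod_congr rfl fun r _ => ?_
    rw [hz]; congr 1; ring
  have e11 : S a * (γ / S a) = γ := by have := hS a; field_simp
  have e12 : S b * (γ / S a) = γ * (S b / S a) := by ring
  have e13 : γ / S a * z = γ * (q ^ K * ω) := by have := hS a; rw [hz]; field_simp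
  have e14 : S a * S b * (γ / S a) / z = γ * (S b / S a) / (q ^ K * ω) := by
    have := hS a; rw [hz]; field_simp
  rw [halfNum_div_halfDen hp hq hab h1, breaker, halfConst, e7, e8, e10, e2, e11, e12, e13, e14,
    prod_pairs (g := fun r s => ellGamma (scaledParam t α w r * scaledParam t α w s) p q)
      (fun r s => by rw [mul_comm]) a, e6, commonFactor, remainderFactor]
  simp only [← hSe, ← hpe, ← hz]
  simp only [Finset.prod_mul_distrib, Finset.prod_inv_distrib] at e9 ⊢
  rw [e4]
  generalize ellGamma (S a * z) p q = A₁ at e1 ⊢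
  generalize theta (S a * z) q = A₂ at e1 ⊢
  generalize ellGamma (S b * z) p q = A₃ at e3 ⊢
  generalize theta (S b * z) q = A₄ at e3 ⊢
  generalize ellGamma (S a * (S a * q ^ K * ω) * p) p q = A₅ at e1 ⊢
  generalize ellGamma (S b * S a * p * ω) p q = A₆ at e3 ⊢
  generalize (∏ j ∈ Finset.range K, theta (p * (S b * S a * ω) * q ^ j) p) = A₇ at e3 hqp
  generalize theta (γ * (q ^ K * ω)) q = A₈ at hqp ⊢
  generalize theta (γ * (S b / S a) / (q ^ K * ω)) q = A₉ at hqp ⊢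
  generalize theta γ q = B₁ at hqp ⊢
  generalize theta (γ * (S b / S a)) q = B₂ at hqp ⊢
  generalize theta (q ^ K * ω)⁻¹ q = B₃ at hqp ⊢
  generalize (∏ r ∈ Finset.univ.erase a, ellGamma (S r * S a) p q) = B₄ at e9 ⊢
  generalize ellGamma (S b * S a) p q = B₅ at e9 ⊢
  generalize (∏ r ∈ (Finset.univ.erase a).erase b, ∏ j ∈ Finset.range K,
    theta (S r * S a * q ^ j) p) = B₆ at e9 ⊢
  generalize (∏ r ∈ (Finset.univ.erase a).erase b, ellGamma (S r * S a * q ^ K) p q) = B₇ at e9 ⊢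
  generalize (∏ r ∈ (Finset.univ.erase a).erase b, ellGamma (S r * S a * q ^ K * ω) p q) = B₈
  generalize (∏ r ∈ Finset.univ.erase a, ellGamma (S r * z⁻¹) p q) = B₉
  generalize (∏ r ∈ Finset.univ.erase a, ∏ j ∈ Finset.range (shiftExp mf mg r),
    theta (S r * S a * q ^ j) p) = D₁
  generalize ellGamma ((q ^ K * ω)⁻¹ * p) p q = D₂
  generalize theta (S a * S b) q = D₃
  generalize theta (z⁻¹ ^ 2) p = D₄
  generalize F w z * G w z = D₅
  generalize (∏ rs : Fin 6 × Fin 6 with rs.1 < rs.2 ∧ rs.1 ≠ a ∧ rs.2 ≠ a,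
    ellGamma (scaledParam t α w rs.1 * scaledParam t α w rs.2) p q) = D₆
  calc _ = qPoch q q * qPoch p p * D₁⁻¹ * D₆⁻¹ * D₄ * D₅ * B₉ * B₈ * D₂ * D₃⁻¹ * B₄⁻¹ *
        (A₂ * A₁) * (A₄ * A₃) * (A₈ * A₉ / (B₁ * B₂ * B₃)) := by
        simp only [div_eq_mul_inv, mul_inv]; ring
    _ = qPoch q q * qPoch p p * D₁⁻¹ * D₆⁻¹ * D₄ * D₅ * B₉ * B₈ * D₂ * D₃⁻¹ *
        (B₅⁻¹ * (B₆ * B₇⁻¹)) * A₅ * A₆ * (A₇ * A₈ * A₉ / (B₁ * B₂ * B₃)) := by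
        rw [e1, e3, e9]; ring
    _ = _ := by rw [hqp, mul_inv]; ring

end EllipticPairing

end

/-! ### Bounds for the theta quotient on the circle -/

noncomputable section

namespace EllipticPairing

section thetaRatio

variable {q : ℂ} (hq0 : q ≠ 0) (hq : ‖q‖ < 1)

lemma isCompact_annulus (r R : ℝ) : IsCompact {x : ℂ | r ≤ ‖x‖ ∧ ‖x‖ ≤ R} := by
  have : {x : ℂ | r ≤ ‖x‖ ∧ ‖x‖ ≤ R} = Metric.closedBall 0 R ∩ {x | r ≤ ‖x‖} := by
    ext x; simp [and_comm]
  rw [this]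
  exact (isCompact_closedBall 0 R).inter_right (isClosed_le continuous_const continuous_norm)

include hq in
lemma continuousOn_theta {r : ℝ} (hr : 0 < r) (R : ℝ) :
    ContinuousOn (fun x => ‖theta x q‖) {x : ℂ | r ≤ ‖x‖ ∧ ‖x‖ ≤ R} := fun _ hx =>
  (differentiableAt_theta hq (norm_pos_iff.1 (hr.trans_le hx.1))).continuousAt.norm.continuousWithinAt

include hq0 hq in
-- The annulus e⁵ ≤ |x| ≤ e lies strictly between the zeros of modulus e⁶ = |q| and 1, so
-- compactness gives a positive lower bound there. The larger annulus for the upper bound contains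
-- all arguments that occur.
lemma exists_norm_theta_mem {e : ℝ} (he : 0 < e) (he1 : e < 1) (heq : e ^ 6 = ‖q‖) :
    ∃ c M : ℝ, 0 < c ∧ 0 < M ∧ (∀ x : ℂ, e ^ 5 ≤ ‖x‖ → ‖x‖ ≤ e → c ≤ ‖theta x q‖) ∧
      ∀ x : ℂ, e ^ 8 ≤ ‖x‖ → ‖x‖ ≤ e⁻¹ ^ 2 → ‖theta x q‖ ≤ M := by
  have hne : ({x : ℂ | e ^ 5 ≤ ‖x‖ ∧ ‖x‖ ≤ e}).Nonempty :=
    ⟨e, by simpa [abs_of_pos he] using pow_le_of_le_one he.le he1.le (by norm_num)⟩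
  obtain ⟨x₀, hx₀, hmin⟩ := (isCompact_annulus (e ^ 5) e).exists_isMinOn hne
    (continuousOn_theta hq (pow_pos he 5) e)
  obtain ⟨M, hM⟩ := ((isCompact_annulus (e ^ 8) (e⁻¹ ^ 2)).image_of_continuousOn
    (continuousOn_theta hq (pow_pos he 8) _)).bddAbove
  refine ⟨‖theta x₀ q‖, max 1 M, norm_pos_iff.2 fun h0 => ?_, by positivity,
    fun x h1 h2 => hmin ⟨h1, h2⟩, fun x h1 h2 => (hM ⟨x, ⟨h1, h2⟩, rfl⟩).trans (le_max_right _ _)⟩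
  have hx0 : x₀ ≠ 0 := norm_pos_iff.1 ((pow_pos he 5).trans_le hx₀.1)
  obtain ⟨n, hn⟩ := (theta_eq_zero_iff hq hq0 hx0).1 h0
  have h1 := hx₀.1
  have h2 := hx₀.2
  rw [hn, norm_zpow, ← heq, ← zpow_natCast, ← zpow_natCast, ← zpow_mul] at h1
  rw [hn, norm_zpow, ← heq, ← zpow_natCast, ← zpow_mul] at h2
  have h3 := (zpow_le_zpow_iff_right_of_lt_one₀ he he1).1 h1
  nth_rewrite 2 [← zpow_one e] at h2
  have h4 := (zpow_le_zpow_iff_right_of_lt_one₀ he he1).1 h2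
  push_cast at h3 h4
  omega

include hq0 hq in
/-- A shift of the variable by which it avoids the powers of `q`. -/
lemma exists_shift {e : ℝ} (he : 0 < e) (he1 : e < 1) (heq : e ^ 6 = ‖q‖) {y : ℂ} (hy : y ≠ 0) :
    ∃ (γ : ℂ) (n : ℤ), e ^ 5 ≤ ‖γ‖ ∧ ‖γ‖ ≤ e ∧ e ^ 5 ≤ ‖γ * y * q ^ n‖ ∧ ‖γ * y * q ^ n‖ ≤ e := by
  obtain ⟨n, h1, h2⟩ := exists_zpow_mul_mem_annulus hq hq0 hy
  have hle : ∀ {i j : ℕ}, i ≤ j → e ^ j ≤ e ^ i := fun h => pow_le_pow_of_le_one he.le he1.le h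
  have hn : ∀ k : ℕ, ‖((e : ℂ)) ^ k‖ = e ^ k := fun k => by
    rw [norm_pow, Complex.norm_real, Real.norm_of_nonneg he.le]
  rw [← heq] at h1
  -- The modulus of yq^n lies in [e⁶, 1]. If it is at least e³, multiplication by γ = e² puts it in
  -- the annulus; otherwise γ = e⁴ does so after one more division by q, which has modulus e⁶.
  rcases le_total (e ^ 3) ‖y * q ^ n‖ with h | h
  · refine ⟨(e : ℂ) ^ 2, n, ?_, ?_, ?_, ?_⟩
    · rw [hn]; exact hle (by norm_num)
    · rw [hn]; simpa using hle (show 1 ≤ 2 by norm_num)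
    · rw [mul_assoc, norm_mul, hn]
      calc e ^ 5 = e ^ 2 * e ^ 3 := by ring
        _ ≤ _ := by gcongr
    · rw [mul_assoc, norm_mul, hn]
      calc e ^ 2 * ‖y * q ^ n‖ ≤ e ^ 2 * 1 := by gcongr
        _ ≤ e := by simpa using hle (show 1 ≤ 2 by norm_num)
  · have e1 : (e : ℂ) ^ 4 * y * q ^ (n - 1) = (e : ℂ) ^ 4 * (y * q ^ n) / q := by
      rw [zpow_sub_one₀ hq0]; ring
    have e2 : ‖(e : ℂ) ^ 4 * y * q ^ (n - 1)‖ = ‖y * q ^ n‖ / e ^ 2 := by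
      rw [e1, norm_div, norm_mul, hn, ← heq]
      field_simp
    refine ⟨(e : ℂ) ^ 4, n - 1, ?_, ?_, ?_, ?_⟩
    · rw [hn]; exact hle (by norm_num)
    · rw [hn]; simpa using hle (show 1 ≤ 4 by norm_num)
    · rw [e2, le_div_iff₀ (by positivity)]
      calc e ^ 5 * e ^ 2 = e ^ 7 := by ring
        _ ≤ e ^ 6 := hle (by norm_num)
        _ ≤ _ := h1
    · rw [e2, div_le_iff₀ (by positivity)]
      calc _ ≤ e ^ 3 := h
        _ = e * e ^ 2 := by ring

include hq0 hq in
lemma theta_div_div_theta {x ω : ℂ} (hx : x ≠ 0) (hω : ω ≠ 0) (n : ℤ) :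
    theta (x / ω) q / theta x q =
      ω ^ (-n) * (theta (x * q ^ n / ω) q / theta (x * q ^ n) q) := by
  have key : ∀ (x : ℂ) (_ : x ≠ 0) (m : ℕ), theta (x / ω) q / theta x q =
      (ω ^ m)⁻¹ * (theta (x * q ^ m / ω) q / theta (x * q ^ m) q) := fun x hx m => by
    have h1 := theta_mul_pow hq hq0 hx m
    have h2 := theta_mul_pow hq hq0 (div_ne_zero hx hω) m
    have n1 := pow_ne_zero m (neg_ne_zero.2 hx)
    have n2 := pow_ne_zero (m.choose 2) hq0
    have n3 := pow_ne_zero m hω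
    rw [← h1, ← h2, ← neg_div, div_pow, show x / ω * q ^ m = x * q ^ m / ω by ring]
    field_simp
  obtain ⟨m, rfl | rfl⟩ := n.eq_nat_or_neg
  · rw [zpow_neg, zpow_natCast, zpow_natCast]
    exact key x hx m
  · have hqm := pow_ne_zero m hq0
    have hx' := mul_ne_zero hx (inv_ne_zero hqm)
    rw [neg_neg, zpow_neg, zpow_natCast, zpow_natCast, key _ hx' m, inv_mul_cancel_right₀ hqm,
      mul_inv_cancel_left₀ (pow_ne_zero m hω)]

include hq0 hq in
-- The shift γ keeps the theta functions of the denominator away from zero. Replacing γy by γyq^n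
-- costs ω^{-n}. This is bounded for n ≥ 0, since |ω| > 1; for n = −m it is at most |q|^{-m}, and
-- |γyq^n| ≤ e turns this into a multiple of 1/|y|.
lemma exists_thetaRatio_bound {e : ℝ} (he : 0 < e) (he1 : e < 1) (heq : e ^ 6 = ‖q‖) :
    ∃ C : ℝ, 0 ≤ C ∧ ∀ y : ℂ, y ≠ 0 → ∃ γ : ℂ, γ ≠ 0 ∧ theta γ q ≠ 0 ∧ theta (γ * y) q ≠ 0 ∧
      ∀ ω : ℂ, ‖ω‖ = e⁻¹ ^ 3 → ‖thetaRatio q γ y ω‖ ≤ C * (1 + ‖y‖⁻¹) := by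
  obtain ⟨c, M, hc, hM, h1, h2⟩ := exists_norm_theta_mem hq0 hq he he1 heq
  have hle : ∀ {i j : ℕ}, i ≤ j → e ^ j ≤ e ^ i := fun h => pow_le_pow_of_le_one he.le he1.le h
  refine ⟨M / c * (M / c) / c * e⁻¹ ^ 4, by positivity, fun y hy => ?_⟩
  obtain ⟨γ, n, g1, g2, g3, g4⟩ := exists_shift hq0 hq he he1 heq hy
  have hγ : γ ≠ 0 := norm_pos_iff.1 ((pow_pos he 5).trans_le g1)
  have hx : γ * y ≠ 0 := mul_ne_zero hγ hy
  have hθ : ∀ x : ℂ, e ^ 5 ≤ ‖x‖ → ‖x‖ ≤ e → theta x q ≠ 0 := fun x hx hx' =>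
    norm_pos_iff.1 (hc.trans_le (h1 x hx hx'))
  refine ⟨γ, hγ, hθ γ g1 g2, fun h0 => hθ _ g3 g4 ?_, fun ω hω => ?_⟩
  · obtain ⟨c', -, h3⟩ := theta_zpow_mul hq hq0 hx n
    rw [h3, h0, mul_zero]
  have hω0 : ω ≠ 0 := norm_pos_iff.1 (by rw [hω]; positivity)
  have hωi : ‖ω⁻¹‖ = e ^ 3 := by rw [norm_inv, hω, ← inv_pow, inv_inv]
  have e1 : thetaRatio q γ y ω = theta (γ * ω) q / theta γ q *
      (ω ^ (-n) * (theta (γ * y * q ^ n / ω) q / theta (γ * y * q ^ n) q)) / theta ω⁻¹ q := by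
    rw [← theta_div_div_theta hq0 hq hx hω0, thetaRatio]
    simp only [div_eq_mul_inv, mul_inv]
    ring
  have b1 : ‖theta (γ * ω) q / theta γ q‖ ≤ M / c := by
    rw [norm_div]
    refine div_le_div₀ hM.le (h2 _ ?_ ?_) hc (h1 _ g1 g2)
    · rw [norm_mul, hω]
      calc e ^ 8 ≤ e ^ 2 := hle (by norm_num)
        _ = e ^ 5 * e⁻¹ ^ 3 := by field_simp
        _ ≤ _ := by gcongr
    · rw [norm_mul, hω]
      calc _ ≤ e * e⁻¹ ^ 3 := by gcongr
        _ = _ := by field_simp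
  have b2 : ‖theta (γ * y * q ^ n / ω) q / theta (γ * y * q ^ n) q‖ ≤ M / c := by
    rw [norm_div]
    refine div_le_div₀ hM.le (h2 _ ?_ ?_) hc (h1 _ g3 g4)
    · rw [div_eq_mul_inv, norm_mul, hωi]
      calc e ^ 8 = e ^ 5 * e ^ 3 := by ring
        _ ≤ _ := by gcongr
    · rw [div_eq_mul_inv, norm_mul, hωi]
      calc _ ≤ e * e ^ 3 := by gcongr
        _ ≤ 1 := mul_le_one₀ he1.le (by positivity) (pow_le_one₀ he.le he1.le)
        _ ≤ _ := one_le_pow₀ ((one_le_inv₀ he).2 he1.le)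
  have b3 : ‖theta ω⁻¹ q‖⁻¹ ≤ c⁻¹ := inv_anti₀ hc (h1 _ (by rw [hωi]; exact hle (by norm_num))
    (by rw [hωi]; simpa using hle (show 1 ≤ 3 by norm_num)))
  have b4 : ‖ω ^ (-n)‖ ≤ e⁻¹ ^ 4 * (1 + ‖y‖⁻¹) := by
    have hy' := norm_pos_iff.2 hy
    have he4 : 1 ≤ e⁻¹ ^ 4 := one_le_pow₀ ((one_le_inv₀ he).2 he1.le)
    rw [norm_zpow, hω]
    obtain ⟨m, rfl | rfl⟩ := n.eq_nat_or_neg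
    · rw [zpow_neg, zpow_natCast, ← inv_pow, inv_pow e, inv_inv]
      calc (e ^ 3) ^ m ≤ 1 := pow_le_one₀ (by positivity) (pow_le_one₀ he.le he1.le)
        _ ≤ _ := one_le_mul_of_one_le_of_one_le he4 (by linarith [inv_pos.2 hy'])
    · rw [neg_neg, zpow_natCast]
      rw [norm_mul, norm_mul, norm_zpow, ← heq, zpow_neg, zpow_natCast, ← inv_pow] at g4
      have g5 : (e⁻¹ ^ 3) ^ m ≤ ((e ^ 6)⁻¹) ^ m := by
        rw [← inv_pow]
        exact pow_le_pow_left₀ (by positivity)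
          (pow_le_pow_right₀ ((one_le_inv₀ he).2 he1.le) (by norm_num)) m
      have g6 : e ^ 5 * ‖y‖ * ((e ^ 6)⁻¹) ^ m ≤ e := le_trans (by gcongr) g4
      calc _ ≤ ((e ^ 6)⁻¹) ^ m := g5
        _ = e⁻¹ ^ 5 * ‖y‖⁻¹ * (e ^ 5 * ‖y‖ * ((e ^ 6)⁻¹) ^ m) := by field_simp
        _ ≤ e⁻¹ ^ 5 * ‖y‖⁻¹ * e := by gcongr
        _ = e⁻¹ ^ 4 * ‖y‖⁻¹ := by field_simp
        _ ≤ _ := by gcongr; linarith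
  rw [e1, norm_div, norm_mul, norm_mul, div_eq_mul_inv]
  calc _ ≤ M / c * (e⁻¹ ^ 4 * (1 + ‖y‖⁻¹) * (M / c)) * c⁻¹ := by gcongr
    _ = _ := by ring

end thetaRatio

lemma GeomBound.at_one {q : ℂ} (hq0 : q ≠ 0) (hq : ‖q‖ < 1) {κ : ℝ} {X : ℂ → ℕ → ℂ → ℂ}
    {Y : ℂ → ℕ → ℝ} (h : GeomBound (fullIndex q κ) X Y) :
    GeomBound (fullIndex q κ) (fun w k _ => X w k 1) Y := by
  obtain ⟨C, hC, h⟩ := h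
  refine ⟨C, hC, h.mono fun w hw i hi => hw (i.1, 1) ⟨hi.1, by simp, ?_⟩⟩
  rw [norm_one]
  exact (one_le_inv₀ (norm_pos_iff.2 hq0)).2 hq.le

/-- The indices that occur in the remaining integral. -/
def remainderIndex (q : ℂ) (κ e : ℝ) (w : ℂ) : Set (ℕ × ℂ) :=
  {i ∈ fullIndex q κ w | i.1 = cutoff q κ w ∧ ‖i.2‖ = e⁻¹ ^ 3}

/-- At the cutoff |p|^{-κ} ≤ |q|^{-(k+1)}, so a fixed negative power of p is absorbed by a geometric
constant. -/
lemma geomBound_pPow_neg_one {q : ℂ} (hq0 : q ≠ 0) (hq : ‖q‖ < 1) {κ : ℝ} (hκ : 0 < κ) (e : ℝ) :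
    GeomBound (remainderIndex q κ e) (fun w _ _ => pPow w (-1)) fun _ _ => 1 := by
  obtain ⟨M, hM⟩ := exists_nat_ge (1 / κ)
  rw [div_le_iff₀ hκ] at hM
  have hq' := norm_pos_iff.2 hq0
  refine ⟨‖q‖⁻¹ ^ M, one_le_pow₀ ((one_le_inv₀ hq').2 hq.le), ?_⟩
  filter_upwards [eventually_re_neg] with w hw i hi
  have h1 := norm_pow_cutoff_le hq0 hq (κ := κ) (w := w)
  rw [hi.2.1, mul_one, ← pow_mul, mul_comm, pow_mul]
  calc ‖pPow w (-1)‖ ≤ ‖pPow w (M * -κ)‖ := by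
        rw [norm_pPow, norm_pPow, Real.exp_le_exp]
        nlinarith
    _ = (‖pPow w κ‖⁻¹) ^ M := by rw [pPow_nat_mul, norm_pow, pPow_neg, norm_inv]
    _ ≤ (‖q‖⁻¹ ^ (cutoff q κ w + 1)) ^ M := by
        rw [inv_pow ‖q‖]
        exact pow_le_pow_left₀ (by positivity) (inv_anti₀ (by positivity) h1) M

lemma norm_circle_average_le {g : ℂ → ℂ} {B : Set ℂ} (hB : B.Countable) {ρ M : ℝ} (hρ : 0 < ρ)
    (hM : 0 ≤ M) (h : ∀ z, ‖z‖ = ρ → z ∉ B → ‖g z‖ ≤ M) :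
    ‖(2 * Real.pi * Complex.I)⁻¹ * circleIntegral (fun z => g z / z) 0 ρ‖ ≤ M := by
  classical
  have e : circleIntegral (fun z => g z / z) 0 ρ =
      circleIntegral (fun z => if z ∈ B then 0 else g z / z) 0 ρ := by
    exact circleIntegral_congr_countable hB hρ fun z _ hz => (if_neg hz).symm
  have h1 := circleIntegral.norm_integral_le_of_norm_le_const (C := M / ρ)
    (f := fun z => if z ∈ B then 0 else g z / z) (c := 0) hρ.le fun z hz => by
      have hz' : ‖z‖ = ρ := by simpa using hz
      split_ifs with hzB
      · rw [norm_zero]; positivity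
      · rw [norm_div, hz']
        exact div_le_div_of_nonneg_right (h z hz' hzB) hρ.le
  rw [e, norm_mul, norm_inv, norm_mul, norm_mul, Complex.norm_I, Complex.norm_real,
    Real.norm_of_nonneg Real.pi_pos.le, Complex.norm_ofNat, mul_one]
  have := Real.pi_pos
  calc _ ≤ (2 * Real.pi)⁻¹ * (2 * Real.pi * ρ * (M / ρ)) := by gcongr
    _ = M := by field_simp

end EllipticPairing

end

/-! ### The integrand on the circle -/

noncomputable section

namespace EllipticPairing

/-- The points of the circle at which the integrand splits into gamma functions. -/
def goodIndex (q : ℂ) (t : Fin 6 → ℂ) (α : Fin 6 → ℝ) (a : Fin 6) (mf mg : ℕ) (κ e : ℝ) (w : ℂ) :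
    Set (ℕ × ℂ) :=
  {i ∈ remainderIndex q κ e w | NonResonant (Complex.exp w) q mf mg (scaledParam t α w) ∧
    ∀ r, dPoch (Complex.exp w) q (tildeParam q mf mg (scaledParam t α w) r *
      (tildeParam q mf mg (scaledParam t α w) a * (q ^ i.1 * i.2))) ≠ 0}

lemma cutoff_zero (q w : ℂ) : cutoff q 0 w = 0 := by simp [cutoff]

/-- A zero would make |q^K ω| an integral power of |q| = e⁶, but |ω| = e⁻³ is a half-integral one.
-/
lemma theta_ne_zero_of_norm {q : ℂ} (hq0 : q ≠ 0) (hq : ‖q‖ < 1) {e : ℝ} (he : 0 < e) (he1 : e < 1)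
    (heq : e ^ 6 = ‖q‖) {ω : ℂ} (hω : ‖ω‖ = e⁻¹ ^ 3) (K : ℕ) : theta (q ^ K * ω)⁻¹ q ≠ 0 := fun h0 => by
  have hω0 : ω ≠ 0 := norm_pos_iff.1 (by rw [hω]; positivity)
  obtain ⟨n, hn⟩ := (theta_eq_zero_iff hq hq0 (inv_ne_zero (mul_ne_zero (pow_ne_zero K hq0) hω0))).1 h0
  have h1 := congrArg (‖·‖) hn
  simp only [norm_inv, norm_mul, norm_pow, norm_zpow, hω, ← heq] at h1
  rw [← zpow_natCast e 6, ← zpow_mul, ← zpow_natCast (e ^ ((6 : ℕ) : ℤ)), ← zpow_mul, inv_pow,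
    ← zpow_natCast e 3, ← zpow_neg, ← zpow_add₀ he.ne', ← zpow_neg] at h1
  have h2 := zpow_right_injective₀ he he1.ne h1
  push_cast at h2
  omega

lemma dPoch_inv_ne_zero {p q : ℂ} (hp : ‖p‖ < 1) (hq0 : q ≠ 0) (hq : ‖q‖ < 1) {e : ℝ} (he : 0 < e)
    (he1 : e < 1) (heq : e ^ 6 = ‖q‖) {ω : ℂ} (hω : ‖ω‖ = e⁻¹ ^ 3) {K : ℕ} (hK : ‖p‖ ≤ ‖q‖ ^ K) :
    dPoch p q (q ^ K * ω)⁻¹ ≠ 0 := fun h0 => by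
  have hω0 : ω ≠ 0 := norm_pos_iff.1 (by rw [hω]; positivity)
  have hx : q ^ K * ω ≠ 0 := mul_ne_zero (pow_ne_zero K hq0) hω0
  rw [dPoch_left hp hq, mul_eq_zero] at h0
  rcases h0 with h0 | h0
  · exact theta_ne_zero_of_norm hq0 hq he he1 heq hω K (by rw [theta, h0, zero_mul])
  · obtain ⟨i, j, hij⟩ := (dPoch_eq_zero_iff hp hq).1 h0
    have h1 : p * (p ^ i * q ^ j) = q ^ K * ω := by
      rw [← mul_right_inj' (inv_ne_zero hx), inv_mul_cancel₀ hx, ← hij]; ring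
    have h2 := congrArg (‖·‖) h1
    simp only [norm_mul, norm_pow, hω] at h2
    have h3 : (1 : ℝ) < e⁻¹ ^ 3 := one_lt_pow₀ ((one_lt_inv₀ he).2 he1) (by norm_num)
    have h4 : ‖p‖ * (‖p‖ ^ i * ‖q‖ ^ j) ≤ ‖q‖ ^ K * 1 := by
      refine mul_le_mul hK ?_ (by positivity) (by positivity)
      exact mul_le_one₀ (pow_le_one₀ (norm_nonneg _) hp.le) (by positivity)
        (pow_le_one₀ (norm_nonneg _) hq.le)
    have h5 := pow_pos (norm_pos_iff.2 hq0) K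
    nlinarith

namespace Admissible

variable {q : ℂ} {t : Fin 6 → ℂ} {α : Fin 6 → ℝ} {a : Fin 6} (h : Admissible q t α a)
  {mf mg : ℕ} {f g F G : ℂ → ℂ → ℂ} {cf cg : HahnSeries ℝ (RatFunc ℂ)} {b : Fin 6} {σ : ℝ}
  (hσ : SeparatingExponent α a b σ) {e : ℝ} (he : 0 < e) (he1 : e < 1) (heq : e ^ 6 = ‖q‖)

include h hσ he he1 heq in
-- For r ≠ a, b the arguments have size |p|^{α_r+α_a+κ} = |p|^{α_r−σ}, which is small by the choice
-- of σ. For b the argument contains an additional p, with exponent 1 + α_b + α_a strictly between 0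
-- and 1. The theta quotient may be as large as a multiple of 1/|p|, which `geomBound_pPow_neg_one`
-- absorbs.
lemma remainderFactor_bound (mf mg : ℕ) : ∃ γ : ℂ → ℂ, (∀ w, γ w ≠ 0 ∧ theta (γ w) q ≠ 0 ∧
      theta (γ w * (tildeParam q mf mg (scaledParam t α w) b /
        tildeParam q mf mg (scaledParam t α w) a)) q ≠ 0) ∧
    GeomBound (remainderIndex q (-α a - σ) e)
      (fun w k ω => remainderFactor (Complex.exp w) q (tildeParam q mf mg (scaledParam t α w)) a b
        (γ w) k ω)
      fun w k => ∏ r ∈ Finset.univ.erase a, ∏ j ∈ Finset.range k,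
        max 1 (‖pPow w (α r + α a)‖ * ‖q‖ ^ j) := by
  have hneg := h.neg
  have hhalf := h.half_le
  have hσ0 := hσ.pos
  have hκ : 0 < -α a - σ := by linarith [hσ.lt_neg]
  have hta := h.t_ne a
  have hq0 := h.q_ne
  have hq := h.q_lt
  have hba := hσ.ne
  have hT : ∀ w r, scaledParam t α w r ≠ 0 := fun w r => mul_ne_zero (h.t_ne r) (pPow_ne_zero _ _)
  have hS : ∀ w r, tildeParam q mf mg (scaledParam t α w) r ≠ 0 := fun w r =>
    tildeParam_ne_zero hq0 (hT w) r
  have hy : ∀ r, tildeParam q mf mg t r * tildeParam q mf mg t a ≠ 0 := fun r =>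
    mul_ne_zero (h.tilde_ne_zero mf mg r) (h.tilde_ne_zero mf mg a)
  have hSS : ∀ w r, tildeParam q mf mg (scaledParam t α w) r *
      tildeParam q mf mg (scaledParam t α w) a =
      tildeParam q mf mg t r * tildeParam q mf mg t a * pPow w (α r + α a) := fun w r => by
    rw [tildeParam_scaledParam, tildeParam_scaledParam, pPow_add]; ring
  have hsub : ∀ w, remainderIndex q (-α a - σ) e w ⊆ fullIndex q (-α a - σ) w := fun w i hi => hi.1
  obtain ⟨Cθ, hCθ, hθ⟩ := exists_thetaRatio_bound hq0 hq he he1 heq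
  choose γ hγ0 hγ1 hγ2 hγ3 using fun w => hθ (tildeParam q mf mg (scaledParam t α w) b /
    tildeParam q mf mg (scaledParam t α w) a) (div_ne_zero (hS w b) (hS w a))
  refine ⟨γ, fun w => ⟨hγ0 w, hγ1 w, hγ2 w⟩, ?_⟩
  have b1 : GeomBound (remainderIndex q (-α a - σ) e) (fun _ k ω => ((ω ^ 2) ^ k)⁻¹)
      fun _ _ => 1 := GeomBound.of_const (C := 1) <| Eventually.of_forall fun w i hi => by
    rw [norm_inv, norm_pow, norm_pow]
    exact inv_le_one_of_one_le₀ (one_le_pow₀ (one_le_pow₀ hi.1.2.1))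
  have b2 := (geomBound_theta hq0 hq hκ.le (hy b) (γ := α b + α a) (h.neg_one_lt_add hba).le
    (by linarith [h.le b hba])).mono hsub
  have b3 : GeomBound (remainderIndex q (-α a - σ) e) (fun w _ ω => thetaRatio q (γ w)
      (tildeParam q mf mg (scaledParam t α w) b / tildeParam q mf mg (scaledParam t α w) a) ω)
      fun _ _ => 1 := by
    have b31 := geomBound_pPow_neg_one hq0 hq hκ e
    have b32 := GeomBound.of_const (I := remainderIndex q (-α a - σ) e)
      (X := fun _ _ _ => ((Cθ * (1 + ‖tildeParam q mf mg t b / tildeParam q mf mg t a‖⁻¹) : ℝ) : ℂ))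
      (Eventually.of_forall fun w i _ => le_rfl)
    refine ((b32.mul b31).congr_left ?_).congr_right fun _ _ => mul_one _
    filter_upwards [eventually_re_neg] with w hw i hi
    refine (hγ3 w i.2 hi.2.2).trans ?_
    rw [norm_mul, Complex.norm_real, Real.norm_of_nonneg (by positivity), mul_assoc]
    refine mul_le_mul_of_nonneg_left ?_ hCθ
    have e1 : tildeParam q mf mg (scaledParam t α w) b / tildeParam q mf mg (scaledParam t α w) a =
        tildeParam q mf mg t b / tildeParam q mf mg t a * pPow w (α b - α a) := by
      rw [tildeParam_scaledParam, tildeParam_scaledParam, pPow_sub]; ring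
    have e2 : ‖pPow w (α b - α a)‖⁻¹ ≤ ‖pPow w (-1)‖ := by
      rw [← norm_inv, ← pPow_neg, norm_pPow, norm_pPow, Real.exp_le_exp]
      nlinarith [h.le b hba]
    have e3 : 1 ≤ ‖pPow w (-1)‖ := by
      rw [norm_pPow, Real.one_le_exp_iff]
      linarith
    rw [e1, norm_mul, mul_inv, add_mul, one_mul]
    gcongr
  obtain ⟨C4, hC4⟩ := ellGamma_cutoff_bound hq0 hq hκ.le (t a ^ 2) (γ := 1 + 2 * α a)
    (by linarith) (by linarith)
  have b4 : GeomBound (remainderIndex q (-α a - σ) e) (fun w k ω =>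
      ellGamma (t a ^ 2 * pPow w (1 + 2 * α a) * q ^ k * ω) (Complex.exp w) q) fun _ _ => 1 :=
    GeomBound.of_const (hC4.mono fun w hw i hi => by
      rw [hi.2.1]; exact hw i.2 hi.1.2.1 hi.1.2.2)
  obtain ⟨C5, hC5⟩ := ellGamma_div_bound hq0 hq hκ.le 1 (γ := 1) (by linarith) le_rfl
  have b5 := (GeomBound.of_const (I := fullIndex q (-α a - σ)) (X := fun w k ω =>
    ellGamma (1 * pPow w 1 / (q ^ k * ω)) (Complex.exp w) q) hC5).mono hsub
  -- The case κ = 0, where the cutoff is 0: no power of q occurs in this argument.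
  obtain ⟨C6, hC6⟩ := ellGamma_cutoff_bound hq0 hq le_rfl
    (tildeParam q mf mg t b * tildeParam q mf mg t a) (γ := 1 + (α b + α a))
    (by linarith [h.neg_one_lt_add hba]) (by linarith [hσ.add_neg])
  have b6 : GeomBound (remainderIndex q (-α a - σ) e) (fun w _ ω =>
      ellGamma (tildeParam q mf mg t b * tildeParam q mf mg t a * pPow w (1 + (α b + α a)) * ω)
        (Complex.exp w) q) fun _ _ => 1 :=
    GeomBound.of_const (hC6.mono fun w hw i hi => by
      simpa [cutoff_zero] using hw i.2 hi.1.2.1 hi.1.2.2)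
  have hone : (1 : ℝ) ≤ ‖q‖⁻¹ := (one_le_inv₀ (norm_pos_iff.2 hq0)).2 hq.le
  obtain ⟨C7, hC7⟩ := inv_ellGamma_cutoff_bound hq0 hq le_rfl
    (tildeParam q mf mg t b * tildeParam q mf mg t a) (γ := 1 + (α b + α a))
    (by linarith [h.neg_one_lt_add hba]) (by linarith [hσ.add_neg])
  have b7 : GeomBound (remainderIndex q (-α a - σ) e) (fun w _ _ =>
      (ellGamma (tildeParam q mf mg t b * tildeParam q mf mg t a * pPow w (1 + (α b + α a)))
        (Complex.exp w) q)⁻¹) fun _ _ => 1 :=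
    GeomBound.of_const (hC7.mono fun w hw i hi => by
      simpa [cutoff_zero] using hw 1 (by simp) (by simpa using hone))
  have b8 := GeomBound.prod (I := remainderIndex q (-α a - σ) e) ((Finset.univ.erase a).erase b)
    (X := fun r w k ω => (∏ j ∈ Finset.range k, theta (tildeParam q mf mg t r *
      tildeParam q mf mg t a * pPow w (α r + α a) * q ^ j * 1) (Complex.exp w)) *
      (ellGamma (tildeParam q mf mg t r * tildeParam q mf mg t a * pPow w (α r + α a) *
        q ^ k * ω) (Complex.exp w) q * (ellGamma (tildeParam q mf mg t r * tildeParam q mf mg t a *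
          pPow w (α r + α a) * q ^ k) (Complex.exp w) q)⁻¹))
    (Y := fun r w k => (∏ j ∈ Finset.range k, max 1 (‖pPow w (α r + α a)‖ * ‖q‖ ^ j)) * (1 * 1))
    fun r hr => by
    have hrb := Finset.ne_of_mem_erase hr
    have hra := Finset.ne_of_mem_erase (Finset.mem_of_mem_erase hr)
    have hrσ := hσ.lt r hra hrb
    have hle := h.le r hra
    refine GeomBound.mul ?_ (GeomBound.mul ?_ ?_)
    · exact ((geomBound_theta hq0 hq hκ.le (hy r) (γ := α r + α a) (h.neg_one_lt_add hra).le
        (by linarith)).at_one hq0 hq).mono hsub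
    · obtain ⟨C, hC⟩ := ellGamma_cutoff_bound hq0 hq hκ.le
        (tildeParam q mf mg t r * tildeParam q mf mg t a) (γ := α r + α a) (by linarith) (by linarith)
      exact GeomBound.of_const (hC.mono fun w hw i hi => by
        rw [hi.2.1]; exact hw i.2 hi.1.2.1 hi.1.2.2)
    · obtain ⟨C, hC⟩ := inv_ellGamma_cutoff_bound hq0 hq hκ.le
        (tildeParam q mf mg t r * tildeParam q mf mg t a) (γ := α r + α a) (by linarith) (by linarith)
      exact GeomBound.of_const (hC.mono fun w hw i hi => by
        rw [hi.2.1]; simpa using hw 1 (by simp) (by simpa using hone))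
  refine (((((b1.mul b2).mul b3).mul (b4.mul b5)).mul (b6.mul b7)).mul b8).congr_left
    (Eventually.of_forall fun w i hi => le_of_eq ?_) |>.congr_right fun w k => ?_
  · congr 1
    have e1 : ∀ ω', tildeParam q mf mg (scaledParam t α w) a *
        (tildeParam q mf mg (scaledParam t α w) a * q ^ i.1 * ω') * Complex.exp w =
        t a ^ 2 * pPow w (1 + 2 * α a) * q ^ i.1 * ω' := fun ω' => by
      rw [tildeParam_self h.ne_four h.ne_five, scaledParam, show 2 * α a = α a + α a by ring,
        pPow_add, pPow_add, pPow_one]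
      ring
    have e2 : (q ^ i.1 * i.2)⁻¹ * Complex.exp w = 1 * pPow w 1 / (q ^ i.1 * i.2) := by
      rw [pPow_one]; ring
    have e3 : tildeParam q mf mg t b * tildeParam q mf mg t a * pPow w (α b + α a) * Complex.exp w =
        tildeParam q mf mg t b * tildeParam q mf mg t a * pPow w (1 + (α b + α a)) := by
      rw [pPow_add w 1, pPow_one]; ring
    rw [remainderFactor, e1, e2]
    simp only [hSS, e3, mul_one]
  · simp only [one_mul, mul_one]
    exact Finset.mul_prod_erase (Finset.univ.erase a) (fun r => ∏ j ∈ Finset.range k,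
      max 1 (‖pPow w (α r + α a)‖ * ‖q‖ ^ j)) (Finset.mem_erase.2 ⟨hba, Finset.mem_univ b⟩)

/-- The remaining integrand, multiplied by the factor in front of the integral. -/
def _root_.EllipticPairing.remainderTerm (q : ℂ) (t : Fin 6 → ℂ) (α : Fin 6 → ℝ) (a b : Fin 6)
    (mf mg : ℕ) (F G : ℂ → ℂ → ℂ) (c w z : ℂ) : ℂ :=
  qPoch q q * qPoch (Complex.exp w) (Complex.exp w) /
      (∏ rs : Fin 6 × Fin 6 with rs.1 < rs.2,
        ellGamma (scaledParam t α w rs.1 * scaledParam t α w rs.2) (Complex.exp w) q) *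
    (halfNum (Complex.exp w) q (tildeParam q mf mg (scaledParam t α w)) a b c (F w) (G w) z /
      halfDen (Complex.exp w) q (tildeParam q mf mg (scaledParam t α w)) a b z)

include h hσ in
lemma eventually_ellGamma_cutoff_ne_zero (mf mg : ℕ) : ∀ᶠ w in cusp,
    NonResonant (Complex.exp w) q mf mg (scaledParam t α w) → ∀ r, r ≠ a → r ≠ b →
      ellGamma (tildeParam q mf mg (scaledParam t α w) r *
        tildeParam q mf mg (scaledParam t α w) a * q ^ cutoff q (-α a - σ) w) (Complex.exp w) q ≠ 0 := by
  have hκ : 0 < -α a - σ := by linarith [hσ.lt_neg]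
  have hneg := h.neg
  have hs := sumBound_pos h.q_lt
  have h1 : ∀ᶠ w in cusp, ∀ r, r ≠ a → r ≠ b → dPoch (Complex.exp w) q (Complex.exp w * q /
      (tildeParam q mf mg t r * tildeParam q mf mg t a * pPow w (α r + α a) *
        q ^ cutoff q (-α a - σ) w * 1)) ≠ 0 := eventually_all.2 fun r => by
    by_cases hra : r = a
    · exact Eventually.of_forall fun _ h' => absurd hra h'
    by_cases hrb : r = b
    · exact Eventually.of_forall fun _ _ h' => absurd hrb h'
    have hrσ := hσ.lt r hra hrb
    filter_upwards [eventually_norm_exp_le (show (0 : ℝ) < 1 / 2 by norm_num), eventually_re_neg,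
      eventually_mul_norm_pPow_le (‖q / (tildeParam q mf mg t r * tildeParam q mf mg t a)‖ *
        sumBound q) (γ := 1 - (α r + α a) - (-α a - σ)) (by linarith [h.le r hra, hσ.pos])
      (show (0 : ℝ) < 1 / 3 by norm_num)] with w hp hw hsmall _ _
    have h3 := norm_div_arg_cutoff_le h.q_ne h.q_lt hκ.le hw (ω := 1) (γ := α r + α a)
      (y := tildeParam q mf mg t r * tildeParam q mf mg t a) (by simp)
    rw [mul_right_comm] at hsmall
    exact dPoch_ne_zero_of_small hp h.q_lt ((mul_le_mul_of_nonneg_right h3 hs.le).trans hsmall)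
  filter_upwards [h1, eventually_norm_exp_le (show (0 : ℝ) < 1 / 2 by norm_num)] with w h1 hp hN r
    hra hrb
  have hp1 := norm_lt_one_of_le_half hp
  have h2 := h1 r hra hrb
  rw [ellGamma_eq hp1 h.q_lt]
  refine div_ne_zero ?_ (EllipticPairing.dPoch_mul_pow_ne_zero hp1 h.q_lt
    (hN.dPoch_ne_zero hp1 h.q_lt r a) _)
  have e1 : tildeParam q mf mg (scaledParam t α w) r * tildeParam q mf mg (scaledParam t α w) a =
      tildeParam q mf mg t r * tildeParam q mf mg t a * pPow w (α r + α a) := by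
    rw [tildeParam_scaledParam, tildeParam_scaledParam, pPow_add]
    ring
  rw [e1, ← mul_one (_ * q ^ _)]
  exact h2

include h hσ he he1 heq in
lemma remainderTerm_bound (hf : IsFamily q (t 4) (α 4) (α a) mf f F cf)
    (hg : IsFamily q (t 5) (α 5) (α a) mg g G cg) : ∃ γ : ℂ → ℂ,
    (∀ w, γ w ≠ 0 ∧ theta (γ w) q ≠ 0 ∧
      theta (γ w * (tildeParam q mf mg (scaledParam t α w) b /
        tildeParam q mf mg (scaledParam t α w) a)) q ≠ 0) ∧
    GeomBound (goodIndex q t α a mf mg (-α a - σ) e)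
      (fun w k ω => pPow w (-cf.order - cg.order) * remainderTerm q t α a b mf mg F G
        (γ w / tildeParam q mf mg (scaledParam t α w) a) w
        (tildeParam q mf mg (scaledParam t α w) a * (q ^ k * ω)))
      fun w k => ∏ j ∈ Finset.range k, stepBound q α a w j := by
  obtain ⟨γ, hγ, b1⟩ := h.remainderFactor_bound hσ he he1 heq mf mg
  refine ⟨γ, hγ, ?_⟩
  have hκ : 0 < -α a - σ := by linarith [hσ.lt_neg]
  have hhalf := h.half_le
  have hs := sumBound_pos h.q_lt
  have hq' := norm_pos_iff.2 h.q_ne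
  have b2 := (h.commonFactor_bound hσ hf hg).mono (J := goodIndex q t α a mf mg (-α a - σ) e)
    fun w i hi => hi.1.1
  have b3 := GeomBound.of_const (I := goodIndex q t α a mf mg (-α a - σ) e)
    (X := fun _ _ _ => qPoch q q) (Eventually.of_forall fun _ _ _ => le_rfl)
  refine ((b3.mul b2).mul (b1.mono fun w i hi => hi.1)).congr_left ?_ |>.congr_right fun w k => ?_
  · filter_upwards [h.eventually_ellGamma_cutoff_ne_zero hσ mf mg, eventually_re_neg,
      eventually_norm_exp_le (show (0 : ℝ) < 1 / 2 by norm_num),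
      eventually_mul_norm_pPow_le (‖tildeParam q mf mg t b * tildeParam q mf mg t a‖ * ‖q‖⁻¹ *
        sumBound q) (γ := 1 + (α b + α a)) (by linarith [h.neg_one_lt_add hσ.ne])
      (show (0 : ℝ) < 1 / 3 by norm_num)] with w hΓ hw hp hsmall i hi
    have hp1 := norm_lt_one_of_le_half hp
    have hω0 : i.2 ≠ 0 := norm_pos_iff.1 (one_pos.trans_le hi.1.1.2.1)
    refine le_of_eq ?_
    congr 1
    rw [remainderTerm, prefactor_mul_half rfl rfl hp1 h.q_lt h.q_ne h.t_ne h.ne_four h.ne_five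
      hσ.ne.symm hω0 (hγ w).1 hi.2.1 rfl hi.2.2
      (dPoch_inv_ne_zero hp1 h.q_ne h.q_lt he he1 heq hi.1.2.2 ?_)
      (theta_ne_zero_of_norm h.q_ne h.q_lt he he1 heq hi.1.2.2 _) ?_
      (fun r hra hrb => by rw [hi.1.2.1]; exact hΓ hi.2.1 r hra hrb)]
    · ring
    · refine le_trans ?_ (pPow_le_of_le_cutoff h.q_ne h.q_lt hκ.le hw hi.1.1.1)
      rw [← pPow_one, norm_pPow, norm_pPow, Real.exp_le_exp]
      nlinarith [hσ.pos]
    · refine dPoch_ne_zero_of_small hp h.q_lt (le_trans ?_ hsmall)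
      have e1 : tildeParam q mf mg (scaledParam t α w) b * tildeParam q mf mg (scaledParam t α w) a *
          Complex.exp w * i.2 = tildeParam q mf mg t b * tildeParam q mf mg t a * i.2 *
            pPow w (1 + (α b + α a)) := by
        rw [tildeParam_scaledParam, tildeParam_scaledParam, pPow_add, pPow_one, pPow_add]; ring
      rw [e1, norm_mul, norm_mul _ i.2, mul_right_comm]
      gcongr
      exact hi.1.1.2.2
  · simp only [one_mul]
    rw [Finset.prod_comm, ← Finset.prod_mul_distrib]
    rfl

end Admissible

end EllipticPairing

end

noncomputable section

namespace EllipticPairing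

/-! ### The limit of the pairing -/

/-- The values of `w` for which the parameters are non-resonant. -/
def nonResonantSet (q : ℂ) (mf mg : ℕ) (t : Fin 6 → ℂ) (α : Fin 6 → ℝ) : Set ℂ :=
  {w | NonResonant (Complex.exp w) q mf mg (scaledParam t α w)}

lemma countable_setOf_exp_mul_eq {β : ℝ} (hβ : β ≠ 0) (x : ℂ) :
    {w : ℂ | pPow w β = x}.Countable := by
  rcases Set.eq_empty_or_nonempty {w : ℂ | pPow w β = x} with h | ⟨w₀, hw₀⟩
  · rw [h]; exact Set.countable_empty
  · have hβ' : (β : ℂ) ≠ 0 := Complex.ofReal_ne_zero.2 hβ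
    refine (Set.countable_range fun n : ℤ => w₀ + n * (2 * Real.pi * Complex.I) / β).mono
      fun w hw => ?_
    have h1 : Complex.exp (β * w) = Complex.exp (β * w₀) := Eq.trans hw (Eq.symm hw₀)
    obtain ⟨n, hn⟩ := Complex.exp_eq_exp_iff_exists_int.1 h1
    refine ⟨n, ?_⟩
    simp only
    field_simp
    rw [hn]
    ring

lemma eventually_theta_ne_zero_of_neg {q : ℂ} (hq : ‖q‖ < 1) {γ : ℝ} (hγ : γ < 0) {y : ℂ} :
    ∀ᶠ w in cusp, dPoch (Complex.exp w) q (y * pPow w γ) ≠ 0 → theta (y * pPow w γ) q ≠ 0 := by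
  have h1 : Tendsto (fun w => q / (y * pPow w γ)) cusp (𝓝 0) := by
    have := (tendsto_pPow (neg_pos.2 hγ)).const_mul (q / y)
    rw [mul_zero] at this
    refine this.congr fun w => ?_
    rw [pPow_neg, div_mul_eq_div_div, div_eq_mul_inv (q / y)]
  have h2 := ((differentiable_qPoch hq).continuous.tendsto 0).comp h1
  rw [qPoch_zero_left] at h2
  filter_upwards [h2.eventually_ne one_ne_zero,
    eventually_norm_exp_le (show (0 : ℝ) < 1 / 2 by norm_num)] with w hw hp hd
  rw [dPoch_left (norm_lt_one_of_le_half hp) hq] at hd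
  exact mul_ne_zero (left_ne_zero_of_mul hd) hw

lemma eventually_mul_norm_pPow_lt (M : ℝ) {γ : ℝ} (hγ : 0 < γ) {ε : ℝ}
    (hε : 0 < ε) : ∀ᶠ w in cusp, M * ‖pPow w γ‖ < ε := by
  filter_upwards [eventually_mul_norm_pPow_le M hγ (half_pos hε)] with w hw
  linarith

namespace Admissible

variable {q : ℂ} {t : Fin 6 → ℂ} {α : Fin 6 → ℝ} {a : Fin 6} (h : Admissible q t α a)

include h

/-- A resonance is an equation c p^β = 1. For β ≠ 0 it has countably many solutions w; for β = 0
genericity excludes it. -/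
lemma countable_compl_nonResonantSet (mf mg : ℕ) : (nonResonantSet q mf mg t α)ᶜ.Countable := by
  have hB : (⋃ i : (Fin 6 × ℕ × ℕ) × (Fin 6 × ℕ × ℕ), {w : ℂ |
      (Complex.exp w ^ i.1.2.1 * q ^ i.1.2.2 * tildeParam q mf mg (scaledParam t α w) i.1.1) *
      (Complex.exp w ^ i.2.2.1 * q ^ i.2.2.2 * tildeParam q mf mg (scaledParam t α w) i.2.1) =
        1}).Countable := by
    refine Set.countable_iUnion fun i => ?_
    set β : ℝ := (i.1.2.1 + i.2.2.1 : ℕ) + (α i.1.1 + α i.2.1) with hβ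
    have hS := mul_ne_zero (h.tilde_ne_zero mf mg i.1.1) (h.tilde_ne_zero mf mg i.2.1)
    have hqn := pow_ne_zero (i.1.2.2 + i.2.2.2) h.q_ne
    have e : ∀ w : ℂ,
        (Complex.exp w ^ i.1.2.1 * q ^ i.1.2.2 * tildeParam q mf mg (scaledParam t α w) i.1.1) *
        (Complex.exp w ^ i.2.2.1 * q ^ i.2.2.2 * tildeParam q mf mg (scaledParam t α w) i.2.1) =
        tildeParam q mf mg t i.1.1 * tildeParam q mf mg t i.2.1 * q ^ (i.1.2.2 + i.2.2.2) *
          pPow w β := fun w => by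
      rw [hβ, tildeParam_scaledParam, tildeParam_scaledParam, pPow_add, pPow_add,
        ← mul_one (((i.1.2.1 + i.2.2.1 : ℕ) : ℝ)), pPow_nat_mul, pPow_one, pow_add, pow_add]
      ring
    simp only [e]
    by_cases h0 : β = 0
    · convert Set.countable_empty
      refine Set.eq_empty_of_forall_notMem fun w hw => ?_
      have hw : _ = (1 : ℂ) := hw
      rw [h0, pPow_zero, mul_one] at hw
      refine h.tilde_mul_ne_zpow mf mg i.1.1 i.2.1 (-(i.1.2.2 + i.2.2.2 : ℕ)) ?_
      rw [zpow_neg, zpow_natCast]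
      exact eq_inv_of_mul_eq_one_left hw
    · refine (countable_setOf_exp_mul_eq h0 (tildeParam q mf mg t i.1.1 *
        tildeParam q mf mg t i.2.1 * q ^ (i.1.2.2 + i.2.2.2))⁻¹).mono fun w hw => ?_
      exact eq_inv_of_mul_eq_one_right hw
  refine hB.mono fun w hw => ?_
  by_contra hn
  refine hw ?_
  rintro x ⟨r, i, j, rfl⟩ y ⟨s, k, l, rfl⟩ hxy
  exact hn (Set.mem_iUnion.2 ⟨((r, i, j), (s, k, l)), hxy⟩)

/-- The complement of a countable set is dense. Without this, the bounds for the residues could not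
be passed on to the terms of the limit series. -/
lemma neBot_nonResonant (mf mg : ℕ) : (cusp ⊓ 𝓟 (nonResonantSet q mf mg t α)).NeBot := by
  rw [inf_principal_neBot_iff]
  intro U hU
  obtain ⟨V, hV, hVU⟩ := mem_comap.1 hU
  obtain ⟨R, hR⟩ := mem_atBot_sets.1 hV
  have hd := (h.countable_compl_nonResonantSet mf mg).dense_compl ℂ
  rw [compl_compl] at hd
  obtain ⟨w, hw, hw'⟩ := hd.inter_open_nonempty {w : ℂ | w.re < R}
    (isOpen_lt Complex.continuous_re continuous_const) ⟨((R - 1 : ℝ) : ℂ), by simp⟩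
  exact ⟨w, hVU (hR w.re (le_of_lt hw)), hw'⟩

/-- Needed for the addition formula at the actual parameters. One Pochhammer symbol in θ divides a
double product that is non-zero by non-resonance; the other tends to 1, since the exponent is
negative. -/
lemma eventually_theta_ne_zero (mf mg : ℕ) {r : Fin 6} (hr : α r + α a < 0) :
    ∀ᶠ w in cusp, NonResonant (Complex.exp w) q mf mg (scaledParam t α w) →
      theta (tildeParam q mf mg (scaledParam t α w) a * tildeParam q mf mg (scaledParam t α w) r) q ≠
        0 := by
  filter_upwards [eventually_theta_ne_zero_of_neg h.q_lt hr
    (y := tildeParam q mf mg t a * tildeParam q mf mg t r),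
    eventually_norm_exp_le (show (0 : ℝ) < 1 / 2 by norm_num)] with w hw hp hN
  have h1 := hN.dPoch_ne_zero (norm_lt_one_of_le_half hp) h.q_lt a r
  have e : tildeParam q mf mg (scaledParam t α w) a * tildeParam q mf mg (scaledParam t α w) r =
      tildeParam q mf mg t a * tildeParam q mf mg t r * pPow w (α r + α a) := by
    rw [tildeParam_scaledParam, tildeParam_scaledParam, pPow_add]
    ring
  rw [e] at h1 ⊢
  exact hw h1

variable {mf mg : ℕ} {f g F G : ℂ → ℂ → ℂ} {cf cg : HahnSeries ℝ (RatFunc ℂ)} {b : Fin 6} {σ : ℝ}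
  (hσ : SeparatingExponent α a b σ) {e : ℝ} (he : 0 < e) (he1 : e < 1) (heq : e ^ 6 = ‖q‖)

/-- The radius of the circle. -/
def _root_.EllipticPairing.circleRadius (q : ℂ) (t : Fin 6 → ℂ) (α : Fin 6 → ℝ) (a : Fin 6) (σ e : ℝ)
    (w : ℂ) : ℝ :=
  ‖t a‖ * ‖pPow w (α a)‖ * (‖q‖ ^ cutoff q (-α a - σ) w * e⁻¹ ^ 3)

include he in
lemma circleRadius_pos (w : ℂ) : 0 < circleRadius q t α a σ e w := by
  have := norm_pos_iff.2 (h.t_ne a)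
  have := norm_pos_iff.2 h.q_ne
  have := norm_pPow_pos w (α a)
  rw [circleRadius]
  positivity

include hσ he he1 in
-- With `circleRadius_le` the radius is |p|^{-σ} up to constants, so that the position of every pole
-- is a question of exponents.
lemma le_circleRadius {w : ℂ} (hw : w.re < 0) :
    ‖t a‖ * ‖pPow w (-σ)‖ ≤ circleRadius q t α a σ e w := by
  have hκ : 0 ≤ -α a - σ := by linarith [hσ.lt_neg]
  have h1 := pPow_le_of_le_cutoff h.q_ne h.q_lt hκ hw le_rfl
  have h2 : 1 ≤ e⁻¹ ^ 3 := one_le_pow₀ ((one_le_inv₀ he).2 he1.le)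
  rw [circleRadius, show -σ = α a + (-α a - σ) by ring, norm_pPow_add, ← mul_assoc]
  refine mul_le_mul_of_nonneg_left ?_ (by positivity)
  calc _ ≤ ‖q‖ ^ cutoff q (-α a - σ) w := h1
    _ ≤ _ := le_mul_of_one_le_right (by positivity) h2

include he heq in
lemma circleRadius_le (w : ℂ) :
    circleRadius q t α a σ e w ≤ ‖t a‖ * e⁻¹ ^ 9 * ‖pPow w (-σ)‖ := by
  have h1 := norm_pow_cutoff_le h.q_ne h.q_lt (κ := -α a - σ) (w := w)
  rw [pow_succ] at h1
  nth_rewrite 2 [← heq] at h1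
  rw [circleRadius, show -σ = α a + (-α a - σ) by ring, norm_pPow_add]
  calc _ = ‖t a‖ * ‖pPow w (α a)‖ * (e⁻¹ ^ 9 *
        (‖q‖ ^ cutoff q (-α a - σ) w * e ^ 6)) := by field_simp
    _ ≤ ‖t a‖ * ‖pPow w (α a)‖ * (e⁻¹ ^ 9 * ‖pPow w (-α a - σ)‖) := by gcongr
    _ = _ := by ring

include hσ he he1 in
-- For the inner points the exponents have to exceed −σ: this holds for α_b by the choice of σ, for
-- the other α_r because they are positive, and for 1 + α_a because it is at least 1/2.
lemma eventually_norm_lt_circleRadius (mf mg : ℕ) : ∀ᶠ w in cusp,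
    (∀ r, r ≠ a → ‖tildeParam q mf mg (scaledParam t α w) r‖ < circleRadius q t α a σ e w) ∧
    ‖Complex.exp w * tildeParam q mf mg (scaledParam t α w) a‖ < circleRadius q t α a σ e w := by
  have hta := norm_pos_iff.2 (h.t_ne a)
  have key : ∀ (y : ℂ) {γ : ℝ}, 0 < γ + σ → ∀ᶠ w in cusp,
      ‖y * pPow w γ‖ < circleRadius q t α a σ e w := fun y γ hγ => by
    filter_upwards [eventually_mul_norm_pPow_lt ‖y‖ hγ hta, eventually_re_neg] with w h1 hw
    refine lt_of_lt_of_le ?_ (h.le_circleRadius hσ he he1 hw)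
    rw [norm_mul, pPow_neg, norm_inv, ← div_eq_mul_inv, lt_div_iff₀ (norm_pPow_pos _ _), mul_assoc,
      ← norm_pPow_add]
    exact h1
  refine (eventually_all.2 fun r => ?_).and ?_
  · by_cases hra : r = a
    · exact Eventually.of_forall fun _ h' => absurd hra h'
    have h1 : 0 < α r + σ := by
      by_cases hrb : r = b
      · rw [hrb]; linarith [hσ.neg_lt]
      · linarith [hσ.lt r hra hrb, hσ.pos]
    filter_upwards [key (tildeParam q mf mg t r) h1] with w hw _
    rwa [tildeParam_scaledParam]
  · filter_upwards [key (tildeParam q mf mg t a) (γ := 1 + α a)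
      (by linarith [h.half_le, hσ.pos])] with w hw
    rwa [tildeParam_scaledParam, ← pPow_one, mul_left_comm, ← pPow_add]

include hσ he heq in
-- For the outer points the exponents have to exceed σ. This is true of α_r for r ≠ a, b, but may
-- fail for a and b, whose parameters have been multiplied by p; there 1 + α_r > σ suffices.
lemma eventually_shiftParam_mul_lt_one (mf mg : ℕ) : ∀ᶠ w in cusp, ∀ r,
    ‖shiftParam (Complex.exp w) (tildeParam q mf mg (scaledParam t α w)) a b r‖ *
      circleRadius q t α a σ e w < 1 := by
  have key : ∀ (y : ℂ) {γ : ℝ}, 0 < γ - σ → ∀ᶠ w in cusp,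
      ‖y * pPow w γ‖ * circleRadius q t α a σ e w < 1 := fun y γ hγ => by
    filter_upwards [eventually_mul_norm_pPow_lt (‖y‖ * (‖t a‖ * e⁻¹ ^ 9)) hγ one_pos] with w h1
    refine lt_of_le_of_lt (mul_le_mul_of_nonneg_left (h.circleRadius_le he heq w)
      (norm_nonneg _)) (lt_of_eq_of_lt ?_ h1)
    rw [norm_mul, sub_eq_add_neg, norm_pPow_add]
    ring
  refine eventually_all.2 fun r => ?_
  have hhalf := h.half_le
  have hlt := hσ.lt_neg
  by_cases hr : r = a ∨ r = b
  · have h1 : 0 < 1 + α r - σ := by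
      rcases hr with rfl | rfl
      · linarith [hσ.add_neg, h.lt _ hσ.ne]
      · linarith [h.lt r hσ.ne]
    filter_upwards [key (tildeParam q mf mg t r) h1] with w hw
    rwa [shiftParam, if_pos hr, tildeParam_scaledParam, ← pPow_one, mul_left_comm, ← pPow_add]
  · rw [not_or] at hr
    filter_upwards [key (tildeParam q mf mg t r) (sub_pos.2 (hσ.lt r hr.1 hr.2))] with w hw
    rwa [shiftParam, if_neg (not_or.2 hr), tildeParam_scaledParam]

include hσ in
lemma exists_uniform_bound {I : ℂ → Set (ℕ × ℂ)} (hI : ∀ w, I w ⊆ fullIndex q (-α a - σ) w)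
    {X : ℂ → ℕ → ℂ → ℂ}
    (hX : GeomBound I X fun w k => ∏ j ∈ Finset.range k, stepBound q α a w j) :
    ∃ B : ℕ → ℝ, Summable B ∧ (∀ k, 0 ≤ B k) ∧
      ∀ᶠ w in cusp, ∀ i ∈ I w, ‖X w i.1 i.2‖ ≤ B i.1 := by
  obtain ⟨C, hC, hX⟩ := hX
  obtain ⟨c, h0, h1, hc⟩ := stepBound_le h.q_ne h.q_lt hσ.ne h.bal hσ.pos hσ.neg_lt hσ.lt_neg hσ.lt
  refine ⟨fun k => C ^ (k + 1) * c ^ k.choose 2, summable_pow_mul_pow_choose C h0 h1,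
    fun k => by positivity, ?_⟩
  filter_upwards [hX, eventually_re_neg] with w hX hw i hi
  refine (hX i hi).trans (mul_le_mul_of_nonneg_left (prod_stepBound_le fun j hj => hc w hw j ?_)
    (by positivity))
  exact pPow_le_of_le_cutoff h.q_ne h.q_lt (by linarith [hσ.lt_neg]) hw (hj.le.trans (hI w hi).1)

include hσ he he1 heq in
-- On the circle the integrand is bounded by the K-th member of a summable sequence, and K tends to
-- infinity as p → 0.
lemma tendsto_remainder (hf : IsFamily q (t 4) (α 4) (α a) mf f F cf)
    (hg : IsFamily q (t 5) (α 5) (α a) mg g G cg) : ∃ γ : ℂ → ℂ,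
    (∀ w, γ w ≠ 0 ∧ theta (γ w) q ≠ 0 ∧
      theta (γ w * (tildeParam q mf mg (scaledParam t α w) b /
        tildeParam q mf mg (scaledParam t α w) a)) q ≠ 0) ∧
    Tendsto (fun w => (2 * Real.pi * Complex.I)⁻¹ * circleIntegral (fun z =>
      pPow w (-cf.order - cg.order) * remainderTerm q t α a b mf mg F G
        (γ w / tildeParam q mf mg (scaledParam t α w) a) w z / z) 0 (circleRadius q t α a σ e w))
      (cusp ⊓ 𝓟 (nonResonantSet q mf mg t α)) (𝓝 0) := by
  obtain ⟨γ, hγ, hb⟩ := h.remainderTerm_bound hσ he he1 heq hf hg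
  refine ⟨γ, hγ, ?_⟩
  obtain ⟨B, hB, hB0, hbound⟩ := h.exists_uniform_bound hσ (fun w i hi => hi.1.1) hb
  have hκ : 0 < -α a - σ := by linarith [hσ.lt_neg]
  have hlim : Tendsto (fun w => B (cutoff q (-α a - σ) w)) (cusp ⊓ 𝓟 (nonResonantSet q mf mg t α))
      (𝓝 0) := (hB.tendsto_atTop_zero.comp (tendsto_cutoff h.q_ne h.q_lt hκ)).mono_left inf_le_left
  refine squeeze_zero_norm' ?_ hlim
  filter_upwards [mem_inf_of_left hbound, mem_inf_of_right (mem_principal_self _),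
    mem_inf_of_left (eventually_norm_exp_le (show (0 : ℝ) < 1 / 2 by norm_num))] with w hw hN hp
  have hT : ∀ r, scaledParam t α w r ≠ 0 := fun r => mul_ne_zero (h.t_ne r) (pPow_ne_zero _ _)
  have hS : ∀ r, tildeParam q mf mg (scaledParam t α w) r ≠ 0 := fun r =>
    tildeParam_ne_zero h.q_ne hT r
  have hcount : (⋃ r, {z | dPoch (Complex.exp w) q
      (tildeParam q mf mg (scaledParam t α w) r * z) = 0}).Countable :=
    Set.countable_iUnion fun r => countable_setOf_mul_mem
      (countable_dPoch_eq_zero (norm_lt_one_of_le_half hp) h.q_lt) (hS r)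
  refine norm_circle_average_le hcount (h.circleRadius_pos he w) (hB0 _) fun z hz hzB => ?_
  set K := cutoff q (-α a - σ) w with hK
  have hx : tildeParam q mf mg (scaledParam t α w) a * q ^ K ≠ 0 :=
    mul_ne_zero (hS a) (pow_ne_zero K h.q_ne)
  have hzω : tildeParam q mf mg (scaledParam t α w) a *
      (q ^ K * (z / (tildeParam q mf mg (scaledParam t α w) a * q ^ K))) = z := by
    rw [← mul_assoc, mul_div_cancel₀ _ hx]
  have hω : ‖z / (tildeParam q mf mg (scaledParam t α w) a * q ^ K)‖ = e⁻¹ ^ 3 := by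
    have h1 := norm_pos_iff.2 hx
    rw [norm_div, hz, div_eq_iff h1.ne', circleRadius, tildeParam_self h.ne_four h.ne_five,
      scaledParam, norm_mul, norm_mul, norm_pow]
    ring
  have he' : 1 ≤ e⁻¹ := (one_le_inv₀ he).2 he1.le
  have := hw (K, z / (tildeParam q mf mg (scaledParam t α w) a * q ^ K))
    ⟨⟨⟨le_rfl, by rw [hω]; exact one_le_pow₀ he', by
      rw [hω, ← heq, ← inv_pow]; exact pow_le_pow_right₀ he' (by norm_num)⟩, rfl, hω⟩, hN,
      fun r h0 => hzB (Set.mem_iUnion.2 ⟨r, by rw [hzω] at h0; exact h0⟩)⟩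
  simp only [hzω] at this
  exact this

end Admissible

end EllipticPairing

end

/-! ### Dominated convergence -/

noncomputable section

namespace EllipticPairing

namespace Admissible

variable {q : ℂ} {t : Fin 6 → ℂ} {α : Fin 6 → ℝ} {a : Fin 6} (h : Admissible q t α a)
  {mf mg : ℕ} {f g F G : ℂ → ℂ → ℂ} {cf cg : HahnSeries ℝ (RatFunc ℂ)} {b : Fin 6} {σ : ℝ}
  (hσ : SeparatingExponent α a b σ) {e : ℝ} (he : 0 < e) (he1 : e < 1) (heq : e ^ 6 = ‖q‖)

include h hσ in
lemma exists_residueTerm_bound (hf : IsFamily q (t 4) (α 4) (α a) mf f F cf)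
    (hg : IsFamily q (t 5) (α 5) (α a) mg g G cg) : ∃ B : ℕ → ℝ, Summable B ∧ (∀ k, 0 ≤ B k) ∧
    ∀ᶠ w in cusp ⊓ 𝓟 (nonResonantSet q mf mg t α), ∀ k ≤ cutoff q (-α a - σ) w,
      ‖pPow w (-cf.order - cg.order) * residueTerm q t α a mf mg F G k w‖ ≤ B k := by
  obtain ⟨B, hB, hB0, hbound⟩ := h.exists_uniform_bound hσ (fun w i hi => hi.1)
    (h.residueTerm_bound hσ hf hg)
  refine ⟨B, hB, hB0, ?_⟩
  filter_upwards [mem_inf_of_left hbound, mem_inf_of_right (mem_principal_self _)] with w hw hN k hk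
  exact hw (k, 1) ⟨⟨hk, by simp, by
    rw [norm_one]; exact (one_le_inv₀ (norm_pos_iff.2 h.q_ne)).2 h.q_lt.le⟩, rfl, hN⟩

include h hσ in
lemma eventually_le_cutoff (k : ℕ) : ∀ᶠ w in cusp ⊓ 𝓟 (nonResonantSet q mf mg t α),
    k < cutoff q (-α a - σ) w :=
  mem_inf_of_left ((tendsto_cutoff h.q_ne h.q_lt (by linarith [hσ.lt_neg])).eventually
    (eventually_gt_atTop k))

include h in
-- For fixed k the cutoff eventually exceeds k, so the uniform bound of the residues holds for their
-- limit as well.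
lemma summable_limit (hf : IsFamily q (t 4) (α 4) (α a) mf f F cf)
    (hg : IsFamily q (t 5) (α 5) (α a) mg g G cg) :
    Summable fun k : ℕ => ratEval cf.leadingCoeff (t a * q ^ k) *
      ratEval cg.leadingCoeff (t a * q ^ k) * limitWeight q t α a k := by
  obtain ⟨b, σ, hσ⟩ := h.exists_separatingExponent
  obtain ⟨B, hB, -, hbound⟩ := h.exists_residueTerm_bound hσ hf hg
  have : (cusp ⊓ 𝓟 {w | NonResonant (Complex.exp w) q mf mg (scaledParam t α w)}).NeBot :=
    h.neBot_nonResonant mf mg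
  refine (summable_mul_left_iff h.limitPrefactor_ne_zero).1 (hB.of_norm_bounded fun k => ?_)
  refine le_of_tendsto (h.tendsto_residueTerm hf hg k).norm ?_
  filter_upwards [hbound, h.eventually_le_cutoff hσ k] with w hw hk
  exact hw k hk.le

include h hσ in
-- The sum is extended by zero beyond the cutoff; each fixed k is eventually below it, so the terms
-- converge one by one under a summable majorant.
lemma tendsto_sum_residueTerm (hf : IsFamily q (t 4) (α 4) (α a) mf f F cf)
    (hg : IsFamily q (t 5) (α 5) (α a) mg g G cg) :
    Tendsto (fun w => ∑ k ∈ Finset.range (cutoff q (-α a - σ) w),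
      pPow w (-cf.order - cg.order) * residueTerm q t α a mf mg F G k w)
      (cusp ⊓ 𝓟 (nonResonantSet q mf mg t α))
      (𝓝 (limitPrefactor q t α a * ∑' k : ℕ, ratEval cf.leadingCoeff (t a * q ^ k) *
        ratEval cg.leadingCoeff (t a * q ^ k) * limitWeight q t α a k)) := by
  obtain ⟨B, hB, hB0, hbound⟩ := h.exists_residueTerm_bound hσ hf hg
  rw [← tsum_mul_left]
  have key := tendsto_tsum_of_dominated_convergence (𝓕 := cusp ⊓ 𝓟 (nonResonantSet q mf mg t α))
    (f := fun w k => if k < cutoff q (-α a - σ) w then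
      pPow w (-cf.order - cg.order) * residueTerm q t α a mf mg F G k w else 0) hB
    (fun k => (h.tendsto_residueTerm hf hg k).congr' ?_) ?_
  · refine key.congr fun w => ?_
    rw [tsum_eq_sum (s := Finset.range (cutoff q (-α a - σ) w)) fun k hk =>
      if_neg fun h' => hk (Finset.mem_range.2 h')]
    exact Finset.sum_congr rfl fun k hk => if_pos (Finset.mem_range.1 hk)
  · filter_upwards [h.eventually_le_cutoff hσ k] with w hw
    rw [if_pos hw]
  · filter_upwards [hbound] with w hw k
    split_ifs with hk
    · exact hw k hk.le
    · rw [norm_zero]; exact hB0 k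

include h in
lemma tendsto_pairing (hf : IsFamily q (t 4) (α 4) (α a) mf f F cf)
    (hg : IsFamily q (t 5) (α 5) (α a) mg g G cg)
    (hfA : ∀ᶠ w in cusp, MemA (scaledParam t α w 4) (Complex.exp w) q mf (f w))
    (hgA : ∀ᶠ w in cusp, MemA (scaledParam t α w 5) (Complex.exp w) q mg (g w))
    {C : ℂ → List WeightedCircle}
    (hC : ∀ᶠ w in cusp ⊓ 𝓟 (nonResonantSet q mf mg t α),
      IsContour (Complex.exp w) q mf mg (scaledParam t α w) (C w)) :
    Tendsto (fun w => pPow w (-cf.order - cg.order) *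
        pairing (Complex.exp w) q (scaledParam t α w) (C w) (f w) (g w))
      (cusp ⊓ 𝓟 (nonResonantSet q mf mg t α))
      (𝓝 (limitPrefactor q t α a * ∑' k : ℕ, ratEval cf.leadingCoeff (t a * q ^ k) *
        ratEval cg.leadingCoeff (t a * q ^ k) * limitWeight q t α a k)) := by
  obtain ⟨b, σ, hσ⟩ := h.exists_separatingExponent
  have hq' := norm_pos_iff.2 h.q_ne
  -- With e = |q|^{1/6} the choice |ω| = e⁻³ = |q|^{-1/2} puts the circle, on a logarithmic scale,
  -- halfway between the moduli of S_a q^K and S_a q^{K−1}.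
  obtain ⟨e, he, he1, heq⟩ : ∃ e : ℝ, 0 < e ∧ e < 1 ∧ e ^ 6 = ‖q‖ :=
    ⟨‖q‖ ^ ((6 : ℕ) : ℝ)⁻¹, Real.rpow_pos_of_pos hq' _,
      Real.rpow_lt_one hq'.le h.q_lt (by norm_num), Real.rpow_inv_natCast_pow hq'.le (by norm_num)⟩
  obtain ⟨γ, hγ, hrem⟩ := h.tendsto_remainder hσ he he1 heq hf hg
  have hlim := hrem.add (h.tendsto_sum_residueTerm hσ hf hg)
  rw [zero_add] at hlim
  refine hlim.congr' ?_
  filter_upwards [hC, mem_inf_of_right (mem_principal_self _), mem_inf_of_left hfA,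
    mem_inf_of_left hgA, mem_inf_of_left hf.diff, mem_inf_of_left hf.eq, mem_inf_of_left hg.diff,
    mem_inf_of_left hg.eq, mem_inf_of_left (h.eventually_theta_ne_zero mf mg hσ.add_neg),
    mem_inf_of_left (h.eventually_theta_ne_zero mf mg (r := a) (by linarith [h.neg])),
    mem_inf_of_left (h.eventually_norm_lt_circleRadius hσ he he1 mf mg),
    mem_inf_of_left (h.eventually_shiftParam_mul_lt_one hσ he heq mf mg),
    mem_inf_of_left (eventually_norm_exp_le (show (0 : ℝ) < 1 / 2 by norm_num))]
    with w hC hN hfA hgA hFd hFe hGd hGe hθb hθa hρ h5 hp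
  have hT : ∀ r, scaledParam t α w r ≠ 0 := fun r => mul_ne_zero (h.t_ne r) (pPow_ne_zero _ _)
  have hS : ∀ r, tildeParam q mf mg (scaledParam t α w) r ≠ 0 := fun r =>
    tildeParam_ne_zero h.q_ne hT r
  have hSa := hS a
  have hta := norm_pos_iff.2 hSa
  have e1 : tildeParam q mf mg (scaledParam t α w) a *
      (γ w / tildeParam q mf mg (scaledParam t α w) a) = γ w := by field_simp
  have e2 : tildeParam q mf mg (scaledParam t α w) b *
      (γ w / tildeParam q mf mg (scaledParam t α w) a) = γ w *
        (tildeParam q mf mg (scaledParam t α w) b / tildeParam q mf mg (scaledParam t α w) a) := by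
    ring
  have hρe : circleRadius q t α a σ e w = ‖tildeParam q mf mg (scaledParam t α w) a‖ *
      (‖q‖ ^ cutoff q (-α a - σ) w * e⁻¹ ^ 3) := by
    rw [circleRadius, tildeParam_self h.ne_four h.ne_five, scaledParam, norm_mul]
  have he3 : 1 < e⁻¹ ^ 3 := one_lt_pow₀ ((one_lt_inv₀ he).2 he1) (by norm_num)
  -- The free parameter of the breaker is c = γ/S_a, so that S_a c = γ and S_b c = γ S_b/S_a, the
  -- two quantities kept away from the zeros of θ.
  rw [pairing_eq (norm_lt_one_of_le_half hp) h.q_lt (Complex.exp_ne_zero w) h.q_ne hT hC hfA hgA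
    hFd hGd hFe hGe rfl hσ.ne.symm (div_ne_zero (hγ w).1 hSa)
    (by
      rw [halfConst, e1, e2]
      exact mul_ne_zero (mul_ne_zero (hθb hN) (hγ w).2.1) (hγ w).2.2)
    (by rw [pow_two]; exact hθa hN) (h.circleRadius_pos he w) (K := cutoff q (-α a - σ) w)
    hρ.1 hρ.2 ?_ ?_ h5]
  · rw [mul_add, mul_add, Finset.mul_sum, Finset.mul_sum]
    congr 1
    rw [mul_left_comm _ (2 * Real.pi * Complex.I : ℂ)⁻¹, mul_left_comm _ (2 * Real.pi * Complex.I : ℂ)⁻¹,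
      ← mul_assoc (pPow w _), ← smul_eq_mul (_ * _) (circleIntegral _ _ _),
      ← circleIntegral.integral_smul]
    congr 2
    funext z
    rw [remainderTerm, smul_eq_mul]
    ring
  · rw [norm_mul, norm_pow, hρe]
    gcongr
    exact lt_mul_of_one_lt_right (pow_pos hq' _) he3
  · intro k hk
    rw [norm_mul, norm_pow, hρe]
    gcongr
    -- From k < K one gets k + 1 ≤ K, and the spare factor |q| = e⁶ outweighs e⁻³.
    calc ‖q‖ ^ cutoff q (-α a - σ) w * e⁻¹ ^ 3 ≤ ‖q‖ ^ (k + 1) * e⁻¹ ^ 3 := by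
          exact mul_le_mul_of_nonneg_right (pow_le_pow_of_le_one hq'.le h.q_lt.le hk)
            (by positivity)
      _ = ‖q‖ ^ k * e ^ 3 := by rw [pow_succ]; nth_rewrite 2 [← heq]; field_simp
      _ < ‖q‖ ^ k := mul_lt_of_lt_one_right (pow_pos hq' _) (pow_lt_one₀ he.le he1 (by norm_num))

end Admissible

lemma exists_isFamily {q y : ℂ} (hq0 : q ≠ 0) (hy : y ≠ 0) {τ ζ : ℝ} {m : ℕ} {f : ℂ → ℂ → ℂ}
    {c : HahnSeries ℝ (RatFunc ℂ)} (h : HasExpansion ζ f c)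
    (hA : ∀ᶠ w in cusp, MemA (y * pPow w τ) (Complex.exp w) q m (f w)) :
    ∃ F : ℂ → ℂ → ℂ, IsFamily q y τ ζ m f F c := by
  have h1 : ∀ w, ∃ F : ℂ → ℂ, MemA (y * pPow w τ) (Complex.exp w) q m (f w) →
      DifferentiableOn ℂ F {0}ᶜ ∧ ∀ z : ℂ, z ≠ 0 →
        poleFactor (y * pPow w τ) (Complex.exp w) q m z ≠ 0 →
        F z = poleFactor (y * pPow w τ) (Complex.exp w) q m z * f w z := fun w => by
    by_cases hw : MemA (y * pPow w τ) (Complex.exp w) q m (f w)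
    · obtain ⟨F, hF⟩ := hw.2
      exact ⟨F, fun _ => hF⟩
    · exact ⟨0, fun h' => absurd h' hw⟩
  choose F hF using h1
  refine ⟨F, h, hA.mono fun w hw => (hF w hw).1, hA.mono fun w hw => (hF w hw).2, ?_⟩
  filter_upwards [hA, eventually_norm_exp_le (show (0 : ℝ) < 1 / 2 by norm_num)] with w hw hp z hz
  exact hw.symm_of_eq (norm_lt_one_of_le_half hp) (Complex.exp_ne_zero w) hq0
    (mul_ne_zero hy (pPow_ne_zero _ _)) (hF w hw).1 (hF w hw).2 hz

end EllipticPairing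

end

theorem mainTheorem10
    (q : ℂ) (hq0 : q ≠ 0) (hq1 : ‖q‖ < 1)
    (t : Fin 6 → ℂ) (ht0 : ∀ r, t r ≠ 0) (htprod : ∏ r, t r = q)
    (htgen : EllipticPairing.Generic q t)
    (α : Fin 6 → ℝ) (hαsum : ∑ r, α r = 1)
    (a : Fin 6) (ha : a ≤ 3) (hαa : -1 / 2 ≤ α a ∧ α a < 0)
    (hαr : ∀ r, r ≠ a → α a < α r ∧ α r ≤ 1 + α a)
    (hαrs : ∀ r s, r ≠ a → s ≠ a → r ≠ s → 0 < α r + α s ∧ α r + α s ≤ 1)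
    (hαbal : 2 * α a = ∑ r : Fin 6 with r ≠ a ∧ α r + α a < 0, (α r + α a))
    (mf mg : ℕ) (f g : ℂ → ℂ → ℂ) (cf cg : HahnSeries ℝ (RatFunc ℂ))
    (hfA : ∀ᶠ w in comap Complex.re atBot,
      EllipticPairing.MemA (EllipticPairing.scaledParam t α w 4) (Complex.exp w) q mf (f w))
    (hgA : ∀ᶠ w in comap Complex.re atBot,
      EllipticPairing.MemA (EllipticPairing.scaledParam t α w 5) (Complex.exp w) q mg (g w))
    (hfM : EllipticPairing.HasExpansion (α a) f cf)
    (hgM : EllipticPairing.HasExpansion (α a) g cg) :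
    (∀ᶠ w in comap Complex.re atBot,
      EllipticPairing.NonResonant (Complex.exp w) q mf mg (EllipticPairing.scaledParam t α w) →
      ∃ C, EllipticPairing.IsContour (Complex.exp w) q mf mg
        (EllipticPairing.scaledParam t α w) C) ∧
    Summable (fun k : ℕ =>
      EllipticPairing.ratEval cf.leadingCoeff (t a * q ^ k) *
        EllipticPairing.ratEval cg.leadingCoeff (t a * q ^ k) *
        EllipticPairing.limitWeight q t α a k) ∧
    ∀ C : ℂ → List EllipticPairing.WeightedCircle,
      (∀ᶠ w in comap Complex.re atBot ⊓ 𝓟 {w | EllipticPairing.NonResonant (Complex.exp w) q mf mg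
          (EllipticPairing.scaledParam t α w)},
        EllipticPairing.IsContour (Complex.exp w) q mf mg
          (EllipticPairing.scaledParam t α w) (C w)) →
      Tendsto
        (fun w => EllipticPairing.pPow w (-cf.order - cg.order) *
          EllipticPairing.pairing (Complex.exp w) q (EllipticPairing.scaledParam t α w) (C w)
            (f w) (g w))
        (comap Complex.re atBot ⊓ 𝓟 {w | EllipticPairing.NonResonant (Complex.exp w) q mf mg
          (EllipticPairing.scaledParam t α w)})
        (𝓝 (EllipticPairing.limitPrefactor q t α a *
          ∑' k : ℕ, EllipticPairing.ratEval cf.leadingCoeff (t a * q ^ k) *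
            EllipticPairing.ratEval cg.leadingCoeff (t a * q ^ k) *
            EllipticPairing.limitWeight q t α a k)) := by
  have h : EllipticPairing.Admissible q t α a :=
    { q_ne := hq0, q_lt := hq1, t_ne := ht0, generic := htgen, a_le := ha, half_le := hαa.1,
      neg := hαa.2, lt := fun r hr => (hαr r hr).1, le := fun r hr => (hαr r hr).2,
      pos := fun r s hr hs hrs => (hαrs r s hr hs hrs).1,
      le_one := fun r s hr hs hrs => (hαrs r s hr hs hrs).2, bal := hαbal }
  obtain ⟨F, hF⟩ := EllipticPairing.exists_isFamily hq0 (ht0 4) hfM hfA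
  obtain ⟨G, hG⟩ := EllipticPairing.exists_isFamily hq0 (ht0 5) hgM hgA
  refine ⟨?_, h.summable_limit hF hG, fun C hC => h.tendsto_pairing hF hG hfA hgA hC⟩
  filter_upwards [EllipticPairing.eventually_norm_exp_le (show (0 : ℝ) < 1 / 2 by norm_num)]
    with w hp
  exact EllipticPairing.exists_isContour (EllipticPairing.norm_lt_one_of_le_half hp) hq1
    (Complex.exp_ne_zero w) hq0 fun r => mul_ne_zero (ht0 r) (EllipticPairing.pPow_ne_zero w (α r))
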